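/- **Theorem.** A *graph timeline* is a sequence $G_1,\dots,G_t$ of undirected simple graphs on a common set $V$ of $n$ vertices such that, for $1\le i<t$, the edge sets of $G_i$ and $G_{i+1}$ differ in exactly one edge. An edge is *permanent* if it belongs to all of $G_1,\dots,G_t$; let $m$ be the number of permanent edges. The timeline is given as a list of the edges of $G_1$ (in arbitrary order), followed by the list of the $t-1$ edge additions and deletions that lead from $G_i$ to $G_{i+1}$. Consider the (deterministic) word RAM with unit-cost addition, subtraction, multiplication, integer division, comparison and indirect memory access, with words of $\Theta(\log t)$ bits or longer (at least $c\log_2 t$ bits, for an absolute constant $c$). There are a preprocessing program and a query program such that, for every timeline with $t\ge n\ge 2$, given in a read-only input array: 1. the preprocessing takes $O(m+t\log n)$ steps in the worst case; 2. the memory used by the preprocessing (besides the read-only input), by the resulting data structure and by the queries consists of $O(t\log n)$ words; 3. after the preprocessing, without further access to the input, every query $\mathrm{forall}(u,v,a,b)$ with $u,v\in V$ and $1\le a\le b\le t$, which asks whether $u$ and $v$ are connected by a path in *each* of $G_a,G_{a+1},\dots,G_b$, is answered correctly in $O(\log n)$ steps in the worst case. The queries may arrive online, in any number and order. The programs and the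 constants $c$ and those hidden in the $O$-notation depend on nothing. -/

import Mathlib

/-! ### Graph timelines -/

/-- A graph timeline `G₁, …, G_t` on the vertex set `{0, …, n - 1}`. The version `G_i` of the usual
numbering `1, …, t` is `graph (i - 1)`. Consecutive versions differ in exactly one edge. -/
structure GraphTimeline (n t : ℕ) where
  graph : Fin t → SimpleGraph (Fin n)
  change : ∀ i j : Fin t, (i : ℕ) + 1 = j →
    (symmDiff (graph i).edgeSet (graph j).edgeSet).ncard = 1

/-- The number of permanent edges, i.e. of edges that are present in every version. -/
noncomputable def GraphTimeline.numPermanent {n t : ℕ} (Γ : GraphTimeline n t) : ℕ :=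
  {e : Sym2 (Fin n) | ∀ i, e ∈ (Γ.graph i).edgeSet}.ncard

/-- The answer to `forall(u, v, a, b)`: in each of the versions `a, …, b` there is a path
between `u` and `v`. -/
def GraphTimeline.ForallConnected {n t : ℕ} (Γ : GraphTimeline n t) (u v : Fin n) (a b : Fin t) :
    Prop :=
  ∀ i : Fin t, a ≤ i → i ≤ b → (Γ.graph i).Reachable u v

/-- The addition (`add = true`) or deletion (`add = false`) of the edge with endpoints `u`, `v`. -/
structure EdgeUpdate (n : ℕ) where
  add : Bool
  u : Fin n
  v : Fin n

/-- The edge set that results from an update. -/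
def EdgeUpdate.apply {n : ℕ} (x : EdgeUpdate n) (E : Set (Sym2 (Fin n))) : Set (Sym2 (Fin n)) :=
  match x.add with
  | true => insert s(x.u, x.v) E
  | false => E \ {s(x.u, x.v)}

/-- A raw description of a timeline: a list of the edges of the first version, and a list of
updates. -/
structure TimelineInput (n : ℕ) where
  edges : List (Fin n × Fin n)
  updates : List (EdgeUpdate n)

/-- `I` describes `Γ`: it lists every edge of the first version exactly once (in any order, with
its endpoints in any order), followed by `t - 1` updates that lead from each version to the next. -/
structure TimelineInput.Describes {n t : ℕ} (I : TimelineInput n) (Γ : GraphTimeline n t) :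
    Prop where
  nodup : (I.edges.map fun p => s(p.1, p.2)).Nodup
  mem_edges : ∀ i : Fin t, (i : ℕ) = 0 → ∀ e : Sym2 (Fin n),
    e ∈ I.edges.map (fun p => s(p.1, p.2)) ↔ e ∈ (Γ.graph i).edgeSet
  length_updates : I.updates.length = t - 1
  step : ∀ (i j : Fin t) (hi : (i : ℕ) < I.updates.length), (i : ℕ) + 1 = j →
    (Γ.graph j).edgeSet = (I.updates[(i : ℕ)]).apply (Γ.graph i).edgeSet

/-- The input as a sequence of machine words: `n`, the number `t` of versions, the number of edges
of the first version, these edges (two words each), the updates (three words each). -/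
def TimelineInput.words {n : ℕ} (I : TimelineInput n) (t : ℕ) : List ℕ :=
  [n, t, I.edges.length]
    ++ I.edges.flatMap (fun p => [(p.1 : ℕ), (p.2 : ℕ)])
    ++ I.updates.flatMap (fun x => [if x.add then 1 else 0, (x.u : ℕ), (x.v : ℕ)])

/-! ### A word RAM -/

namespace WordRAM

/-- Binary operations on words. -/
inductive BinOp
  | add
  | sub
  | mul
  | div

/-- The result of a binary operation; subtraction is truncated at `0` and division rounds down. -/
def BinOp.eval : BinOp → ℕ → ℕ → ℕ
  | .add, x, y => x + y
  | .sub, x, y => x - y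
  | .mul, x, y => x * y
  | .div, x, y => x / y

/-- Programs of the RAM. Registers are named by natural numbers (a program mentions only finitely
many of them); `R[i]` is the content of register `i`. -/
inductive Prog
  /-- Do nothing. -/
  | skip
  /-- `R[d] := k`. -/
  | const (d k : ℕ)
  /-- `R[d] := R[x] ∘ R[y]`. -/
  | op (o : BinOp) (d x y : ℕ)
  /-- `R[d] := input[R[x]]`. -/
  | input (d x : ℕ)
  /-- `R[d] := memory[R[x]]`. -/
  | load (d x : ℕ)
  /-- `memory[R[x]] := R[y]`. -/
  | store (x y : ℕ)
  /-- `p; q`. -/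
  | seq (p q : Prog)
  /-- `if R[x] < R[y] then p else q`. -/
  | ite (x y : ℕ) (p q : Prog)
  /-- `while R[x] < R[y] do p`. -/
  | while (x y : ℕ) (p : Prog)

/-- A configuration: the contents of the registers and of the memory. -/
structure State where
  reg : ℕ → ℕ
  mem : ℕ → ℕ

/-- The configuration in which all registers and memory cells contain `0`. -/
def State.zero : State := ⟨fun _ => 0, fun _ => 0⟩

/-- Assign to a register. -/
def State.setReg (σ : State) (d x : ℕ) : State := ⟨Function.update σ.reg d x, σ.mem⟩

/-- Assign to a memory cell. -/
def State.setMem (σ : State) (i x : ℕ) : State := ⟨σ.reg, Function.update σ.mem i x⟩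

/-- `Exec w S inp p σ k σ'`: on a RAM with words of `w` bits, a memory of `S` words (at the addresses
`0, …, S - 1`) and the read-only input `inp`, the program `p` started in `σ` halts after exactly `k`
steps in `σ'`. Every instruction and every evaluation of a test is one step. A run that computes a
number of more than `w` bits, or that accesses the memory or the input out of range, is aborted and
does not halt in any configuration. -/
inductive Exec (w S : ℕ) (inp : List ℕ) : Prog → State → ℕ → State → Prop
  | skip (σ : State) : Exec w S inp .skip σ 1 σ
  | const (σ : State) (d k : ℕ) (hk : k < 2 ^ w) : Exec w S inp (.const d k) σ 1 (σ.setReg d k)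
  | op (σ : State) (o : BinOp) (d x y : ℕ) (h : o.eval (σ.reg x) (σ.reg y) < 2 ^ w) :
      Exec w S inp (.op o d x y) σ 1 (σ.setReg d (o.eval (σ.reg x) (σ.reg y)))
  | input (σ : State) (d x : ℕ) (h : σ.reg x < inp.length) (hw : inp[σ.reg x] < 2 ^ w) :
      Exec w S inp (.input d x) σ 1 (σ.setReg d inp[σ.reg x])
  | load (σ : State) (d x : ℕ) (h : σ.reg x < S) :
      Exec w S inp (.load d x) σ 1 (σ.setReg d (σ.mem (σ.reg x)))
  | store (σ : State) (x y : ℕ) (h : σ.reg x < S) :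
      Exec w S inp (.store x y) σ 1 (σ.setMem (σ.reg x) (σ.reg y))
  | seq {p q : Prog} {σ σ' σ'' : State} {k l : ℕ} (hp : Exec w S inp p σ k σ')
      (hq : Exec w S inp q σ' l σ'') : Exec w S inp (.seq p q) σ (k + l) σ''
  | ite_true {x y : ℕ} {p q : Prog} {σ σ' : State} {k : ℕ} (h : σ.reg x < σ.reg y)
      (hp : Exec w S inp p σ k σ') : Exec w S inp (.ite x y p q) σ (k + 1) σ'
  | ite_false {x y : ℕ} {p q : Prog} {σ σ' : State} {k : ℕ} (h : ¬ σ.reg x < σ.reg y)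
      (hq : Exec w S inp q σ k σ') : Exec w S inp (.ite x y p q) σ (k + 1) σ'
  | while_true {x y : ℕ} {p : Prog} {σ σ' σ'' : State} {k l : ℕ} (h : σ.reg x < σ.reg y)
      (hp : Exec w S inp p σ k σ') (hq : Exec w S inp (.while x y p) σ' l σ'') :
      Exec w S inp (.while x y p) σ (k + l + 1) σ''
  | while_false {x y : ℕ} {p : Prog} {σ : State} (h : ¬ σ.reg x < σ.reg y) :
      Exec w S inp (.while x y p) σ 1 σ

/-- The machine is deterministic: time and result of a halting run are unique. -/
theorem Exec.deterministic {w S : ℕ} {inp : List ℕ} {p : Prog} {σ σ₁ σ₂ : State} {k₁ k₂ : ℕ}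
    (h₁ : Exec w S inp p σ k₁ σ₁) (h₂ : Exec w S inp p σ k₂ σ₂) : k₁ = k₂ ∧ σ₁ = σ₂ := by
  induction h₁ generalizing k₂ σ₂ with
  | skip | const | op | input | load | store => cases h₂; exact ⟨rfl, rfl⟩
  | seq _ _ ih₁ ih₂ =>
    cases h₂ with
    | seq hp hq =>
      obtain ⟨rfl, rfl⟩ := ih₁ hp
      obtain ⟨rfl, rfl⟩ := ih₂ hq
      exact ⟨rfl, rfl⟩
  | ite_true h _ ih =>
    cases h₂ with
    | ite_true _ hp => obtain ⟨rfl, rfl⟩ := ih hp; exact ⟨rfl, rfl⟩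
    | ite_false h' => exact absurd h h'
  | ite_false h _ ih =>
    cases h₂ with
    | ite_true h' => exact absurd h' h
    | ite_false _ hq => obtain ⟨rfl, rfl⟩ := ih hq; exact ⟨rfl, rfl⟩
  | while_true h _ _ ih₁ ih₂ =>
    cases h₂ with
    | while_true _ hp hq =>
      obtain ⟨rfl, rfl⟩ := ih₁ hp
      obtain ⟨rfl, rfl⟩ := ih₂ hq
      exact ⟨rfl, rfl⟩
    | while_false h' => exact absurd h h'
  | while_false h =>
    cases h₂ with
    | while_true h' => exact absurd h' h
    | while_false => exact ⟨rfl, rfl⟩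

end WordRAM

open WordRAM in
/-- The configuration in which the query program is started: the four arguments of the query are put
into the registers `0, 1, 2, 3`, everything else is as it was left before. -/
def WordRAM.State.withQuery {n t : ℕ} (σ : State) (u v : Fin n) (a b : Fin t) : State :=
  (((σ.setReg 0 u).setReg 1 v).setReg 2 a).setReg 3 b

open WordRAM in
/-- The configurations in which the data structure can be when a query arrives: the one that the
preprocessing of `inp` leaves, and those that are left after any number of queries. The input is not
available to queries. -/
inductive DataStructureState (n t w S : ℕ) (inp : List ℕ) (pre query : Prog) : State → Prop
  | preprocessed {k : ℕ} {σ : State} (h : Exec w S inp pre State.zero k σ) :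
      DataStructureState n t w S inp pre query σ
  | queried {k : ℕ} {σ σ' : State} (u v : Fin n) (a b : Fin t) (hab : a ≤ b)
      (hσ : DataStructureState n t w S inp pre query σ)
      (h : Exec w S [] query (σ.withQuery u v a b) k σ') :
      DataStructureState n t w S inp pre query σ'

set_option linter.constructorNameAsVariable false
set_option linter.unusedVariables false
set_option linter.style.nameCheck false
/-! ### A small imperative language on top of the word RAM -/

namespace ForallRAM

/-! Only edges that are updated at some time need individual treatment. Every update `x` becomes a
record with a lifetime `[rs x, re x)` of versions. The permanent edges matter only through their
components, which are stored as `n` star edges, each from a vertex to its representative, alive for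
ever. This leaves fewer than `2t` records, with the same components as the graph in every version
(`TL.live_iff`). The edges of the first version are read in batches of `t`, each merged into the
labels found so far, so that only `O(t)` memory is used. Their number exceeds `m` by at most `t - 1`
(`edges_length_le`), hence this takes time `O(m + t)`.

Time is cut into `nb` blocks of `B = 2 ^ d` versions, where `min t (n * n) ≤ B < 2 * min t (n * n)`;
thus `d = O(log n)`. Over each block stands a complete binary tree of dyadic intervals. A root has
the vertices `0, …, n - 1` and the records that matter for its block. The graph of a child, with an
interval of `L` versions, comes from that of its parent: edges alive throughout the interval are
contracted, edges alive in no version of it are dropped, and the others are kept. As consecutive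
versions differ in one edge, at most `2L` lifetimes begin or end inside the interval
(`Recs.card_partial`). So at most `2L` edges and `4L` vertices remain; all other contracted vertices
are isolated throughout the interval and are not stored. A node costs `O(L)`, a level `O(t)`, and
all trees `O(t log n)` (`process_spec`, `nodes_spec`). Connectivity at each single version is
preserved from parent to child (`contract_iff`).

Being connected in every version of an interval is an equivalence relation, the intersection of the
relations of the two halves. Hence its classes are computed from the leaves upwards, by giving a
common name to equal pairs of class names with bucket sort (`name_spec`, `ClassOk.combine`,
`classes_spec`). For whole blocks, a table counts, for each pair of vertices, the blocks from a
given one on in which the pair is not always connected; two counts agree exactly if no bad block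
lies between them (`TotOk.iff`). The table is needed only if there are two or more blocks. Then `n *
n ≤ B`, and its size is within `O(t)`.

A query interval consists of its two ends, of dyadic intervals hanging off the two paths from a root
to an end, and of whole blocks (`interval_cover`). Walking down a path, the program translates the
two vertices into the names of the current node and compares their classes at the sibling, if the
sibling's interval lies inside the query. Once one of the two vertices is isolated, connectivity is
constant on the rest of the path's interval, and the walk may stop. This always happens, since
leaves have no vertices (`walk_spec`). Thus a query takes `O(d)` steps.

The programs are written in a small language with arrays and a clock. Its compilation costs a
constant factor (`compile_correct`), and correctness and running time are proved together by weakest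
preconditions. -/

/-- Program variables. The first four are the registers in which queries pass their arguments. -/
inductive Var
  | qu | qv | qa | qb
  | n | t | m | te | d | B | nb | Z | lim
  | i | j | k | x | y | z | h | r | q | e | hd | tl
  | num | V | cnt | done | rp | mp | pb | id | p | lo | hi | len | cn | A | le | c | sz
  | g | sb | sl | ok | run | cx | cy | base
  deriving DecidableEq

/-- Program arrays. -/
inductive Arr
  | add | c1 | c2 | rep | head | nxt | stamp | val
  | eu | ev | lab | que
  | ru | rv | rs | re | last
  | rb | rc | nA | mb | qx | qy | qr | mq | num | T2 | tot
  deriving DecidableEq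

theorem Var.ctorIdx_lt (x : Var) : x.ctorIdx < 64 := by cases x <;> decide

theorem Var.ctorIdx_inj {x y : Var} (h : x.ctorIdx = y.ctorIdx) : x = y := by
  rw [← Var.ofNat_ctorIdx x, h, Var.ofNat_ctorIdx]

theorem Arr.ctorIdx_lt (x : Arr) : x.ctorIdx < 32 := by cases x <;> decide

theorem Arr.ctorIdx_inj {x y : Arr} (h : x.ctorIdx = y.ctorIdx) : x = y := by
  rw [← Arr.ofNat_ctorIdx x, h, Arr.ofNat_ctorIdx]

/-- States: values of variables, contents of arrays, and a clock. -/
structure St where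
  v : Var → ℕ
  a : Arr → ℕ → ℕ
  time : ℕ

/-- Word size, capacity of each array, and input. -/
structure Env where
  w : ℕ
  N : ℕ
  inp : List ℕ

/-- The number of words; kept folded for the sake of arithmetic tactics. -/
def Env.W (E : Env) : ℕ := 2 ^ E.w

def St.set (s : St) (x : Var) (k : ℕ) : St := ⟨Function.update s.v x k, s.a, s.time + 1⟩

/-- Change one value of a function. -/
def upd (f : ℕ → ℕ) (i k : ℕ) : ℕ → ℕ := fun j => if j = i then k else f j

@[simp] theorem upd_self (f : ℕ → ℕ) (i k : ℕ) : upd f i k i = k := if_pos rfl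
theorem upd_of_ne {f : ℕ → ℕ} {i j k : ℕ} (h : j ≠ i) : upd f i k j = f j := if_neg h
theorem upd_apply (f : ℕ → ℕ) (i j k : ℕ) : upd f i k j = if j = i then k else f j := rfl

def St.put (s : St) (A : Arr) (i k : ℕ) : St :=
  ⟨s.v, Function.update s.a A (upd (s.a A) i k), s.time + 1⟩

def St.tick (s : St) : St := ⟨s.v, s.a, s.time + 1⟩

@[simp] theorem St.set_v (s : St) (x y : Var) (k : ℕ) :
    (s.set x k).v y = if y = x then k else s.v y := by simp [St.set, Function.update_apply]
@[simp] theorem St.set_a (s : St) (x : Var) (k : ℕ) : (s.set x k).a = s.a := rfl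
@[simp] theorem St.set_time (s : St) (x : Var) (k : ℕ) : (s.set x k).time = s.time + 1 := rfl
@[simp] theorem St.put_v (s : St) (A : Arr) (i k : ℕ) : (s.put A i k).v = s.v := rfl
@[simp] theorem St.put_a (s : St) (A B : Arr) (i k : ℕ) :
    (s.put A i k).a B = if B = A then upd (s.a A) i k else s.a B := by
  simp only [St.put, Function.update_apply]
@[simp] theorem St.put_time (s : St) (A : Arr) (i k : ℕ) : (s.put A i k).time = s.time + 1 := rfl
@[simp] theorem St.tick_v (s : St) : s.tick.v = s.v := rfl
@[simp] theorem St.tick_a (s : St) : s.tick.a = s.a := rfl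
@[simp] theorem St.tick_time (s : St) : s.tick.time = s.time + 1 := rfl

/-- The `i`-th word of the input. -/
def Env.word (E : Env) (i : ℕ) : ℕ := E.inp.getD i 0

/-- Expressions. -/
inductive Exp
  | lit (k : ℕ)
  | var (x : Var)
  | bin (o : WordRAM.BinOp) (a b : Exp)
  | get (A : Arr) (i : Exp)
  | inp (i : Exp)

instance : Add Exp := ⟨.bin .add⟩
instance : Sub Exp := ⟨.bin .sub⟩
instance : Mul Exp := ⟨.bin .mul⟩
instance : Div Exp := ⟨.bin .div⟩

/-- The value of an expression. -/
def Exp.eval (E : Env) (s : St) : Exp → ℕ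
  | .lit k => k
  | .var x => s.v x
  | .bin o a b => o.eval (a.eval E s) (b.eval E s)
  | .get A i => s.a A (i.eval E s)
  | .inp i => E.word (i.eval E s)

/-- Evaluation neither overflows nor leaves the range of an array or of the input. -/
def Exp.safe (E : Env) (s : St) : Exp → Prop
  | .lit k => k < 2 ^ E.w
  | .var _ => True
  | .bin .add a b => a.safe E s ∧ b.safe E s ∧ a.eval E s + b.eval E s < 2 ^ E.w
  | .bin .mul a b => a.safe E s ∧ b.safe E s ∧ a.eval E s * b.eval E s < 2 ^ E.w
  -- Truncated subtraction and division need no bound: the result is at most the left operand, which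
  -- is a word already.
  | .bin _ a b => a.safe E s ∧ b.safe E s
  | .get _ i => i.safe E s ∧ i.eval E s < E.N
  | .inp i => i.safe E s ∧ i.eval E s < E.inp.length ∧ E.word (i.eval E s) < 2 ^ E.w

section
variable (E : Env) (s : St) (a b : Exp)
@[simp] theorem eval_lit (k : ℕ) : (Exp.lit k).eval E s = k := rfl
@[simp] theorem eval_var (x : Var) : (Exp.var x).eval E s = s.v x := rfl
@[simp] theorem eval_add : (a + b).eval E s = a.eval E s + b.eval E s := rfl
@[simp] theorem eval_sub : (a - b).eval E s = a.eval E s - b.eval E s := rfl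
@[simp] theorem eval_mul : (a * b).eval E s = a.eval E s * b.eval E s := rfl
@[simp] theorem eval_div : (a / b).eval E s = a.eval E s / b.eval E s := rfl
@[simp] theorem eval_get (A : Arr) : (Exp.get A a).eval E s = s.a A (a.eval E s) := rfl
@[simp] theorem eval_inp : (Exp.inp a).eval E s = E.word (a.eval E s) := rfl
@[simp] theorem safe_lit (k : ℕ) : (Exp.lit k).safe E s ↔ k < E.W := Iff.rfl
@[simp] theorem safe_var (x : Var) : (Exp.var x).safe E s ↔ True := Iff.rfl
@[simp] theorem safe_add : (a + b).safe E s ↔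
    a.safe E s ∧ b.safe E s ∧ a.eval E s + b.eval E s < E.W := Iff.rfl
@[simp] theorem safe_sub : (a - b).safe E s ↔ a.safe E s ∧ b.safe E s := Iff.rfl
@[simp] theorem safe_mul : (a * b).safe E s ↔
    a.safe E s ∧ b.safe E s ∧ a.eval E s * b.eval E s < E.W := Iff.rfl
@[simp] theorem safe_div : (a / b).safe E s ↔ a.safe E s ∧ b.safe E s := Iff.rfl
@[simp] theorem safe_get (A : Arr) : (Exp.get A a).safe E s ↔
    a.safe E s ∧ a.eval E s < E.N := Iff.rfl
@[simp] theorem safe_inp : (Exp.inp a).safe E s ↔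
    a.safe E s ∧ a.eval E s < E.inp.length ∧ E.word (a.eval E s) < E.W := Iff.rfl
end

/-- Commands. -/
inductive Cmd
  | skip
  | assign (x : Var) (e : Exp)
  | store (A : Arr) (i e : Exp)
  | seq (p q : Cmd)
  | ite (a b : Exp) (p q : Cmd)
  | while (a b : Exp) (p : Cmd)

infixr:60 " ;; " => Cmd.seq
infix:62 " ::= " => Cmd.assign

/-- Big-step semantics; assignments and tests take one unit of time. -/
inductive Run (E : Env) : Cmd → St → St → Prop
  | skip (s : St) : Run E .skip s s.tick
  | assign (s : St) (x : Var) (e : Exp) (h : e.safe E s) :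
      Run E (.assign x e) s (s.set x (e.eval E s))
  | store (s : St) (A : Arr) (i e : Exp) (hi : i.safe E s) (he : e.safe E s)
      (h : i.eval E s < E.N) : Run E (.store A i e) s (s.put A (i.eval E s) (e.eval E s))
  | seq {p q : Cmd} {s s' s'' : St} (hp : Run E p s s') (hq : Run E q s' s'') :
      Run E (.seq p q) s s''
  | ite_true {a b : Exp} {p q : Cmd} {s s' : St} (ha : a.safe E s) (hb : b.safe E s)
      (h : a.eval E s < b.eval E s) (hp : Run E p s.tick s') : Run E (.ite a b p q) s s'
  | ite_false {a b : Exp} {p q : Cmd} {s s' : St} (ha : a.safe E s) (hb : b.safe E s)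
      (h : ¬ a.eval E s < b.eval E s) (hq : Run E q s.tick s') : Run E (.ite a b p q) s s'
  | while_true {a b : Exp} {p : Cmd} {s s' s'' : St} (ha : a.safe E s) (hb : b.safe E s)
      (h : a.eval E s < b.eval E s) (hp : Run E p s.tick s') (hq : Run E (.while a b p) s' s'') :
      Run E (.while a b p) s s''
  | while_false {a b : Exp} {p : Cmd} {s : St} (ha : a.safe E s) (hb : b.safe E s)
      (h : ¬ a.eval E s < b.eval E s) : Run E (.while a b p) s s.tick

/-- The variables that a command may change. -/
def Cmd.wv : Cmd → Var → Bool
  | .skip, _ => false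
  | .assign x _, y => decide (y = x)
  | .store _ _ _, _ => false
  | .seq p q, y => p.wv y || q.wv y
  | .ite _ _ p q, y => p.wv y || q.wv y
  | .while _ _ p, y => p.wv y

/-- The arrays that a command may change. -/
def Cmd.wa : Cmd → Arr → Bool
  | .skip, _ => false
  | .assign _ _, _ => false
  | .store A _ _, B => decide (B = A)
  | .seq p q, y => p.wa y || q.wa y
  | .ite _ _ p q, y => p.wa y || q.wa y
  | .while _ _ p, y => p.wa y

/-- `s'` agrees with `s` except for what `c` may change. -/
structure Agree (c : Cmd) (s s' : St) : Prop where
  v : ∀ x, c.wv x = false → s'.v x = s.v x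
  a : ∀ A, c.wa A = false → s'.a A = s.a A
  time : s.time ≤ s'.time

/-- The frame rule. Since `wv` and `wa` are computed from the syntax, later proofs settle by `rfl`
that a variable or an array survives a piece of program. -/
theorem Run.agree {E : Env} {c : Cmd} {s s' : St} (h : Run E c s s') : Agree c s s' := by
  induction h with
  | skip s => exact ⟨fun _ _ => rfl, fun _ _ => rfl, by simp⟩
  | assign s x e h =>
    refine ⟨fun y hy => ?_, fun _ _ => rfl, by simp⟩
    simp only [Cmd.wv, decide_eq_false_iff_not] at hy
    simp [hy]
  | store s A i e hi he h =>
    refine ⟨fun _ _ => rfl, fun y hy => ?_, by simp⟩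
    simp only [Cmd.wa, decide_eq_false_iff_not] at hy
    simp [hy]
  | seq _ _ h1 h2 =>
    refine ⟨fun y hy => ?_, fun y hy => ?_, h1.time.trans h2.time⟩
    · simp only [Cmd.wv, Bool.or_eq_false_iff] at hy
      rw [h2.v y hy.2, h1.v y hy.1]
    · simp only [Cmd.wa, Bool.or_eq_false_iff] at hy
      rw [h2.a y hy.2, h1.a y hy.1]
  | ite_true _ _ _ _ ih =>
    refine ⟨fun y hy => ?_, fun y hy => ?_, (Nat.le_succ _).trans ih.time⟩
    · simp only [Cmd.wv, Bool.or_eq_false_iff] at hy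
      exact ih.v y hy.1
    · simp only [Cmd.wa, Bool.or_eq_false_iff] at hy
      exact ih.a y hy.1
  | ite_false _ _ _ _ ih =>
    refine ⟨fun y hy => ?_, fun y hy => ?_, (Nat.le_succ _).trans ih.time⟩
    · simp only [Cmd.wv, Bool.or_eq_false_iff] at hy
      exact ih.v y hy.2
    · simp only [Cmd.wa, Bool.or_eq_false_iff] at hy
      exact ih.a y hy.2
  | while_true _ _ _ _ _ h1 h2 =>
    refine ⟨fun y hy => ?_, fun y hy => ?_, ((Nat.le_succ _).trans h1.time).trans h2.time⟩
    · rw [h2.v y hy, h1.v y hy]; rfl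
    · rw [h2.a y hy, h1.a y hy]; rfl
  | while_false => exact ⟨fun _ _ => rfl, fun _ _ => rfl, by simp⟩

theorem Agree.trans_loop {c : Cmd} {s s' s'' : St} (h1 : Agree c s s') (h2 : Agree c s' s'') :
    Agree c s s'' :=
  ⟨fun x hx => (h2.v x hx).trans (h1.v x hx), fun x hx => (h2.a x hx).trans (h1.a x hx),
    h1.time.trans h2.time⟩

/-! ### Weakest preconditions, and rules for loops that also bound the time. -/

/-- Weakest precondition. -/
def wp (E : Env) (c : Cmd) (Q : St → Prop) (s : St) : Prop := ∃ s', Run E c s s' ∧ Q s'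

section
variable {E : Env} {s : St} {Q : St → Prop}

@[simp] theorem wp_skip : wp E .skip Q s ↔ Q s.tick :=
  ⟨fun ⟨_, h, hq⟩ => by cases h; exact hq, fun h => ⟨_, .skip s, h⟩⟩

@[simp] theorem wp_assign {x : Var} {e : Exp} :
    wp E (x ::= e) Q s ↔ e.safe E s ∧ Q (s.set x (e.eval E s)) :=
  ⟨fun ⟨_, h, hq⟩ => by cases h with | assign _ _ _ h => exact ⟨h, hq⟩,
    fun h => ⟨_, .assign s x e h.1, h.2⟩⟩

@[simp] theorem wp_store {A : Arr} {i e : Exp} :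
    wp E (.store A i e) Q s ↔ i.safe E s ∧ e.safe E s ∧ i.eval E s < E.N ∧
      Q (s.put A (i.eval E s) (e.eval E s)) :=
  ⟨fun ⟨_, h, hq⟩ => by cases h with | store _ _ _ _ h1 h2 h3 => exact ⟨h1, h2, h3, hq⟩,
    fun h => ⟨_, .store s A i e h.1 h.2.1 h.2.2.1, h.2.2.2⟩⟩

@[simp] theorem wp_seq {p q : Cmd} : wp E (p ;; q) Q s ↔ wp E p (fun s' => wp E q Q s') s :=
  ⟨fun ⟨_, h, hq⟩ => by cases h with | seq h1 h2 => exact ⟨_, h1, _, h2, hq⟩,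
    fun ⟨_, h1, _, h2, hq⟩ => ⟨_, .seq h1 h2, hq⟩⟩

@[simp] theorem wp_ite {a b : Exp} {p q : Cmd} :
    wp E (.ite a b p q) Q s ↔ a.safe E s ∧ b.safe E s ∧
      (a.eval E s < b.eval E s → wp E p Q s.tick) ∧
      (b.eval E s ≤ a.eval E s → wp E q Q s.tick) := by
  constructor
  · rintro ⟨_, h, hq⟩
    cases h with
    | ite_true ha hb h hp => exact ⟨ha, hb, fun _ => ⟨_, hp, hq⟩, fun h' => absurd h h'.not_gt⟩
    | ite_false ha hb h hp => exact ⟨ha, hb, fun h' => absurd h' h, fun _ => ⟨_, hp, hq⟩⟩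
  · rintro ⟨ha, hb, h1, h2⟩
    by_cases h : a.eval E s < b.eval E s
    · obtain ⟨s', hr, hq⟩ := h1 h
      exact ⟨s', .ite_true ha hb h hr, hq⟩
    · obtain ⟨s', hr, hq⟩ := h2 (not_lt.1 h)
      exact ⟨s', .ite_false ha hb h hr, hq⟩

/-- Besides the consequence rule this supplies the frame `Agree c s s'`, so specifications of
subprograms need not list what they leave unchanged. -/
theorem wp_mono {c : Cmd} {P : St → Prop} (h : wp E c P s)
    (hQ : ∀ s', P s' → Agree c s s' → Q s') : wp E c Q s :=
  let ⟨s', hr, hp⟩ := h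
  ⟨s', hr, hQ s' hp hr.agree⟩

/-- The rule for loops, with an invariant and a measure. -/
theorem wp_while {a b : Exp} {p : Cmd} (I : St → Prop) (μ : St → ℕ) (h0 : I s)
    (hstep : ∀ s', Agree p s s' → I s' → a.safe E s' ∧ b.safe E s' ∧
      (a.eval E s' < b.eval E s' → wp E p (fun s'' => I s'' ∧ μ s'' < μ s') s'.tick) ∧
      (b.eval E s' ≤ a.eval E s' → Q s'.tick)) :
    wp E (.while a b p) Q s := by
  -- Induction on a bound for the measure. The frame relative to the state in which the loop was
  -- entered is carried along, so that invariants need not repeat it.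
  have key : ∀ (N : ℕ) (s' : St), μ s' < N → Agree p s s' → I s' → wp E (.while a b p) Q s' := by
    intro N
    induction N with
    | zero => intro s' h; exact absurd h (Nat.not_lt_zero _)
    | succ N ih =>
      intro s' hm hA hI
      obtain ⟨ha, hb, h1, h2⟩ := hstep s' hA hI
      by_cases h : a.eval E s' < b.eval E s'
      · obtain ⟨s1, hr, hi, hlt⟩ := h1 h
        have hag := hr.agree
        obtain ⟨s2, hr2, hq⟩ := ih s1 (by omega)
          (hA.trans_loop ⟨fun x hx => by rw [hag.v x hx]; rfl, fun x hx => by rw [hag.a x hx]; rfl,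
            (Nat.le_succ _).trans hag.time⟩) hi
        exact ⟨s2, .while_true ha hb h hr hr2, hq⟩
      · exact ⟨_, .while_false ha hb h, h2 (not_lt.1 h)⟩
  exact key _ s (Nat.lt_succ_self _) ⟨fun _ _ => rfl, fun _ _ => rfl, le_rfl⟩ h0

/-- `for x = 0, …, e - 1 do p`. -/
def Cmd.for (x : Var) (e : Exp) (p : Cmd) : Cmd :=
  x ::= .lit 0 ;; .while (.var x) e (p ;; x ::= .var x + Exp.lit 1)

/-- The rule for counting loops; `f` bounds the time. -/
theorem wp_for {x : Var} {e : Exp} {p : Cmd} (m : ℕ) (f : ℕ → St → ℕ) (I : ℕ → St → Prop)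
    (hm : m < E.W) (hx : p.wv x = false)
    (h0 : I 0 (s.set x 0))
    (he : ∀ j ≤ m, ∀ s', I j s' → Agree (p ;; x ::= .var x + Exp.lit 1) s s' →
      s'.v x = j → e.safe E s' ∧ e.eval E s' = m)
    (hstep : ∀ j < m, ∀ s', I j s' → Agree (p ;; x ::= .var x + Exp.lit 1) s s' → s'.v x = j →
      wp E p (fun s'' => I (j + 1) (s''.set x (j + 1)) ∧ 
        s''.time + 1 + f j s' ≤ s'.time + f (j + 1) (s''.set x (j + 1)))
        s'.tick)
    (hQ : ∀ s', I m s' → Agree (p ;; x ::= .var x + Exp.lit 1) s s' → s'.v x = m →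
      s'.time + f 0 (s.set x 0) ≤ s.time + 1 + f m s' → Q s'.tick) :
    wp E (.for x e p) Q s := by
  have hw : 0 < E.W := by unfold Env.W; positivity
  -- The time bounds of the rounds telescope: the clock advances by no more than `f` grows. As `f`
  -- may depend on the state it can serve as a potential for amortised bounds. The `1` is for the
  -- assignment `x := 0`.
  have key : ∀ (N j : ℕ) (s' : St), j + N = m → s'.v x = j → I j s' →
      Agree (p ;; x ::= .var x + Exp.lit 1) s s' → s'.time + f 0 (s.set x 0) ≤ s.time + 1 + f j s' →
      wp E (.while (.var x) e (p ;; x ::= .var x + Exp.lit 1)) Q s' := by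
    intro N
    induction N with
    | zero =>
      intro j s' hj hxj hI hA ht
      obtain rfl : j = m := by omega
      obtain ⟨h1, h2⟩ := he j le_rfl s' hI hA hxj
      refine ⟨_, .while_false (by simp) h1 (by simp [h2, hxj]), hQ s' hI hA hxj ht⟩
    | succ N ih =>
      intro j s' hj hxj hI hA ht
      obtain ⟨h1, h2⟩ := he j (by omega) s' hI hA hxj
      obtain ⟨s1, hr, hI1, ht1⟩ := hstep j (by omega) s' hI hA hxj
      have hag := hr.agree
      have hx1 : s1.v x = j := by rw [hag.v x hx]; exact hxj
      have hr' : Run E (p ;; x ::= .var x + Exp.lit 1) s'.tick (s1.set x (j + 1)) := by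
        refine .seq hr ?_
        have := Run.assign (E := E) s1 x (.var x + Exp.lit 1)
          (by simp only [safe_add, safe_var, safe_lit, eval_var, eval_lit, hx1, true_and]; omega)
        simpa [hx1] using this
      have hag' := hr'.agree
      obtain ⟨s2, hr2, hq⟩ := ih (j + 1) (s1.set x (j + 1)) (by omega) (by simp) hI1
        (hA.trans_loop ⟨fun y hy => by rw [hag'.v y hy]; rfl,
          fun y hy => by rw [hag'.a y hy]; rfl, (Nat.le_succ _).trans hag'.time⟩)
        (by simp only [St.set_time]; omega)
      exact ⟨s2, .while_true (by simp) h1 (by simp only [eval_var]; omega) hr' hr2, hq⟩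
  simp only [Cmd.for, wp_seq, wp_assign, safe_lit, eval_lit]
  refine ⟨hw, key m 0 _ (by omega) (by simp) h0 ⟨fun y hy => ?_, fun _ _ => rfl, by simp⟩ (by simp)⟩
  simp only [Cmd.wv, Bool.or_eq_false_iff, decide_eq_false_iff_not] at hy
  simp [hy.2]

end

/-! ### Compilation -/

open WordRAM (Prog State Exec BinOp)

/-- Evaluate an expression into register `d`, using registers from `d` on. -/
def Exp.compile : Exp → ℕ → Prog
  | .lit k, d => .const d k
  -- The machine has no move instruction; a register is copied by adding it to zero.
  | .var x, d => .seq (.const d 0) (.op .add d d x.ctorIdx)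
  | .bin o a b, d => .seq (a.compile d) (.seq (b.compile (d + 1)) (.op o d d (d + 1)))
  -- The arrays are interleaved with stride 32: cell `i` of `A` has the address `32 * i +
  -- A.ctorIdx`.
  | .get A i, d => .seq (i.compile d) (.seq (.seq (.const (d + 1) 32) (.seq (.op .mul d d (d + 1))
      (.seq (.const (d + 1) A.ctorIdx) (.op .add d d (d + 1))))) (.load d d))
  | .inp i, d => .seq (i.compile d) (.input d d)

def Exp.cost : Exp → ℕ
  | .lit _ => 1
  | .var _ => 2
  | .bin _ a b => a.cost + (b.cost + 1)
  | .get _ i => i.cost + (4 + 1)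
  | .inp i => i.cost + 1

/-- Registers below 64 hold the variables, those from 64 on are scratch. The machine compares
registers only, so a loop evaluates its test once beforehand and again at the end of each round. -/
def Cmd.compile : Cmd → Prog
  | .skip => .skip
  | .assign x e => .seq (e.compile 64) (.seq (.const x.ctorIdx 0) (.op .add x.ctorIdx x.ctorIdx 64))
  | .store A i e => .seq (i.compile 64) (.seq (.seq (.const 65 32) (.seq (.op .mul 64 64 65)
      (.seq (.const 65 A.ctorIdx) (.op .add 64 64 65)))) (.seq (e.compile 65) (.store 64 65)))
  | .seq p q => .seq p.compile q.compile
  | .ite a b p q => .seq (.seq (a.compile 64) (b.compile 65)) (.ite 64 65 p.compile q.compile)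
  | .while a b p => .seq (.seq (a.compile 64) (b.compile 65))
      (.while 64 65 (.seq p.compile (.seq (a.compile 64) (b.compile 65))))

/-- The largest number of machine steps per unit of time. -/
def Cmd.cost : Cmd → ℕ
  | .skip => 1
  | .assign _ e => e.cost + 2
  | .store _ i e => i.cost + e.cost + 5
  | .seq p q => max p.cost q.cost
  | .ite a b p q => max (a.cost + b.cost + 1) (max p.cost q.cost)
  | .while a b p => max (a.cost + b.cost + 1) p.cost

/-- The machine configuration `σ` represents `s`. -/
structure Rep (E : Env) (σ : State) (s : St) : Prop where
  v : ∀ x : Var, σ.reg x.ctorIdx = s.v x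
  a : ∀ (A : Arr) (i : ℕ), i < E.N → σ.mem (32 * i + A.ctorIdx) = s.a A i
  reg : ∀ i, σ.reg i < 2 ^ E.w
  mem : ∀ i, σ.mem i < 2 ^ E.w

theorem Rep.setTmp {E : Env} {σ : State} {s : St} (h : Rep E σ s) {d k : ℕ} (hd : 64 ≤ d)
    (hk : k < 2 ^ E.w) : Rep E (σ.setReg d k) s := by
  refine ⟨fun x => ?_, h.a, fun i => ?_, h.mem⟩
  · have := x.ctorIdx_lt
    simp only [State.setReg]
    rw [Function.update_of_ne (by omega), h.v]
  · simp only [State.setReg, Function.update_apply]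
    split_ifs
    · exact hk
    · exact h.reg i

theorem Rep.tick {E : Env} {σ : State} {s : St} (h : Rep E σ s) : Rep E σ s.tick :=
  ⟨h.v, h.a, h.reg, h.mem⟩

/-- The bound `hW` leaves room in a word for every address, for the stride and for the index of the
array. -/
theorem address {E : Env} {S : ℕ} {σ : State} {s : St} (h : Rep E σ s) (hS : 32 * E.N ≤ S)
    (hW : 32 * E.N + 64 ≤ 2 ^ E.w) (A : Arr) (d : ℕ) (hd : 64 ≤ d) (hi : σ.reg d < E.N) :
    ∃ σ', Exec E.w S E.inp (.seq (.const (d + 1) 32) (.seq (.op .mul d d (d + 1))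
      (.seq (.const (d + 1) A.ctorIdx) (.op .add d d (d + 1))))) σ 4 σ' ∧ Rep E σ' s ∧
      σ'.reg d = 32 * σ.reg d + A.ctorIdx ∧ (∀ i < d, σ'.reg i = σ.reg i) ∧ σ'.mem = σ.mem := by
  have hA := A.ctorIdx_lt
  have e1 : (σ.setReg (d + 1) 32).reg d = σ.reg d := by simp [State.setReg]
  have e2 : (σ.setReg (d + 1) 32).reg (d + 1) = 32 := by simp [State.setReg]
  let σ2 := ((σ.setReg (d + 1) 32).setReg d (σ.reg d * 32)).setReg (d + 1) A.ctorIdx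
  have e3 : σ2.reg d = σ.reg d * 32 := by simp [σ2, State.setReg]
  have e4 : σ2.reg (d + 1) = A.ctorIdx := by simp [σ2, State.setReg]
  have hr2 : Rep E σ2 s :=
    ((h.setTmp (by omega) (by omega)).setTmp hd (by omega)).setTmp (by omega) (by omega)
  refine ⟨σ2.setReg d (σ.reg d * 32 + A.ctorIdx), ?_, hr2.setTmp hd (by omega), ?_, ?_, ?_⟩
  · refine .seq (k := 1) (l := 3) (.const _ _ _ (by omega)) (.seq (k := 1) (l := 2)
      (σ' := (σ.setReg (d + 1) 32).setReg d (σ.reg d * 32)) ?_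
      (.seq (k := 1) (l := 1) (.const _ _ _ (by omega)) ?_))
    · have := Exec.op (w := E.w) (S := S) (inp := E.inp) (σ.setReg (d + 1) 32) .mul d d (d + 1)
        (by rw [e1, e2]; simp only [BinOp.eval]; omega)
      rw [e1, e2] at this
      exact this
    · have := Exec.op (w := E.w) (S := S) (inp := E.inp) σ2 .add d d (d + 1)
        (by rw [e3, e4]; simp only [BinOp.eval]; omega)
      rw [e3, e4] at this
      exact this
  · simp [State.setReg, mul_comm]
  · intro i hi
    simp only [State.setReg, σ2]
    rw [Function.update_of_ne (by omega), Function.update_of_ne (by omega),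
      Function.update_of_ne (by omega), Function.update_of_ne (by omega)]
  · rfl

/-- Registers below `d` survive, which is why the value of a left operand can wait in `d` while the
right one is evaluated from `d + 1` on. -/
theorem compile_exp {E : Env} {S : ℕ} (hS : 32 * E.N ≤ S) (hW : 32 * E.N + 64 ≤ 2 ^ E.w) {s : St}
    (e : Exp) : ∀ (d : ℕ) (σ : State), 64 ≤ d → Rep E σ s → e.safe E s →
    ∃ σ', Exec E.w S E.inp (e.compile d) σ e.cost σ' ∧ Rep E σ' s ∧ σ'.reg d = e.eval E s ∧
      (∀ i < d, σ'.reg i = σ.reg i) ∧ σ'.mem = σ.mem := by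
  induction e with
  | lit k =>
    intro d σ hd hr hs
    refine ⟨_, .const σ d k hs, hr.setTmp hd hs, by simp [State.setReg], fun i hi => ?_, rfl⟩
    simp [State.setReg, Function.update_of_ne (show i ≠ d by omega)]
  | var x =>
    intro d σ hd hr hs
    have hx := x.ctorIdx_lt
    have hw : 0 < 2 ^ E.w := by positivity
    have e1 : (σ.setReg d 0).reg d = 0 := by simp [State.setReg]
    have e2 : (σ.setReg d 0).reg x.ctorIdx = s.v x := by
      simp only [State.setReg]
      rw [Function.update_of_ne (by omega), hr.v]
    have hb : s.v x < 2 ^ E.w := by rw [← hr.v]; exact hr.reg _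
    have h2 := Exec.op (w := E.w) (S := S) (inp := E.inp) (σ.setReg d 0) .add d d x.ctorIdx
      (by rw [e1, e2]; simpa [BinOp.eval] using hb)
    rw [e1, e2] at h2
    simp only [BinOp.eval, zero_add] at h2
    refine ⟨_, .seq (k := 1) (l := 1) (.const σ d 0 hw) h2,
      (hr.setTmp hd hw).setTmp hd hb, by simp [State.setReg], fun i hi => ?_, rfl⟩
    simp [State.setReg, Function.update_of_ne (show i ≠ d by omega)]
  | bin o a b iha ihb =>
    intro d σ hd hr hs
    have hsa : a.safe E s := by cases o <;> exact hs.1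
    have hsb : b.safe E s := by
      cases o
      · exact hs.2.1
      · exact hs.2
      · exact hs.2.1
      · exact hs.2
    obtain ⟨σ1, x1, r1, v1, f1, m1⟩ := iha d σ hd hr hsa
    obtain ⟨σ2, x2, r2, v2, f2, m2⟩ := ihb (d + 1) σ1 (by omega) r1 hsb
    have v1' : σ2.reg d = a.eval E s := by rw [f2 d (by omega), v1]
    have hb : o.eval (a.eval E s) (b.eval E s) < 2 ^ E.w := by
      have := r1.reg d
      rw [v1] at this
      cases o
      · exact hs.2.2
      · exact (Nat.sub_le _ _).trans_lt this
      · exact hs.2.2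
      · exact (Nat.div_le_self _ _).trans_lt this
    have h3 := Exec.op (w := E.w) (S := S) (inp := E.inp) σ2 o d d (d + 1) (by rw [v1', v2]; exact hb)
    rw [v1', v2] at h3
    refine ⟨_, .seq x1 (.seq x2 h3), r2.setTmp hd hb, by simp [State.setReg, Exp.eval],
      fun i hi => ?_, by rw [← m1, ← m2]; rfl⟩
    rw [← f1 i hi, ← f2 i (by omega)]
    simp [State.setReg, Function.update_of_ne (show i ≠ d by omega)]
  | get A i ih =>
    intro d σ hd hr hs
    obtain ⟨σ1, x1, r1, v1, f1, m1⟩ := ih d σ hd hr hs.1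
    obtain ⟨σ2, x2, r2, v2, f2, m2⟩ := address r1 hS hW A d hd (by rw [v1]; exact hs.2)
    have hA := A.ctorIdx_lt
    have hs2 := hs.2
    have h3 := Exec.load (w := E.w) (S := S) (inp := E.inp) σ2 d d (by rw [v2, v1]; omega)
    rw [v2, v1, r2.a A _ hs.2] at h3
    have hb : s.a A (i.eval E s) < 2 ^ E.w := by rw [← r2.a A _ hs.2]; exact r2.mem _
    refine ⟨_, .seq x1 (.seq x2 h3), r2.setTmp hd hb, by simp [State.setReg, Exp.eval],
      fun i hi => ?_, by rw [← m1, ← m2]; rfl⟩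
    rw [← f1 i hi, ← f2 i hi]
    simp [State.setReg, Function.update_of_ne (show i ≠ d by omega)]
  | inp i ih =>
    intro d σ hd hr hs
    obtain ⟨σ1, x1, r1, v1, f1, m1⟩ := ih d σ hd hr hs.1
    obtain ⟨-, hl, hb⟩ := hs
    have hl' : σ1.reg d < E.inp.length := by rw [v1]; exact hl
    have e1 : E.inp[σ1.reg d] = E.word (i.eval E s) := by
      rw [Env.word, List.getD_eq_getElem _ _ hl]
      simp only [v1]
    have h3 := Exec.input (w := E.w) (S := S) σ1 d d hl' (by rw [e1]; exact hb)
    rw [e1] at h3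
    refine ⟨_, .seq x1 h3, r1.setTmp hd hb, by simp [State.setReg, Exp.eval],
      fun i hi => ?_, by rw [← m1]; rfl⟩
    rw [← f1 i hi]
    simp [State.setReg, Function.update_of_ne (show i ≠ d by omega)]

theorem compile_test {E : Env} {S : ℕ} (hS : 32 * E.N ≤ S) (hW : 32 * E.N + 64 ≤ 2 ^ E.w) {s : St}
    {a b : Exp} {σ : State} (hr : Rep E σ s) (ha : a.safe E s) (hb : b.safe E s) :
    ∃ σ', Exec E.w S E.inp (.seq (a.compile 64) (b.compile 65)) σ (a.cost + b.cost) σ' ∧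
      Rep E σ' s ∧ σ'.reg 64 = a.eval E s ∧ σ'.reg 65 = b.eval E s := by
  obtain ⟨σ1, x1, r1, v1, f1, m1⟩ := compile_exp hS hW a 64 σ le_rfl hr ha
  obtain ⟨σ2, x2, r2, v2, f2, m2⟩ := compile_exp hS hW b 65 σ1 (by omega) r1 hb
  exact ⟨σ2, .seq x1 x2, r2, by rw [f2 64 (by omega), v1], v2⟩

/-- Needed for loops: the run of a compiled loop is split into its first test and the machine loop,
so that another round can be put in front. -/
theorem exec_seq {w S : ℕ} {inp : List ℕ} {p q : Prog} {σ σ' : State} {k : ℕ}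
    (h : Exec w S inp (.seq p q) σ k σ') :
    ∃ k₁ k₂ τ, k = k₁ + k₂ ∧ Exec w S inp p σ k₁ τ ∧ Exec w S inp q τ k₂ σ' := by
  cases h with
  | seq h1 h2 => exact ⟨_, _, _, rfl, h1, h2⟩

/-- Compiled commands simulate the semantics, at constant cost per unit of time. -/
theorem compile_correct {E : Env} {S : ℕ} (hS : 32 * E.N ≤ S) (hW : 32 * E.N + 64 ≤ 2 ^ E.w)
    {c : Cmd} {s s' : St} (h : Run E c s s') : ∀ (M : ℕ), c.cost ≤ M → ∀ σ, Rep E σ s →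
    ∃ k σ', Exec E.w S E.inp c.compile σ k σ' ∧ Rep E σ' s' ∧ k + M * s.time ≤ M * s'.time := by
  -- The claim is for every `M` above the cost of the command, so that one constant serves both
  -- halves of a sequence.
  induction h with
  | skip s =>
    intro M hM σ hr
    simp only [Cmd.cost] at hM
    exact ⟨1, σ, .skip σ, hr.tick, by simp only [St.tick_time]; linarith⟩
  | assign s x e h =>
    intro M hM σ hr
    simp only [Cmd.cost] at hM
    obtain ⟨σ1, x1, r1, v1, f1, m1⟩ := compile_exp hS hW e 64 σ le_rfl hr h
    have hx := x.ctorIdx_lt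
    have hw : 0 < 2 ^ E.w := by positivity
    have hb : e.eval E s < 2 ^ E.w := by rw [← v1]; exact r1.reg _
    have e1 : (σ1.setReg x.ctorIdx 0).reg x.ctorIdx = 0 := by simp [State.setReg]
    have e2 : (σ1.setReg x.ctorIdx 0).reg 64 = e.eval E s := by
      simp only [State.setReg]
      rw [Function.update_of_ne (by omega), v1]
    have h3 := Exec.op (w := E.w) (S := S) (inp := E.inp) (σ1.setReg x.ctorIdx 0) .add
      x.ctorIdx x.ctorIdx 64 (by rw [e1, e2]; simpa [BinOp.eval] using hb)
    rw [e1, e2] at h3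
    simp only [BinOp.eval, zero_add] at h3
    refine ⟨_, _, .seq x1 (.seq (.const _ _ _ hw) h3), ⟨fun y => ?_, r1.a, fun i => ?_, r1.mem⟩,
      by simp only [St.set_time]; linarith⟩
    · by_cases hy : y = x
      · subst hy
        simp [State.setReg]
      · have : y.ctorIdx ≠ x.ctorIdx := fun h => hy (Var.ctorIdx_inj h)
        simp [State.setReg, Function.update_of_ne this, hy, r1.v]
    · simp only [State.setReg, Function.update_idem, Function.update_apply]
      split_ifs
      · exact hb
      · exact r1.reg i
  | store s A i e hi he h =>
    intro M hM σ hr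
    simp only [Cmd.cost] at hM
    obtain ⟨σ1, x1, r1, v1, f1, m1⟩ := compile_exp hS hW i 64 σ le_rfl hr hi
    obtain ⟨σ2, x2, r2, v2, f2, m2⟩ := address r1 hS hW A 64 le_rfl (by rw [v1]; exact h)
    obtain ⟨σ3, x3, r3, v3, f3, m3⟩ := compile_exp hS hW e 65 σ2 (by omega) r2 he
    have hA := A.ctorIdx_lt
    have e1 : σ3.reg 64 = 32 * i.eval E s + A.ctorIdx := by rw [f3 64 (by omega), v2, v1]
    have hb : e.eval E s < 2 ^ E.w := by rw [← v3]; exact r3.reg _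
    have h4 := Exec.store (w := E.w) (S := S) (inp := E.inp) σ3 64 65 (by rw [e1]; omega)
    rw [e1, v3] at h4
    refine ⟨_, _, .seq x1 (.seq x2 (.seq x3 h4)), ⟨r3.v, fun B j hj => ?_, r3.reg, fun j => ?_⟩,
      by simp only [St.put_time]; linarith⟩
    · have hB := B.ctorIdx_lt
      simp only [State.setMem, St.put_a, Function.update_apply]
      by_cases hBA : B = A
      · subst hBA
        by_cases hij : j = i.eval E s
        · subst hij
          simp
        · rw [if_neg (by omega), if_pos rfl, upd_of_ne hij, r3.a _ _ hj]
      · have : B.ctorIdx ≠ A.ctorIdx := fun h => hBA (Arr.ctorIdx_inj h)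
        rw [if_neg (by omega), if_neg hBA, r3.a _ _ hj]
    · simp only [State.setMem, Function.update_apply]
      split_ifs
      · exact hb
      · exact r3.mem j
  | seq _ _ ih1 ih2 =>
    intro M hM σ hr
    simp only [Cmd.cost, max_le_iff] at hM
    obtain ⟨k1, σ1, x1, r1, t1⟩ := ih1 M hM.1 σ hr
    obtain ⟨k2, σ2, x2, r2, t2⟩ := ih2 M hM.2 σ1 r1
    exact ⟨_, σ2, .seq x1 x2, r2, by omega⟩
  | ite_true ha hb h _ ih =>
    intro M hM σ hr
    simp only [Cmd.cost, max_le_iff] at hM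
    obtain ⟨σ1, x1, r1, v1, v2⟩ := compile_test hS hW hr ha hb
    obtain ⟨k2, σ2, x2, r2, t2⟩ := ih M hM.2.1 σ1 r1.tick
    refine ⟨_, σ2, .seq x1 (.ite_true (by rw [v1, v2]; exact h) x2), r2, ?_⟩
    simp only [St.tick_time] at t2
    linarith
  | ite_false ha hb h _ ih =>
    intro M hM σ hr
    simp only [Cmd.cost, max_le_iff] at hM
    obtain ⟨σ1, x1, r1, v1, v2⟩ := compile_test hS hW hr ha hb
    obtain ⟨k2, σ2, x2, r2, t2⟩ := ih M hM.2.2 σ1 r1.tick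
    refine ⟨_, σ2, .seq x1 (.ite_false (by rw [v1, v2]; exact h) x2), r2, ?_⟩
    simp only [St.tick_time] at t2
    linarith
  | while_true ha hb h _ _ ih1 ih2 =>
    intro M hM σ hr
    have hM' := hM
    simp only [Cmd.cost, max_le_iff] at hM
    obtain ⟨σ1, x1, r1, v1, v2⟩ := compile_test hS hW hr ha hb
    obtain ⟨k2, σ2, x2, r2, t2⟩ := ih1 M hM.2 σ1 r1.tick
    obtain ⟨k3, σ3, x3, r3, t3⟩ := ih2 M hM' σ2 r2
    -- The remaining loop begins with its own evaluation of the test, which is exactly the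
    -- evaluation that ends the compiled body of the present round.
    obtain ⟨l1, l2, τ, rfl, y1, y2⟩ := exec_seq x3
    refine ⟨_, σ3, .seq x1 (.while_true (by rw [v1, v2]; exact h) (.seq x2 y1) y2), r3, ?_⟩
    simp only [St.tick_time] at t2
    linarith
  | while_false ha hb h =>
    intro M hM σ hr
    simp only [Cmd.cost, max_le_iff] at hM
    obtain ⟨σ1, x1, r1, v1, v2⟩ := compile_test hS hW hr ha hb
    refine ⟨_, σ1, .seq x1 (.while_false (by rw [v1, v2]; exact h)), r1.tick, ?_⟩
    simp only [St.tick_time]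
    linarith

/-! ### Bucket lists -/

/-- `h` is the head of a linked list with elements `l`; elements are shifted by one, `0` is the
end of the list. -/
def Chain (nx : ℕ → ℕ) : ℕ → List ℕ → Prop
  | h, [] => h = 0
  | h, x :: l => h = x + 1 ∧ Chain nx (nx x) l

theorem Chain.congr {nx nx' : ℕ → ℕ} {h : ℕ} {l : List ℕ} (hc : Chain nx h l)
    (he : ∀ x ∈ l, nx' x = nx x) : Chain nx' h l := by
  induction l generalizing h with
  | nil => exact hc
  | cons x l ih =>
    refine ⟨hc.1, ?_⟩
    rw [he x (by simp)]
    exact ih hc.2 fun y hy => he y (by simp [hy])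

/-- The indices in `[a, k)` with key `z`. -/
def keyList (key : ℕ → ℕ) (z a k : ℕ) : List ℕ :=
  (List.range' a (k - a)).filter fun x => key x = z

theorem mem_keyList {key : ℕ → ℕ} {z a k x : ℕ} :
    x ∈ keyList key z a k ↔ a ≤ x ∧ x < k ∧ key x = z := by
  simp [keyList, List.mem_range'_1]
  omega

theorem keyList_self (key : ℕ → ℕ) (z k : ℕ) : keyList key z k k = [] := by simp [keyList]

theorem keyList_step (key : ℕ → ℕ) (z : ℕ) {a k : ℕ} (h : a < k) :
    keyList key z a k = if key a = z then a :: keyList key z (a + 1) k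
      else keyList key z (a + 1) k := by
  have : k - a = (k - (a + 1)) + 1 := by omega
  simp only [keyList, this, List.range'_succ, List.filter_cons, decide_eq_true_eq]

/-- The buckets partition the indices. This is what makes a cost linear in the length of each bucket
linear in total. -/
theorem sum_length_keyList (key : ℕ → ℕ) {V k : ℕ} (h : ∀ x < k, key x < V) :
    ∑ z ∈ Finset.range V, (keyList key z 0 k).length = k := by
  have h1 : ∀ z, (keyList key z 0 k).length = ((Finset.range k).filter fun x => key x = z).card := by
    intro z
    rw [keyList, Nat.sub_zero, ← List.range_eq_range']
    rfl
  simp only [h1]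
  rw [← Finset.card_eq_sum_card_fiberwise (f := key) (t := Finset.range V)]
  · simp
  · intro x hx
    simpa using h x (by simpa using hx)

abbrev v (x : Var) : Exp := .var x
abbrev lit (k : ℕ) : Exp := .lit k
abbrev rd (A : Arr) (e : Exp) : Exp := .get A e

/-- Sort the indices `< k` into linked lists according to their keys `< V`. -/
def bucket (key : Arr) : Cmd :=
  .for .z (v .V) (.store .head (v .z) (lit 0)) ;;
  .for .g (v .k) (.y ::= v .k - lit 1 - v .g ;;
    .store .nxt (v .y) (rd .head (rd key (v .y))) ;;
    .store .head (rd key (v .y)) (v .y + lit 1))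

/-- Indices are put in front of their lists in decreasing order, hence every list is increasing. The
naming of pairs relies on this order to find least representatives. -/
theorem bucket_spec {E : Env} (hE : 100 * (E.N + 1) ≤ E.W) {s : St} {key : Arr} {k V : ℕ}
    (hk : s.v .k = k) (hV : s.v .V = V) (hkN : k ≤ E.N) (hVN : V ≤ E.N)
    (hkey : ∀ x < k, s.a key x < V) (h1 : key ≠ .head) (h2 : key ≠ .nxt) :
    wp E (bucket key) (fun s' => s'.time ≤ s.time + 10 * (k + V + 1) ∧
      ∀ z < V, Chain (s'.a .nxt) (s'.a .head z) (keyList (s.a key) z 0 k)) s := by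
  have h1' := h1.symm
  simp only [bucket, wp_seq]
  refine wp_for V (fun j _ => 3 * j) (fun j s' => ∀ z < j, s'.a .head z = 0) (by omega) rfl
    (by simp) (fun j hj s' hI hA hz => ?_) (fun j hj s' hI hA hz => ?_) (fun s' hI hA hz ht => ?_)
  · simpa [hA.v .V rfl]
  · simp [hz, upd_apply]
    and_intros <;> try omega
    intro z hz
    exact fun hne => hI z (by omega)
  have hk' : s'.v .k = k := by rw [hA.v .k rfl, hk]
  have hkey' : s'.a key = s.a key := hA.a key (by simp [Cmd.wa, h1])
  refine wp_for k (fun j _ => 5 * j)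
    (fun j s' => ∀ z < V, Chain (s'.a .nxt) (s'.a .head z) (keyList (s.a key) z (k - j) k))
    (by omega) rfl ?_ (fun j hj s2 hI hA2 hz => ?_) (fun j hj s2 hI2 hA2 hz => ?_)
    (fun s2 hI2 hA2 hz ht2 => ?_)
  · intro z hz
    simp only [St.set_a, St.tick_a, Nat.sub_zero, keyList_self]
    exact hI z hz
  · simpa [hA2.v .k rfl]
  · have hk2 : s2.v .k = k := by rw [hA2.v .k rfl]; exact hk'
    have hkey2 : s2.a key = s.a key := by
      rw [hA2.a key (by simp [Cmd.wa, h1, h2])]; exact hkey'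
    obtain ⟨y, hy⟩ : ∃ y, y = k - 1 - j := ⟨_, rfl⟩
    have hky := hkey y (by omega)
    have e : k - j = y + 1 := by omega
    have e' : k - (j + 1) = y := by omega
    rw [e] at hI2
    simp [hz, hk2, hkey2, h2, ← hy, e']
    and_intros <;> try omega
    intro z hz
    -- The lists built so far contain only indices above `y`, so overwriting the link of `y` does
    -- not touch them.
    have hch := (hI2 z hz).congr (nx' := upd (s2.a .nxt) y (s2.a .head (s.a key y)))
      (fun x hx => by
        rw [mem_keyList] at hx
        rw [upd_of_ne (by omega)])
    rw [keyList_step _ _ (show y < k by omega)]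
    split_ifs with hzk
    · subst hzk
      simpa [Chain] using hch
    · simpa [upd_of_ne (Ne.symm hzk)] using hch
  · refine ⟨by simp only [St.tick_time] at *; omega, ?_⟩
    simpa using hI2

/-- Run `body` with `x` ranging over the list with head `h`. -/
def Cmd.chain (body : Cmd) : Cmd :=
  .while (lit 0) (v .h) (.x ::= v .h - lit 1 ;; body ;; .h ::= rd .nxt (v .x))

/-- The invariant refers to the part of the list already visited. Each element costs `c` for the
body and 3 for the test, for fetching the element and for advancing. -/
theorem wp_chain {E : Env} (hE : 100 * (E.N + 1) ≤ E.W) {s : St} {Q : St → Prop} {body : Cmd}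
    (c : ℕ) (l : List ℕ) (I : List ℕ → St → Prop) (hl : ∀ x ∈ l, x < E.N)
    (hh : body.wv .h = false) (hx : body.wv .x = false) (hn : body.wa .nxt = false)
    (hc : Chain (s.a .nxt) (s.v .h) l) (h0 : I [] s)
    (hstep : ∀ d x r, l = d ++ x :: r → ∀ s', I d s' →
      Agree (.x ::= v .h - lit 1 ;; body ;; .h ::= rd .nxt (v .x)) s s' →
      wp E body (fun s'' => (∀ y, I (d ++ [x]) (s''.set .h y)) ∧ s''.time ≤ s'.time + 2 + c)
        (s'.tick.set .x x))
    (hQ : ∀ s', I l s' → Agree (.x ::= v .h - lit 1 ;; body ;; .h ::= rd .nxt (v .x)) s s' →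
      s'.time ≤ s.time + (c + 3) * l.length → Q s'.tick) :
    wp E (.chain body) Q s := by
  refine wp_while (fun s' => ∃ d r, l = d ++ r ∧ Chain (s'.a .nxt) (s'.v .h) r ∧ I d s' ∧
      s'.a .nxt = s.a .nxt ∧ (s'.v .h = 0 ↔ r = []) ∧
      s'.time ≤ s.time + (c + 3) * d.length ∧
      Agree (.x ::= v .h - lit 1 ;; body ;; .h ::= rd .nxt (v .x)) s s')
    -- The remaining time budget serves as the measure, since the clock increases in every round.
    (fun s' => s.time + (c + 3) * l.length + 1 - s'.time)
    ⟨[], l, rfl, hc, h0, rfl, ?_, by simp, ⟨fun _ _ => rfl, fun _ _ => rfl, le_rfl⟩⟩ ?_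
  · cases l with
    | nil => simpa [Chain] using hc
    | cons x l => simp [hc.1]
  · rintro s' - ⟨d, r, hdr, hch, hI, hnx, hr, ht, hA⟩
    refine ⟨by simp; omega, by simp, fun hlt => ?_, fun hle => ?_⟩
    · simp only [eval_lit, eval_var] at hlt
      obtain _ | ⟨x, r⟩ := r
      · simp [Chain] at hch; omega
      have hxl := hl x (by simp [hdr])
      have hhx := hch.1
      simp only [wp_seq, wp_assign]
      refine ⟨by simp; omega, ?_⟩
      have he : (v .h - lit 1).eval E s'.tick = x := by simp [hhx]
      rw [he]
      refine wp_mono (hstep d x r hdr s' hI hA) fun s2 h2 hA2 => ?_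
      have hx2 : s2.v .x = x := by rw [hA2.v .x hx]; simp
      have hn2 : s2.a .nxt = s'.a .nxt := by rw [hA2.a .nxt hn]; simp
      have ht2 := hA2.time
      simp only [St.set_time, St.tick_time] at ht2
      have e1 : (c + 3) * (d ++ [x]).length = (c + 3) * d.length + (c + 3) := by
        simp [Nat.mul_add]
      have e2 : (c + 3) * (d ++ [x]).length ≤ (c + 3) * l.length := by
        apply Nat.mul_le_mul_left; simp [hdr]
      have e3 := h2.2
      simp only [safe_get, safe_var, true_and, eval_get, eval_var, hx2, hxl]
      refine ⟨⟨d ++ [x], r, by simp [hdr], ?_, h2.1 _, by simp [hn2, hnx], ?_, ?_, ?_⟩, ?_⟩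
      · simpa [hn2] using hch.2
      · have := hch.2
        cases r with
        | nil => simpa [hn2, Chain] using this
        | cons y r => simp [hn2, this.1]
      · simp only [St.set_time]; omega
      · refine hA.trans_loop ⟨fun y hy => ?_, fun y hy => ?_, by simp only [St.set_time]; omega⟩
        · simp only [Cmd.wv, Bool.or_eq_false_iff, decide_eq_false_iff_not] at hy
          simp only [St.set_v, hy.2.2, if_false, hA2.v y hy.2.1, hy.1, St.tick_v]
        · simp only [Cmd.wa, Bool.false_or, Bool.or_false] at hy
          simp only [St.set_a, hA2.a y hy, St.tick_a]
      · simp only [St.set_time]; omega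
    · simp only [eval_lit, eval_var] at hle
      obtain rfl : r = [] := hr.1 (by omega)
      obtain rfl : l = d := by simpa using hdr
      exact hQ s' hI hA ht

/-! ### Naming pairs -/

theorem keyList_sorted (key : ℕ → ℕ) (z a k : ℕ) : (keyList key z a k).Pairwise (· < ·) :=
  (List.pairwise_lt_range' (s := a) (n := k - a)).filter _

/-- `y` is the least index `< k` that carries the same pair as `x`. -/
structure MinRep (c1 c2 : ℕ → ℕ) (k x y : ℕ) : Prop where
  le : y ≤ x
  fst : c1 y = c1 x
  snd : c2 y = c2 x
  min : ∀ z < k, c1 z = c1 x → c2 z = c2 x → y ≤ z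

theorem MinRep.eq_iff {c1 c2 rep : ℕ → ℕ} {k x y : ℕ} (h : ∀ x < k, MinRep c1 c2 k x (rep x))
    (hx : x < k) (hy : y < k) : rep x = rep y ↔ c1 x = c1 y ∧ c2 x = c2 y := by
  have h1 := h x hx
  have h2 := h y hy
  constructor
  · intro he
    exact ⟨by rw [← h1.fst, he, h2.fst], by rw [← h1.snd, he, h2.snd]⟩
  · rintro ⟨e1, e2⟩
    apply le_antisymm
    · exact h1.min _ (h2.le.trans_lt hy) (h2.fst.trans e1.symm) (h2.snd.trans e2.symm)
    · exact h2.min _ (h1.le.trans_lt hx) (h1.fst.trans e1) (h1.snd.trans e2)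

/-- Compute `rep` for the `k` pairs in `c1`, `c2` with entries `< V`. -/
def name : Cmd :=
  bucket .c1 ;;
  .for .z (v .V) (.store .stamp (v .z) (lit 0)) ;;
  .for .z (v .V) (.h ::= rd .head (v .z) ;;
    .chain (.ite (rd .stamp (rd .c2 (v .x))) (v .z + lit 1)
      (.store .stamp (rd .c2 (v .x)) (v .z + lit 1) ;;
        .store .val (rd .c2 (v .x)) (v .x) ;;
        .store .rep (v .x) (v .x))
      (.store .rep (v .x) (rd .val (rd .c2 (v .x))))))

/-- The pairs are grouped by their first entry. In the group of `z`, the stamp `z + 1` at `c` says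
that the second entry `c` has occurred, first at index `val c`. Stamps from earlier groups are
smaller, and `0` means never stamped, so nothing has to be cleared between groups and the time stays
linear. -/
theorem name_spec {E : Env} (hE : 100 * (E.N + 1) ≤ E.W) {s : St} {k V : ℕ}
    (hk : s.v .k = k) (hV : s.v .V = V) (hkN : k ≤ E.N) (hVN : V ≤ E.N)
    (h1 : ∀ x < k, s.a .c1 x < V) (h2 : ∀ x < k, s.a .c2 x < V) :
    wp E name (fun s' => s'.time ≤ s.time + 40 * (k + V + 1) ∧
      ∀ x < k, MinRep (s.a .c1) (s.a .c2) k x (s'.a .rep x)) s := by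
  obtain ⟨c1, hc1⟩ : ∃ c1, c1 = s.a .c1 := ⟨_, rfl⟩
  obtain ⟨c2, hc2⟩ : ∃ c2, c2 = s.a .c2 := ⟨_, rfl⟩
  rw [← hc1] at h1
  rw [← hc2] at h2
  simp only [name, wp_seq, ← hc1, ← hc2]
  refine wp_mono (bucket_spec hE hk hV hkN hVN (by rwa [← hc1]) (by decide) (by decide))
    fun s1 ⟨ht1, hb1⟩ hA1 => ?_
  have hV1 : s1.v .V = V := by rw [hA1.v .V rfl, hV]
  refine wp_for V (fun j _ => 3 * j) (fun j s' => ∀ z < j, s'.a .stamp z = 0) (by omega) rfl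
    (by simp) (fun j hj s' hI hA hz => ?_) (fun j hj s' hI hA hz => ?_) (fun s2 hI2 hA2 hz2 ht2 => ?_)
  · simpa [hA.v .V rfl]
  · simp [hz, upd_apply]
    and_intros <;> try omega
    intro z hz
    exact fun hne => hI z (by omega)
  have hV2 : s2.v .V = V := by rw [hA2.v .V rfl, hV1]
  have e1 : s2.a .c1 = c1 := by rw [hA2.a .c1 rfl, hA1.a .c1 rfl, hc1]
  have e2 : s2.a .c2 = c2 := by rw [hA2.a .c2 rfl, hA1.a .c2 rfl, hc2]
  have e3 : s2.a .head = s1.a .head := hA2.a .head rfl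
  have e4 : s2.a .nxt = s1.a .nxt := hA2.a .nxt rfl
  -- The potential charges each group by its length; summed over all groups the lengths give `k`.
  refine wp_for V (fun z _ => ∑ z' ∈ Finset.range z, (10 * (keyList c1 z' 0 k).length + 10))
    (fun z s' => (∀ x < k, c1 x < z → MinRep c1 c2 k x (s'.a .rep x)) ∧ ∀ c < V, s'.a .stamp c ≤ z)
    (by omega) rfl ?_ (fun j hj s' hI hA hz => ?_) (fun z hz s3 hI3 hA3 hz3 => ?_)
    (fun s3 hI3 hA3 hz3 ht3 => ?_)
  · simpa using fun c hc => (hI2 c hc).le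
  · simpa [hA.v .V rfl]
  · have f1 : s3.a .c1 = c1 := by rw [hA3.a .c1 rfl]; exact e1
    have f2 : s3.a .c2 = c2 := by rw [hA3.a .c2 rfl]; exact e2
    have f3 : s3.a .head = s1.a .head := by rw [hA3.a .head rfl]; exact e3
    have f4 : s3.a .nxt = s1.a .nxt := by rw [hA3.a .nxt rfl]; exact e4
    have hb := hb1 z hz
    simp only [wp_seq, wp_assign]
    simp [hz3, f3]
    refine ⟨by omega, ?_⟩
    refine wp_chain hE 6 (keyList c1 z 0 k)
      (fun d s' => (∀ x < k, c1 x < z → MinRep c1 c2 k x (s'.a .rep x)) ∧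
        (∀ x ∈ d, MinRep c1 c2 k x (s'.a .rep x)) ∧
        ∀ c < V, s'.a .stamp c ≤ z + 1 ∧ (s'.a .stamp c = z + 1 → s'.a .val c < k ∧
          c1 (s'.a .val c) = z ∧ c2 (s'.a .val c) = c ∧
            ∀ y < k, c1 y = z → c2 y = c → s'.a .val c ≤ y) ∧
          (s'.a .stamp c ≠ z + 1 → ∀ x ∈ d, c2 x ≠ c)) ?_ rfl rfl rfl ?_ ?_ ?_ ?_
    · intro x hx
      rw [mem_keyList] at hx
      omega
    · simpa [f4, hc1] using hb
    · simp
      refine ⟨hI3.1, fun c hc => ?_⟩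
      have := hI3.2 c hc
      omega
    · rintro d x r hl s4 ⟨hI4, hd4, hst4⟩ hA4
      have hx : x ∈ keyList c1 z 0 k := by rw [hl]; simp
      rw [mem_keyList] at hx
      have g2 : s4.a .c2 = c2 := by rw [hA4.a .c2 rfl]; simp [f2]
      have gz : s4.v .z = z := by rw [hA4.v .z rfl]; simp [hz3]
      have hc2x := h2 x hx.2.1
      simp [g2, gz]
      obtain ⟨hs1, hs2, hs3⟩ := hst4 _ hc2x
      -- The group is listed in increasing order, so a member not yet visited cannot be smaller than
      -- `x`.
      have hmin : ∀ y < k, c1 y = z → y ∈ d ∨ x ≤ y := by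
        intro y hy hyz
        have hm : y ∈ keyList c1 z 0 k := mem_keyList.2 ⟨Nat.zero_le _, hy, hyz⟩
        have hs := keyList_sorted c1 z 0 k
        rw [hl] at hm hs
        rw [List.pairwise_append, List.pairwise_cons] at hs
        simp only [List.mem_append, List.mem_cons] at hm
        rcases hm with hm | rfl | hm
        · exact .inl hm
        · exact .inr le_rfl
        · exact .inr (hs.2.1.1 y hm).le
      have hxd : x ∉ d := by
        intro hxd
        have hs := keyList_sorted c1 z 0 k
        rw [hl, List.pairwise_append] at hs
        exact lt_irrefl _ (hs.2.2 x hxd x (by simp))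
      and_intros <;> try omega
      · intro hlt
        have hne := hs3 (by omega)
        have hok : MinRep c1 c2 k x x :=
          ⟨le_rfl, rfl, rfl, fun y hy e e' => (hmin y hy (e.trans hx.2.2)).resolve_left
            fun h => hne y h e'⟩
        simp only [upd_apply]
        and_intros <;> try omega
        · intro y hy hyz
          rw [if_neg (by rintro rfl; omega)]
          exact hI4 y hy hyz
        · rintro y (hy | rfl)
          · rw [if_neg (by rintro rfl; exact hxd hy)]
            exact hd4 y hy
          · rw [if_pos rfl]; exact hok
        · intro c hc
          by_cases hcc : c = c2 x
          · subst hcc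
            simp
            exact ⟨hx.2.1, hx.2.2, fun y hy e e' => hok.min y hy (e.trans hx.2.2.symm) e'⟩
          · simp only [if_neg hcc]
            obtain ⟨k1, k2, k3⟩ := hst4 c hc
            refine ⟨k1, k2, fun h y hy => ?_⟩
            rcases hy with hy | rfl
            · exact k3 h y hy
            · exact fun h => hcc h.symm
      · intro hle
        obtain ⟨k1, k2, k3, k4⟩ := hs2 (by omega)
        have hok : MinRep c1 c2 k x (s4.a .val (c2 x)) :=
          ⟨k4 x hx.2.1 hx.2.2 rfl, k2.trans hx.2.2.symm, k3,
            fun y hy e e' => k4 y hy (e.trans hx.2.2) e'⟩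
        simp only [upd_apply]
        and_intros <;> try omega
        · intro y hy hyz
          rw [if_neg (by rintro rfl; omega)]
          exact hI4 y hy hyz
        · rintro y (hy | rfl)
          · rw [if_neg (by rintro rfl; exact hxd hy)]
            exact hd4 y hy
          · rw [if_pos rfl]; exact hok
        · intro c hc
          obtain ⟨k1, k2, k3⟩ := hst4 c hc
          refine ⟨k1, k2, fun h y hy => ?_⟩
          rcases hy with hy | rfl
          · exact k3 h y hy
          · rintro rfl
            omega
    · rintro s4 ⟨hI4, hd4, hst4⟩ hA4 ht4
      simp only [St.tick_time, St.set_time] at ht4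
      simp only [St.tick_time, St.set_time, Finset.sum_range_succ, St.tick_a, St.set_a]
      and_intros <;> try omega
      · intro x hx hxz
        rcases hxz.lt_or_eq with h | h
        · exact hI4 x hx h
        · exact hd4 x (mem_keyList.2 ⟨Nat.zero_le _, hx, h⟩)
      · exact fun c hc => (hst4 c hc).1
  · have hsum := sum_length_keyList c1 h1
    simp only [Finset.sum_add_distrib, ← Finset.mul_sum, hsum, Finset.sum_const, Finset.card_range,
      Finset.range_zero, Finset.sum_empty, smul_eq_mul, St.tick_time] at *
    refine ⟨by omega, fun x hx => ?_⟩
    exact hI3.1 x hx (h1 x hx)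

open Relation (EqvGen)

/-! ### Connected components -/

/-- The directed edges `< m` given by two arrays. -/
def Edge (eu ev : ℕ → ℕ) (m x y : ℕ) : Prop := ∃ j < m, eu j = x ∧ ev j = y

/-- The invariant of a breadth first search on the vertices `< V`; vertices with label `V` are
not visited, the others have the root of their component as label. -/
structure Bfs (D : ℕ → ℕ → Prop) (V : ℕ) (lab que : ℕ → ℕ) (tl : ℕ) : Prop where
  le : ∀ x < V, lab x ≤ V
  root : ∀ x < V, lab x < V → lab (lab x) = lab x ∧ EqvGen D x (lab x)
  que_lt : ∀ p < tl, que p < V ∧ lab (que p) < V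
  inj : ∀ p < tl, ∀ q < tl, que p = que q → p = q
  surj : ∀ x < V, lab x < V → ∃ p < tl, que p = x

/-- Covers both ways of reaching a vertex `y`: as the root of a new component (`z = y`), or as a
neighbour that inherits the root `z` of the current one. -/
theorem Bfs.push {D : ℕ → ℕ → Prop} {V : ℕ} {lab que : ℕ → ℕ} {tl y z : ℕ}
    (h : Bfs D V lab que tl) (hy : y < V) (hly : V ≤ lab y) (hz : z < V) (hD : EqvGen D y z)
    (hr : z = y ∨ lab z = z) :
    Bfs D V (upd lab y z) (upd que tl y) (tl + 1) := by
  have hne : ∀ x, lab x < V → x ≠ y := by rintro x hx rfl; omega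
  refine ⟨fun x hx => ?_, fun x hx hlx => ?_, fun p hp => ?_, fun p hp q hq he => ?_,
    fun x hx hlx => ?_⟩
  · have := h.le x hx
    rw [upd_apply]
    split_ifs <;> omega
  · by_cases hxy : x = y
    · subst hxy
      simp only [upd_self]
      refine ⟨?_, hD⟩
      rcases hr with rfl | hr
      · simp
      · rw [upd_of_ne (hne z (by omega)), hr]
    · rw [upd_of_ne hxy] at hlx ⊢
      obtain ⟨h1, h2⟩ := h.root x hx hlx
      refine ⟨?_, h2⟩
      rw [upd_of_ne (hne _ (by omega)), h1]
  · by_cases hpt : p = tl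
    · subst hpt
      simp [hy, hz]
    · obtain ⟨h1, h2⟩ := h.que_lt p (by omega)
      rw [upd_of_ne hpt, upd_of_ne (hne _ h2)]
      exact ⟨h1, h2⟩
  · by_cases hpt : p = tl <;> by_cases hqt : q = tl
    · omega
    · subst hpt
      rw [upd_self, upd_of_ne hqt] at he
      exact absurd he.symm (hne _ (h.que_lt q (by omega)).2)
    · subst hqt
      rw [upd_self, upd_of_ne hpt] at he
      exact absurd he (hne _ (h.que_lt p (by omega)).2)
    · rw [upd_of_ne hpt, upd_of_ne hqt] at he
      exact h.inj p (by omega) q (by omega) he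
  · by_cases hxy : x = y
    · exact ⟨tl, by omega, by simp [hxy]⟩
    · rw [upd_of_ne hxy] at hlx
      obtain ⟨p, hp, he⟩ := h.surj x hx hlx
      exact ⟨p, by omega, by rw [upd_of_ne (by omega), he]⟩

theorem Bfs.tl_le {D : ℕ → ℕ → Prop} {V : ℕ} {lab que : ℕ → ℕ} {tl : ℕ}
    (h : Bfs D V lab que tl) : tl ≤ V := by
  have := Finset.card_le_card_of_injOn (s := Finset.range tl) (t := Finset.range V) que
    (fun p hp => by simpa using (h.que_lt p (by simpa using hp)).1)
    (fun p hp q hq he => h.inj p (by simpa using hp) q (by simpa using hq) he)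
  simpa using this

/-- No vertex enters the queue twice, so costs charged to queue positions are bounded by a sum over
vertices; with degrees as costs, the search is linear. -/
theorem Bfs.sum_le {D : ℕ → ℕ → Prop} {V : ℕ} {lab que : ℕ → ℕ} {tl hd : ℕ}
    (h : Bfs D V lab que tl) (hh : hd ≤ tl) (f : ℕ → ℕ) :
    ∑ p ∈ Finset.range hd, f (que p) ≤ ∑ x ∈ Finset.range V, f x := by
  rw [← Finset.sum_image (f := f) (g := que) (s := Finset.range hd)]
  · refine Finset.sum_le_sum_of_subset fun x hx => ?_
    simp only [Finset.mem_image, Finset.mem_range] at hx ⊢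
    obtain ⟨p, hp, rfl⟩ := hx
    exact (h.que_lt p (by omega)).1
  · intro p hp q hq he
    simp only [Finset.coe_range, Set.mem_Iio] at hp hq
    exact h.inj p (by omega) q (by omega) he

/-- Visit the neighbours of a vertex. -/
def scan : Cmd :=
  .chain (.y ::= rd .ev (v .x) ;;
    .ite (rd .lab (v .y)) (v .V) .skip
      (.store .lab (v .y) (v .z) ;; .store .que (v .tl) (v .y) ;; .tl ::= v .tl + lit 1))

/-- Visit the component of the vertex `z`. -/
def visit : Cmd :=
  .store .lab (v .z) (v .z) ;; .store .que (v .tl) (v .z) ;; .tl ::= v .tl + lit 1 ;;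
  .while (v .hd) (v .tl)
    (.h ::= rd .head (rd .que (v .hd)) ;; .hd ::= v .hd + lit 1 ;; scan)

/-- Label the vertices `< V` by representatives of their components, in the graph with the edges
`< k` in `eu`, `ev`, each of which is listed in both directions. -/
def comp : Cmd :=
  bucket .eu ;;
  .for .z (v .V) (.store .lab (v .z) (v .V)) ;;
  .hd ::= lit 0 ;; .tl ::= lit 0 ;;
  .for .z (v .V) (.ite (rd .lab (v .z)) (v .V) .skip visit)

section
variable {E : Env} (hE : 100 * (E.N + 1) ≤ E.W) {s : St} {eu ev : ℕ → ℕ} {m V z : ℕ}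

-- `p` is the queue position whose vertex is scanned. The edges at earlier positions join equal
-- labels already, and all positions from `p` on belong to the component of `z`.
include hE in
theorem scan_spec {p : ℕ} (heu : ∀ j < m, eu j < V) (hev : ∀ j < m, ev j < V)
    (hsym : ∀ j < m, ∃ i < m, eu i = ev j ∧ ev i = eu j) (hmN : m ≤ E.N) (hVN : V ≤ E.N)
    (e1 : s.a .ev = ev) (hV : s.v .V = V) (hz : s.v .z = z) (hzV : z < V) (hzz : s.a .lab z = z)
    (hB : Bfs (Edge eu ev m) V (s.a .lab) (s.a .que) (s.v .tl))
    (hp : p < s.v .tl) (hh : Chain (s.a .nxt) (s.v .h) (keyList eu (s.a .que p) 0 m))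
    (hproc : ∀ q < p, ∀ j < m, eu j = s.a .que q → s.a .lab (ev j) = s.a .lab (s.a .que q))
    (hcur : ∀ q, p ≤ q → q < s.v .tl → s.a .lab (s.a .que q) = z) :
    wp E scan (fun s' => Bfs (Edge eu ev m) V (s'.a .lab) (s'.a .que) (s'.v .tl) ∧
      s.v .tl ≤ s'.v .tl ∧ (∀ q < s.v .tl, s'.a .que q = s.a .que q) ∧
      (∀ x < V, s.a .lab x < V → s'.a .lab x = s.a .lab x) ∧
      (∀ q < p + 1, ∀ j < m, eu j = s'.a .que q → s'.a .lab (ev j) = s'.a .lab (s'.a .que q)) ∧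
      (∀ q, p ≤ q → q < s'.v .tl → s'.a .lab (s'.a .que q) = z) ∧
      s'.time ≤ s.time + 9 * (keyList eu (s.a .que p) 0 m).length + 1) s := by
  refine wp_chain hE 5 (keyList eu (s.a .que p) 0 m)
    (fun d s' => Bfs (Edge eu ev m) V (s'.a .lab) (s'.a .que) (s'.v .tl) ∧
      s.v .tl ≤ s'.v .tl ∧ (∀ q < s.v .tl, s'.a .que q = s.a .que q) ∧
      (∀ x < V, s.a .lab x < V → s'.a .lab x = s.a .lab x) ∧
      (∀ j ∈ d, s'.a .lab (ev j) = z) ∧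
      (∀ q, p ≤ q → q < s'.v .tl → s'.a .lab (s'.a .que q) = z)) ?_ rfl rfl rfl hh ?_ ?_ ?_
  · intro x hx
    rw [mem_keyList] at hx
    omega
  · exact ⟨hB, le_rfl, fun _ _ => rfl, fun _ _ _ => rfl, by simp, hcur⟩
  · rintro d j r hl s1 ⟨hB1, htl, hq1, hl1, hd1, hc1⟩ hA1
    have hj : j ∈ keyList eu (s.a .que p) 0 m := by rw [hl]; simp
    rw [mem_keyList] at hj
    have f1 : s1.a .ev = ev := by rw [hA1.a .ev rfl, e1]
    have f2 : s1.v .V = V := by rw [hA1.v .V rfl, hV]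
    have f3 : s1.v .z = z := by rw [hA1.v .z rfl, hz]
    have hy := hev j hj.2.1
    have hlz : s1.a .lab z = z := by rw [hl1 z hzV (by omega), hzz]
    have hqp := hcur p le_rfl hp
    have hqV := (hB.que_lt p hp).1
    simp [f1, f2, f3]
    refine ⟨by omega, by omega, fun hlt => ⟨hB1, htl, hq1, hl1, ?_, hc1⟩, fun hge => ?_⟩
    · rintro i (hi | rfl)
      · exact hd1 i hi
      · obtain ⟨q, hq, he⟩ := hB1.surj _ hy hlt
        by_cases hqp' : p ≤ q
        · rw [← he]; exact hc1 q hqp' hq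
        -- The neighbour stands before position `p`, so its edges have been processed. One of them
        -- is the reverse of the present edge, which forces the neighbour's label to be `z` as well.
        · obtain ⟨i', hi', e1', e2'⟩ := hsym i hj.2.1
          have e4 : s.a .que q = ev i := by rw [← hq1 q (by omega), he]
          have e3 := hproc q (by omega) i' hi' (by rw [e4, e1'])
          rw [e2', e4, hj.2.2, hqp] at e3
          rw [hl1 _ hy (by omega), ← e3]
    · have hE' : EqvGen (Edge eu ev m) (ev j) z := by
        have h1 : EqvGen (Edge eu ev m) (s.a .que p) (ev j) :=
          .rel _ _ ⟨j, hj.2.1, hj.2.2, rfl⟩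
        have h2 := (hB.root _ hqV (by omega)).2
        rw [hqp] at h2
        exact .trans _ _ _ (.symm _ _ h1) h2
      have hB2 := hB1.push hy hge hzV hE' (.inr hlz)
      have htV := hB2.tl_le
      and_intros <;> try omega
      · intro q hq
        rw [upd_of_ne (by omega), hq1 q hq]
      · intro x hx hlx
        rw [upd_of_ne, hl1 x hx hlx]
        rintro rfl
        rw [hl1 _ hx hlx] at hge
        omega
      · intro i hi
        rw [upd_apply]
        split_ifs with hii
        · rfl
        · rcases hi with hi | rfl
          · exact hd1 i hi
          · exact absurd rfl hii
      · intro q hq hq'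
        by_cases hqt : q = s1.v .tl
        · subst hqt; simp
        · rw [upd_of_ne hqt, upd_of_ne]
          · exact hc1 q hq (by omega)
          · intro he
            have := (hB1.que_lt q (by omega)).2
            rw [he] at this
            omega
  · rintro s1 ⟨hB1, htl, hq1, hl1, hd1, hc1⟩ hA1 ht1
    refine ⟨hB1, htl, hq1, hl1, fun q hq j hj he => ?_, hc1, by simp only [St.tick_time]; omega⟩
    simp only [St.tick_a] at he ⊢
    rw [hq1 q (by omega)] at he ⊢
    have hqV := hB.que_lt q (by omega)
    rw [hl1 _ hqV.1 hqV.2]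
    rcases Nat.lt_succ_iff_lt_or_eq.1 hq with h | rfl
    · have := hproc q h j hj he
      rw [hl1 _ (hev j hj) (by omega), this]
    · rw [hcur q le_rfl (by omega)]
      exact hd1 j (mem_keyList.2 ⟨Nat.zero_le _, hj, he⟩)

/-- The time that a search spends on the first `hd` vertices. -/
def searchCost (eu que : ℕ → ℕ) (m hd : ℕ) : ℕ :=
  ∑ p ∈ Finset.range hd, (9 * (keyList eu (que p) 0 m).length + 5)

-- The search starts with an empty queue (`hd = tl`), so every position filled from now on belongs
-- to the component of `z`.
include hE in
theorem visit_spec (heu : ∀ j < m, eu j < V) (hev : ∀ j < m, ev j < V)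
    (hsym : ∀ j < m, ∃ i < m, eu i = ev j ∧ ev i = eu j) (hmN : m ≤ E.N) (hVN : V ≤ E.N)
    (e1 : s.a .ev = ev) (hV : s.v .V = V) (hz : s.v .z = z) (hzV : z < V)
    (hlz : V ≤ s.a .lab z) (hh : ∀ z < V, Chain (s.a .nxt) (s.a .head z) (keyList eu z 0 m))
    (hB : Bfs (Edge eu ev m) V (s.a .lab) (s.a .que) (s.v .tl)) (htl : s.v .hd = s.v .tl)
    (hproc : ∀ q < s.v .hd, ∀ j < m, eu j = s.a .que q → s.a .lab (ev j) = s.a .lab (s.a .que q)) :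
    wp E visit (fun s' => Bfs (Edge eu ev m) V (s'.a .lab) (s'.a .que) (s'.v .tl) ∧
      s'.v .hd = s'.v .tl ∧ s'.a .lab z < V ∧
      (∀ x < V, s.a .lab x < V → s'.a .lab x = s.a .lab x) ∧
      (∀ q < s'.v .hd, ∀ j < m, eu j = s'.a .que q → s'.a .lab (ev j) = s'.a .lab (s'.a .que q)) ∧
      s'.time + searchCost eu (s.a .que) m (s.v .hd) ≤
        s.time + 5 + searchCost eu (s'.a .que) m (s'.v .hd)) s := by
  have hB0 := hB.push hzV hlz hzV (.refl z) (.inl rfl)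
  have htV := hB0.tl_le
  have hne : ∀ x, s.a .lab x < V → x ≠ z := by rintro x hx rfl; omega
  simp only [visit, wp_seq, wp_assign, wp_store]
  simp [hz]
  and_intros <;> try omega
  refine wp_while (fun s' => Bfs (Edge eu ev m) V (s'.a .lab) (s'.a .que) (s'.v .tl) ∧
      s'.v .hd ≤ s'.v .tl ∧ s'.a .lab z = z ∧
      (∀ x < V, s.a .lab x < V → s'.a .lab x = s.a .lab x) ∧
      (∀ q < s'.v .hd, ∀ j < m, eu j = s'.a .que q → s'.a .lab (ev j) = s'.a .lab (s'.a .que q)) ∧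
      (∀ q, s'.v .hd ≤ q → q < s'.v .tl → s'.a .lab (s'.a .que q) = z) ∧
      s'.time + searchCost eu (s.a .que) m (s.v .hd) ≤
        s.time + 3 + searchCost eu (s'.a .que) m (s'.v .hd)) (fun s' => V - s'.v .hd)
    ⟨?_, ?_, ?_, fun x hx hlx => ?_, fun q hq j hj he => ?_, fun q hq hq' => ?_, ?_⟩ ?_
  · simpa using hB0
  · simp; omega
  · simp
  · simp [upd_of_ne (hne x hlx)]
  · simp at hq he ⊢
    rw [upd_of_ne (by omega)] at he
    rw [upd_of_ne (j := q) (by omega)]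
    have h1 := (hB.que_lt q (by omega)).2
    have h2 := hproc q hq j hj he
    rw [upd_of_ne (hne _ h1), upd_of_ne (hne _ (by rw [h2]; exact h1)), h2]
  · simp at hq hq' ⊢
    obtain rfl : q = s.v .tl := by omega
    simp
  · simp
    -- The new entry is at position `tl = hd`, just beyond the positions that are summed.
    have : searchCost eu (upd (s.a .que) (s.v .tl) z) m (s.v .hd) =
        searchCost eu (s.a .que) m (s.v .hd) := by
      refine Finset.sum_congr rfl fun p hp => ?_
      simp only [Finset.mem_range] at hp
      rw [upd_of_ne (by omega)]
    omega
  · rintro s1 hA1 ⟨hB1, hht, hzz, hl1, hp1, hc1, ht1⟩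
    have f1 : s1.a .ev = ev := by rw [hA1.a .ev rfl]; simpa using e1
    have f2 : s1.v .V = V := by rw [hA1.v .V rfl]; simpa using hV
    have f3 : s1.v .z = z := by rw [hA1.v .z rfl]; simpa using hz
    have f4 : s1.a .head = s.a .head := by rw [hA1.a .head rfl]; simp
    have f5 : s1.a .nxt = s.a .nxt := by rw [hA1.a .nxt rfl]; simp
    have htV1 := hB1.tl_le
    refine ⟨by simp, by simp, fun hlt => ?_, fun hge => ?_⟩
    · simp only [eval_var] at hlt
      have hq := hB1.que_lt _ hlt
      simp only [wp_seq, wp_assign]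
      simp [f4]
      and_intros <;> try omega
      refine wp_mono (scan_spec (p := s1.v .hd) hE heu hev hsym hmN hVN ?_ ?_ ?_ hzV ?_ ?_ ?_ ?_ ?_ ?_) ?_
      · simpa using f1
      · simpa using f2
      · simpa using f3
      · simpa using hzz
      · simpa using hB1
      · simpa using hlt
      · simpa [f5] using hh _ hq.1
      · simpa using hp1
      · simpa using hc1
      · rintro s2 ⟨hB2, htl2, hq2, hl2, hp2, hc2, ht2⟩ hA2
        have g1 : s2.v .hd = s1.v .hd + 1 := by rw [hA2.v .hd rfl]; simp
        simp at htl2 hq2 hl2 ht2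
        have hzV' : s1.a .lab z < V := by omega
        rw [g1]
        refine ⟨⟨hB2, by omega, ?_, fun x hx hlx => ?_, hp2, fun q hq hq' => hc2 q (by omega) hq', ?_⟩,
          by omega⟩
        · rw [hl2 z hzV hzV', hzz]
        · rw [hl2 x hx (by rw [hl1 x hx hlx]; exact hlx), hl1 x hx hlx]
        · have : searchCost eu (s2.a .que) m (s1.v .hd + 1) =
              searchCost eu (s1.a .que) m (s1.v .hd + 1) := by
            refine Finset.sum_congr rfl fun p hp => ?_
            simp only [Finset.mem_range] at hp
            rw [hq2 p (by omega)]
          rw [this]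
          simp only [searchCost, Finset.sum_range_succ] at *
          omega
    · simp only [eval_var] at hge
      simp only [St.tick_v, St.tick_a, St.tick_time]
      exact ⟨hB1, by omega, by omega, hl1, hp1, by omega⟩

-- In the end every edge joins vertices with the same label, and every vertex is connected to its
-- label. Hence labels agree exactly on components.
include hE in
theorem comp_spec (hk : s.v .k = m) (hV : s.v .V = V) (hmN : m ≤ E.N) (hVN : V ≤ E.N)
    (heu : ∀ j < m, s.a .eu j < V) (hev : ∀ j < m, s.a .ev j < V)
    (hsym : ∀ j < m, ∃ i < m, s.a .eu i = s.a .ev j ∧ s.a .ev i = s.a .eu j) :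
    wp E comp (fun s' => s'.time ≤ s.time + 50 * (m + V + 1) ∧
      (∀ x < V, s'.a .lab x < V ∧ EqvGen (Edge (s.a .eu) (s.a .ev) m) x (s'.a .lab x)) ∧
      ∀ x < V, ∀ y < V,
        s'.a .lab x = s'.a .lab y ↔ EqvGen (Edge (s.a .eu) (s.a .ev) m) x y) s := by
  obtain ⟨eu, heu'⟩ : ∃ eu, eu = s.a .eu := ⟨_, rfl⟩
  obtain ⟨ev, hev'⟩ : ∃ ev, ev = s.a .ev := ⟨_, rfl⟩
  rw [← heu'] at heu
  rw [← hev'] at hev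
  rw [← heu', ← hev'] at hsym
  simp only [comp, wp_seq, ← heu', ← hev']
  refine wp_mono (bucket_spec hE hk hV hmN hVN (by rwa [← heu']) (by decide) (by decide))
    fun s1 ⟨ht1, hb1⟩ hA1 => ?_
  rw [← heu'] at hb1
  have hV1 : s1.v .V = V := by rw [hA1.v .V rfl, hV]
  refine wp_for V (fun j _ => 3 * j) (fun j s' => ∀ z < j, s'.a .lab z = V) (by omega) rfl
    (by simp) (fun j hj s' hI hA hz => ?_) (fun j hj s' hI hA hz => ?_) (fun s2 hI2 hA2 hz2 ht2 => ?_)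
  · simpa [hA.v .V rfl]
  · have : s'.v .V = V := by rw [hA.v .V rfl, hV1]
    simp [hz, upd_apply, this]
    and_intros <;> try omega
    intro z hz
    exact fun hne => hI z (by omega)
  have hV2 : s2.v .V = V := by rw [hA2.v .V rfl, hV1]
  have e2 : s2.a .ev = ev := by rw [hA2.a .ev rfl, hA1.a .ev rfl, hev']
  have e3 : s2.a .head = s1.a .head := hA2.a .head rfl
  have e4 : s2.a .nxt = s1.a .nxt := hA2.a .nxt rfl
  simp only [wp_assign, safe_lit, eval_lit]
  refine ⟨by omega, by omega, ?_⟩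
  refine wp_for V (fun z s' => searchCost eu (s'.a .que) m (s'.v .hd) + 9 * z)
    (fun z s' => Bfs (Edge eu ev m) V (s'.a .lab) (s'.a .que) (s'.v .tl) ∧
      s'.v .hd = s'.v .tl ∧ (∀ x < z, s'.a .lab x < V) ∧
      (∀ q < s'.v .hd, ∀ j < m, eu j = s'.a .que q → s'.a .lab (ev j) = s'.a .lab (s'.a .que q)))
    (by omega) rfl ⟨⟨?_, ?_, ?_, ?_, ?_⟩, ?_, ?_, ?_⟩ (fun j hj s' hI hA hz => ?_)
    (fun z hz s3 ⟨hB3, hht, hlt, hp3⟩ hA3 hz3 => ?_) (fun s3 ⟨hB3, hht, hlt, hp3⟩ hA3 hz3 ht3 => ?_)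
  · simpa using fun x hx => (hI2 x hx).le
  · intro x hx hlx
    simp [hI2 x hx] at hlx
  · simp
  · simp
  · intro x hx hlx
    simp [hI2 x hx] at hlx
  · simp
  · simp
  · simp
  · have : s'.v .V = V := by rw [hA.v .V rfl]; simpa using hV2
    simpa
  · have f1 : s3.a .ev = ev := by rw [hA3.a .ev rfl]; simpa using e2
    have f2 : s3.v .V = V := by rw [hA3.v .V rfl]; simpa using hV2
    have f3 : s3.a .head = s1.a .head := by rw [hA3.a .head rfl]; simpa using e3
    have f4 : s3.a .nxt = s1.a .nxt := by rw [hA3.a .nxt rfl]; simpa using e4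
    simp only [wp_ite]
    simp [hz3, f2]
    refine ⟨by omega, fun hl => ⟨⟨hB3, hht, fun x hx => ?_, hp3⟩, by omega⟩, fun hl => ?_⟩
    · rcases hx.lt_or_eq with h | rfl
      · exact hlt x h
      · exact hl
    · refine wp_mono (visit_spec (z := z) hE heu hev hsym hmN hVN ?_ ?_ ?_ hz ?_ ?_ ?_ ?_ ?_) ?_
      · simpa using f1
      · simpa using f2
      · simpa using hz3
      · simpa using hl
      · simpa [f3, f4] using hb1
      · simpa using hB3
      · simpa using hht
      · simpa using hp3
      · rintro s4 ⟨hB4, hht4, hz4, hl4, hp4, ht4⟩ hA4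
        simp at hl4 ht4
        refine ⟨⟨hB4, hht4, fun x hx => ?_, hp4⟩, by omega⟩
        rcases hx.lt_or_eq with h | rfl
        · rw [hl4 x (by omega) (hlt x h)]
          exact hlt x h
        · exact hz4
  · have hsum := sum_length_keyList eu heu
    have hle := hB3.sum_le hht.le fun x => 9 * (keyList eu x 0 m).length + 5
    simp only [Finset.sum_add_distrib, ← Finset.mul_sum, hsum, Finset.sum_const, Finset.card_range,
      smul_eq_mul] at hle
    have hle' : searchCost eu (s3.a .que) m (s3.v .hd) ≤ 9 * m + V * 5 := by
      simpa [searchCost, Finset.sum_add_distrib, ← Finset.mul_sum] using hle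
    simp [searchCost] at ht3
    have hlab : ∀ j < m, s3.a .lab (eu j) = s3.a .lab (ev j) := by
      intro j hj
      obtain ⟨p, hp, he⟩ := hB3.surj _ (heu j hj) (hlt _ (heu j hj))
      have := hp3 p (by omega) j hj he.symm
      rw [this, he]
    refine ⟨?_, fun x hx => ⟨hlt x hx, (hB3.root x hx (hlt x hx)).2⟩, fun x hx y hy => ⟨fun he => ?_, fun he => ?_⟩⟩
    · have : searchCost eu (s3.a .que) m (s3.v .hd) =
        ∑ x ∈ Finset.range (s3.v .hd), (9 * (keyList eu (s3.a .que x) 0 m).length + 5) := rfl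
      simp only [St.tick_time] at *
      omega
    · simp only [St.tick_a] at he
      have h1 := (hB3.root x hx (hlt x hx)).2
      have h2 := (hB3.root y hy (hlt y hy)).2
      rw [he] at h1
      exact .trans _ _ _ h1 (.symm _ _ h2)
    · simp only [St.tick_a]
      clear hx hy
      induction he with
      | rel x y h =>
        obtain ⟨j, hj, rfl, rfl⟩ := h
        exact hlab j hj
      | refl x => rfl
      | symm x y _ ih => exact ih.symm
      | trans x y z _ _ ih1 ih2 => exact ih1.trans ih2

end

/-! ### Timelines in terms of natural numbers, and the lifetimes of edges -/

/-- A timeline of `t` graphs on the vertices `< n`: `g i a b` says that the edge between `a < b` is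
present in version `i`; the pairs `iu j`, `iw j` with `j < m` are the edges of version `0`; the
update from version `x` to version `x + 1` concerns the pair `eu x`, `ew x`. -/
structure TL (n t m : ℕ) where
  g : ℕ → ℕ → ℕ → Prop
  iu : ℕ → ℕ
  iw : ℕ → ℕ
  add : ℕ → ℕ
  eu : ℕ → ℕ
  ew : ℕ → ℕ
  i_lt : ∀ j < m, iu j < n ∧ iw j < n
  e_lt : ∀ x, x + 1 < t → eu x < n ∧ ew x < n
  add_le : ∀ x, x + 1 < t → add x ≤ 1
  init : ∀ a b, a < b → (g 0 a b ↔ ∃ j < m, min (iu j) (iw j) = a ∧ max (iu j) (iw j) = b)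
  hit : ∀ x, x + 1 < t → min (eu x) (ew x) < max (eu x) (ew x) ∧
    (g x (min (eu x) (ew x)) (max (eu x) (ew x)) ↔ add x = 0) ∧
    (g (x + 1) (min (eu x) (ew x)) (max (eu x) (ew x)) ↔ add x = 1)
  miss : ∀ x, x + 1 < t → ∀ a b, ¬ (min (eu x) (ew x) = a ∧ max (eu x) (ew x) = b) →
    (g (x + 1) a b ↔ g x a b)
  g_lt : ∀ i a b, g i a b → a < b ∧ b < n

namespace TL

variable {n t m : ℕ} (T : TL n t m)

def e1 (x : ℕ) : ℕ := min (T.eu x) (T.ew x)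
def e2 (x : ℕ) : ℕ := max (T.eu x) (T.ew x)

/-- The updates `x` and `y` concern the same edge. -/
def Same (x y : ℕ) : Prop := T.e1 x = T.e1 y ∧ T.e2 x = T.e2 y

/-- The interval `[s, e)` of versions that is assigned to the update `x`. -/
def Life (Z x s e : ℕ) : Prop :=
  (T.add x = 1 → s = x + 1 ∧ ((e = Z ∧ ∀ y, x < y → y + 1 < t → ¬ T.Same x y) ∨
    ∃ y, x < y ∧ y + 1 < t ∧ T.Same x y ∧ e = y + 1 ∧ ∀ z, x < z → z < y → ¬ T.Same x z)) ∧
  (T.add x = 0 → s = 0 ∧ ((∀ y < x, ¬ T.Same x y) → e = x + 1) ∧ ((∃ y < x, T.Same x y) → e = 0))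

variable {T}

theorem Same.symm {x y : ℕ} (h : T.Same x y) : T.Same y x := ⟨h.1.symm, h.2.symm⟩
theorem Same.trans {x y z : ℕ} (h : T.Same x y) (h' : T.Same y z) : T.Same x z :=
  ⟨h.1.trans h'.1, h.2.trans h'.2⟩

theorem const {i j a b : ℕ} (hij : i ≤ j) (hj : j < t)
    (h : ∀ x, i ≤ x → x < j → ¬ (T.e1 x = a ∧ T.e2 x = b)) : T.g i a b ↔ T.g j a b := by
  induction j, hij using Nat.le_induction with
  | base => rfl
  | succ j hij ih =>
    rw [T.miss j hj a b (h j hij (Nat.lt_succ_self j))]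
    exact ih (by omega) fun x hx hx' => h x hx (by omega)

theorem add_cases {x : ℕ} (hx : x + 1 < t) : T.add x = 0 ∨ T.add x = 1 := by
  have := T.add_le x hx
  omega

/-- An update that covers `i` is the last one before `i`, or the first one at all. -/
theorem life_unique {Z : ℕ} {rs re : ℕ → ℕ} (h : ∀ x, x + 1 < t → T.Life Z x (rs x) (re x))
    {x y i : ℕ} (hy : y + 1 < t) (hxy : x < y) (hs : T.Same x y)
    (h1 : i < re x) (h3 : rs y ≤ i) (h4 : i < re y) : False := by
  have hx : x + 1 < t := by omega
  -- A deletion preceded by an update of the same edge has the empty lifetime. So `y` is an addition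
  -- and `y < i`; but the lifetime of `x` ends with the next update of the edge, which is no later
  -- than `y`.
  rcases add_cases (T := T) hy with ay | ay
  · have := ((h y hy).2 ay).2.2 ⟨x, hxy, hs.symm⟩
    omega
  · have e1 := ((h y hy).1 ay).1
    rcases add_cases (T := T) hx with ax | ax
    · obtain ⟨-, k1, k2⟩ := (h x hx).2 ax
      by_cases hex : ∃ z < x, T.Same x z
      · have := k2 hex
        omega
      · have := k1 fun z hz hs => hex ⟨z, hz, hs⟩
        omega
    · obtain ⟨-, ⟨-, k⟩ | ⟨z, hz, hzt, hsz, e, k⟩⟩ := (h x hx).1 ax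
      · exact k y hxy hy hs
      · rcases lt_or_ge y z with hyz | hyz
        · exact k y hxy hyz hs
        · omega

/-- The lifetimes of one edge are disjoint. Hence at any time there is at most one living record per
pair of vertices, which yields the field `alive` of `Recs`. -/
theorem life_inj {Z : ℕ} {rs re : ℕ → ℕ} (h : ∀ x, x + 1 < t → T.Life Z x (rs x) (re x))
    {x y i : ℕ} (hx : x + 1 < t) (hy : y + 1 < t) (hs : T.Same x y)
    (h1 : rs x ≤ i) (h2 : i < re x) (h3 : rs y ≤ i) (h4 : i < re y) : x = y := by
  rcases lt_trichotomy x y with hl | rfl | hl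
  · exact (life_unique h hy hl hs h2 h3 h4).elim
  · rfl
  · exact (life_unique h hx hl hs.symm h4 h1 h2).elim

/-- A lifetime that is neither empty nor open-ended is ended by an update of its own edge. As one
update concerns one edge, different records end at different times. -/
theorem life_end {Z : ℕ} {rs re : ℕ → ℕ} (h : ∀ x, x + 1 < t → T.Life Z x (rs x) (re x))
    {x : ℕ} (hx : x + 1 < t) (hZ : re x < Z) (h0 : 0 < re x) :
    T.Same x (re x - 1) ∧ rs x < re x := by
  rcases add_cases (T := T) hx with ax | ax
  · obtain ⟨k0, k1, k2⟩ := (h x hx).2 ax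
    by_cases hex : ∃ z < x, T.Same x z
    · have := k2 hex
      omega
    · have := k1 fun z hz hs => hex ⟨z, hz, hs⟩
      rw [this, k0]
      exact ⟨⟨rfl, rfl⟩, by omega⟩
  · obtain ⟨k0, ⟨k, -⟩ | ⟨z, hz, hzt, hsz, e, k⟩⟩ := (h x hx).1 ax
    · omega
    · rw [e, k0]
      exact ⟨hsz, by omega⟩

/-- The last update of an edge before version `i` decides whether the edge is present. If there is
none, the first later update decides: the edge is present exactly if that update deletes it. The
lifetimes assign `i` to this deciding update. -/
theorem g_iff_life {Z : ℕ} (hZ : t ≤ Z) {rs re : ℕ → ℕ}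
    (h : ∀ x, x + 1 < t → T.Life Z x (rs x) (re x)) {i x0 : ℕ} (hi : i < t) (hx0 : x0 + 1 < t) :
    T.g i (T.e1 x0) (T.e2 x0) ↔
      ∃ x, x + 1 < t ∧ T.Same x x0 ∧ rs x ≤ i ∧ i < re x := by
  classical
  by_cases hex : ∃ x < i, T.Same x x0
  · obtain ⟨x, ⟨hxi, hs⟩, hmax⟩ : ∃ x, (x < i ∧ T.Same x x0) ∧
        ∀ y, x < y → y < i → ¬ T.Same y x0 := by
      obtain ⟨y0, hy0, hs0⟩ := hex
      refine ⟨Nat.findGreatest (fun x => x < i ∧ T.Same x x0) i,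
        Nat.findGreatest_spec (P := fun x => x < i ∧ T.Same x x0) hy0.le ⟨hy0, hs0⟩,
        fun y hy hyi hsy => ?_⟩
      exact Nat.findGreatest_is_greatest hy hyi.le ⟨hyi, hsy⟩
    have hx : x + 1 < t := by omega
    have hg : T.g i (T.e1 x0) (T.e2 x0) ↔ T.add x = 1 := by
      rw [← const (i := x + 1) (by omega) hi fun y hy hyi hh => hmax y (by omega) hyi hh]
      rw [← hs.1, ← hs.2]
      exact (T.hit x hx).2.2
    rw [hg]
    constructor
    · intro ha
      obtain ⟨k0, k⟩ := (h x hx).1 ha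
      refine ⟨x, hx, hs, by omega, ?_⟩
      rcases k with ⟨k, -⟩ | ⟨z, hz, hzt, hsz, e, k⟩
      · omega
      · by_contra hlt
        exact hmax z hz (by omega) (hsz.symm.trans hs)
    · rintro ⟨y, hy, hsy, h1, h2⟩
      have hxy : T.Same y x := hsy.trans hs.symm
      rcases add_cases (T := T) hy with ay | ay
      · obtain ⟨k0, k1, k2⟩ := (h y hy).2 ay
        by_cases hex : ∃ z < y, T.Same y z
        · have := k2 hex
          omega
        · have := k1 fun z hz hs => hex ⟨z, hz, hs⟩
          exact absurd ⟨x, by omega, hxy⟩ hex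
      · obtain ⟨k0, k⟩ := (h y hy).1 ay
        rcases lt_trichotomy x y with hl | rfl | hl
        · exact absurd hsy (hmax y hl (by omega))
        · exact ay
        · rcases k with ⟨-, k⟩ | ⟨z, hz, hzt, hsz, e, k⟩
          · exact absurd hxy (k x hl hx)
          · rcases lt_or_ge x z with hxz | hxz
            · exact absurd hxy (k x hl hxz)
            · omega
  · push Not at hex
    -- The first update of the edge, which here is not before `i`. It is at most `x0`, hence a
    -- genuine update; `Same` alone does not bound its arguments.
    obtain ⟨x, hsx, hmin⟩ : ∃ x, T.Same x x0 ∧ ∀ y < x, ¬ T.Same y x0 :=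
      have hx : ∃ x, T.Same x x0 := ⟨x0, rfl, rfl⟩
      ⟨_, Nat.find_spec hx, fun y hy => Nat.find_min hx hy⟩
    have hxi : i ≤ x := by
      by_contra hlt
      exact hex x (by omega) hsx
    have hxx : x ≤ x0 := by
      by_contra hlt
      exact hmin x0 (by omega) ⟨rfl, rfl⟩
    have hx : x + 1 < t := by omega
    have hg : T.g i (T.e1 x0) (T.e2 x0) ↔ T.add x = 0 := by
      rw [const (j := x) hxi (by omega) fun y hy hyi hh => hmin y hyi hh, ← hsx.1, ← hsx.2]
      exact (T.hit x hx).2.1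
    rw [hg]
    constructor
    · intro ha
      obtain ⟨k0, k1, -⟩ := (h x hx).2 ha
      have := k1 fun z hz hs => hmin z hz (hs.symm.trans hsx)
      exact ⟨x, hx, hsx, by omega, by omega⟩
    · rintro ⟨y, hy, hsy, h1, h2⟩
      rcases add_cases (T := T) hy with ay | ay
      · rcases lt_trichotomy x y with hl | rfl | hl
        · have := ((h y hy).2 ay).2.2 ⟨x, hl, hsy.trans hsx.symm⟩
          omega
        · exact ay
        · exact absurd hsy (hmin y hl)
      · have := ((h y hy).1 ay).1
        exact absurd hsy (hex y (by omega))

/-- The first `k` edges of version `0`, except for those that are updated later. -/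
def Perm (T : TL n t m) (k a b : ℕ) : Prop :=
  (∃ j < k, min (T.iu j) (T.iw j) = a ∧ max (T.iu j) (T.iw j) = b) ∧
    ∀ x, x + 1 < t → ¬ (T.e1 x = a ∧ T.e2 x = b)

end TL

/-- Edges with lifetimes, in the form in which they are stored. -/
structure Recs (n te M Z : ℕ) (ru rv rs re : ℕ → ℕ) : Prop where
  lt : ∀ r < M, ru r < n ∧ rv r < n
  start : ∀ r < M, 0 < rs r → r < te ∧ rs r = r + 1
  inj_end : ∀ r < M, ∀ q < M, re r = re q → 0 < re r → re r < Z → r = q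
  alive : ∀ i, ((Finset.range M).filter fun r => rs r ≤ i ∧ i < re r).card ≤ n * n + n
  end_le : ∀ r < M, re r ≤ Z

/-- The stored edges that are present at time `i`. -/
def Live (M : ℕ) (ru rv rs re : ℕ → ℕ) (i a b : ℕ) : Prop :=
  ∃ r < M, ru r = a ∧ rv r = b ∧ rs r ≤ i ∧ i < re r

/-- A lifetime that meets `[lo, hi)` without covering it begins or ends strictly inside, and at each
time at most one lifetime begins and at most one ends. This is where the running time uses that
consecutive versions differ in a single edge. -/
theorem Recs.card_partial {n te M Z : ℕ} {ru rv rs re : ℕ → ℕ} (h : Recs n te M Z ru rv rs re)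
    {lo hi : ℕ} (hZ : hi ≤ Z) :
    ((Finset.range M).filter fun r => rs r < hi ∧ lo < re r ∧ ¬ (rs r ≤ lo ∧ hi ≤ re r)).card
      ≤ 2 * (hi - lo) := by
  have h1 : ((Finset.range M).filter fun r => lo < rs r ∧ rs r < hi).card ≤ hi - lo := by
    have := Finset.card_le_card_of_injOn
      (s := (Finset.range M).filter fun r => lo < rs r ∧ rs r < hi) (t := Finset.Ico lo hi) rs
      (fun r hr => by simp at hr ⊢; omega)
      (fun r hr q hq he => by
        simp only [Finset.coe_filter, Finset.mem_range, Set.mem_setOf_eq] at hr hq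
        have h1 := (h.start r hr.1 (by omega)).2
        have h2 := (h.start q hq.1 (by omega)).2
        omega)
    simpa using this
  have h2 : ((Finset.range M).filter fun r => lo < re r ∧ re r < hi).card ≤ hi - lo := by
    have := Finset.card_le_card_of_injOn
      (s := (Finset.range M).filter fun r => lo < re r ∧ re r < hi) (t := Finset.Ico lo hi) re
      (fun r hr => by simp at hr ⊢; omega)
      (fun r hr q hq he => by
        simp only [Finset.coe_filter, Finset.mem_range, Set.mem_setOf_eq] at hr hq
        exact h.inj_end r hr.1 q hq.1 he (by omega) (by omega))
    simpa using this
  refine (Finset.card_le_card (t := ((Finset.range M).filter fun r => lo < rs r ∧ rs r < hi) ∪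
    ((Finset.range M).filter fun r => lo < re r ∧ re r < hi)) fun r hr => ?_).trans
    ((Finset.card_union_le _ _).trans (by omega))
  simp at hr ⊢
  omega

/-- Records below `t - 1` are the updates; record `t - 1 + x` is the star edge at the vertex `x`,
alive for ever. -/
theorem TL.recs {n t m : ℕ} (T : TL n t m) {Z : ℕ} (hZ : t ≤ Z) (ht : 1 ≤ t)
    {ru rv rs re lab : ℕ → ℕ} (h : ∀ x, x + 1 < t → T.Life Z x (rs x) (re x))
    (hu : ∀ x, x + 1 < t → ru x = T.e1 x ∧ rv x = T.e2 x)
    (hr : ∀ x < n, ru (t - 1 + x) = x ∧ rv (t - 1 + x) = lab x ∧ rs (t - 1 + x) = 0 ∧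
      re (t - 1 + x) = Z)
    (hlt : ∀ x < n, lab x < n) : Recs n (t - 1) (t - 1 + n) Z ru rv rs re := by
  have hcase : ∀ r < t - 1 + n, r + 1 < t ∨ ∃ x < n, r = t - 1 + x := fun r hr => by
    by_cases h1 : r + 1 < t
    · exact .inl h1
    · exact .inr ⟨r - (t - 1), by omega, by omega⟩
  refine ⟨fun r hrM => ?_, fun r hrM h0 => ?_, fun r hrM q hqM he h0 hZ' => ?_,
    fun i => ?_, fun r hrM => ?_⟩
  · rcases hcase r hrM with h1 | ⟨x, hx, rfl⟩
    · rw [(hu r h1).1, (hu r h1).2]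
      have := T.e_lt r h1
      simp only [TL.e1, TL.e2]
      omega
    · obtain ⟨h1, h2, -⟩ := hr x hx
      rw [h1, h2]
      exact ⟨hx, hlt x hx⟩
  · rcases hcase r hrM with h1 | ⟨x, hx, rfl⟩
    · refine ⟨by omega, ?_⟩
      rcases T.add_cases h1 with ax | ax
      · have := ((h r h1).2 ax).1
        omega
      · exact ((h r h1).1 ax).1
    · have := (hr x hx).2.2.1
      omega
  · have hr1 : r + 1 < t := by
      rcases hcase r hrM with h1 | ⟨x, hx, rfl⟩
      · exact h1
      · have := (hr x hx).2.2.2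
        omega
    have hq1 : q + 1 < t := by
      rcases hcase q hqM with h1 | ⟨x, hx, rfl⟩
      · exact h1
      · have := (hr x hx).2.2.2
        omega
    -- Both lifetimes contain the version `re r - 1` and belong to the edge that is updated there;
    -- by disjointness they are the same.
    obtain ⟨s1, l1⟩ := TL.life_end h hr1 hZ' h0
    obtain ⟨s2, l2⟩ := TL.life_end h hq1 (he ▸ hZ') (he ▸ h0)
    rw [← he] at s2
    exact TL.life_inj h hr1 hq1 (s1.trans s2.symm) (i := re r - 1) (by omega) (by omega)
      (by omega) (by omega)
  · have hlt' : ∀ x, x + 1 < t → T.e1 x < n ∧ T.e2 x < n := fun x hx => by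
      have := T.e_lt x hx
      simp only [TL.e1, TL.e2]
      omega
    have hmul : ∀ x, x + 1 < t → T.e1 x * n + T.e2 x < n * n := fun x hx => by
      have := hlt' x hx
      nlinarith
    -- Living updates are encoded injectively by their pairs of endpoints, as numbers below `n * n`;
    -- the `n` star edges are placed behind these.
    have := Finset.card_le_card_of_injOn
      (s := (Finset.range (t - 1 + n)).filter fun r => rs r ≤ i ∧ i < re r)
      (t := Finset.range (n * n + n))
      (fun r => if r + 1 < t then T.e1 r * n + T.e2 r else n * n + (r - (t - 1)))
      (fun r hr => by
        simp at hr ⊢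
        split_ifs with h1
        · have := hmul r h1
          omega
        · omega)
      (fun r hr q hq he => by
        simp only [Finset.coe_filter, Finset.mem_range, Set.mem_setOf_eq] at hr hq
        dsimp only at he
        split_ifs at he with h1 h2 h2
        · obtain ⟨a1, a2⟩ := hlt' r h1
          obtain ⟨b1, b2⟩ := hlt' q h2
          have e2 : T.e2 r = T.e2 q := by
            have := congrArg (· % n) he
            simpa [Nat.mul_add_mod', Nat.mod_eq_of_lt a2, Nat.mod_eq_of_lt b2] using this
          have e1 : T.e1 r = T.e1 q := by
            rw [e2] at he
            exact Nat.eq_of_mul_eq_mul_right (by omega) (Nat.add_right_cancel he)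
          exact TL.life_inj h h1 h2 ⟨e1, e2⟩ hr.2.1 hr.2.2 hq.2.1 hq.2.2
        · have := hmul r h1
          omega
        · have := hmul q h2
          omega
        · omega)
    simpa using this
  · rcases hcase r hrM with h1 | ⟨x, hx, rfl⟩
    · rcases T.add_cases h1 with ax | ax
      · obtain ⟨k0, k1, k2⟩ := (h r h1).2 ax
        by_cases hex : ∃ z < r, T.Same r z
        · rw [k2 hex]
          omega
        · have := k1 fun z hz hs => hex ⟨z, hz, hs⟩
          omega
      · obtain ⟨k0, ⟨k, -⟩ | ⟨z, hz, hzt, hsz, e, k⟩⟩ := (h r h1).1 ax <;> omega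
    · exact (hr x hx).2.2.2.le

/-- It suffices to replace each generating edge by a path. -/
theorem eqvGen_mono_gen {D D' : ℕ → ℕ → Prop} (h : ∀ a b, D a b → EqvGen D' a b) {a b : ℕ}
    (hab : EqvGen D a b) : EqvGen D' a b := by
  induction hab with
  | rel _ _ h' => exact h _ _ h'
  | refl _ => exact .refl _
  | symm _ _ _ ih => exact .symm _ _ ih
  | trans _ _ _ _ _ ih1 ih2 => exact .trans _ _ _ ih1 ih2

/-- The stored edges have the same connected components as the graphs of the timeline. -/
theorem TL.live_iff {n t m : ℕ} (T : TL n t m) {Z : ℕ} (hZ : t ≤ Z)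
    {ru rv rs re lab : ℕ → ℕ} (h : ∀ x, x + 1 < t → T.Life Z x (rs x) (re x))
    (hu : ∀ x, x + 1 < t → ru x = T.e1 x ∧ rv x = T.e2 x)
    (hr : ∀ x < n, ru (t - 1 + x) = x ∧ rv (t - 1 + x) = lab x ∧ rs (t - 1 + x) = 0 ∧
      re (t - 1 + x) = Z)
    (hl : ∀ x < n, EqvGen (T.Perm m) x (lab x))
    (hp : ∀ a b, a < n → b < n → T.Perm m a b → lab a = lab b) {i a b : ℕ} (hi : i < t) :
    EqvGen (Live (t - 1 + n) ru rv rs re i) a b ↔ EqvGen (T.g i) a b := by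
  have hle : ∀ a b, T.Perm m a b → a < b ∨ a = b := by
    rintro a b ⟨⟨j, hj, rfl, rfl⟩, -⟩
    exact min_le_max.lt_or_eq
  constructor
  · refine eqvGen_mono_gen ?_
    rintro a b ⟨r, hrM, rfl, rfl, h1, h2⟩
    by_cases hrt : r + 1 < t
    · rw [(hu r hrt).1, (hu r hrt).2]
      exact .rel _ _ ((TL.g_iff_life hZ h hi hrt).2 ⟨r, hrt, ⟨rfl, rfl⟩, h1, h2⟩)
    · obtain ⟨x, hx⟩ : ∃ x, r = t - 1 + x := ⟨r - (t - 1), by omega⟩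
      subst hx
      obtain ⟨e1, e2, -⟩ := hr x (by omega)
      rw [e1, e2]
      -- A star edge is replaced by a path of permanent edges. Such an edge may be degenerate as far
      -- as `Perm` is concerned, hence the case `a = b` below.
      refine eqvGen_mono_gen (fun a b hab => ?_) (hl x (by omega))
      rcases hle a b hab with hlt | rfl
      · obtain ⟨h1, h2⟩ := hab
        refine .rel _ _ ?_
        rw [← T.const (i := 0) (by omega) hi fun x _ hx => h2 x (by omega)]
        exact (T.init a b hlt).2 h1
      · exact .refl _
  · refine eqvGen_mono_gen fun a b hab => ?_
    obtain ⟨hlt, hbn⟩ := T.g_lt i a b hab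
    by_cases hex : ∃ x, x + 1 < t ∧ T.e1 x = a ∧ T.e2 x = b
    · obtain ⟨x, hx, rfl, rfl⟩ := hex
      obtain ⟨y, hy, hs, h1, h2⟩ := (TL.g_iff_life hZ h hi hx).1 hab
      exact .rel _ _ ⟨y, by omega, by rw [(hu y hy).1, hs.1], by rw [(hu y hy).2, hs.2], h1, h2⟩
    · push Not at hex
      have hno : ∀ x, x + 1 < t → ¬ (T.e1 x = a ∧ T.e2 x = b) := fun x hx hh => hex x hx hh.1 hh.2
      rw [← T.const (i := 0) (by omega) hi fun x _ hx => hno x (by omega), T.init a b hlt] at hab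
      -- An edge that is never updated is permanent, so its endpoints have the same label and are
      -- joined by their two star edges.
      have hstar : ∀ x < n, EqvGen (Live (t - 1 + n) ru rv rs re i) x (lab x) := fun x hx => by
        obtain ⟨e1, e2, e3, e4⟩ := hr x hx
        exact .rel _ _ ⟨t - 1 + x, by omega, e1, e2, by omega, by omega⟩
      have h1 := hstar a (by omega)
      rw [hp a b (by omega) hbn ⟨hab, hno⟩] at h1
      exact .trans _ _ _ h1 (.symm _ _ (hstar b hbn))

/-! ### Parameters -/

/-- The parameters of a run: time is divided into `nb` blocks of `2 ^ d` versions. -/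
structure Par (E : Env) where
  n : ℕ
  t : ℕ
  m : ℕ
  d : ℕ
  nb : ℕ
  hn : 2 ≤ n
  hnt : n ≤ t
  hB1 : min t (n * n) ≤ 2 ^ d
  hB2 : 2 ^ d < 2 * min t (n * n)
  hnb : nb = (t + 2 ^ d - 1) / 2 ^ d
  hE : 100 * (E.N + 1) ≤ E.W
  hN : 64 * (t * (d + 2)) ≤ E.N
  hm : 100 * (m + t + 1) ≤ E.W
  hnn : n * n < E.W

namespace Par

variable {E : Env} (P : Par E)

def B : ℕ := 2 ^ P.d
def Z : ℕ := P.nb * P.B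

theorem B_pos : 0 < P.B := Nat.two_pow_pos _

theorem B_lt : P.B < 2 * P.t := by
  have := P.hB2
  simp only [B]
  omega

theorem n_le_B : P.n ≤ P.B := by
  have := P.hB1
  have := P.hn
  have := P.hnt
  have : P.n ≤ P.n * P.n := Nat.le_mul_self _
  simp only [B]
  omega

theorem t_le_Z : P.t ≤ P.Z := by
  have h := Nat.lt_div_mul_add (a := P.t + P.B - 1) P.B_pos
  have := P.B_pos
  have h2 : P.Z = (P.t + P.B - 1) / P.B * P.B := by rw [Z, P.hnb]; rfl
  omega

theorem Z_lt : P.Z < P.t + P.B := by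
  have h := Nat.div_mul_le_self (P.t + P.B - 1) P.B
  have := P.B_pos
  have h2 : P.Z = (P.t + P.B - 1) / P.B * P.B := by rw [Z, P.hnb]; rfl
  omega

/-- Most range checks for array accesses are reduced to this slack. -/
theorem tN : 128 * P.t ≤ E.N := by
  have := P.hN
  have : P.t * 2 ≤ P.t * (P.d + 2) := Nat.mul_le_mul_left _ (by omega)
  omega

theorem nb_pos : 0 < P.nb := by
  by_contra h
  have h0 : P.nb = 0 := by omega
  have := P.t_le_Z
  have := P.hn
  have := P.hnt
  simp [Z, h0] at *
  omega

theorem nb_le : P.nb ≤ P.Z := Nat.le_mul_of_pos_right _ P.B_pos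

theorem Z_lt' : P.Z < 3 * P.t := by
  have := P.Z_lt
  have := P.B_lt
  omega

/-- The variables that hold the parameters. -/
def vars : List Var := [.n, .t, .m, .te, .d, .B, .nb, .Z]

end Par

/-- The parameters are stored in variables. -/
structure Setup {E : Env} (P : Par E) (f : Var → ℕ) : Prop where
  n : f .n = P.n
  t : f .t = P.t
  m : f .m = P.m
  te : f .te = P.t - 1
  d : f .d = P.d
  B : f .B = P.B
  nb : f .nb = P.nb
  Z : f .Z = P.Z

theorem Setup.agree {E : Env} {P : Par E} {c : Cmd} {s s' : St} (h : Setup P s.v)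
    (hA : Agree c s s') (hc : (Par.vars.all fun x => !c.wv x) = true) : Setup P s'.v := by
  simp [Par.vars] at hc
  obtain ⟨h1, h2, h3, h4, h5, h6, h7, h8⟩ := hc
  exact ⟨by rw [hA.v _ h1, h.n], by rw [hA.v _ h2, h.t], by rw [hA.v _ h3, h.m],
    by rw [hA.v _ h4, h.te], by rw [hA.v _ h5, h.d], by rw [hA.v _ h6, h.B],
    by rw [hA.v _ h7, h.nb], by rw [hA.v _ h8, h.Z]⟩

/-- The input words describe the timeline `T`. -/
structure Inp {E : Env} (P : Par E) (T : TL P.n P.t P.m) : Prop where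
  len : E.inp.length = 3 + 2 * P.m + 3 * (P.t - 1)
  n : E.word 0 = P.n
  t : E.word 1 = P.t
  m : E.word 2 = P.m
  iu : ∀ j < P.m, E.word (3 + 2 * j) = T.iu j
  iw : ∀ j < P.m, E.word (3 + 2 * j + 1) = T.iw j
  add : ∀ x, x + 1 < P.t → E.word (3 + 2 * P.m + 3 * x) = T.add x
  eu : ∀ x, x + 1 < P.t → E.word (3 + 2 * P.m + 3 * x + 1) = T.eu x
  ew : ∀ x, x + 1 < P.t → E.word (3 + 2 * P.m + 3 * x + 2) = T.ew x

/-- `B` is doubled until it reaches `lim`, the minimum of `t` and `n * n`. -/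
def setup : Cmd :=
  .n ::= .inp (lit 0) ;; .t ::= .inp (lit 1) ;; .m ::= .inp (lit 2) ;; .te ::= v .t - lit 1 ;;
  .ite (v .n * v .n) (v .t) (.lim ::= v .n * v .n) (.lim ::= v .t) ;;
  .B ::= lit 1 ;; .d ::= lit 0 ;;
  .while (v .B) (v .lim) (.B ::= v .B + v .B ;; .d ::= v .d + lit 1) ;;
  .nb ::= (v .t + v .B - lit 1) / v .B ;; .Z ::= v .nb * v .B

theorem setup_spec {E : Env} {P : Par E} {T : TL P.n P.t P.m} (hI : Inp P T) (s : St) :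
    wp E setup (fun s' => Setup P s'.v ∧ s'.time ≤ s.time + 20 + 3 * P.d) s := by
  have hE := P.hE
  have hm := P.hm
  have hn := P.hn
  have hnt := P.hnt
  have hnn := P.hnn
  have hlen := hI.len
  have htN := P.tN
  have hBt := P.B_lt
  -- The common continuation of the two branches that compute the minimum.
  have key : ∀ s1 : St, s1.v .n = P.n → s1.v .t = P.t → s1.v .m = P.m → s1.v .te = P.t - 1 →
      s1.v .lim = min P.t (P.n * P.n) → s1.time ≤ s.time + 8 →
      wp E (.B ::= lit 1 ;; .d ::= lit 0 ;;
        .while (v .B) (v .lim) (.B ::= v .B + v .B ;; .d ::= v .d + lit 1) ;;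
        .nb ::= (v .t + v .B - lit 1) / v .B ;; .Z ::= v .nb * v .B)
        (fun s' => Setup P s'.v ∧ s'.time ≤ s.time + 20 + 3 * P.d) s1 := by
    intro s1 h1 h2 h3 h4 h5 ht
    simp only [wp_seq, wp_assign]
    simp only [safe_lit, eval_lit]
    refine ⟨by omega, by omega, ?_⟩
    refine wp_while (fun s' => s'.v .d ≤ P.d ∧ s'.v .B = 2 ^ s'.v .d ∧
      s'.time ≤ s1.time + 2 + 3 * s'.v .d) (fun s' => P.d - s'.v .d) (by simp) ?_
    rintro s2 hA ⟨i1, i2, i3⟩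
    have g1 : s2.v .n = P.n := by rw [hA.v .n rfl]; simpa
    have g2 : s2.v .t = P.t := by rw [hA.v .t rfl]; simpa
    have g3 : s2.v .m = P.m := by rw [hA.v .m rfl]; simpa
    have g4 : s2.v .te = P.t - 1 := by rw [hA.v .te rfl]; simpa
    have g5 : s2.v .lim = min P.t (P.n * P.n) := by rw [hA.v .lim rfl]; simpa
    have hB1 := P.hB1
    have hB2 := P.hB2
    refine ⟨by simp, by simp, fun hlt => ?_, fun hge => ?_⟩
    · simp only [eval_var, g5, i2] at hlt
      have hd : s2.v .d < P.d := by
        by_contra hge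
        have : P.d = s2.v .d := by omega
        rw [this] at hB1
        omega
      have hpow : 2 ^ (s2.v .d + 1) ≤ 2 ^ P.d := Nat.pow_le_pow_right (by norm_num) hd
      have hdl : P.d < 2 ^ P.d := Nat.lt_two_pow_self
      simp [i2]
      rw [pow_succ] at hpow
      simp only [Par.B] at hBt
      rw [pow_succ]
      omega
    · simp only [eval_var, g5, i2] at hge
      -- If the loop stopped before `P.d` doublings, one more doubling would give `2 * lim ≤ 2 ^
      -- P.d`, against `hB2`.
      have hd : s2.v .d = P.d := by
        by_contra hne
        have hpow : 2 ^ (s2.v .d + 1) ≤ 2 ^ P.d := Nat.pow_le_pow_right (by norm_num) (by omega)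
        rw [pow_succ] at hpow
        omega
      have hBB : s2.v .B = P.B := by rw [i2, hd]; rfl
      have hnb : (P.t + P.B - 1) / P.B = P.nb := P.hnb.symm
      have hZ : P.nb * P.B = P.Z := rfl
      have hZt := P.Z_lt'
      simp [g2, hBB, hnb, hZ]
      refine ⟨by omega, by omega, ⟨?_, ?_, ?_, ?_, ?_, ?_, ?_, ?_⟩, by omega⟩ <;>
        simp [g1, g2, g3, g4, hd, hBB]
  have hnn' : P.n ≤ P.n * P.n := Nat.le_mul_self _
  have key1 := key (((((((s.set .n P.n).set .t P.t).set .m P.m).set .te (P.t - 1)).tick).set .lim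
      (P.n * P.n))) (by simp) (by simp) (by simp) (by simp)
  have key2 := key (((((((s.set .n P.n).set .t P.t).set .m P.m).set .te (P.t - 1)).tick).set .lim
      P.t)) (by simp) (by simp) (by simp) (by simp)
  simp only [setup]
  rw [wp_seq, wp_assign]
  rcases lt_or_ge (P.n * P.n) P.t with h | h
  · have := key1 (by simp; omega) (by simp)
    simp at this
    simp [hI.n, hI.t, hI.m, h, h.not_ge]
    and_intros <;> first | omega | exact this.2.2
  · have := key2 (by simp; omega) (by simp)
    simp at this
    simp [hI.n, hI.t, hI.m, h, h.not_gt]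
    and_intros <;> first | omega | exact this.2.2

/-! ### Lifetimes of edges -/

/-- The endpoints are put in increasing order, so that updates of the same edge carry the same pair.
The pairs are stored twice: as input for the naming, and as records. -/
def loadEvents : Cmd :=
  .for .i (v .te) (.x ::= lit 3 + lit 2 * v .m + lit 3 * v .i ;;
    .store .add (v .i) (.inp (v .x)) ;;
    .y ::= .inp (v .x + lit 1) ;; .z ::= .inp (v .x + lit 2) ;;
    .ite (v .y) (v .z) .skip (.x ::= v .y ;; .y ::= v .z ;; .z ::= v .x) ;;
    .store .c1 (v .i) (v .y) ;; .store .c2 (v .i) (v .z) ;;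
    .store .ru (v .i) (v .y) ;; .store .rv (v .i) (v .z))

theorem loadEvents_spec {E : Env} {P : Par E} {T : TL P.n P.t P.m} (hI : Inp P T) {s : St}
    (hS : Setup P s.v) :
    wp E loadEvents (fun s' => s'.time ≤ s.time + 2 + 15 * P.t ∧ ∀ x, x + 1 < P.t →
      s'.a .add x = T.add x ∧ s'.a .c1 x = T.e1 x ∧ s'.a .c2 x = T.e2 x ∧
      s'.a .ru x = T.e1 x ∧ s'.a .rv x = T.e2 x) s := by
  have hE := P.hE
  have hm := P.hm
  have hlen := hI.len
  have htN := P.tN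
  have hnt := P.hnt
  refine wp_for (P.t - 1) (fun j _ => 15 * j) (fun j s' => ∀ x < j,
      s'.a .add x = T.add x ∧ s'.a .c1 x = T.e1 x ∧ s'.a .c2 x = T.e2 x ∧
      s'.a .ru x = T.e1 x ∧ s'.a .rv x = T.e2 x) (by omega) rfl (by simp)
      (fun j hj s' hI' hA hz => ?_) (fun j hj s' hI' hA hz => ?_) (fun s2 hI2 hA2 hz2 ht2 => ?_)
  · simp [(hS.agree hA rfl).te]
  · have hS' := hS.agree hA rfl
    have hj1 : j + 1 < P.t := by omega
    have ha := T.add_le j hj1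
    obtain ⟨hu, hw⟩ := T.e_lt j hj1
    have hfin : ∀ a b, a = T.e1 j → b = T.e2 j → ∀ x ≤ j, upd (s'.a .add) j (T.add j) x = T.add x ∧
        upd (s'.a .c1) j a x = T.e1 x ∧ upd (s'.a .c2) j b x = T.e2 x ∧
        upd (s'.a .ru) j a x = T.e1 x ∧ upd (s'.a .rv) j b x = T.e2 x := by
      rintro _ _ rfl rfl x hx
      by_cases hxj : x = j
      · subst hxj; simp
      · simp only [upd_of_ne hxj]
        exact hI' x (by omega)
    rcases lt_or_ge (T.eu j) (T.ew j) with h | h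
    · simp [hz, hS'.m, hI.add j hj1, hI.eu j hj1, hI.ew j hj1, h, h.not_ge]
      and_intros <;> try omega
      exact hfin _ _ (by simp [TL.e1, h.le]) (by simp [TL.e2, h.le])
    · simp [hz, hS'.m, hI.add j hj1, hI.eu j hj1, hI.ew j hj1, h, h.not_gt]
      and_intros <;> try omega
      exact hfin _ _ (by simp [TL.e1, h]) (by simp [TL.e2, h])
  · simp only [St.tick_time, St.tick_a]
    exact ⟨by omega, fun x hx => hI2 x (by omega)⟩

/-- Compute the lifetimes of the edges, going through the updates backwards. -/
def lives : Cmd :=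
  .for .i (v .te) (.x ::= v .te - lit 1 - v .i ;;
    .ite (lit 0) (rd .add (v .x))
      (.store .rs (v .x) (v .x + lit 1) ;;
        .store .re (v .x) (v .Z - rd .last (rd .rep (v .x))))
      (.store .rs (v .x) (lit 0) ;;
        .ite (rd .rep (v .x)) (v .x) (.store .re (v .x) (lit 0))
          (.store .re (v .x) (v .x + lit 1))) ;;
    .store .last (rd .rep (v .x)) (v .Z - (v .x + lit 1)))

/-- For each name of an edge, `last` holds `Z - (y + 1)`, where `y` is the nearest later update of
this edge. The initial value `0` thus means that there is none, and `Z - last` is the end of the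
lifetime in both cases. A deletion is the first update of its edge exactly if it is its own least
representative. -/
theorem lives_spec {E : Env} {P : Par E} {T : TL P.n P.t P.m} {s : St}
    (hS : Setup P s.v) (hl : ∀ x, s.a .last x = 0) (ha : ∀ x, x + 1 < P.t → s.a .add x = T.add x)
    (hr : ∀ x < P.t - 1, MinRep T.e1 T.e2 (P.t - 1) x (s.a .rep x)) :
    wp E lives (fun s' => s'.time ≤ s.time + 2 + 10 * P.t ∧ ∀ x, x + 1 < P.t →
      T.Life P.Z x (s'.a .rs x) (s'.a .re x)) s := by
  have hE := P.hE
  have htN := P.tN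
  have hZ := P.t_le_Z
  have hZ' := P.Z_lt'
  obtain ⟨rep, hrep⟩ : ∃ f, f = s.a .rep := ⟨_, rfl⟩
  rw [← hrep] at hr
  have hsame : ∀ x < P.t - 1, ∀ y < P.t - 1, rep x = rep y ↔ T.Same x y :=
    fun x hx y hy => MinRep.eq_iff hr hx hy
  refine wp_for (P.t - 1) (fun j _ => 10 * j) (fun j s' =>
      (∀ x, P.t - 1 - j ≤ x → x + 1 < P.t → T.Life P.Z x (s'.a .rs x) (s'.a .re x)) ∧
      ∀ x < P.t - 1, (s'.a .last x = 0 ∧ ∀ y, P.t - 1 - j ≤ y → y + 1 < P.t → rep y ≠ x) ∨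
        ∃ y, P.t - 1 - j ≤ y ∧ y + 1 < P.t ∧ rep y = x ∧ s'.a .last x = P.Z - (y + 1) ∧
          ∀ z, P.t - 1 - j ≤ z → z < y → rep z ≠ x)
      (by omega) rfl ⟨fun x hx hx' => by omega, fun x hx => .inl ⟨by simp [hl], by omega⟩⟩
      (fun j hj s' hI' hA hz => ?_) (fun j hj s' hI' hA hz => ?_) (fun s2 hI2 hA2 hz2 ht2 => ?_)
  · simp [(hS.agree hA rfl).te]
  · have hS' := hS.agree hA rfl
    obtain ⟨hL, hN⟩ := hI'
    obtain ⟨x, hx⟩ : ∃ x, x = P.t - 1 - 1 - j := ⟨_, rfl⟩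
    have hx1 : x + 1 < P.t := by omega
    have hxt : x < P.t - 1 := by omega
    have e1 : P.t - 1 - j = x + 1 := by omega
    have e2 : P.t - 1 - (j + 1) = x := by omega
    rw [e1] at hL hN
    have g1 : s'.a .add x = T.add x := by rw [hA.a .add rfl]; exact ha x hx1
    have g2 : s'.a .rep = rep := by rw [hA.a .rep rfl, hrep]
    have hrx := (hr x (by omega)).le
    have hlast : ∀ c, P.Z - (x + 1) = c → ∀ y < P.t - 1,
        (upd (s'.a .last) (rep x) c y = 0 ∧ ∀ z, x ≤ z → z + 1 < P.t → rep z ≠ y) ∨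
        ∃ z, x ≤ z ∧ z + 1 < P.t ∧ rep z = y ∧ upd (s'.a .last) (rep x) c y = P.Z - (z + 1) ∧
          ∀ w, x ≤ w → w < z → rep w ≠ y := by
      rintro c rfl y hy
      by_cases hyx : y = rep x
      · subst hyx
        exact .inr ⟨x, le_rfl, hx1, rfl, by simp, by omega⟩
      · rw [upd_of_ne hyx]
        rcases hN y hy with ⟨k1, k2⟩ | ⟨z, k1, k2, k3, k4, k5⟩
        · refine .inl ⟨k1, fun z hz hzt => ?_⟩
          rcases hz.lt_or_eq with h | rfl
          · exact k2 z h hzt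
          · exact Ne.symm hyx
        · refine .inr ⟨z, by omega, k2, k3, k4, fun w hw hwz => ?_⟩
          rcases hw.lt_or_eq with h | rfl
          · exact k5 w h hwz
          · exact Ne.symm hyx
    have hlife : ∀ a b, T.Life P.Z x a b → ∀ y, x ≤ y → y + 1 < P.t →
        T.Life P.Z y (upd (s'.a .rs) x a y) (upd (s'.a .re) x b y) := by
      intro a b hab y hy hyt
      by_cases hyx : y = x
      · subst hyx; simpa using hab
      · rw [upd_of_ne hyx, upd_of_ne hyx]
        exact hL y (by omega) hyt
    have hadd := T.add_le x hx1
    rcases Nat.eq_zero_or_pos (T.add x) with h0 | hpos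
    · rcases lt_or_ge (rep x) x with hlt | hge
      · simp [hz, hS'.te, hS'.Z, ← hx, g1, g2, e2, h0, hlt, hlt.not_ge]
        and_intros <;> try omega
        · refine hlife _ _ ⟨by omega, fun _ => ⟨rfl, fun hno => ?_, fun _ => rfl⟩⟩
          exact absurd ⟨(hr x hxt).fst.symm, (hr x hxt).snd.symm⟩ (hno _ hlt)
        · exact hlast _ rfl
      · simp [hz, hS'.te, hS'.Z, ← hx, g1, g2, e2, h0, hge, hge.not_gt]
        and_intros <;> try omega
        · refine hlife _ _ ⟨by omega, fun _ => ⟨rfl, fun _ => rfl, ?_⟩⟩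
          rintro ⟨y, hy, hs⟩
          have := (hr x hxt).min y (by omega) hs.1.symm hs.2.symm
          omega
        · exact hlast _ rfl
    · simp [hz, hS'.te, hS'.Z, ← hx, g1, g2, e2, hpos, hpos.ne']
      and_intros <;> try omega
      · refine hlife _ _ ⟨fun _ => ⟨rfl, ?_⟩, by omega⟩
        rcases hN (rep x) (by omega) with ⟨k1, k2⟩ | ⟨z, k1, k2, k3, k4, k5⟩
        · refine .inl ⟨by omega, fun y hy hyt hs => ?_⟩
          exact k2 y hy hyt ((hsame y (by omega) x hxt).2 hs.symm)
        · refine .inr ⟨z, by omega, k2, ((hsame z (by omega) x hxt).1 k3).symm, by omega,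
            fun y hy hyz hs => ?_⟩
          exact k5 y hy hyz ((hsame y (by omega) x hxt).2 hs.symm)
      · exact hlast _ rfl
  · simp only [St.tick_time, St.tick_a]
    exact ⟨by omega, fun x hx => hI2.1 x (by omega) hx⟩

/-! ### Collecting edges -/

/-- The edges collected so far in `eu`, `ev` are those of `D`, in both directions. -/
def Coll (a : Arr → ℕ → ℕ) (q : ℕ) (D : ℕ → ℕ → Prop) : Prop :=
  ∀ x y, Edge (a .eu) (a .ev) q x y ↔ D x y ∨ D y x

/-- Each edge is stored in both directions, as the search requires. -/
def push (a b : Exp) : Cmd :=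
  .store .eu (v .q) a ;; .store .ev (v .q) b ;;
  .store .eu (v .q + lit 1) b ;; .store .ev (v .q + lit 1) a ;; .q ::= v .q + lit 2

theorem edge_push {eu ev : ℕ → ℕ} {q a b x y : ℕ} :
    Edge (upd (upd eu q a) (q + 1) b) (upd (upd ev q b) (q + 1) a) (q + 2) x y ↔
      Edge eu ev q x y ∨ (a = x ∧ b = y) ∨ (b = x ∧ a = y) := by
  have hold : ∀ j < q, upd (upd eu q a) (q + 1) b j = eu j ∧ upd (upd ev q b) (q + 1) a j = ev j :=
    fun j hj => by
      simp only [upd_of_ne (show j ≠ q by omega), upd_of_ne (show j ≠ q + 1 by omega), and_self]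
  have hq : upd (upd eu q a) (q + 1) b q = a ∧ upd (upd ev q b) (q + 1) a q = b := by
    simp [upd_of_ne (show q ≠ q + 1 by omega)]
  constructor
  · rintro ⟨j, hj, h1, h2⟩
    rcases lt_trichotomy j q with h | rfl | h
    · rw [(hold j h).1] at h1
      rw [(hold j h).2] at h2
      exact .inl ⟨j, h, h1, h2⟩
    · rw [hq.1] at h1
      rw [hq.2] at h2
      exact .inr (.inl ⟨h1, h2⟩)
    · obtain rfl : j = q + 1 := by omega
      simp at h1 h2
      exact .inr (.inr ⟨h1, h2⟩)
  · rintro (⟨j, hj, h1, h2⟩ | ⟨h1, h2⟩ | ⟨h1, h2⟩)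
    · exact ⟨j, by omega, by rw [(hold j hj).1, h1], by rw [(hold j hj).2, h2]⟩
    · exact ⟨q, by omega, by rw [hq.1, h1], by rw [hq.2, h2]⟩
    · exact ⟨q + 1, by omega, by simp [h1], by simp [h2]⟩

/-- Each expression is evaluated twice, with stores in between; therefore its value is assumed for
all states that differ in `eu` and `ev` only. -/
theorem push_spec {E : Env} (hE : 100 * (E.N + 1) ≤ E.W) {s : St} {a b : Exp} {x y q : ℕ}
    {D : ℕ → ℕ → Prop} (hD : Coll s.a q D) (hq : s.v .q = q) (hqN : q + 1 < E.N)
    (ha : ∀ s' : St, s'.v = s.v → (∀ A, A ≠ .eu → A ≠ .ev → s'.a A = s.a A) →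
      a.safe E s' ∧ a.eval E s' = x)
    (hb : ∀ s' : St, s'.v = s.v → (∀ A, A ≠ .eu → A ≠ .ev → s'.a A = s.a A) →
      b.safe E s' ∧ b.eval E s' = y) :
    wp E (push a b) (fun s' => Coll s'.a (q + 2) (fun c d => D c d ∨ (x = c ∧ y = d)) ∧
      s'.v .q = q + 2 ∧ s'.time = s.time + 5) s := by
  have h1 := ha s rfl fun _ _ _ => rfl
  have h2 := hb (s.put .eu q x) (by simp) fun A h h' => by simp [h]
  have h3 := hb ((s.put .eu q x).put .ev q y) (by simp) fun A h h' => by simp [h, h']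
  have h4 := ha (((s.put .eu q x).put .ev q y).put .eu (q + 1) y) (by simp)
    fun A h h' => by simp [h, h']
  simp only [push, wp_seq, wp_store, eval_var, hq, h1.1, h1.2, h2.1, h2.2, St.put_v, eval_add,
    eval_lit, h3.1, h3.2, h4.1, h4.2, safe_var, safe_add, safe_lit, true_and, wp_assign]
  refine ⟨by omega, by omega, by omega, by omega, by omega, by omega, by omega, fun c d => ?_,
    by simp [hq], by simp⟩
  have := @edge_push (s.a .eu) (s.a .ev) q x y c d
  simp only [St.set_a, St.put_a, reduceCtorEq, if_true, if_false]
  rw [this, hD c d]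
  tauto

/-- The search in terms of the relation that was collected; adding the reversed edges does not
change the generated equivalence. -/
theorem comp_coll {E : Env} (hE : 100 * (E.N + 1) ≤ E.W) {s : St} {q V : ℕ} {D : ℕ → ℕ → Prop}
    (hD : Coll s.a q D) (hV : ∀ x y, D x y → x < V ∧ y < V)
    (hk : s.v .k = q) (hVv : s.v .V = V) (hq : q ≤ E.N) (hVN : V ≤ E.N) :
    wp E comp (fun s' => s'.time ≤ s.time + 50 * (q + V + 1) ∧
      (∀ x < V, s'.a .lab x < V ∧ EqvGen D x (s'.a .lab x)) ∧
      ∀ x < V, ∀ y < V, s'.a .lab x = s'.a .lab y ↔ EqvGen D x y) s := by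
  have hb : ∀ j < q, D (s.a .eu j) (s.a .ev j) ∨ D (s.a .ev j) (s.a .eu j) :=
    fun j hj => (hD _ _).1 ⟨j, hj, rfl, rfl⟩
  have hiff : ∀ x y, EqvGen (Edge (s.a .eu) (s.a .ev) q) x y ↔ EqvGen D x y := fun x y => by
    constructor
    · refine eqvGen_mono_gen fun a b h => ?_
      rcases (hD a b).1 h with h | h
      · exact .rel _ _ h
      · exact .symm _ _ (.rel _ _ h)
    · exact eqvGen_mono_gen fun a b h => .rel _ _ ((hD a b).2 (.inl h))
  refine wp_mono (comp_spec hE hk hVv hq hVN (fun j hj => ?_) (fun j hj => ?_) fun j hj => ?_)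
    fun s' ⟨h1, h2, h3⟩ _ => ⟨h1, fun x hx => ⟨(h2 x hx).1, (hiff _ _).1 (h2 x hx).2⟩,
      fun x hx y hy => (h3 x hx y hy).trans (hiff _ _)⟩
  · rcases hb j hj with h | h
    · exact (hV _ _ h).1
    · exact (hV _ _ h).2
  · rcases hb j hj with h | h
    · exact (hV _ _ h).2
    · exact (hV _ _ h).1
  · exact (hD _ _).2 (hb j hj).symm

/-! ### Permanent edges -/

/-- Load the edges `done, …, done + cnt - 1` of the first version behind the updates. -/
def loadBatch : Cmd :=
  .for .i (v .cnt) (.x ::= lit 3 + lit 2 * (v .done + v .i) ;;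
    .y ::= .inp (v .x) ;; .z ::= .inp (v .x + lit 1) ;;
    .ite (v .y) (v .z) .skip (.x ::= v .y ;; .y ::= v .z ;; .z ::= v .x) ;;
    .store .c1 (v .te + v .i) (v .y) ;; .store .c2 (v .te + v .i) (v .z))

/-- The stars of the present labels stand for all earlier batches. An edge of the batch is never
updated exactly if the least index with its pair is not that of an update, that is, not below `te`.
-/
def pushBatch : Cmd :=
  .q ::= lit 0 ;;
  .for .i (v .n) (push (v .i) (rd .lab (v .i))) ;;
  .for .i (v .cnt) (.ite (rd .rep (v .te + v .i)) (v .te) .skip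
    (push (rd .c1 (v .te + v .i)) (rd .c2 (v .te + v .i))))

/-- Process one batch of edges of the first version. -/
def batch : Cmd :=
  .cnt ::= v .m - v .done ;; .ite (v .t) (v .cnt) (.cnt ::= v .t) .skip ;;
  loadBatch ;;
  .k ::= v .te + v .cnt ;; .V ::= v .n ;; name ;;
  pushBatch ;;
  .k ::= v .q ;; .V ::= v .n ;; comp ;;
  .done ::= v .done + v .cnt

/-- Compute the components of the permanent edges, and store them as stars. -/
def perm : Cmd :=
  .for .i (v .n) (.store .lab (v .i) (v .i)) ;;
  .done ::= lit 0 ;;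
  .while (v .done) (v .m) batch ;;
  .for .i (v .n) (.store .ru (v .te + v .i) (v .i) ;;
    .store .rv (v .te + v .i) (rd .lab (v .i)) ;;
    .store .rs (v .te + v .i) (lit 0) ;; .store .re (v .te + v .i) (v .Z))

section
variable {E : Env} {P : Par E} {T : TL P.n P.t P.m} {s : St} {δ c : ℕ}

theorem loadBatch_spec (hI : Inp P T) (hS : Setup P s.v) (hd : s.v .done = δ) (hc : s.v .cnt = c)
    (hdc : δ + c ≤ P.m) (hct : c ≤ P.t) :
    wp E loadBatch (fun s' => s'.time ≤ s.time + 2 + 12 * P.t ∧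
      (∀ x < P.t - 1, s'.a .c1 x = s.a .c1 x ∧ s'.a .c2 x = s.a .c2 x) ∧
      ∀ x < c, s'.a .c1 (P.t - 1 + x) = min (T.iu (δ + x)) (T.iw (δ + x)) ∧
        s'.a .c2 (P.t - 1 + x) = max (T.iu (δ + x)) (T.iw (δ + x))) s := by
  have hE := P.hE
  have hm := P.hm
  have hlen := hI.len
  have htN := P.tN
  have hnt := P.hnt
  refine wp_for c (fun j _ => 12 * j) (fun j s' =>
      (∀ x < P.t - 1, s'.a .c1 x = s.a .c1 x ∧ s'.a .c2 x = s.a .c2 x) ∧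
      ∀ x < j, s'.a .c1 (P.t - 1 + x) = min (T.iu (δ + x)) (T.iw (δ + x)) ∧
        s'.a .c2 (P.t - 1 + x) = max (T.iu (δ + x)) (T.iw (δ + x))) (by omega) rfl
      (by simp) (fun j hj s' hI' hA hz => ?_) (fun j hj s' hI' hA hz => ?_) (fun s2 hI2 hA2 hz2 ht2 => ?_)
  · simp [hA.v .cnt rfl, hc]
  · have hS' := hS.agree hA rfl
    have hd' : s'.v .done = δ := by rw [hA.v .done rfl, hd]
    have hj1 : δ + j < P.m := by omega
    obtain ⟨hu, hw⟩ := T.i_lt _ hj1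
    obtain ⟨hI1, hI2⟩ := hI'
    have hfin : ∀ a b, a = min (T.iu (δ + j)) (T.iw (δ + j)) → b = max (T.iu (δ + j)) (T.iw (δ + j)) →
        (∀ x < P.t - 1, upd (s'.a .c1) (P.t - 1 + j) a x = s.a .c1 x ∧
          upd (s'.a .c2) (P.t - 1 + j) b x = s.a .c2 x) ∧
        ∀ x ≤ j, upd (s'.a .c1) (P.t - 1 + j) a (P.t - 1 + x) = min (T.iu (δ + x)) (T.iw (δ + x)) ∧
          upd (s'.a .c2) (P.t - 1 + j) b (P.t - 1 + x) = max (T.iu (δ + x)) (T.iw (δ + x)) := by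
      rintro _ _ rfl rfl
      refine ⟨fun x hx => ?_, fun x hx => ?_⟩
      · simp only [upd_of_ne (show x ≠ P.t - 1 + j by omega)]
        exact hI1 x hx
      · by_cases hxj : x = j
        · subst hxj; simp
        · simp only [upd_of_ne (show P.t - 1 + x ≠ P.t - 1 + j by omega)]
          exact hI2 x (by omega)
    rcases lt_or_ge (T.iu (δ + j)) (T.iw (δ + j)) with h | h
    · obtain ⟨h1, h2⟩ := hfin _ _ (min_eq_left h.le).symm (max_eq_right h.le).symm
      simp [hz, hS'.te, hd', hI.iu _ hj1, hI.iw _ hj1, h, h.not_ge]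
      and_intros <;> first | omega | assumption
    · obtain ⟨h1, h2⟩ := hfin _ _ (min_eq_right h).symm (max_eq_left h).symm
      simp [hz, hS'.te, hd', hI.iu _ hj1, hI.iw _ hj1, h, h.not_gt]
      and_intros <;> first | omega | assumption
  · simp only [St.tick_time, St.tick_a]
    exact ⟨by omega, hI2⟩

theorem pushBatch_spec (hS : Setup P s.v) (hc : s.v .cnt = c) (hct : c ≤ P.t) :
    wp E pushBatch (fun s' => s'.time ≤ s.time + 10 + 20 * P.t ∧ s'.v .q ≤ 4 * P.t ∧
      Coll s'.a (s'.v .q) fun a b => (∃ x < P.n, x = a ∧ s.a .lab x = b) ∨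
        ∃ x < c, P.t - 1 ≤ s.a .rep (P.t - 1 + x) ∧
          s.a .c1 (P.t - 1 + x) = a ∧ s.a .c2 (P.t - 1 + x) = b) s := by
  have hE := P.hE
  have htN := P.tN
  have hnt := P.hnt
  simp only [pushBatch, wp_seq, wp_assign, safe_lit, eval_lit]
  refine ⟨by omega, ?_⟩
  refine wp_for P.n (fun j _ => 8 * j) (fun j s' => s'.v .q = 2 * j ∧
    Coll s'.a (s'.v .q) fun a b => ∃ x < j, x = a ∧ s.a .lab x = b) (by omega) rfl
      ⟨by simp, fun x y => by simp [Edge]⟩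
      (fun j hj s' hI' hA hz => ?_) (fun j hj s' hI' hA hz => ?_) (fun s2 hI2 hA2 hz2 ht2 => ?_)
  · have hn : s'.v .n = P.n := by rw [hA.v .n rfl]; simpa using hS.n
    simpa using hn
  · obtain ⟨h1, h2⟩ := hI'
    have hl : s'.a .lab = s.a .lab := by rw [hA.a .lab rfl]; simp
    refine wp_mono (push_spec (x := j) (y := s.a .lab j) (q := 2 * j) hE
      (by rw [h1] at h2; exact h2) (by simpa using h1) (by omega) ?_ ?_) ?_
    · intro s'' e1 e2
      simp [e1, hz]
    · intro s'' e1 e2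
      have : s''.a .lab = s.a .lab := by rw [e2 .lab (by decide) (by decide)]; simpa using hl
      simp [e1, hz, this]
      omega
    · rintro s3 ⟨k1, k2, k3⟩ hA3
      simp at k3
      refine ⟨⟨by simp [k2]; ring, ?_⟩, by omega⟩
      simp only [St.set_v, reduceCtorEq, if_false, k2, St.set_a]
      refine fun x y => (k1 x y).trans (or_congr ?_ ?_) <;>
      · constructor
        · rintro (⟨z, hz, e⟩ | e)
          · exact ⟨z, by omega, e⟩
          · exact ⟨j, by omega, e⟩
        · rintro ⟨z, hz, e⟩
          rcases Nat.lt_succ_iff_lt_or_eq.1 hz with h | rfl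
          · exact .inl ⟨z, h, e⟩
          · exact .inr e
  obtain ⟨hq2, hC2⟩ := hI2
  have hc2 : s2.v .cnt = c := by rw [hA2.v .cnt rfl]; simpa using hc
  have hte2 : s2.v .te = P.t - 1 := by rw [hA2.v .te rfl]; simpa using hS.te
  have g1 : s2.a .c1 = s.a .c1 := by rw [hA2.a .c1 rfl]; simp
  have g2 : s2.a .c2 = s.a .c2 := by rw [hA2.a .c2 rfl]; simp
  have g3 : s2.a .rep = s.a .rep := by rw [hA2.a .rep rfl]; simp
  refine wp_for c (fun j _ => 9 * j) (fun j s' => s'.v .q ≤ 2 * P.n + 2 * j ∧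
    Coll s'.a (s'.v .q) fun a b => (∃ x < P.n, x = a ∧ s.a .lab x = b) ∨
        ∃ x < j, P.t - 1 ≤ s.a .rep (P.t - 1 + x) ∧
          s.a .c1 (P.t - 1 + x) = a ∧ s.a .c2 (P.t - 1 + x) = b) (by omega) rfl
      ⟨by simp [hq2], ?_⟩
      (fun j hj s' hI' hA hz => ?_) (fun j hj s' hI' hA hz => ?_) (fun s3 hI3 hA3 hz3 ht3 => ?_)
  · simpa using hC2
  · simp [hA.v .cnt rfl, hc2]
  · obtain ⟨h1, h2⟩ := hI'
    have f0 : s'.v .te = P.t - 1 := by rw [hA.v .te rfl]; simpa using hte2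
    have f1 : s'.a .c1 = s.a .c1 := by rw [hA.a .c1 rfl]; simpa using g1
    have f2 : s'.a .c2 = s.a .c2 := by rw [hA.a .c2 rfl]; simpa using g2
    have f3 : s'.a .rep = s.a .rep := by rw [hA.a .rep rfl]; simpa using g3
    rcases lt_or_ge (s.a .rep (P.t - 1 + j)) (P.t - 1) with hlt | hge
    · rw [wp_ite]
      simp only [safe_get, safe_add, safe_var, eval_add, eval_get, eval_var, St.tick_v, St.tick_a,
        f0, f3, hz, hlt, hlt.not_ge, true_and]
      refine ⟨by omega, fun _ => wp_skip.2 ?_, fun h => h.elim⟩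
      simp only [St.set_v, reduceCtorEq, if_false, St.set_a, St.tick_v, St.tick_a, St.tick_time]
      refine ⟨⟨by omega, fun x y => (h2 x y).trans (or_congr (or_congr_right ?_)
        (or_congr_right ?_))⟩, by omega⟩ <;>
      · constructor
        · rintro ⟨z, hz, e⟩
          exact ⟨z, by omega, e⟩
        · rintro ⟨z, hz, e0, e⟩
          rcases Nat.lt_succ_iff_lt_or_eq.1 hz with h | rfl
          · exact ⟨z, h, e0, e⟩
          · omega
    · rw [wp_ite]
      simp only [safe_get, safe_add, safe_var, eval_add, eval_get, eval_var, St.tick_v, St.tick_a,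
        f0, f3, hz, hge, hge.not_gt, true_and]
      refine ⟨by omega, fun h => h.elim, fun _ => ?_⟩
      refine wp_mono (push_spec (x := s.a .c1 (P.t - 1 + j)) (y := s.a .c2 (P.t - 1 + j)) hE
        h2 (by simp) (by omega) ?_ ?_) ?_
      · intro s'' e1 e2
        have : s''.a .c1 = s.a .c1 := by rw [e2 .c1 (by decide) (by decide)]; simpa using f1
        simp [e1, f0, hz, this]
        omega
      · intro s'' e1 e2
        have : s''.a .c2 = s.a .c2 := by rw [e2 .c2 (by decide) (by decide)]; simpa using f2
        simp [e1, f0, hz, this]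
        omega
      · rintro s3 ⟨k1, k2, k3⟩ hA3
        simp at k3
        simp only [St.set_v, reduceCtorEq, if_false, k2, St.set_a]
        refine ⟨⟨by omega, fun x y => (k1 x y).trans (or_congr ?_ ?_)⟩, by omega⟩ <;>
        · constructor
          · rintro ((e | ⟨z, hz, e⟩) | e)
            · exact .inl e
            · exact .inr ⟨z, by omega, e⟩
            · exact .inr ⟨j, by omega, hge, e⟩
          · rintro (e | ⟨z, hz, e⟩)
            · exact .inl (.inl e)
            · rcases Nat.lt_succ_iff_lt_or_eq.1 hz with h | rfl
              · exact .inl (.inr ⟨z, h, e⟩)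
              · exact .inr e.2
  · simp only [St.tick_time, St.tick_a, St.tick_v, St.set_time] at *
    exact ⟨by omega, by omega, hI3.2⟩

/-- The labels describe the components of the first `k` permanent edges. -/
structure Labels (T : TL P.n P.t P.m) (k : ℕ) (lab : ℕ → ℕ) : Prop where
  lt : ∀ x < P.n, lab x < P.n
  conn : ∀ x < P.n, EqvGen (T.Perm k) x (lab x)
  eq : ∀ a b, T.Perm k a b → lab a = lab b

/-- A batch together with the updates has fewer than `2t` pairs, so naming them and recomputing the
components takes `O(t)` time and memory, whatever the number of edges of the first version. -/
theorem batch_spec (hI : Inp P T) (hS : Setup P s.v) (hd : s.v .done = δ) (hdm : δ < P.m)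
    (hL : Labels T δ (s.a .lab)) (hc : ∀ x, x + 1 < P.t → s.a .c1 x = T.e1 x ∧ s.a .c2 x = T.e2 x) :
    wp E batch (fun s' => s'.time ≤ s.time + 1000 * P.t ∧ s'.v .done = min P.m (δ + P.t) ∧
      Labels T (s'.v .done) (s'.a .lab) ∧
      ∀ x, x + 1 < P.t → s'.a .c1 x = T.e1 x ∧ s'.a .c2 x = T.e2 x) s := by
  have hE := P.hE
  have htN := P.tN
  have hn := P.hn
  have hnt := P.hnt
  have hm := P.hm
  obtain ⟨c, hcc⟩ : ∃ c, c = min (P.m - δ) P.t := ⟨_, rfl⟩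
  have key : ∀ s1 : St, Setup P s1.v → s1.v .done = δ → s1.v .cnt = c → s1.a = s.a →
      s1.time ≤ s.time + 3 → wp E (loadBatch ;;
        .k ::= v .te + v .cnt ;; .V ::= v .n ;; name ;;
        pushBatch ;;
        .k ::= v .q ;; .V ::= v .n ;; comp ;;
        .done ::= v .done + v .cnt) (fun s' => s'.time ≤ s.time + 1000 * P.t ∧
          s'.v .done = min P.m (δ + P.t) ∧ Labels T (s'.v .done) (s'.a .lab) ∧
          ∀ x, x + 1 < P.t → s'.a .c1 x = T.e1 x ∧ s'.a .c2 x = T.e2 x) s1 := by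
    intro s1 hS1 hd1 hc1 ha1 ht1
    simp only [wp_seq]
    refine wp_mono (loadBatch_spec hI hS1 hd1 hc1 (by omega) (by omega)) fun s2 ⟨ht2, hl2, hr2⟩ hA2 => ?_
    have hS2 := hS1.agree hA2 rfl
    have hd2 : s2.v .done = δ := by rw [hA2.v .done rfl, hd1]
    have hc2 : s2.v .cnt = c := by rw [hA2.v .cnt rfl, hc1]
    have hlab2 : s2.a .lab = s.a .lab := by rw [hA2.a .lab rfl, ha1]
    have hev2 : ∀ x < P.t - 1, s2.a .c1 x = T.e1 x ∧ s2.a .c2 x = T.e2 x := fun x hx => by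
      rw [(hl2 x hx).1, (hl2 x hx).2, ha1]
      exact hc x (by omega)
    have hlt2 : ∀ x < P.t - 1 + c, s2.a .c1 x < P.n ∧ s2.a .c2 x < P.n := fun x hx => by
      by_cases hxt : x < P.t - 1
      · obtain ⟨e1, e2⟩ := hev2 x hxt
        have := T.e_lt x (by omega)
        rw [e1, e2]
        simp only [TL.e1, TL.e2]
        omega
      · obtain ⟨y, rfl⟩ : ∃ y, x = P.t - 1 + y := ⟨x - (P.t - 1), by omega⟩
        obtain ⟨e1, e2⟩ := hr2 y (by omega)
        have := T.i_lt (δ + y) (by omega)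
        rw [e1, e2]
        omega
    simp only [wp_assign]
    simp only [safe_add, safe_var, eval_add, eval_var, true_and, hS2.te, hc2, St.set_v, reduceCtorEq,
      if_false, hS2.n]
    refine ⟨by omega, ?_⟩
    refine wp_mono (name_spec (k := P.t - 1 + c) (V := P.n) hE (by simp) (by simp) (by omega)
      (by omega) (fun x hx => (hlt2 x hx).1) (fun x hx => (hlt2 x hx).2)) fun s3 ⟨ht3, hr3⟩ hA3 => ?_
    simp only [St.set_a, St.set_time] at hr3 ht3
    have hS3 : Setup P s3.v := by
      refine Setup.agree (s := (s2.set .k (P.t - 1 + c)).set .V P.n) ?_ hA3 rfl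
      obtain ⟨h1, h2, h3, h4, h5, h6, h7, h8⟩ := hS2
      constructor <;> simpa
    have hd3 : s3.v .done = δ := by rw [hA3.v .done rfl]; simpa using hd2
    have hc3 : s3.v .cnt = c := by rw [hA3.v .cnt rfl]; simpa using hc2
    have g1 : s3.a .c1 = s2.a .c1 := by rw [hA3.a .c1 rfl]; simp
    have g2 : s3.a .c2 = s2.a .c2 := by rw [hA3.a .c2 rfl]; simp
    have g3 : s3.a .lab = s.a .lab := by rw [hA3.a .lab rfl]; simpa using hlab2
    refine wp_mono (pushBatch_spec hS3 hc3 (by omega)) fun s4 ⟨ht4, hq4, hC4⟩ hA4 => ?_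
    have hn4 : s4.v .n = P.n := by rw [hA4.v .n rfl, hS3.n]
    have hd4 : s4.v .done = δ := by rw [hA4.v .done rfl]; exact hd3
    have hc4 : s4.v .cnt = c := by rw [hA4.v .cnt rfl]; exact hc3
    have k1 : s4.a .c1 = s2.a .c1 := by rw [hA4.a .c1 rfl]; simpa using g1
    have k2 : s4.a .c2 = s2.a .c2 := by rw [hA4.a .c2 rfl]; simpa using g2
    rw [g1, g2, g3] at hC4
    simp only [hn4, true_and, St.set_v, reduceCtorEq, if_false]
    refine wp_mono (comp_coll (V := P.n) hE hC4 ?_ (by simp) (by simp) (by omega) (by omega))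
      fun s5 ⟨ht5, hl5, he5⟩ hA5 => ?_
    · rintro x y (⟨z, hz, rfl, rfl⟩ | ⟨z, hz, -, rfl, rfl⟩)
      · exact ⟨hz, hL.lt _ hz⟩
      · exact hlt2 _ (by omega)
    have hd5 : s5.v .done = δ := by rw [hA5.v .done rfl]; simpa using hd4
    have hc5 : s5.v .cnt = c := by rw [hA5.v .cnt rfl]; simpa using hc4
    have hS5 : Setup P s5.v := by
      refine Setup.agree (s := (s4.set .k (s4.v .q)).set .V P.n) ?_ hA5 rfl
      obtain ⟨h1, h2, h3, h4, h5, h6, h7, h8⟩ := hS3.agree hA4 rfl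
      constructor <;> simpa
    -- The updates come first in the list of pairs, so the least index of a pair is that of an
    -- update as soon as any update carries the pair.
    have hperm : ∀ x < c, P.t - 1 ≤ s3.a .rep (P.t - 1 + x) ↔ ∀ y, y + 1 < P.t →
        ¬ (T.e1 y = s2.a .c1 (P.t - 1 + x) ∧ T.e2 y = s2.a .c2 (P.t - 1 + x)) := by
      intro x hx
      have hmr := hr3 (P.t - 1 + x) (by omega)
      constructor
      · rintro hge y hy ⟨e1, e2⟩
        have := hmr.min y (by omega) (by rw [(hev2 y (by omega)).1, e1])
          (by rw [(hev2 y (by omega)).2, e2])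
        omega
      · intro hno
        by_contra hlt
        refine hno (s3.a .rep (P.t - 1 + x)) (by omega) ?_
        have h1 := hmr.fst
        have h2 := hmr.snd
        rw [(hev2 _ (by omega)).1] at h1
        rw [(hev2 _ (by omega)).2] at h2
        exact ⟨h1, h2⟩
    have hmono : ∀ a b, T.Perm δ a b → T.Perm (δ + c) a b := by
      rintro a b ⟨⟨j, hj, e⟩, h⟩
      exact ⟨⟨j, by omega, e⟩, h⟩
    have hbatch : ∀ x < c, P.t - 1 ≤ s3.a .rep (P.t - 1 + x) →
        T.Perm (δ + c) (s2.a .c1 (P.t - 1 + x)) (s2.a .c2 (P.t - 1 + x)) := by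
      intro x hx hge
      refine ⟨⟨δ + x, by omega, ?_⟩, (hperm x hx).1 hge⟩
      rw [(hr2 x hx).1, (hr2 x hx).2]
      exact ⟨rfl, rfl⟩
    have hgen : ∀ a b, (∃ x < P.n, x = a ∧ s.a .lab x = b) ∨ (∃ x < c, P.t - 1 ≤ s3.a .rep (P.t - 1 + x) ∧
          s2.a .c1 (P.t - 1 + x) = a ∧ s2.a .c2 (P.t - 1 + x) = b) →
        EqvGen (T.Perm (δ + c)) a b := by
      rintro a b (⟨x, hx, rfl, rfl⟩ | ⟨x, hx, hge, rfl, rfl⟩)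
      · exact eqvGen_mono_gen (fun a b h => .rel _ _ (hmono a b h)) (hL.conn x hx)
      · exact .rel _ _ (hbatch x hx hge)
    simp only [hd5, hc5, St.set_v, if_true, St.set_a, St.set_time] at *
    refine ⟨by omega, by omega, by omega, ⟨fun x hx => (hl5 x hx).1, fun x hx => ?_, ?_⟩, fun x hx => ?_⟩
    · exact eqvGen_mono_gen hgen (hl5 x hx).2
    · intro a b hab
      obtain ⟨⟨j, hj, e1, e2⟩, hno⟩ := hab
      have hjm := T.i_lt j (by omega)
      refine (he5 a (by omega) b (by omega)).2 ?_
      by_cases hjd : j < δ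
      -- Edges from earlier batches join equal old labels, so their endpoints are connected through
      -- a common star.
      · have := hL.eq a b ⟨⟨j, hjd, e1, e2⟩, hno⟩
        have h1 : EqvGen (fun a b => (∃ x < P.n, x = a ∧ s.a .lab x = b) ∨
            ∃ x < c, P.t - 1 ≤ s3.a .rep (P.t - 1 + x) ∧ s2.a .c1 (P.t - 1 + x) = a ∧
              s2.a .c2 (P.t - 1 + x) = b) a (s.a .lab a) :=
          .rel _ _ (.inl ⟨a, by omega, rfl, rfl⟩)
        rw [this] at h1
        exact .trans _ _ _ h1 (.symm _ _ (.rel _ _ (.inl ⟨b, by omega, rfl, rfl⟩)))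
      · obtain ⟨x, rfl⟩ : ∃ x, j = δ + x := ⟨j - δ, by omega⟩
        have hx : x < c := by omega
        obtain ⟨e3, e4⟩ := hr2 x hx
        rw [e1] at e3
        rw [e2] at e4
        refine .rel _ _ (.inr ⟨x, hx, (hperm x hx).2 ?_, e3, e4⟩)
        rw [e3, e4]
        exact hno
    · have := hev2 x (by omega)
      rw [hA5.a .c1 rfl, hA5.a .c2 rfl]
      simpa [k1, k2] using this
  simp only [batch]
  rw [wp_seq, wp_assign, wp_seq, wp_ite]
  simp only [safe_sub, safe_var, eval_sub, eval_var, true_and, hS.m, hd, St.set_v, reduceCtorEq,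
    if_false, if_true, hS.t, wp_assign, wp_skip]
  obtain ⟨h1, h2, h3, h4, h5, h6, h7, h8⟩ := hS
  refine ⟨fun hlt => ?_, fun hge => ?_⟩
  · refine key _ ⟨?_, ?_, ?_, ?_, ?_, ?_, ?_, ?_⟩ ?_ ?_ ?_ ?_ <;> simp [*]
    omega
  · refine key _ ⟨?_, ?_, ?_, ?_, ?_, ?_, ?_, ?_⟩ ?_ ?_ ?_ ?_ <;> simp [*]

theorem perm_spec (hI : Inp P T) (hS : Setup P s.v)
    (hc : ∀ x, x + 1 < P.t → s.a .c1 x = T.e1 x ∧ s.a .c2 x = T.e2 x) :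
    wp E perm (fun s' => s'.time ≤ s.time + 1001 * P.m + 1100 * P.t ∧
      (∀ x < P.t - 1, s'.a .ru x = s.a .ru x ∧ s'.a .rv x = s.a .rv x ∧
        s'.a .rs x = s.a .rs x ∧ s'.a .re x = s.a .re x) ∧
      ∃ lab, Labels T P.m lab ∧ ∀ x < P.n, s'.a .ru (P.t - 1 + x) = x ∧
        s'.a .rv (P.t - 1 + x) = lab x ∧ s'.a .rs (P.t - 1 + x) = 0 ∧
        s'.a .re (P.t - 1 + x) = P.Z) s := by
  have hE := P.hE
  have htN := P.tN
  have hn := P.hn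
  have hnt := P.hnt
  have hm := P.hm
  simp only [perm, wp_seq]
  refine wp_for P.n (fun j _ => 3 * j) (fun j s' => ∀ x < j, s'.a .lab x = x) (by omega) rfl
    (by simp) (fun j hj s' hI hA hz => ?_) (fun j hj s' hI hA hz => ?_) (fun s1 hI1 hA1 hz1 ht1 => ?_)
  · simp [hA.v .n rfl, hS.n]
  · simp [hz, upd_apply]
    and_intros <;> try omega
    intro x hx
    split_ifs with h
    · exact h.symm
    · exact hI x (by omega)
  have hS1 := hS.agree hA1 rfl
  simp only [wp_assign, safe_lit, eval_lit]
  refine ⟨by omega, ?_⟩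
  -- A full batch costs `O(t)` and advances `done` by `t`, so it is paid for by its edges. Only the
  -- last batch can be shorter; the final term `1001 * P.t` pays for that one.
  refine wp_while (fun s' => s'.v .done ≤ P.m ∧ Labels T (s'.v .done) (s'.a .lab) ∧
      (∀ x, x + 1 < P.t → s'.a .c1 x = T.e1 x ∧ s'.a .c2 x = T.e2 x) ∧
      (s'.v .done < P.m → s'.time ≤ s1.time + 2 + 1001 * s'.v .done) ∧
      s'.time ≤ s1.time + 3 + 1001 * s'.v .done + 1001 * P.t) (fun s' => P.m - s'.v .done) ?_ ?_
  · simp only [St.set_v, if_true, St.set_a, St.tick_a, St.set_time, St.tick_time]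
    refine ⟨by omega, ⟨fun x hx => ?_, fun x hx => ?_, ?_⟩, ?_, by omega, by omega⟩
    · rw [hI1 x hx]; exact hx
    · rw [hI1 x hx]; exact .refl _
    · rintro a b ⟨⟨j, hj, -⟩, -⟩
      omega
    · rw [hA1.a .c1 rfl, hA1.a .c2 rfl]
      exact hc
  · rintro s2 hA2 ⟨hd, hL, hcc, ht, ht'⟩
    have hS2 : Setup P s2.v := by
      refine Setup.agree (s := s1.tick.set .done 0) ?_ hA2 rfl
      obtain ⟨h1, h2, h3, h4, h5, h6, h7, h8⟩ := hS1
      constructor <;> simpa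
    refine ⟨by simp, by simp, fun hlt => ?_, fun hge => ?_⟩
    · simp only [eval_var, hS2.m] at hlt
      refine wp_mono (batch_spec (δ := s2.v .done) hI (s := s2.tick) hS2 (by simp) hlt hL hcc)
        fun s3 ⟨ht3, hd3, hL3, hc3⟩ hA3 => ?_
      simp only [St.tick_time] at ht3
      have := ht hlt
      refine ⟨⟨by omega, hL3, hc3, fun h => ?_, ?_⟩, by omega⟩
      · have : s3.v .done = s2.v .done + P.t := by omega
        rw [this, Nat.mul_add]
        omega
      · have h1 : s2.v .done ≤ s3.v .done := by omega
        have h2 : 1001 * s2.v .done ≤ 1001 * s3.v .done := Nat.mul_le_mul_left _ h1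
        omega
    · simp only [eval_var, hS2.m] at hge
      have hdm : s2.v .done = P.m := by omega
      have hS2' : Setup P s2.tick.v := hS2
      have hfr : ∀ A ∈ [Arr.ru, .rv, .rs, .re], s2.a A = s.a A := by
        intro A hA
        simp at hA
        rcases hA with rfl | rfl | rfl | rfl <;>
        · rw [hA2.a _ rfl, St.set_a, St.tick_a, hA1.a _ rfl]
      refine wp_for P.n (fun j _ => 6 * j) (fun j s' =>
        (∀ x < P.t - 1, s'.a .ru x = s.a .ru x ∧ s'.a .rv x = s.a .rv x ∧
          s'.a .rs x = s.a .rs x ∧ s'.a .re x = s.a .re x) ∧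
        ∀ x < j, s'.a .ru (P.t - 1 + x) = x ∧
          s'.a .rv (P.t - 1 + x) = s2.a .lab x ∧ s'.a .rs (P.t - 1 + x) = 0 ∧
          s'.a .re (P.t - 1 + x) = P.Z) (by omega) rfl ⟨fun x hx => ?_, by omega⟩
        (fun j hj s' hI hA hz => ?_) (fun j hj s' hI hA hz => ?_) (fun s3 hI3 hA3 hz3 ht3 => ?_)
      · simp [hfr]
      · simp [hA.v .n rfl, hS2.n]
      · have hS3 := hS2'.agree hA rfl
        have hl : s'.a .lab = s2.a .lab := by rw [hA.a .lab rfl]; simp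
        simp [hz, hS3.te, hS3.Z, hl]
        and_intros <;> try omega
        · intro x hx
          simp only [upd_of_ne (show x ≠ P.t - 1 + j by omega)]
          exact hI.1 x hx
        · intro x hx
          by_cases hxj : x = j
          · subst hxj; simp
          · simp only [upd_of_ne (show P.t - 1 + x ≠ P.t - 1 + j by omega)]
            exact hI.2 x (by omega)
      · simp only [St.tick_time, St.tick_a] at *
        refine ⟨?_, hI3.1, s2.a .lab, by rw [hdm] at hL; exact hL, hI3.2⟩
        rw [hdm] at ht'
        omega

end

/-! ### All stored edges -/

/-- Compute the parameters, and all edges with their lifetimes. -/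
def prepare : Cmd :=
  setup ;; loadEvents ;; .k ::= v .te ;; .V ::= v .n ;; name ;; lives ;; perm

theorem Par.d_lt {E : Env} (P : Par E) : P.d < 2 * P.t := by
  have h := P.B_lt
  have : P.d < 2 ^ P.d := Nat.lt_two_pow_self
  simp only [Par.B] at h
  omega

theorem prepare_spec {E : Env} {P : Par E} {T : TL P.n P.t P.m} (hI : Inp P T) {s : St}
    (hl : ∀ x, s.a .last x = 0) :
    wp E prepare (fun s' => Setup P s'.v ∧ s'.time ≤ s.time + 1001 * P.m + 2000 * P.t ∧
      Recs P.n (P.t - 1) (P.t - 1 + P.n) P.Z (s'.a .ru) (s'.a .rv) (s'.a .rs) (s'.a .re) ∧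
      ∀ i < P.t, ∀ a b, EqvGen (Live (P.t - 1 + P.n) (s'.a .ru) (s'.a .rv) (s'.a .rs) (s'.a .re) i)
        a b ↔ EqvGen (T.g i) a b) s := by
  have hE := P.hE
  have htN := P.tN
  have hn := P.hn
  have hnt := P.hnt
  have hd := P.d_lt
  simp only [prepare, wp_seq]
  refine wp_mono (setup_spec hI s) fun s1 ⟨hS1, ht1⟩ hA1 => ?_
  refine wp_mono (loadEvents_spec hI hS1) fun s2 ⟨ht2, hl2⟩ hA2 => ?_
  have hS2 := hS1.agree hA2 rfl
  simp only [wp_assign, safe_var, eval_var, true_and, hS2.te, hS2.n, St.set_v, reduceCtorEq, if_false]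
  have hlt : ∀ x < P.t - 1, T.e1 x < P.n ∧ T.e2 x < P.n := fun x hx => by
    have := T.e_lt x (by omega)
    simp only [TL.e1, TL.e2]
    omega
  refine wp_mono (name_spec (k := P.t - 1) (V := P.n) hE (by simp) (by simp) (by omega)
    (by omega) (fun x hx => ?_) (fun x hx => ?_)) fun s3 ⟨ht3, hr3⟩ hA3 => ?_
  · simp only [St.set_a]
    rw [(hl2 x (by omega)).2.1]
    exact (hlt x hx).1
  · simp only [St.set_a]
    rw [(hl2 x (by omega)).2.2.1]
    exact (hlt x hx).2
  simp only [St.set_a, St.set_time] at hr3 ht3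
  have hS3 : Setup P s3.v := by
    refine Setup.agree (s := (s2.set .k (P.t - 1)).set .V P.n) ?_ hA3 rfl
    obtain ⟨h1, h2, h3, h4, h5, h6, h7, h8⟩ := hS2
    constructor <;> simpa
  have hmr : ∀ x < P.t - 1, MinRep T.e1 T.e2 (P.t - 1) x (s3.a .rep x) := fun x hx => by
    obtain ⟨h1, h2, h3, h4⟩ := hr3 x hx
    have hy : s3.a .rep x < P.t - 1 := by omega
    rw [(hl2 x (by omega)).2.1] at h2 h4
    rw [(hl2 _ (by omega)).2.1] at h2
    rw [(hl2 x (by omega)).2.2.1] at h3 h4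
    rw [(hl2 _ (by omega)).2.2.1] at h3
    refine ⟨h1, h2, h3, fun z hz e1 e2 => h4 z hz ?_ ?_⟩
    · rw [(hl2 z (by omega)).2.1, e1]
    · rw [(hl2 z (by omega)).2.2.1, e2]
  have fr : ∀ A ∈ [Arr.add, .c1, .c2, .ru, .rv], s3.a A = s2.a A := by
    intro A hA
    simp at hA
    rcases hA with rfl | rfl | rfl | rfl | rfl <;> exact hA3.a _ rfl
  refine wp_mono (lives_spec (T := T) hS3 (fun x => ?_) (fun x hx => ?_) hmr) fun s4 ⟨ht4, hlf⟩ hA4 => ?_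
  · rw [hA3.a .last rfl, St.set_a, St.set_a, hA2.a .last rfl, hA1.a .last rfl, hl]
  · rw [fr .add (by simp), (hl2 x hx).1]
  have hS4 := hS3.agree hA4 rfl
  refine wp_mono (perm_spec hI hS4 fun x hx => ?_) fun s5 ⟨ht5, ho, lab, hL, hnew⟩ hA5 => ?_
  · rw [hA4.a .c1 rfl, hA4.a .c2 rfl, fr .c1 (by simp), fr .c2 (by simp)]
    exact ⟨(hl2 x hx).2.1, (hl2 x hx).2.2.1⟩
  have hu : ∀ x, x + 1 < P.t → s5.a .ru x = T.e1 x ∧ s5.a .rv x = T.e2 x := fun x hx => by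
    obtain ⟨e1, e2, -⟩ := ho x (by omega)
    rw [e1, e2, hA4.a .ru rfl, hA4.a .rv rfl, fr .ru (by simp), fr .rv (by simp)]
    exact (hl2 x hx).2.2.2
  have hlife : ∀ x, x + 1 < P.t → T.Life P.Z x (s5.a .rs x) (s5.a .re x) := fun x hx => by
    obtain ⟨-, -, e1, e2⟩ := ho x (by omega)
    rw [e1, e2]
    exact hlf x hx
  refine ⟨hS4.agree hA5 rfl, by omega, T.recs P.t_le_Z (by omega) hlife hu hnew hL.lt,
    fun i hi a b => T.live_iff P.t_le_Z hlife hu hnew hL.conn (fun a b _ _ h => hL.eq a b h) hi⟩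

/-! ### The edges that matter for a block -/

/-- The entries `[b, e)` of the pool are edges that start until `hi` and end after `lo`, or start
after `lo`; all edges of the first kind are there. -/
structure RootList (M : ℕ) (ru rv rs re : ℕ → ℕ) (a : Arr → ℕ → ℕ) (b e lo hi : ℕ) : Prop where
  mem : ∀ x, b ≤ x → x < e → a .qr x < M ∧ a .qx x = ru (a .qr x) ∧ a .qy x = rv (a .qr x) ∧
    rs (a .qr x) ≤ hi ∧ (lo < re (a .qr x) ∨ lo < rs (a .qr x))
  inj : ∀ x, b ≤ x → x < e → ∀ y, b ≤ y → y < e → a .qr x = a .qr y → x = y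
  full : ∀ r < M, rs r ≤ hi → lo < re r → ∃ x, b ≤ x ∧ x < e ∧ a .qr x = r

theorem RootList.congr {M : ℕ} {ru rv rs re : ℕ → ℕ} {a a' : Arr → ℕ → ℕ} {b e lo hi : ℕ}
    (h : RootList M ru rv rs re a b e lo hi)
    (ha : ∀ x, b ≤ x → x < e → a' .qr x = a .qr x ∧ a' .qx x = a .qx x ∧ a' .qy x = a .qy x) :
    RootList M ru rv rs re a' b e lo hi := by
  refine ⟨fun x h1 h2 => ?_, fun x h1 h2 y h3 h4 he => ?_, fun r h1 h2 h3 => ?_⟩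
  · obtain ⟨e1, e2, e3⟩ := ha x h1 h2
    rw [e1, e2, e3]
    exact h.mem x h1 h2
  · rw [(ha x h1 h2).1, (ha y h3 h4).1] at he
    exact h.inj x h1 h2 y h3 h4 he
  · obtain ⟨x, h4, h5, h6⟩ := h.full r h1 h2 h3
    exact ⟨x, h4, h5, by rw [(ha x h4 h5).1, h6]⟩

/-- At most `n * n + n` entries are alive at `lo`, and starts after `lo` are distinct, which leaves
at most `hi - lo` others. -/
theorem RootList.card_le {n te M Z : ℕ} {ru rv rs re : ℕ → ℕ} {a : Arr → ℕ → ℕ} {b e lo hi : ℕ}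
    (h : RootList M ru rv rs re a b e lo hi) (hR : Recs n te M Z ru rv rs re) :
    e - b ≤ M ∧ e - b ≤ n * n + n + (hi - lo) := by
  have key : ∀ S : Finset ℕ, (∀ x, b ≤ x → x < e → a .qr x ∈ S) → e - b ≤ S.card := fun S hS => by
    have := Finset.card_le_card_of_injOn (s := Finset.Ico b e) (t := S) (a .qr)
      (fun x hx => by simp at hx; exact hS x hx.1 hx.2)
      (fun x hx y hy he => by
        simp at hx hy
        exact h.inj x hx.1 hx.2 y hy.1 hy.2 he)
    simpa using this
  constructor
  · have := key (Finset.range M) fun x h1 h2 => by simpa using (h.mem x h1 h2).1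
    simpa using this
  · have h1 : ((Finset.range M).filter fun r => lo < rs r ∧ rs r ≤ hi).card ≤ hi - lo := by
      have := Finset.card_le_card_of_injOn
        (s := (Finset.range M).filter fun r => lo < rs r ∧ rs r ≤ hi) (t := Finset.Ioc lo hi) rs
        (fun r hr => by simp at hr ⊢; omega)
        (fun r hr q hq he => by
          simp only [Finset.coe_filter, Finset.mem_range, Set.mem_setOf_eq] at hr hq
          have h1 := (hR.start r hr.1 (by omega)).2
          have h2 := (hR.start q hq.1 (by omega)).2
          omega)
      simpa using this
    refine (key (((Finset.range M).filter fun r => rs r ≤ lo ∧ lo < re r) ∪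
      ((Finset.range M).filter fun r => lo < rs r ∧ rs r ≤ hi)) fun x h1 h2 => ?_).trans
      ((Finset.card_union_le _ _).trans (Nat.add_le_add (hR.alive lo) h1))
    have := h.mem x h1 h2
    simp
    omega

/-- Append an entry to the pool. -/
def append : Cmd :=
  .store .qx (v .rp) (v .x) ;; .store .qy (v .rp) (v .y) ;; .store .qr (v .rp) (v .r) ;;
  .rp ::= v .rp + lit 1

/-- The records alive at version `0`; they play the part of a predecessor of the first block. -/
def initList : Cmd :=
  .rp ::= lit 0 ;;
  .for .i (v .te + v .n) (.r ::= v .i ;; .x ::= rd .ru (v .r) ;; .y ::= rd .rv (v .r) ;;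
    .ite (rd .rs (v .r)) (lit 1) (.ite (lit 0) (rd .re (v .r)) append .skip) .skip)

/-- The list of a block consists of the entries of the preceding list that have not ended, and of
the records that start later than the first version of the block. A positive start of record `r` is
`r + 1`, so the latter are found among the indices `lo, …, lo + B - 1` without any search. -/
def rootList : Cmd :=
  .lo ::= v .i * v .B ;; .store .rb (v .i) (v .rp) ;; .store .nA (v .i) (v .n) ;;
  .cnt ::= v .rp - v .pb ;;
  .for .j (v .cnt) (.e ::= v .pb + v .j ;; .x ::= rd .qx (v .e) ;; .y ::= rd .qy (v .e) ;;
    .r ::= rd .qr (v .e) ;; .ite (v .lo) (rd .re (v .r)) append .skip) ;;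
  .for .j (v .B) (.r ::= v .lo + v .j ;; 
    .ite (v .r) (v .te) (.ite (lit 0) (rd .rs (v .r))
      (.x ::= rd .ru (v .r) ;; .y ::= rd .rv (v .r) ;; append) .skip) .skip) ;;
  .pb ::= rd .rb (v .i) ;; .store .rc (v .i) (v .rp - v .pb)

def roots : Cmd :=
  initList ;; .pb ::= lit 0 ;; .for .i (v .nb) rootList

section
variable {E : Env} {P : Par E} {s : St} {M : ℕ} {ru rv rs re : ℕ → ℕ}

/-- The arrays of stored edges. -/
structure Stored (ru rv rs re : ℕ → ℕ) (a : Arr → ℕ → ℕ) : Prop where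
  ru : a .ru = ru
  rv : a .rv = rv
  rs : a .rs = rs
  re : a .re = re

theorem Stored.agree {c : Cmd} {s s' : St} (h : Stored ru rv rs re s.a) (hA : Agree c s s')
    (hc : (!c.wa .ru && !c.wa .rv && !c.wa .rs && !c.wa .re) = true) :
    Stored ru rv rs re s'.a := by
  simp at hc
  obtain ⟨⟨⟨h1, h2⟩, h3⟩, h4⟩ := hc
  exact ⟨by rw [hA.a _ h1, h.ru], by rw [hA.a _ h2, h.rv], by rw [hA.a _ h3, h.rs],
    by rw [hA.a _ h4, h.re]⟩

/-- Appending entries one by one: `p r` tells which of the candidates are accepted. -/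
structure Filt (M : ℕ) (ru rv : ℕ → ℕ) (a : Arr → ℕ → ℕ) (b e : ℕ) (S : ℕ → Prop) : Prop where
  mem : ∀ x, b ≤ x → x < e → a .qr x < M ∧ a .qx x = ru (a .qr x) ∧ a .qy x = rv (a .qr x) ∧
    S (a .qr x)
  inj : ∀ x, b ≤ x → x < e → ∀ y, b ≤ y → y < e → a .qr x = a .qr y → x = y
  full : ∀ r, S r → ∃ x, b ≤ x ∧ x < e ∧ a .qr x = r

theorem Filt.mono {a : Arr → ℕ → ℕ} {b e : ℕ} {S S' : ℕ → Prop} (h : Filt M ru rv a b e S)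
    (hS : ∀ r, S r ↔ S' r) : Filt M ru rv a b e S' := by
  obtain rfl : S = S' := funext fun r => propext (hS r)
  exact h

theorem Filt.append {b e r : ℕ} {S : ℕ → Prop} {a a' : Arr → ℕ → ℕ}
    (h : Filt M ru rv a b e S) (hb : b ≤ e) (hr : r < M) (hS : ¬ S r)
    (h1 : a' .qx = upd (a .qx) e (ru r)) (h2 : a' .qy = upd (a .qy) e (rv r))
    (h3 : a' .qr = upd (a .qr) e r) : Filt M ru rv a' b (e + 1) (fun q => S q ∨ q = r) := by
  have hold : ∀ x < e, a' .qr x = a .qr x ∧ a' .qx x = a .qx x ∧ a' .qy x = a .qy x := fun x hx => by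
    rw [h1, h2, h3, upd_of_ne (by omega), upd_of_ne (by omega), upd_of_ne (by omega)]
    simp
  have hnew : a' .qr e = r ∧ a' .qx e = ru r ∧ a' .qy e = rv r := by simp [h1, h2, h3]
  refine ⟨fun x hx hxe => ?_, fun x hx hxe y hy hye he => ?_, fun q hq => ?_⟩
  · rcases Nat.lt_succ_iff_lt_or_eq.1 hxe with hlt | rfl
    · obtain ⟨e1, e2, e3⟩ := hold x hlt
      obtain ⟨k1, k2, k3, k4⟩ := h.mem x hx hlt
      rw [e1, e2, e3]
      exact ⟨k1, k2, k3, .inl k4⟩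
    · obtain ⟨e1, e2, e3⟩ := hnew
      rw [e1, e2, e3]
      exact ⟨hr, rfl, rfl, .inr rfl⟩
  · rcases Nat.lt_succ_iff_lt_or_eq.1 hxe with hlt | rfl <;>
    rcases Nat.lt_succ_iff_lt_or_eq.1 hye with hlt' | rfl
    · rw [(hold x hlt).1, (hold y hlt').1] at he
      exact h.inj x hx hlt y hy hlt' he
    · rw [(hold x hlt).1, hnew.1] at he
      exact (hS (he ▸ (h.mem x hx hlt).2.2.2)).elim
    · rw [(hold y hlt').1, hnew.1] at he
      exact (hS (he ▸ (h.mem y hy hlt').2.2.2)).elim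
    · rfl
  · rcases hq with hq | rfl
    · obtain ⟨x, k1, k2, k3⟩ := h.full q hq
      exact ⟨x, k1, by omega, by rw [(hold x k2).1, k3]⟩
    · exact ⟨e, hb, by omega, hnew.1⟩

theorem initList_spec (hS : Setup P s.v) (hst : Stored ru rv rs re s.a) :
    wp E initList (fun s' => s'.time ≤ s.time + 30 * P.t ∧ s'.v .rp ≤ 2 * P.t ∧
      RootList (P.t - 1 + P.n) ru rv rs re s'.a 0 (s'.v .rp) 0 0) s := by
  have hE := P.hE
  have htN := P.tN
  have hn := P.hn
  have hnt := P.hnt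
  simp only [initList, wp_seq, wp_assign, safe_lit, eval_lit]
  refine ⟨by omega, ?_⟩
  refine wp_for (P.t - 1 + P.n) (fun j _ => 11 * j) (fun j s' => s'.v .rp ≤ j ∧
    Filt (P.t - 1 + P.n) ru rv s'.a 0 (s'.v .rp) fun r => r < j ∧ rs r = 0 ∧ 0 < re r) (by omega) rfl
    ⟨by simp, by simp, by simp, by simp⟩ (fun j hj s' hI' hA hz => ?_)
    (fun j hj s' ⟨hrp, hF⟩ hA hz => ?_) (fun s2 ⟨hrp2, hF2⟩ hA2 hz2 ht2 => ?_)
  · have h1 : s'.v .te = P.t - 1 := by rw [hA.v .te rfl]; simpa using hS.te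
    have h2 : s'.v .n = P.n := by rw [hA.v .n rfl]; simpa using hS.n
    simp [h1, h2]
    omega
  · have f1 : s'.a .ru = ru := by rw [hA.a .ru rfl]; simpa using hst.ru
    have f2 : s'.a .rv = rv := by rw [hA.a .rv rfl]; simpa using hst.rv
    have f3 : s'.a .rs = rs := by rw [hA.a .rs rfl]; simpa using hst.rs
    have f4 : s'.a .re = re := by rw [hA.a .re rfl]; simpa using hst.re
    have hno : ∀ s'' : St, s''.v .rp = s'.v .rp → s''.a = s'.a → ¬ (rs j = 0 ∧ 0 < re j) →
        Filt (P.t - 1 + P.n) ru rv s''.a 0 (s''.v .rp) fun r => r < j + 1 ∧ rs r = 0 ∧ 0 < re r := by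
      intro s'' e1 e2 h
      rw [e1, e2]
      refine hF.mono fun r => ⟨fun hr => ⟨by omega, hr.2⟩, fun hr => ⟨?_, hr.2⟩⟩
      rcases Nat.lt_succ_iff_lt_or_eq.1 hr.1 with hlt | rfl
      · exact hlt
      · exact (h hr.2).elim
    simp only [wp_seq, wp_assign]
    rcases lt_or_ge (rs j) 1 with h1 | h1
    · rcases lt_or_ge 0 (re j) with h2 | h2
      · simp [hz, f1, f2, f3, f4, append, h1, h1.not_ge, h2, h2.not_ge]
        and_intros <;> first | omega | skip
        refine (hF.append (r := j) (Nat.zero_le _) hj (by simp) (by simp) (by simp) (by simp)).mono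
          fun r => ⟨?_, ?_⟩
        · rintro (h | rfl)
          · omega
          · omega
        · intro h
          by_cases hrj : r = j
          · exact .inr hrj
          · exact .inl ⟨by omega, h.2⟩
      · simp [hz, f1, f2, f3, f4, append, h1, h1.not_ge, h2, h2.not_gt]
        and_intros <;> first | omega | skip
        simpa [Nat.lt_succ_iff] using hno s' rfl rfl (by omega)
    · simp [hz, f1, f2, f3, f4, append, h1, h1.not_gt]
      and_intros <;> first | omega | skip
      simpa [Nat.lt_succ_iff] using hno s' rfl rfl (by omega)
  · simp only [St.tick_time, St.tick_v, St.tick_a, St.set_time] at *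
    refine ⟨by omega, by omega, fun x h1 h2 => ?_, hF2.inj, fun r h1 h2 h3 => hF2.full r ⟨h1, by omega, h3⟩⟩
    obtain ⟨k1, k2, k3, k4⟩ := hF2.mem x h1 h2
    exact ⟨k1, k2, k3, by omega, by omega⟩

/-- The arrays agree on the first `z` nodes, and on the first `rp` and `mp` entries of the pools. -/
structure Ext (z rp mp : ℕ) (a a' : Arr → ℕ → ℕ) : Prop where
  node : ∀ i < z, a' .rb i = a .rb i ∧ a' .rc i = a .rc i ∧ a' .nA i = a .nA i ∧ a' .mb i = a .mb i
  pool : ∀ x < rp, a' .qx x = a .qx x ∧ a' .qy x = a .qy x ∧ a' .qr x = a .qr x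
  map : ∀ x < mp, a' .mq x = a .mq x

theorem Ext.refl (z rp mp : ℕ) (a : Arr → ℕ → ℕ) : Ext z rp mp a a :=
  ⟨by simp, by simp, by simp⟩

theorem Ext.trans {z rp mp z' rp' mp' : ℕ} {a a' a'' : Arr → ℕ → ℕ} (h : Ext z rp mp a a')
    (h' : Ext z' rp' mp' a' a'') (h1 : z ≤ z') (h2 : rp ≤ rp') (h3 : mp ≤ mp') :
    Ext z rp mp a a'' := by
  refine ⟨fun i hi => ?_, fun x hx => ?_, fun x hx => ?_⟩
  · obtain ⟨e1, e2, e3, e4⟩ := h.node i hi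
    obtain ⟨k1, k2, k3, k4⟩ := h'.node i (by omega)
    exact ⟨by omega, by omega, by omega, by omega⟩
  · obtain ⟨e1, e2, e3⟩ := h.pool x hx
    obtain ⟨k1, k2, k3⟩ := h'.pool x (by omega)
    exact ⟨by omega, by omega, by omega⟩
  · have := h.map x hx
    have := h'.map x (by omega)
    omega

/-- The upper limit is inclusive: a record that starts with the first version of the next block is
not added there, and must be found in the list of the present block. -/
theorem rootList_spec (hS : Setup P s.v) (hst : Stored ru rv rs re s.a)
    (hR : Recs P.n (P.t - 1) (P.t - 1 + P.n) P.Z ru rv rs re)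
    {i b p lo' : ℕ} (hi : i < P.nb) (hiv : s.v .i = i) (hb : s.v .pb = b) (hp : s.v .rp = p)
    (hbp : b ≤ p) (hpN : p + (p - b) + P.B < E.N)
    (hlo' : lo' ≤ i * P.B) (hL : RootList (P.t - 1 + P.n) ru rv rs re s.a b p lo' (i * P.B)) :
    wp E rootList (fun s' => s'.time ≤ s.time + 15 * (p - b) + 15 * P.B + 15 ∧ s'.v .pb = p ∧
      p ≤ s'.v .rp ∧ s'.a .rb i = p ∧ s'.a .rc i = s'.v .rp - p ∧ s'.a .nA i = P.n ∧
      Ext i p E.N s.a s'.a ∧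
      RootList (P.t - 1 + P.n) ru rv rs re s'.a p (s'.v .rp) (i * P.B) (i * P.B + P.B)) s := by
  have hE := P.hE
  have htN := P.tN
  have hn := P.hn
  have hnt := P.hnt
  have hZ := P.Z_lt'
  have hnb := P.nb_le
  obtain ⟨lo, hlo⟩ : ∃ lo, lo = i * P.B := ⟨_, rfl⟩
  have hloZ : lo + P.B ≤ P.Z := by
    rw [hlo, ← Nat.succ_mul]
    exact Nat.mul_le_mul_right _ hi
  rw [← hlo] at hL hlo' ⊢
  simp only [rootList, wp_seq, wp_assign, wp_store]
  simp [hiv, hp, hb, hS.n, hS.B, ← hlo]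
  and_intros <;> first | omega | skip
  refine wp_for (p - b) (fun j _ => 11 * j) (fun j s' => p ≤ s'.v .rp ∧ s'.v .rp ≤ p + j ∧
    Ext i p E.N s.a s'.a ∧
    Filt (P.t - 1 + P.n) ru rv s'.a p (s'.v .rp)
      fun r => ∃ x, b ≤ x ∧ x < b + j ∧ s.a .qr x = r ∧ lo < re r) (by omega) rfl
    ⟨by simp [hp], by simp [hp], ⟨?_, by simp, by simp⟩, ?_⟩ (fun j hj s' hI' hA hz => ?_)
    (fun j hj s' ⟨hrp, hrp', hX, hF⟩ hA hz => ?_) (fun s2 ⟨hrp2, hrp2', hX2, hF2⟩ hA2 hz2 ht2 => ?_)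
  · intro x hx
    simp [upd_of_ne (show x ≠ i by omega)]
  · simp [hp]
    exact ⟨fun x h1 h2 => by omega, fun x h1 h2 => by omega, fun r ⟨x, h1, h2, _⟩ => by omega⟩
  · have h1 : s'.v .cnt = p - b := by rw [hA.v .cnt rfl]; simp
    simp [h1]
  · have f1 : s'.v .pb = b := by rw [hA.v .pb rfl]; simpa using hb
    have f2 : s'.v .lo = lo := by rw [hA.v .lo rfl]; simp
    have f4 : s'.a .re = re := by rw [hA.a .re rfl]; simpa using hst.re
    obtain ⟨e1, e2, e3⟩ := hX.pool (b + j) (by omega)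
    obtain ⟨k1, k2, k3, k4, k5⟩ := hL.mem (b + j) (by omega) (by omega)
    simp only [wp_seq, wp_assign]
    rcases lt_or_ge lo (re (s.a .qr (b + j))) with h2 | h2
    · simp [hz, f1, f2, f4, append, h2, h2.not_ge, e1, e2, e3]
      and_intros <;> first | omega | skip
      · refine ⟨fun x hx => by simpa using hX.node x hx, fun x hx => ?_,
          fun x hx => by simpa using hX.map x hx⟩
        simp [upd_of_ne (show x ≠ s'.v .rp by omega)]
        exact hX.pool x hx
      · refine (hF.append (r := s.a .qr (b + j)) hrp k1 ?_ (by simp [k2]) (by simp [k3])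
          (by simp)).mono fun r => ⟨?_, ?_⟩
        · rintro ⟨x, h3, h4, h5, h6⟩
          have := hL.inj x h3 (by omega) (b + j) (by omega) (by omega) h5
          omega
        · rintro (⟨x, h3, h4, h5⟩ | rfl)
          · exact ⟨x, h3, by omega, h5⟩
          · exact ⟨b + j, by omega, by omega, rfl, h2⟩
        · rintro ⟨x, h3, h4, h5⟩
          by_cases hxj : x = b + j
          · subst hxj
            exact .inr h5.1.symm
          · exact .inl ⟨x, h3, by omega, h5⟩
    · simp [hz, f1, f2, f4, append, h2, h2.not_gt, e1, e2, e3]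
      and_intros <;> first | omega | exact hX | skip
      refine hF.mono fun r => ⟨?_, ?_⟩
      · rintro ⟨x, h3, h4, h5⟩
        exact ⟨x, h3, by omega, h5⟩
      · rintro ⟨x, h3, h4, h5⟩
        by_cases hxj : x = b + j
        · subst hxj
          obtain ⟨rfl, h6⟩ := h5
          omega
        · exact ⟨x, h3, by omega, h5⟩
  have hBv : s2.v .B = P.B := by rw [hA2.v .B rfl]; simpa using hS.B
  have hbp' : b + (p - b) = p := by omega
  rw [hbp'] at hF2
  refine wp_for P.B (fun j _ => 12 * j) (fun j s' => p ≤ s'.v .rp ∧ s'.v .rp ≤ p + (p - b) + j ∧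
    Ext i p E.N s.a s'.a ∧
    Filt (P.t - 1 + P.n) ru rv s'.a p (s'.v .rp)
      fun r => (∃ x, b ≤ x ∧ x < p ∧ s.a .qr x = r ∧ lo < re r) ∨
        (lo ≤ r ∧ r < lo + j ∧ r < P.t - 1 ∧ 0 < rs r)) (by omega) rfl
    ⟨by simpa, by simpa, by simpa, ?_⟩ (fun j hj s' hI' hA hz => ?_)
    (fun j hj s' ⟨hrp, hrp', hX, hF⟩ hA hz => ?_) (fun s3 ⟨hrp3, hrp3', hX3, hF3⟩ hA3 hz3 ht3 => ?_)
  · simp only [St.set_a, St.set_v, reduceCtorEq, if_false, St.tick_a, St.tick_v]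
    exact hF2.mono fun r => by simp; omega
  · have h1 : s'.v .B = P.B := by rw [hA.v .B rfl]; simpa using hBv
    simp [h1]
  · have f2 : s'.v .lo = lo := by rw [hA.v .lo rfl, St.tick_v, hA2.v .lo rfl]; simp
    have f5 : s'.v .te = P.t - 1 := by rw [hA.v .te rfl, St.tick_v, hA2.v .te rfl]; simpa using hS.te
    have g1 : s'.a .ru = ru := by rw [hA.a .ru rfl, St.tick_a, hA2.a .ru rfl]; simpa using hst.ru
    have g2 : s'.a .rv = rv := by rw [hA.a .rv rfl, St.tick_a, hA2.a .rv rfl]; simpa using hst.rv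
    have g3 : s'.a .rs = rs := by rw [hA.a .rs rfl, St.tick_a, hA2.a .rs rfl]; simpa using hst.rs
    have hno : ∀ s'' : St, s''.v .rp = s'.v .rp → s''.a = s'.a → ¬ (lo + j < P.t - 1 ∧ 0 < rs (lo + j)) →
        Filt (P.t - 1 + P.n) ru rv s''.a p (s''.v .rp)
          fun r => (∃ x, b ≤ x ∧ x < p ∧ s.a .qr x = r ∧ lo < re r) ∨
            (lo ≤ r ∧ r < lo + (j + 1) ∧ r < P.t - 1 ∧ 0 < rs r) := by
      intro s'' e1 e2 h
      rw [e1, e2]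
      refine hF.mono fun r => or_congr_right ⟨fun hr => by omega, fun hr => ?_⟩
      by_cases hrj : r = lo + j
      · subst hrj
        exact (h hr.2.2).elim
      · omega
    simp only [wp_seq, wp_assign]
    rcases lt_or_ge (lo + j) (P.t - 1) with h1 | h1
    · rcases lt_or_ge 0 (rs (lo + j)) with h2 | h2
      · simp [hz, f2, f5, g1, g2, g3, append, h1, h1.not_ge, h2, h2.not_ge]
        and_intros <;> first | omega | skip
        · refine ⟨fun x hx => by simpa using hX.node x hx, fun x hx => ?_,
            fun x hx => by simpa using hX.map x hx⟩
          simp [upd_of_ne (show x ≠ s'.v .rp by omega)]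
          exact hX.pool x hx
        · refine (hF.append (r := lo + j) hrp (by omega) ?_ (by simp) (by simp)
            (by simp)).mono fun r => ⟨?_, ?_⟩
          -- The record is not yet in the list: entries taken over from the preceding list start at
          -- `lo` at the latest, this one starts at `lo + j + 1`.
          · rintro (⟨x, h3, h4, h5, h6⟩ | h)
            · have := (hL.mem x h3 h4).2.2.2.1
              rw [h5] at this
              have := hR.start (lo + j) (by omega) h2
              omega
            · omega
          · rintro ((h | h) | rfl)
            · exact .inl h
            · exact .inr (by omega)
            · exact .inr (by omega)
          · rintro (h | h)
            · exact .inl (.inl h)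
            · by_cases hrj : r = lo + j
              · exact .inr hrj
              · exact .inl (.inr (by omega))
      · simp [hz, f2, f5, g1, g2, g3, append, h1, h1.not_ge, h2, h2.not_gt]
        and_intros <;> first | omega | exact hX | skip
        exact hno s' rfl rfl (by omega)
    · simp [hz, f2, f5, g1, g2, g3, append, h1, h1.not_gt]
      and_intros <;> first | omega | exact hX | skip
      exact hno s' rfl rfl (by omega)
  · have f1 : s3.v .i = i := by rw [hA3.v .i rfl, St.tick_v, hA2.v .i rfl]; simpa using hiv
    have f2 : s3.a .rb i = p := by rw [hA3.a .rb rfl, St.tick_a, hA2.a .rb rfl]; simp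
    have f3 : s3.a .nA i = P.n := by rw [hA3.a .nA rfl, St.tick_a, hA2.a .nA rfl]; simp
    simp [f1, f2, f3] at ht2 ht3 ⊢
    and_intros <;> first | omega | skip
    · refine ⟨fun x hx => ?_, fun x hx => by simpa using hX3.pool x hx,
        fun x hx => by simpa using hX3.map x hx⟩
      simp [upd_of_ne (show x ≠ i by omega)]
      exact hX3.node x hx
    · refine ⟨fun x h1 h2 => ?_, hF3.inj, fun r h1 h2 h3 => hF3.full r ?_⟩
      · obtain ⟨k1, k2, k3, k4⟩ := hF3.mem x h1 h2
        refine ⟨k1, k2, k3, ?_⟩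
        simp only [St.set_a, St.put_a, reduceCtorEq, if_false, St.tick_a]
        rcases k4 with ⟨y, h3, h4, h5, h6⟩ | h
        · have := (hL.mem y h3 h4).2.2.2.1
          rw [h5] at this
          exact ⟨by omega, .inl h6⟩
        · have := hR.start _ k1 h.2.2.2
          omega
      · by_cases h4 : rs r ≤ lo
        · obtain ⟨x, k1, k2, k3⟩ := hL.full r h1 h4 (by omega)
          exact .inl ⟨x, k1, k2, k3, h3⟩
        · have := hR.start r h1 (by omega)
          exact .inr (by omega)

/-- With two blocks `B < t`, so the minimum that `B` dominates is `n * n`. -/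
theorem Par.sq_le_B (P : Par E) (h : 2 ≤ P.nb) : P.n * P.n ≤ P.B := by
  have h1 := P.Z_lt
  have h2 : 2 * P.B ≤ P.Z := Nat.mul_le_mul_right _ h
  have h3 := P.hB1
  simp only [Par.B] at *
  omega

/-- A single block has at least `t` versions, and there are fewer than `2t` records. With more
blocks, `n * n ≤ B` and the bound `n * n + n + B` is at most `3B`. -/
theorem RootList.card_le_four {a : Arr → ℕ → ℕ} {b e lo : ℕ}
    (hR : Recs P.n (P.t - 1) (P.t - 1 + P.n) P.Z ru rv rs re)
    (h : RootList (P.t - 1 + P.n) ru rv rs re a b e lo (lo + P.B)) : e - b ≤ 4 * P.B := by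
  obtain ⟨h1, h2⟩ := h.card_le hR
  have hnt := P.hnt
  have hnB := P.n_le_B
  have htZ := P.t_le_Z
  rcases Nat.lt_or_ge P.nb 2 with h3 | h3
  · have h4 : P.nb = 1 := by have := P.nb_pos; omega
    rw [Par.Z, h4] at htZ
    omega
  · have := P.sq_le_B h3
    omega

/-- The lists of the blocks `< j`. -/
structure RootsOk (P : Par E) (ru rv rs re : ℕ → ℕ) (a : Arr → ℕ → ℕ) (rp j : ℕ) : Prop where
  list : ∀ i < j, RootList (P.t - 1 + P.n) ru rv rs re a (a .rb i) (a .rb i + a .rc i) (i * P.B)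
    (i * P.B + P.B)
  le : ∀ i < j, a .rb i + a .rc i ≤ rp
  nA : ∀ i < j, a .nA i = P.n

theorem roots_spec (hS : Setup P s.v) (hst : Stored ru rv rs re s.a)
    (hR : Recs P.n (P.t - 1) (P.t - 1 + P.n) P.Z ru rv rs re) :
    wp E roots (fun s' => s'.time ≤ s.time + 500 * P.t ∧ s'.v .rp ≤ 14 * P.t ∧
      RootsOk P ru rv rs re s'.a (s'.v .rp) P.nb) s := by
  have hE := P.hE
  have htN := P.tN
  have hn := P.hn
  have hnt := P.hnt
  have hZ := P.Z_lt'
  have hnb := P.nb_le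
  have hB := P.B_lt
  simp only [roots, wp_seq]
  refine wp_mono (initList_spec hS hst) fun s1 ⟨ht1, hr1, hL1⟩ hA1 => ?_
  simp only [wp_assign, safe_lit, eval_lit]
  refine ⟨by omega, ?_⟩
  have hS1 := hS.agree hA1 rfl
  have hst1 := hst.agree hA1 rfl
  -- A round takes time proportional to the length `rp - pb` of the preceding list. Afterwards `pb`
  -- is the old `rp`, so the growth of `15 * pb` pays for it.
  refine wp_for P.nb (fun j s' => 15 * s'.v .pb + (15 * (P.B * j) + 20 * j)) (fun j s' =>
    s'.v .pb ≤ s'.v .rp ∧ s'.v .rp - s'.v .pb ≤ 2 * P.t ∧ s'.v .rp ≤ 2 * P.t + 4 * (j * P.B) ∧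
    (∃ lo', lo' ≤ j * P.B ∧
      RootList (P.t - 1 + P.n) ru rv rs re s'.a (s'.v .pb) (s'.v .rp) lo' (j * P.B)) ∧
    RootsOk P ru rv rs re s'.a (s'.v .rp) j) (by omega) rfl ⟨by simp, by simpa, by simpa, ⟨0, ?_⟩, ?_⟩
      (fun j hj s' hI' hA hz => ?_)
    (fun j hj s' ⟨hpr, hle, hrp, ⟨lo', hlo', hL⟩, hO⟩ hA hz => ?_)
    (fun s2 ⟨hpr, hle, hrp, _, hO⟩ hA2 hz2 ht2 => ?_)
  · simpa using hL1
  · exact ⟨by simp, by simp, by simp⟩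
  · have h1 : s'.v .nb = P.nb := by rw [hA.v .nb rfl]; simpa using hS1.nb
    simp [h1]
  · have hS' : Setup P s'.v := by
      refine Setup.agree (s := s1.set .pb 0) ?_ hA rfl
      obtain ⟨h1, h2, h3, h4, h5, h6, h7, h8⟩ := hS1
      constructor <;> simpa
    have hst' : Stored ru rv rs re s'.a :=
      Stored.agree (s := s1.set .pb 0) (by simpa using hst1) hA rfl
    have hjZ : (j + 1) * P.B ≤ P.Z := Nat.mul_le_mul_right _ hj
    have hjs : (j + 1) * P.B = j * P.B + P.B := by ring
    refine wp_mono (rootList_spec (P := P) (i := j) (b := s'.v .pb) (p := s'.v .rp)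
      (by simpa using hS') (by simpa using hst') hR hj (by simpa using hz) (by simp) (by simp)
      hpr (by omega) hlo' (by simpa using hL)) ?_
    rintro s3 ⟨ht3, hpb3, hrp3, hrb3, hrc3, hnA3, hX3, hL3⟩ hA3
    have hc := hL3.card_le_four hR
    have hc' := (hL3.card_le hR).1
    simp only [St.tick_time] at ht3
    simp only [St.set_v, reduceCtorEq, if_false, St.set_a, hpb3]
    refine ⟨⟨hrp3, by omega, by omega, ⟨j * P.B, by omega, by rw [hjs]; exact hL3⟩, ⟨fun i hi => ?_, fun i hi => ?_, fun i hi => ?_⟩⟩, ?_⟩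
    · rcases Nat.lt_succ_iff_lt_or_eq.1 hi with hlt | rfl
      · obtain ⟨e1, e2, e3, e4⟩ := hX3.node i hlt
        simp only [St.tick_a] at e1 e2
        have := hO.le i hlt
        rw [e1, e2]
        refine (hO.list i hlt).congr fun x h1 h2 => ?_
        obtain ⟨k1, k2, k3⟩ := hX3.pool x (by omega)
        exact ⟨k3, k1, k2⟩
      · rw [hrb3, hrc3, show s'.v .rp + (s3.v .rp - s'.v .rp) = s3.v .rp by omega]
        exact hL3
    · rcases Nat.lt_succ_iff_lt_or_eq.1 hi with hlt | rfl
      · obtain ⟨e1, e2, e3, e4⟩ := hX3.node i hlt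
        simp only [St.tick_a] at e1 e2
        have := hO.le i hlt
        omega
      · omega
    · rcases Nat.lt_succ_iff_lt_or_eq.1 hi with hlt | rfl
      · obtain ⟨e1, e2, e3, e4⟩ := hX3.node i hlt
        simp only [St.tick_a] at e3
        rw [e3, hO.nA i hlt]
      · exact hnA3
    · rw [show P.B * (j + 1) = P.B * j + P.B by ring]
      omega
  · have hBZ : P.B * P.nb = P.Z := mul_comm _ _
    have hBZ' : P.nb * P.B = P.Z := rfl
    simp only [St.tick_time, St.tick_v, St.tick_a, St.set_v, St.set_time, reduceCtorEq, if_false,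
      if_true] at *
    rw [hBZ] at ht2
    exact ⟨by omega, by omega, hO⟩

end

/-! ### Contraction -/

/-- `F` consists of the contracted edges, `f` maps a vertex to the name of its class, and `D'`
consists of the images of the remaining edges. A path of `D` is mapped edge by edge, contracted
edges collapsing. Conversely the edges of a path of `D'` are lifted one by one; successive lifts
meet in a common class, inside which `F` connects them. -/
theorem contract_iff {k : ℕ} {D F D' : ℕ → ℕ → Prop} {f : ℕ → ℕ}
    (hF : ∀ a < k, ∀ b < k, f a = f b ↔ EqvGen F a b) (hFD : ∀ a b, F a b → D a b)
    (hD : ∀ a b, D a b → a < k ∧ b < k ∧ (F a b ∨ D' (f a) (f b)))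
    (hD' : ∀ c d, D' c d → ∃ a b, a < k ∧ b < k ∧ D a b ∧ f a = c ∧ f b = d) {x y : ℕ}
    (hx : x < k) (hy : y < k) : EqvGen D x y ↔ EqvGen D' (f x) (f y) := by
  have hFD' : ∀ a < k, ∀ b < k, f a = f b → EqvGen D a b := fun a ha b hb h =>
    eqvGen_mono_gen (fun c d h => .rel _ _ (hFD c d h)) ((hF a ha b hb).1 h)
  constructor
  · intro h
    clear hx hy
    induction h with
    | rel a b h =>
      obtain ⟨ha, hb, h | h⟩ := hD a b h
      · rw [(hF a ha b hb).2 (.rel _ _ h)]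
        exact .refl _
      · exact .rel _ _ h
    | refl _ => exact .refl _
    | symm _ _ _ ih => exact .symm _ _ ih
    | trans _ _ _ _ _ ih1 ih2 => exact .trans _ _ _ ih1 ih2
  -- The alternative `c = d` is for numbers that are not names of classes: a generated equivalence
  -- is reflexive on all of `ℕ`.
  · have key : ∀ c d, EqvGen D' c d → c = d ∨ ∃ a b, a < k ∧ b < k ∧ f a = c ∧ f b = d ∧ EqvGen D a b := by
      intro c d h
      induction h with
      | rel c d h =>
        obtain ⟨a, b, ha, hb, hab, e1, e2⟩ := hD' c d h
        exact .inr ⟨a, b, ha, hb, e1, e2, .rel _ _ hab⟩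
      | refl _ => exact .inl rfl
      | symm _ _ _ ih =>
        rcases ih with rfl | ⟨a, b, ha, hb, e1, e2, h⟩
        · exact .inl rfl
        · exact .inr ⟨b, a, hb, ha, e2, e1, .symm _ _ h⟩
      | trans _ _ _ _ _ ih1 ih2 =>
        rcases ih1 with rfl | ⟨a, b, ha, hb, e1, e2, h⟩
        · exact ih2
        · rcases ih2 with rfl | ⟨a', b', ha', hb', e1', e2', h'⟩
          · exact .inr ⟨a, b, ha, hb, e1, e2, h⟩
          · exact .inr ⟨a, b', ha, hb', e1, e2',
              .trans _ _ _ (.trans _ _ _ h (hFD' b hb a' ha' (by rw [e2, e1']))) h'⟩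
    intro h
    rcases key _ _ h with h | ⟨a, b, ha, hb, e1, e2, h⟩
    · exact hFD' x hx y hy h
    · exact .trans _ _ _ (.trans _ _ _ (hFD' x hx a ha e1.symm) h) (hFD' b hb y hy e2)

/-- The edge `r` is present during all of `[lo, hi)`. -/
def Cover (rs re : ℕ → ℕ) (lo hi r : ℕ) : Prop := rs r ≤ lo ∧ hi ≤ re r

/-- The edge `r` is present during a part of `[lo, hi)`. -/
def Part (rs re : ℕ → ℕ) (lo hi r : ℕ) : Prop :=
  rs r < hi ∧ lo < re r ∧ ¬ (rs r ≤ lo ∧ hi ≤ re r)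

/-- Set `c` to `2` if the edge `r` is present all the time, to `1` if it is so partially. -/
def classify : Cmd :=
  .c ::= lit 0 ;;
  .ite (rd .rs (v .r)) (v .hi) (.ite (v .lo) (rd .re (v .r))
    (.c ::= lit 1 ;; .ite (rd .rs (v .r)) (v .lo + lit 1)
      (.ite (v .hi) (rd .re (v .r) + lit 1) (.c ::= lit 2) .skip) .skip) .skip) .skip

theorem classify_spec {E : Env} (hE : 100 * (E.N + 1) ≤ E.W) {s : St} {r lo hi : ℕ} {rs re : ℕ → ℕ}
    (hr : s.v .r = r) (hlo : s.v .lo = lo) (hhi : s.v .hi = hi) (hrs : s.a .rs = rs)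
    (hre : s.a .re = re) (hrN : r < E.N) (hlt : lo < hi) (hhW : hi < E.N) (hrW : re r < E.N) :
    wp E classify (fun s' => s'.time ≤ s.time + 7 ∧ (s'.v .c = 2 ↔ Cover rs re lo hi r) ∧
      (s'.v .c = 1 ↔ Part rs re lo hi r) ∧ s'.v .c ≤ 2) s := by
  simp only [classify, wp_seq, wp_assign, Cover, Part]
  rcases lt_or_ge (rs r) hi with h1 | h1
  · rcases lt_or_ge lo (re r) with h2 | h2
    · rcases lt_or_ge (rs r) (lo + 1) with h3 | h3
      · rcases lt_or_ge hi (re r + 1) with h4 | h4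
        · simp [hr, hlo, hhi, hrs, hre, h1, h2, h3, h4, h1.not_ge, h2.not_ge, h3.not_ge, h4.not_ge]
          omega
        · simp [hr, hlo, hhi, hrs, hre, h1, h2, h3, h4, h1.not_ge, h2.not_ge, h3.not_ge, h4.not_gt]
          omega
      · simp [hr, hlo, hhi, hrs, hre, h1, h2, h3, h1.not_ge, h2.not_ge, h3.not_gt]
        omega
    · simp [hr, hlo, hhi, hrs, hre, h1, h2, h1.not_ge, h2.not_gt]
      omega
  · simp [hr, hlo, hhi, hrs, hre, h1, h1.not_gt]
    omega

/-- Compute the components of the edges that are present all the time. -/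
def contract : Cmd :=
  .q ::= lit 0 ;;
  .for .j (v .cnt) (.e ::= v .pb + v .j ;; .r ::= rd .qr (v .e) ;; classify ;;
    .ite (lit 1) (v .c) (push (rd .qx (v .e)) (rd .qy (v .e))) .skip) ;;
  .k ::= v .q ;; .V ::= v .A ;; comp

theorem contract_spec {E : Env} (hE : 100 * (E.N + 1) ≤ E.W) {s : St} {b m A lo hi M : ℕ}
    {rs re : ℕ → ℕ} (hb : s.v .pb = b) (hm : s.v .cnt = m) (hA : s.v .A = A) (hlo : s.v .lo = lo)
    (hhi : s.v .hi = hi) (hrs : s.a .rs = rs) (hre : s.a .re = re) (hMN : M ≤ E.N) (hlt : lo < hi)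
    (hhN : hi < E.N) (hreN : ∀ r < M, re r < E.N) (hbN : b + m ≤ E.N) (hmN : 2 * m ≤ E.N)
    (hAN : A ≤ E.N)
    (hmem : ∀ e, b ≤ e → e < b + m → s.a .qx e < A ∧ s.a .qy e < A ∧ s.a .qr e < M) :
    wp E contract (fun s' => s'.time ≤ s.time + 120 * m + 50 * A + 60 ∧
      (∀ x < A, s'.a .lab x < A) ∧ ∀ x < A, ∀ y < A, s'.a .lab x = s'.a .lab y ↔
        EqvGen (fun x y => ∃ e, b ≤ e ∧ e < b + m ∧ s.a .qx e = x ∧ s.a .qy e = y ∧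
          Cover rs re lo hi (s.a .qr e)) x y) s := by
  simp only [contract, wp_seq, wp_assign, safe_lit, eval_lit]
  refine ⟨by omega, ?_⟩
  refine wp_for m (fun j _ => 18 * j) (fun j s' => s'.v .q ≤ 2 * j ∧
    Coll s'.a (s'.v .q) fun x y => ∃ e, b ≤ e ∧ e < b + j ∧ s.a .qx e = x ∧ s.a .qy e = y ∧
          Cover rs re lo hi (s.a .qr e)) (by omega) rfl ⟨by simp, fun x y => ?_⟩
    (fun j hj s' hI' hA hz => ?_)
    (fun j hj s' ⟨hq, hC⟩ hA' hz => ?_) (fun s2 ⟨hq2, hC2⟩ hA2 hz2 ht2 => ?_)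
  · simp only [St.set_v, if_true, reduceCtorEq, if_false]
    constructor
    · rintro ⟨e, he, -⟩
      omega
    · rintro (⟨e, h1, h2, -⟩ | ⟨e, h1, h2, -⟩) <;> omega
  · have h1 : s'.v .cnt = m := by rw [hA.v .cnt rfl]; simpa using hm
    simp [h1]
  · have f1 : s'.v .pb = b := by rw [hA'.v .pb rfl]; simpa using hb
    have f2 : s'.v .lo = lo := by rw [hA'.v .lo rfl]; simpa using hlo
    have f3 : s'.v .hi = hi := by rw [hA'.v .hi rfl]; simpa using hhi
    have g1 : s'.a .rs = rs := by rw [hA'.a .rs rfl]; simpa using hrs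
    have g2 : s'.a .re = re := by rw [hA'.a .re rfl]; simpa using hre
    have g3 : s'.a .qx = s.a .qx := by rw [hA'.a .qx rfl]; simp
    have g4 : s'.a .qy = s.a .qy := by rw [hA'.a .qy rfl]; simp
    have g5 : s'.a .qr = s.a .qr := by rw [hA'.a .qr rfl]; simp
    obtain ⟨hx, hy, hr⟩ := hmem (b + j) (by omega) (by omega)
    have hreN' := hreN _ hr
    simp only [wp_seq, wp_assign]
    simp only [safe_add, safe_var, eval_add, eval_var, true_and, safe_get, eval_get, St.set_v,
      reduceCtorEq, if_false, if_true, St.tick_v, St.set_a, St.tick_a, f1, hz, g5]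
    refine ⟨by omega, by omega, ?_⟩
    refine wp_mono (classify_spec (r := s.a .qr (b + j)) (lo := lo) (hi := hi) (rs := rs) (re := re)
      hE (by simp) (by simpa) (by simpa) (by simpa) (by simpa) (by omega) hlt hhN hreN')
      fun s3 ⟨ht3, hc2, hc1, hc⟩ hA3 => ?_
    have k1 : s3.v .e = b + j := by rw [hA3.v .e rfl]; simp
    have k2 : s3.v .q = s'.v .q := by rw [hA3.v .q rfl]; simp
    have k3 : s3.a .qx = s.a .qx := by rw [hA3.a .qx rfl]; simpa using g3
    have k4 : s3.a .qy = s.a .qy := by rw [hA3.a .qy rfl]; simpa using g4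
    have k5 : Coll s3.a (s'.v .q) fun x y => ∃ e, b ≤ e ∧ e < b + j ∧ s.a .qx e = x ∧ s.a .qy e = y ∧
          Cover rs re lo hi (s.a .qr e) := by
      intro x y
      rw [hA3.a .eu rfl, hA3.a .ev rfl]
      simpa using hC x y
    simp only [St.set_time, St.tick_time] at ht3
    rw [wp_ite]
    simp only [safe_lit, safe_var, eval_lit, eval_var, true_and]
    refine ⟨by omega, fun hlt => ?_, fun hge => wp_skip.2 ?_⟩
    · refine wp_mono (push_spec (x := s.a .qx (b + j)) (y := s.a .qy (b + j)) hE
        (by simpa using k5) (by simpa using k2) (by omega) ?_ ?_) ?_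
      · intro s'' e1 e2
        have : s''.a .qx = s.a .qx := by rw [e2 .qx (by decide) (by decide)]; simpa using k3
        simp [e1, k1, this]
        omega
      · intro s'' e1 e2
        have : s''.a .qy = s.a .qy := by rw [e2 .qy (by decide) (by decide)]; simpa using k4
        simp [e1, k1, this]
        omega
      · rintro s4 ⟨l1, l2, l3⟩ hA4
        have hcov := hc2.1 (by omega)
        simp only [St.tick_time] at l3
        simp only [St.set_v, reduceCtorEq, if_false, l2, St.set_a]
        refine ⟨⟨by omega, fun x y => (l1 x y).trans (or_congr ?_ ?_)⟩, by omega⟩ <;>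
        · constructor
          · rintro (⟨e, h1, h2, h3⟩ | ⟨h1, h2⟩)
            · exact ⟨e, h1, by omega, h3⟩
            · exact ⟨b + j, by omega, by omega, h1, h2, hcov⟩
          · rintro ⟨e, h1, h2, h3, h4, h5⟩
            by_cases hej : e = b + j
            · subst hej
              exact .inr ⟨h3, h4⟩
            · exact .inl ⟨e, h1, by omega, h3, h4, h5⟩
    · have hcov : ¬ Cover rs re lo hi (s.a .qr (b + j)) := fun h => by
        have := hc2.2 h
        omega
      simp only [St.set_v, reduceCtorEq, if_false, St.set_a, St.tick_v, St.tick_a, k2, St.tick_time]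
      refine ⟨⟨by omega, fun x y => (k5 x y).trans (or_congr ?_ ?_)⟩, by omega⟩ <;>
      · constructor
        · rintro ⟨e, h1, h2, h3⟩
          exact ⟨e, h1, by omega, h3⟩
        · rintro ⟨e, h1, h2, h3, h4, h5⟩
          by_cases hej : e = b + j
          · subst hej
            exact (hcov h5).elim
          · exact ⟨e, h1, by omega, h3, h4, h5⟩
  · have hA' : s2.v .A = A := by rw [hA2.v .A rfl]; simpa using hA
    simp only [safe_var, eval_var, true_and, St.tick_v, St.set_v, reduceCtorEq, if_false, hA']
    refine wp_mono (comp_coll (V := A) hE (q := s2.v .q) hC2 ?_ (by simp) (by simp) (by omega)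
      (by omega)) fun s5 ⟨ht5, hl5, he5⟩ hA5 => ?_
    · rintro x y ⟨e, h1, h2, rfl, rfl, h5⟩
      exact ⟨(hmem e h1 h2).1, (hmem e h1 h2).2.1⟩
    · simp only [St.set_time, St.tick_time] at *
      exact ⟨by omega, fun x hx => (hl5 x hx).1, he5⟩

/-! ### Numbering the touched vertices -/

/-- The names given so far: `cn` vertices have got the numbers `< cn`. -/
structure Num (A cn : ℕ) (num : ℕ → ℕ) : Prop where
  lt : ∀ z < A, num z < cn ∨ num z = A + z
  inj : ∀ z < A, ∀ y < A, num z = num y → z = y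
  surj : ∀ c < cn, ∃ z < A, num z = c

theorem Num.le {A cn : ℕ} {num : ℕ → ℕ} (h : Num A cn num) : cn ≤ A := by
  have : Finset.range cn ⊆ (Finset.range A).image num := fun c hc => by
    obtain ⟨z, hz, e⟩ := h.surj c (by simpa using hc)
    exact Finset.mem_image.2 ⟨z, by simpa using hz, e⟩
  have := (Finset.card_le_card this).trans Finset.card_image_le
  simpa using this

/-- A vertex without a number has the provisional value `A + z`, so comparison with `A` tells the
two kinds apart. As long as some vertex has no number, counting gives `cn < A`, so the new number is
distinct from all provisional values. -/
theorem Num.touch {A cn x : ℕ} {num : ℕ → ℕ} (h : Num A cn num) (hx : x < A) (hn : A ≤ num x) :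
    Num A (cn + 1) (upd num x cn) := by
  have hle := h.le
  have hlt : cn < A := by
    have : insert (num x) (Finset.range cn) ⊆ (Finset.range A).image num := fun c hc => by
      rcases Finset.mem_insert.1 hc with rfl | hc
      · exact Finset.mem_image.2 ⟨x, by simpa using hx, rfl⟩
      · obtain ⟨z, hz, e⟩ := h.surj c (by simpa using hc)
        exact Finset.mem_image.2 ⟨z, by simpa using hz, e⟩
    have := (Finset.card_le_card this).trans Finset.card_image_le
    rw [Finset.card_insert_of_notMem (by simp; omega)] at this
    simpa using this
  refine ⟨fun z hz => ?_, fun z hz y hy he => ?_, fun c hc => ?_⟩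
  · simp only [upd_apply]
    have := h.lt z hz
    split_ifs <;> omega
  · simp only [upd_apply] at he
    have h1 := h.lt z hz
    have h2 := h.lt y hy
    split_ifs at he
    · omega
    · omega
    · omega
    · exact h.inj z hz y hy he
  · rcases Nat.lt_succ_iff_lt_or_eq.1 hc with hlt' | rfl
    · obtain ⟨z, hz, e⟩ := h.surj c hlt'
      exact ⟨z, hz, by rw [upd_of_ne (by rintro rfl; omega), e]⟩
    · exact ⟨x, hx, by simp⟩

/-- Give a number to the vertex in `X`, unless it has one. -/
def touch (X : Var) : Cmd :=
  .ite (rd .num (v X)) (v .A) .skip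
    (.store .num (v X) (v .cn) ;; .cn ::= v .cn + lit 1)

theorem touch_spec {E : Env} (hE : 100 * (E.N + 1) ≤ E.W) {s : St} {X : Var} {A x : ℕ}
    (hA : s.v .A = A) (hx : s.v X = x) (hxA : x < A) (hAN : A ≤ E.N) (hX : X ≠ .cn)
    (h : Num A (s.v .cn) (s.a .num)) :
    wp E (touch X) (fun s' => s'.time ≤ s.time + 3 ∧ Num A (s'.v .cn) (s'.a .num) ∧
      s'.a .num x < s'.v .cn ∧ s.v .cn ≤ s'.v .cn ∧ s'.v .cn ≤ s.v .cn + 1 ∧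
      ∀ z < A, s.a .num z < s.v .cn → s'.a .num z = s.a .num z) s := by
  have hle := h.le
  have hl := h.lt x hxA
  simp only [touch]
  rcases lt_or_ge (s.a .num x) A with h1 | h1
  · simp [hA, hx, h1, h1.not_ge, h]
    omega
  · have h2 := h.touch hxA h1
    simp [hA, hx, h1, h1.not_gt, h2]
    refine ⟨by omega, by omega, fun z hz hlt => ?_⟩
    rw [upd_of_ne]
    rintro rfl
    omega

/-! ### Passing edges on to a child -/

/-- The entries `[b', rp)` of the pool come from the entries `[b, e)` that satisfy `S`. -/
structure Moved (A cn : ℕ) (lab num QX QY QR : ℕ → ℕ) (S : ℕ → Prop) (a : Arr → ℕ → ℕ)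
    (b e b' rp : ℕ) : Prop where
  ok : Num A cn num
  cn_le : cn ≤ 2 * (rp - b')
  lt : ∀ x, b' ≤ x → x < rp → a .qx x < cn ∧ a .qy x < cn
  mem : ∀ x, b' ≤ x → x < rp → ∃ f, b ≤ f ∧ f < e ∧ a .qr x = QR f ∧ S (QR f) ∧
    a .qx x = num (lab (QX f)) ∧ a .qy x = num (lab (QY f))
  full : ∀ f, b ≤ f → f < e → S (QR f) → ∃ x, b' ≤ x ∧ x < rp ∧ a .qr x = QR f ∧
    a .qx x = num (lab (QX f)) ∧ a .qy x = num (lab (QY f))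
  inj : ∀ x, b' ≤ x → x < rp → ∀ y, b' ≤ y → y < rp → a .qr x = a .qr y → x = y

theorem Moved.skip {A cn : ℕ} {lab num QX QY QR : ℕ → ℕ} {S : ℕ → Prop} {a : Arr → ℕ → ℕ}
    {b e b' rp : ℕ} (h : Moved A cn lab num QX QY QR S a b e b' rp) (hS : ¬ S (QR e)) :
    Moved A cn lab num QX QY QR S a b (e + 1) b' rp := by
  refine ⟨h.ok, h.cn_le, h.lt, fun x h1 h2 => ?_, fun f h1 h2 h3 => ?_, h.inj⟩
  · obtain ⟨f, k1, k2, k3⟩ := h.mem x h1 h2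
    exact ⟨f, k1, by omega, k3⟩
  · refine h.full f h1 ?_ h3
    rcases Nat.lt_succ_iff_lt_or_eq.1 h2 with hlt | rfl
    · exact hlt
    · exact (hS h3).elim

/-- Numbers once given never change, so older entries stay correct. An entry needs at most two new
numbers, whence `cn` is at most twice the number of entries. -/
theorem Moved.append {A cn cn' : ℕ} {lab num num' QX QY QR : ℕ → ℕ} {S : ℕ → Prop}
    {a a' : Arr → ℕ → ℕ} {b e b' rp : ℕ} (h : Moved A cn lab num QX QY QR S a b e b' rp)
    (hS : S (QR e)) (hbe : b ≤ e) (hb : b' ≤ rp) (hn : Num A cn' num') (hcn : cn ≤ cn') (hcn' : cn' ≤ cn + 2)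
    (hsame : ∀ z < A, num z < cn → num' z = num z)
    (hlab : ∀ f, b ≤ f → f < e + 1 → lab (QX f) < A ∧ lab (QY f) < A)
    (hx : num' (lab (QX e)) < cn') (hy : num' (lab (QY e)) < cn')
    (hinj : ∀ f, b ≤ f → f < e → QR f ≠ QR e)
    (h1 : a' .qx = upd (a .qx) rp (num' (lab (QX e))))
    (h2 : a' .qy = upd (a .qy) rp (num' (lab (QY e)))) (h3 : a' .qr = upd (a .qr) rp (QR e)) :
    Moved A cn' lab num' QX QY QR S a' b (e + 1) b' (rp + 1) := by
  have hold : ∀ x < rp, a' .qr x = a .qr x ∧ a' .qx x = a .qx x ∧ a' .qy x = a .qy x := fun x hx => by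
    rw [h1, h2, h3, upd_of_ne (by omega), upd_of_ne (by omega), upd_of_ne (by omega)]
    simp
  obtain ⟨n1, n2, n3⟩ : a' .qr rp = QR e ∧ a' .qx rp = num' (lab (QX e)) ∧
    a' .qy rp = num' (lab (QY e)) := by simp [h1, h2, h3]
  have hc := h.cn_le
  refine ⟨hn, by omega, fun x k1 k2 => ?_, fun x k1 k2 => ?_, fun f k1 k2 k3 => ?_,
    fun x hx1 hxe y hy1 hye he => ?_⟩
  · rcases Nat.lt_succ_iff_lt_or_eq.1 k2 with hlt | rfl
    · obtain ⟨e1, e2, e3⟩ := hold x hlt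
      have := h.lt x k1 hlt
      omega
    · omega
  · rcases Nat.lt_succ_iff_lt_or_eq.1 k2 with hlt | rfl
    · obtain ⟨e1, e2, e3⟩ := hold x hlt
      obtain ⟨f, l1, l2, l3, l4, l5, l6⟩ := h.mem x k1 hlt
      obtain ⟨m1, m2⟩ := h.lt x k1 hlt
      obtain ⟨m3, m4⟩ := hlab f l1 (by omega)
      refine ⟨f, l1, by omega, e1.trans l3, l4, ?_, ?_⟩
      · rw [e2, hsame _ m3 (by omega), l5]
      · rw [e3, hsame _ m4 (by omega), l6]
    · exact ⟨e, hbe, by omega, n1, hS, n2, n3⟩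
  · rcases Nat.lt_succ_iff_lt_or_eq.1 k2 with hlt | rfl
    · obtain ⟨x, l1, l2, l3, l4, l5⟩ := h.full f k1 hlt k3
      obtain ⟨m1, m2⟩ := h.lt x l1 l2
      obtain ⟨e1, e2, e3⟩ := hold x l2
      obtain ⟨m3, m4⟩ := hlab f k1 (by omega)
      refine ⟨x, l1, by omega, e1.trans l3, ?_, ?_⟩
      · rw [e2, hsame _ m3 (by omega), l4]
      · rw [e3, hsame _ m4 (by omega), l5]
    · exact ⟨rp, hb, by omega, n1, n2, n3⟩
  · have key : ∀ x, b' ≤ x → x < rp → a .qr x ≠ QR e := fun x k1 k2 he => by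
      obtain ⟨f, l1, l2, l3, -⟩ := h.mem x k1 k2
      exact hinj f l1 l2 (l3.symm.trans he)
    rcases Nat.lt_succ_iff_lt_or_eq.1 hxe with hlt | rfl <;>
    rcases Nat.lt_succ_iff_lt_or_eq.1 hye with hlt' | rfl
    · rw [(hold x hlt).1, (hold y hlt').1] at he
      exact h.inj x hx1 hlt y hy1 hlt' he
    · rw [(hold x hlt).1, n1] at he
      exact (key x hx1 hlt he).elim
    · rw [(hold y hlt').1, n1] at he
      exact (key y hy1 hlt' he.symm).elim
    · rfl

/-- Copy the edges that are present partially, with their endpoints renamed. -/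
def transfer : Cmd :=
  .for .i (v .A) (.store .num (v .i) (v .A + v .i)) ;;
  .cn ::= lit 0 ;;
  .for .j (v .cnt) (.e ::= v .pb + v .j ;; .r ::= rd .qr (v .e) ;; classify ;;
    .ite (v .c) (lit 1) .skip (.ite (v .c) (lit 2)
      (.x ::= rd .lab (rd .qx (v .e)) ;; .y ::= rd .lab (rd .qy (v .e)) ;;
        touch .x ;; touch .y ;; .x ::= rd .num (v .x) ;; .y ::= rd .num (v .y) ;; append) .skip))

theorem transfer_spec {E : Env} (hE : 100 * (E.N + 1) ≤ E.W) {s : St} {b m A lo hi M p : ℕ}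
    {rs re lab QX QY QR : ℕ → ℕ} (hb : s.v .pb = b) (hm : s.v .cnt = m) (hA : s.v .A = A) (hlo : s.v .lo = lo)
    (hhi : s.v .hi = hi) (hp : s.v .rp = p) (hrs : s.a .rs = rs) (hre : s.a .re = re)
    (hl : s.a .lab = lab) (hqx : s.a .qx = QX) (hqy : s.a .qy = QY) (hqr : s.a .qr = QR)
    (hMN : M ≤ E.N) (hlt : lo < hi) (hhN : hi < E.N) (hreN : ∀ r < M, re r < E.N) (hbN : b + m ≤ p)
    (hpN : p + m ≤ E.N) (hAN : A ≤ E.N) (hlab : ∀ x < A, lab x < A)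
    (hmem : ∀ e, b ≤ e → e < b + m → QX e < A ∧ QY e < A ∧ QR e < M)
    (hinj : ∀ x, b ≤ x → x < b + m → ∀ y, b ≤ y → y < b + m → QR x = QR y → x = y) :
    wp E transfer (fun s' => s'.time ≤ s.time + 31 * m + 3 * A + 10 ∧
      (∀ x < p, s'.a .qx x = QX x ∧ s'.a .qy x = QY x ∧ s'.a .qr x = QR x) ∧
      p ≤ s'.v .rp ∧ s'.v .rp ≤ p + m ∧ Moved A (s'.v .cn) lab (s'.a .num) QX QY QR
        (Part rs re lo hi) s'.a b (b + m) p (s'.v .rp)) s := by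
  simp only [transfer, wp_seq]
  refine wp_for A (fun j _ => 3 * j) (fun j s' => ∀ z < j, s'.a .num z = A + z) (by omega) rfl
    (by simp) (fun j hj s' hI hA' hz => ?_) (fun j hj s' hI hA' hz => ?_) (fun s1 hI1 hA1 hz1 ht1 => ?_)
  · simp [hA'.v .A rfl, hA]
  · have : s'.v .A = A := by rw [hA'.v .A rfl, hA]
    simp [hz, upd_apply, this]
    and_intros <;> try omega
    intro z hz
    split_ifs with h
    · rw [h]
    · exact hI z (by omega)
  simp only [wp_assign, safe_lit, eval_lit]
  refine ⟨by omega, ?_⟩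
  refine wp_for m (fun j _ => 30 * j) (fun j s' =>
      (∀ x < p, s'.a .qx x = QX x ∧ s'.a .qy x = QY x ∧ s'.a .qr x = QR x) ∧
      p ≤ s'.v .rp ∧ s'.v .rp ≤ p + j ∧ Moved A (s'.v .cn) lab (s'.a .num) QX QY QR
        (Part rs re lo hi) s'.a b (b + j) p (s'.v .rp)) (by omega) rfl ⟨fun x hx => ?_, ?_, ?_, ?_⟩
    (fun j hj s' hI' hA' hz => ?_)
    (fun j hj s' ⟨hq, hpr, hpr', hC⟩ hA' hz => ?_) (fun s2 ⟨hq2, hpr2, hpr2', hC2⟩ hA2 hz2 ht2 => ?_)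
  · simp only [St.set_a, St.tick_a]
    rw [hA1.a .qx rfl, hA1.a .qy rfl, hA1.a .qr rfl, hqx, hqy, hqr]
    simp
  · simp [hA1.v .rp rfl, hp]
  · simp [hA1.v .rp rfl, hp]
  · have : s1.v .rp = p := by rw [hA1.v .rp rfl, hp]
    simp only [St.set_a, St.set_v, St.tick_a, St.tick_v, reduceCtorEq, if_false, if_true, this]
    refine ⟨⟨fun z hz => .inr (hI1 z hz), fun z hz y hy he => ?_, by omega⟩, by omega,
      by omega, by omega, by omega, by omega⟩
    rw [hI1 z hz, hI1 y hy] at he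
    omega
  · have h1 : s'.v .cnt = m := by rw [hA'.v .cnt rfl]; simpa [hA1.v .cnt rfl] using hm
    simp [h1]
  · have f1 : s'.v .pb = b := by rw [hA'.v .pb rfl]; simpa [hA1.v .pb rfl] using hb
    have f2 : s'.v .lo = lo := by rw [hA'.v .lo rfl]; simpa [hA1.v .lo rfl] using hlo
    have f3 : s'.v .hi = hi := by rw [hA'.v .hi rfl]; simpa [hA1.v .hi rfl] using hhi
    have f4 : s'.v .A = A := by rw [hA'.v .A rfl]; simpa [hA1.v .A rfl] using hA
    have g1 : s'.a .rs = rs := by rw [hA'.a .rs rfl]; simpa [hA1.a .rs rfl] using hrs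
    have g2 : s'.a .re = re := by rw [hA'.a .re rfl]; simpa [hA1.a .re rfl] using hre
    have g3 : s'.a .lab = lab := by rw [hA'.a .lab rfl]; simpa [hA1.a .lab rfl] using hl
    obtain ⟨hx, hy, hr⟩ := hmem (b + j) (by omega) (by omega)
    obtain ⟨q1, q2, q3⟩ := hq (b + j) (by omega)
    have hlx := hlab _ hx
    have hly := hlab _ hy
    have hreN' := hreN _ hr
    have hcA := hC.ok.le
    simp only [wp_seq, wp_assign]
    simp only [safe_add, safe_var, eval_add, eval_var, true_and, safe_get, eval_get, St.set_v,
      reduceCtorEq, if_false, if_true, St.tick_v, St.set_a, St.tick_a, f1, hz, q3]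
    refine ⟨by omega, by omega, ?_⟩
    refine wp_mono (classify_spec (r := QR (b + j)) (lo := lo) (hi := hi) (rs := rs) (re := re)
      hE (by simp) (by simpa) (by simpa) (by simpa) (by simpa) (by omega) hlt hhN hreN')
      fun s3 ⟨ht3, hc2, hc1, hc⟩ hA3 => ?_
    have k1 : s3.v .e = b + j := by rw [hA3.v .e rfl]; simp
    have k2 : s3.v .rp = s'.v .rp := by rw [hA3.v .rp rfl]; simp
    have k3 : s3.v .A = A := by rw [hA3.v .A rfl]; simpa using f4
    have k4 : s3.v .cn = s'.v .cn := by rw [hA3.v .cn rfl]; simp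
    have k5 : s3.v .r = QR (b + j) := by rw [hA3.v .r rfl]; simp
    have ka : s3.a = s'.a := by
      funext A
      rw [hA3.a A (by cases A <;> rfl)]
      simp
    simp only [St.set_time, St.tick_time] at ht3
    have hno : ∀ s'' : St, s''.v = s3.v → s''.a = s3.a → s''.time ≤ s3.time + 5 → s3.v .c ≠ 1 →
        ((∀ x < p, (s''.set .j (j + 1)).a .qx x = QX x ∧ (s''.set .j (j + 1)).a .qy x = QY x ∧
            (s''.set .j (j + 1)).a .qr x = QR x) ∧
          p ≤ (s''.set .j (j + 1)).v .rp ∧ (s''.set .j (j + 1)).v .rp ≤ p + (j + 1) ∧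
          Moved A ((s''.set .j (j + 1)).v .cn) lab ((s''.set .j (j + 1)).a .num) QX QY QR
            (Part rs re lo hi) (s''.set .j (j + 1)).a b (b + (j + 1)) p ((s''.set .j (j + 1)).v .rp)) ∧
        s''.time + 1 + 30 * j ≤ s'.time + 30 * (j + 1) := by
      intro s'' e1 e2 e3 hne
      simp only [St.set_a, St.set_v, reduceCtorEq, if_false, e1, e2, ka, k2, k4]
      exact ⟨⟨hq, hpr, by omega, hC.skip fun h => hne (hc1.2 h)⟩, by omega⟩
    rw [wp_ite]
    simp only [safe_lit, safe_var, eval_lit, eval_var, true_and]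
    refine ⟨by omega, fun hlt => wp_skip.2 (hno s3.tick.tick rfl rfl (by simp only [St.tick_time]; omega) (by omega)), fun hge => ?_⟩
    rw [wp_ite]
    simp only [safe_lit, safe_var, eval_lit, eval_var, true_and, St.tick_v]
    refine ⟨by omega, fun hlt => ?_,
      fun hge => wp_skip.2 (hno s3.tick.tick.tick rfl rfl (by simp only [St.tick_time]; omega) (by omega))⟩
    have hpart := hc1.1 (by omega)
    simp only [wp_seq, wp_assign]
    simp only [safe_add, safe_var, eval_add, eval_var, true_and, safe_get, eval_get, St.set_v,
      reduceCtorEq, if_false, if_true, St.tick_v, St.set_a, St.tick_a, k1, ka, q1, q2, g3]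
    refine ⟨⟨by omega, by omega⟩, ⟨by omega, by omega⟩, ?_⟩
    refine wp_mono (touch_spec (X := .x) (A := A) (x := lab (QX (b + j))) hE (by simpa using k3)
      (by simp) hlx hAN (by decide) (by simpa [k4, ka] using hC.ok)) fun s4 ⟨ht4, hN4, hx4, hc4, hc4', hs4⟩ hA4 => ?_
    simp only [St.set_v, St.tick_v, reduceCtorEq, if_false, if_true, k4, St.set_a, St.tick_a, ka,
      St.set_time, St.tick_time] at ht4 hc4 hc4' hs4
    refine wp_mono (touch_spec (X := .y) (A := A) (x := lab (QY (b + j))) hE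
      (by rw [hA4.v .A rfl]; simpa using k3)
      (by rw [hA4.v .y rfl]; simp) hly hAN (by decide) hN4) fun s5 ⟨ht5, hN5, hy5, hc5, hc5', hs5⟩ hA5 => ?_
    have l1 : s5.v .x = lab (QX (b + j)) := by rw [hA5.v .x rfl, hA4.v .x rfl]; simp
    have l2 : s5.v .y = lab (QY (b + j)) := by rw [hA5.v .y rfl, hA4.v .y rfl]; simp
    have l3 : s5.v .rp = s'.v .rp := by rw [hA5.v .rp rfl, hA4.v .rp rfl]; simpa using k2
    have l4 : s5.v .r = QR (b + j) := by rw [hA5.v .r rfl, hA4.v .r rfl]; simpa using k5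
    have l5 : s5.a .qx = s'.a .qx := by rw [hA5.a .qx rfl, hA4.a .qx rfl]; simp [ka]
    have l6 : s5.a .qy = s'.a .qy := by rw [hA5.a .qy rfl, hA4.a .qy rfl]; simp [ka]
    have l7 : s5.a .qr = s'.a .qr := by rw [hA5.a .qr rfl, hA4.a .qr rfl]; simp [ka]
    have hx5 : s5.a .num (lab (QX (b + j))) < s5.v .cn := by
      rw [hs5 _ hlx hx4]
      omega
    have hsame : ∀ z < A, s'.a .num z < s'.v .cn → s5.a .num z = s'.a .num z := fun z hz hlt => by
      have := hs4 z hz hlt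
      rw [hs5 z hz (by omega), this]
    have hfin := fun a' => hC.append (cn' := s5.v .cn) (num' := s5.a .num) (a' := a') hpart (by omega) hpr hN5 (by omega) (by omega) hsame
      (fun f h1 h2 => by
        obtain ⟨m1, m2, -⟩ := hmem f h1 (by omega)
        exact ⟨hlab _ m1, hlab _ m2⟩) hx5 hy5
      (fun f h1 h2 he => by
        have := hinj f h1 (by omega) (b + j) (by omega) (by omega) he
        omega)
    simp only [append, wp_seq, wp_assign, wp_store]
    simp [l1, l2, l3, l4, l5, l6, l7]
    and_intros <;> first | omega | skip
    · intro x hx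
      simp only [upd_of_ne (show x ≠ s'.v .rp by omega)]
      exact hq x hx
    · exact hfin _ (by simp [l1, l5]) (by simp [l2, l6]) (by simp [l7])
  · simp only [St.tick_time, St.tick_v, St.tick_a, St.set_time] at *
    exact ⟨by omega, hq2, hpr2, hpr2', hC2⟩

/-! ### The nodes of the trees -/

/-- The edges in the list of node `z` that are present at time `i`. -/
def NRel (rs re : ℕ → ℕ) (a : Arr → ℕ → ℕ) (z i x y : ℕ) : Prop :=
  ∃ e, a .rb z ≤ e ∧ e < a .rb z + a .rc z ∧ a .qx e = x ∧ a .qy e = y ∧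
    rs (a .qr e) ≤ i ∧ i < re (a .qr e)

/-- Node `z`, for an interval of length `L`, is well-formed. -/
structure NodeOk (M : ℕ) (a : Arr → ℕ → ℕ) (z L rp : ℕ) : Prop where
  mem : ∀ e, a .rb z ≤ e → e < a .rb z + a .rc z → a .qx e < a .nA z ∧ a .qy e < a .nA z ∧
    a .qr e < M
  inj : ∀ x, a .rb z ≤ x → x < a .rb z + a .rc z → ∀ y, a .rb z ≤ y → y < a .rb z + a .rc z →
    a .qr x = a .qr y → x = y
  rc_le : a .rc z ≤ 4 * L
  nA_le : a .nA z ≤ 4 * L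
  le : a .rb z + a .rc z ≤ rp

/-- Node `c` is a child of node `p`, with interval `[lo, hi)`. -/
structure Link (rs re : ℕ → ℕ) (a : Arr → ℕ → ℕ) (p c lo hi mp : ℕ) : Prop where
  le : a .mb c + a .nA p ≤ mp
  lt : ∀ x < a .nA p, a .mq (a .mb c + x) < 2 * a .nA p
  iff : ∀ i, lo ≤ i → i < hi → ∀ x < a .nA p, ∀ y < a .nA p,
    EqvGen (NRel rs re a p i) x y ↔
      EqvGen (NRel rs re a c i) (a .mq (a .mb c + x)) (a .mq (a .mb c + y))
  leaf : hi ≤ lo + 1 → a .nA c = 0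

/-- Nodes and pool entries are only ever appended, so what is known about older nodes survives. The
next two lemmas serve the same purpose. -/
theorem NRel.ext {rs re : ℕ → ℕ} {a a' : Arr → ℕ → ℕ} {cur rp mp M z L i : ℕ} (h : Ext cur rp mp a a')
    (hz : z < cur) (hN : NodeOk M a z L rp) : NRel rs re a' z i = NRel rs re a z i := by
  obtain ⟨e1, e2, e3, e4⟩ := h.node z hz
  have hle := hN.le
  funext x y
  simp only [NRel, e1, e2, eq_iff_iff]
  refine exists_congr fun e => ⟨fun ⟨h1, h2, h3⟩ => ?_, fun ⟨h1, h2, h3⟩ => ?_⟩ <;>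
  · obtain ⟨k1, k2, k3⟩ := h.pool e (by omega)
    simp only [k1, k2, k3] at h3 ⊢
    exact ⟨h1, h2, h3⟩

theorem NodeOk.ext {a a' : Arr → ℕ → ℕ} {cur rp rp' mp M z L : ℕ} (h : Ext cur rp mp a a')
    (hz : z < cur) (hN : NodeOk M a z L rp) (hr : rp ≤ rp') : NodeOk M a' z L rp' := by
  obtain ⟨e1, e2, e3, e4⟩ := h.node z hz
  have hle := hN.le
  refine ⟨fun e h1 h2 => ?_, fun x h1 h2 y h3 h4 he => ?_, by rw [e2]; exact hN.rc_le,
    by rw [e3]; exact hN.nA_le, by omega⟩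
  · rw [e1] at h1 h2
    rw [e2] at h2
    obtain ⟨k1, k2, k3⟩ := h.pool e (by omega)
    rw [k1, k2, k3, e3]
    exact hN.mem e h1 h2
  · rw [e1] at h1 h2 h3 h4
    rw [e2] at h2 h4
    rw [(h.pool x (by omega)).2.2, (h.pool y (by omega)).2.2] at he
    exact hN.inj x h1 h2 y h3 h4 he

theorem Link.ext {rs re : ℕ → ℕ} {a a' : Arr → ℕ → ℕ} {cur rp mp mp' M p c L L' lo hi : ℕ}
    (h : Ext cur rp mp a a') (hp : p < cur) (hc : c < cur) (hP : NodeOk M a p L rp)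
    (hC : NodeOk M a c L' rp) (hL : Link rs re a p c lo hi mp) (hm : mp ≤ mp') :
    Link rs re a' p c lo hi mp' := by
  obtain ⟨e1, e2, e3, e4⟩ := h.node p hp
  obtain ⟨k1, k2, k3, k4⟩ := h.node c hc
  have hle := hL.le
  refine ⟨by omega, fun x hx => ?_, fun i h1 h2 x hx y hy => ?_, by rw [k3]; exact hL.leaf⟩
  · rw [e3] at hx ⊢
    rw [k4, h.map _ (by omega)]
    exact hL.lt x hx
  · rw [e3] at hx hy
    rw [k4, h.map _ (by omega), h.map _ (by omega), NRel.ext h hp hP, NRel.ext h hc hC]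
    exact hL.iff i h1 h2 x hx y hy

/-- Set up node `id` for the interval `[lo, hi)`. -/
def process : Cmd :=
  .p ::= (v .id - v .nb) / lit 2 ;; .A ::= rd .nA (v .p) ;; .pb ::= rd .rb (v .p) ;;
  .cnt ::= rd .rc (v .p) ;;
  contract ;;
  .store .rb (v .id) (v .rp) ;;
  transfer ;;
  .store .rc (v .id) (v .rp - rd .rb (v .id)) ;; .store .nA (v .id) (v .cn) ;;
  .store .mb (v .id) (v .mp) ;;
  .for .i (v .A) (.store .mq (v .mp + v .i) (rd .num (rd .lab (v .i)))) ;;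
  .mp ::= v .mp + v .A

/-- A parent of length `2L` has at most `8L` entries and `8L` vertices, so contracting and passing
on takes `O(L)`. The result is again within the bounds for `L`, because few lifetimes begin or end
inside the interval and not because the parent is small. -/
theorem process_spec {E : Env} (hE : 100 * (E.N + 1) ≤ E.W) {s : St} {n te M Z : ℕ}
    {ru rv rs re : ℕ → ℕ} (hR : Recs n te M Z ru rv rs re) {p c nb lo L rp mp : ℕ}
    (hc : s.v .id = c) (hnb : s.v .nb = nb) (hpc : (c - nb) / 2 = p) (hpc' : p < c) (hlo : s.v .lo = lo)
    (hhi : s.v .hi = lo + L) (hrp : s.v .rp = rp) (hmp : s.v .mp = mp) (hrs : s.a .rs = rs)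
    (hre : s.a .re = re) (hMN : M ≤ E.N) (hL : 0 < L) (hloZ : lo + L ≤ Z) (hZN : Z < E.N)
    (hreN : ∀ r < M, re r < E.N) (hcN : c < E.N) (hrpN : rp + 8 * L ≤ E.N) (hmpN : mp + 8 * L ≤ E.N)
    (hLN : 16 * L ≤ E.N) (hP : NodeOk M s.a p (2 * L) rp) :
    wp E process (fun s' => s'.time ≤ s.time + 1900 * L ∧ s'.v .rp ≤ rp + 2 * L ∧ rp ≤ s'.v .rp ∧
      mp ≤ s'.v .mp ∧ s'.v .mp ≤ mp + 8 * L ∧ s'.a .mb c = mp ∧ Ext c rp mp s.a s'.a ∧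
      NodeOk M s'.a c L (s'.v .rp) ∧ Link rs re s'.a p c lo (lo + L) (s'.v .mp)) s := by
  obtain ⟨A, hA⟩ : ∃ A, A = s.a .nA p := ⟨_, rfl⟩
  obtain ⟨b, hb⟩ : ∃ b, b = s.a .rb p := ⟨_, rfl⟩
  obtain ⟨m, hm⟩ : ∃ m, m = s.a .rc p := ⟨_, rfl⟩
  obtain ⟨hmem, hinj, hrc, hnA, hle⟩ := hP
  simp only [← hA, ← hb, ← hm] at hmem hinj hrc hnA hle
  simp only [process, wp_seq, wp_assign]
  simp [hc, hnb, hpc, ← hA, ← hb, ← hm]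
  refine ⟨by omega, by omega, ?_⟩
  refine wp_mono (contract_spec (b := b) (m := m) (A := A) (lo := lo) (hi := lo + L) (M := M) (rs := rs)
    (re := re) hE (by simp) (by simp) (by simp) (by simpa) (by simpa) (by simpa) (by simpa) hMN
    (by omega) (by omega) hreN (by omega) (by omega) (by omega) (by simpa using hmem))
    fun s1 ⟨ht1, hlt1, hl1⟩ hA1 => ?_
  simp only [St.set_time, St.set_a] at ht1 hl1
  have f1 : s1.v .id = c := by rw [hA1.v .id rfl]; simpa
  have f2 : s1.v .rp = rp := by rw [hA1.v .rp rfl]; simpa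
  have f3 : s1.a .qx = s.a .qx := by rw [hA1.a .qx rfl]; simp
  have f4 : s1.a .qy = s.a .qy := by rw [hA1.a .qy rfl]; simp
  have f5 : s1.a .qr = s.a .qr := by rw [hA1.a .qr rfl]; simp
  simp [f1, f2]
  refine ⟨by omega, ?_⟩
  refine wp_mono (transfer_spec (b := b) (m := m) (A := A) (lo := lo) (hi := lo + L) (M := M)
    (p := rp) (rs := rs) (re := re) (lab := s1.a .lab) (QX := s.a .qx) (QY := s.a .qy)
    (QR := s.a .qr) hE ?_ ?_ ?_ ?_ ?_ (by simpa using f2) ?_ ?_ (by simp) (by simpa using f3)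
    (by simpa using f4) (by simpa using f5) hMN (by omega) (by omega) hreN (by omega) (by omega) (by omega)
    hlt1 hmem hinj) fun s2 ⟨ht2, hq2, hrp2, hrp2', hM2⟩ hA2 => ?_
  · rw [St.put_v, hA1.v .pb rfl]; simp
  · rw [St.put_v, hA1.v .cnt rfl]; simp
  · rw [St.put_v, hA1.v .A rfl]; simp
  · rw [St.put_v, hA1.v .lo rfl]; simpa
  · rw [St.put_v, hA1.v .hi rfl]; simpa
  · simp; rw [hA1.a .rs rfl]; simpa
  · simp; rw [hA1.a .re rfl]; simpa
  simp only [St.put_time] at ht2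
  have g1 : s2.v .id = c := by rw [hA2.v .id rfl]; simpa
  have g2 : s2.a .rb = upd (s.a .rb) c rp := by rw [hA2.a .rb rfl]; simp [hA1.a .rb rfl]
  have g3 : s2.v .A = A := by rw [hA2.v .A rfl, St.put_v, hA1.v .A rfl]; simp
  have g4 : s2.v .mp = mp := by rw [hA2.v .mp rfl, St.put_v, hA1.v .mp rfl]; simpa
  have g5 : s2.a .rc = s.a .rc := by rw [hA2.a .rc rfl]; simp [hA1.a .rc rfl]
  have g6 : s2.a .nA = s.a .nA := by rw [hA2.a .nA rfl]; simp [hA1.a .nA rfl]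
  have g7 : s2.a .mb = s.a .mb := by rw [hA2.a .mb rfl]; simp [hA1.a .mb rfl]
  have g8 : s2.a .mq = s.a .mq := by rw [hA2.a .mq rfl]; simp [hA1.a .mq rfl]
  have g9 : s2.a .lab = s1.a .lab := by rw [hA2.a .lab rfl]; simp
  have hcA := hM2.ok.le
  simp [g1, g2, g4]
  and_intros <;> first | omega | skip
  refine wp_for A (fun j _ => 3 * j) (fun j s' => (∀ x < mp, s'.a .mq x = s.a .mq x) ∧
      ∀ x < j, s'.a .mq (mp + x) = s2.a .num (s1.a .lab x)) (by omega) rfl ⟨?_, by simp⟩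
      (fun j hj s' hI hA hz => ?_) (fun j hj s' hI hA' hz => ?_) (fun s3 hI3 hA3 hz3 ht3 => ?_)
  · simp [g8]
  · have : s'.v .A = A := by rw [hA.v .A rfl]; simpa
    simp [this]
  · have k1 : s'.v .mp = mp := by rw [hA'.v .mp rfl]; simpa
    have k2 : s'.a .lab = s1.a .lab := by rw [hA'.a .lab rfl]; simpa
    have k3 : s'.a .num = s2.a .num := by rw [hA'.a .num rfl]; simp
    have := hlt1 j hj
    simp [hz, k1, k2, k3]
    and_intros <;> first | omega | skip
    · intro x hx
      rw [upd_of_ne (by omega)]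
      exact hI.1 x hx
    · intro x hx
      by_cases hxj : x = j
      · subst hxj; simp
      · rw [upd_of_ne (by omega)]
        exact hI.2 x (by omega)
  · have l1 : s3.v .mp = mp := by rw [hA3.v .mp rfl]; simpa
    have l2 : s3.v .A = A := by rw [hA3.v .A rfl]; simpa
    have l3 : s3.v .rp = s2.v .rp := by rw [hA3.v .rp rfl]; simp
    have l4 : s3.a .rb = upd (s.a .rb) c rp := by rw [hA3.a .rb rfl]; simpa
    have l5 : s3.a .rc = upd (s.a .rc) c (s2.v .rp - rp) := by rw [hA3.a .rc rfl]; simp [g5]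
    have l6 : s3.a .nA = upd (s.a .nA) c (s2.v .cn) := by rw [hA3.a .nA rfl]; simp [g6]
    have l7 : s3.a .mb = upd (s.a .mb) c mp := by rw [hA3.a .mb rfl]; simp [g7]
    have l8 : s3.a .qx = s2.a .qx := by rw [hA3.a .qx rfl]; simp
    have l9 : s3.a .qy = s2.a .qy := by rw [hA3.a .qy rfl]; simp
    have l10 : s3.a .qr = s2.a .qr := by rw [hA3.a .qr rfl]; simp
    have hrpe : rp + (s2.v .rp - rp) = s2.v .rp := by omega
    -- The new entries are distinct records whose lifetimes meet the interval without covering it.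
    have hcard : s2.v .rp - rp ≤ 2 * L := by
      have h1 := hR.card_partial (lo := lo) (hi := lo + L) hloZ
      have := Finset.card_le_card_of_injOn (s := Finset.Ico rp (s2.v .rp))
        (t := (Finset.range M).filter fun r => rs r < lo + L ∧ lo < re r ∧ ¬ (rs r ≤ lo ∧ lo + L ≤ re r))
        (s2.a .qr)
        (fun x hx => by
          simp only [Finset.coe_Ico, Set.mem_Ico] at hx
          obtain ⟨f, k1, k2, k3, k4, -⟩ := hM2.mem x hx.1 hx.2
          simp only [Finset.coe_filter, Finset.mem_range, Set.mem_setOf_eq, k3]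
          exact ⟨(hmem f k1 k2).2.2, k4⟩)
        (fun x hx y hy he => by
          simp only [Finset.coe_Ico, Set.mem_Ico] at hx hy
          exact hM2.inj x hx.1 hx.2 y hy.1 hy.2 he)
      simp only [Nat.card_Ico] at this
      omega
    have hcn := hM2.cn_le
    have hne : p ≠ c := by omega
    have hX : Ext c rp mp s.a s3.a := by
      refine ⟨fun x hx => ?_, fun x hx => ?_, fun x hx => hI3.1 x hx⟩
      · simp [l4, l5, l6, l7, upd_of_ne (show x ≠ c by omega)]
      · rw [l8, l9, l10]
        exact hq2 x hx
    have hNR : ∀ i x y, NRel rs re s3.a c i x y ↔ ∃ e, rp ≤ e ∧ e < s2.v .rp ∧ s2.a .qx e = x ∧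
        s2.a .qy e = y ∧ rs (s2.a .qr e) ≤ i ∧ i < re (s2.a .qr e) := fun i x y => by
      simp [NRel, l4, l5, l8, l9, l10, hrpe]
    have hNP : ∀ i x y, NRel rs re s3.a p i x y ↔ ∃ e, b ≤ e ∧ e < b + m ∧ s.a .qx e = x ∧
        s.a .qy e = y ∧ rs (s.a .qr e) ≤ i ∧ i < re (s.a .qr e) := fun i x y => by
      have : NRel rs re s3.a p i = NRel rs re s.a p i :=
        NRel.ext hX hpc' (M := M) (L := 2 * L) ⟨by rw [← hA, ← hb, ← hm]; exact hmem,
          by rw [← hb, ← hm]; exact hinj, by omega, by omega, by omega⟩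
      rw [this]
      simp [NRel, ← hb, ← hm]
    simp only [wp_assign, safe_add, safe_var, eval_add, eval_var, true_and, St.tick_v, l1, l2]
    simp only [St.put_time, St.set_time, St.tick_time] at ht3 ⊢
    refine ⟨by omega, by omega, by simp [l3]; omega, by simp [l3]; omega, by simp, by simp; omega, by simp [l7], hX, ?_, ?_⟩
    · refine ⟨fun e h1 h2 => ?_, fun x h1 h2 y h3 h4 he => ?_, ?_, ?_, ?_⟩
      · simp [l4, l5, hrpe] at h1 h2
        simp [l6, l8, l9, l10]
        obtain ⟨f, k1, k2, k3, k4, -⟩ := hM2.mem e h1 h2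
        rw [k3]
        have := hM2.lt e h1 h2
        exact ⟨this.1, this.2, (hmem f k1 k2).2.2⟩
      · simp [l4, l5, hrpe] at h1 h2 h3 h4
        simp [l10] at he
        exact hM2.inj x h1 h2 y h3 h4 he
      · simp [l5]; omega
      · simp [l6]; omega
      · simp [l4, l5, l3]; omega
    · have hmq : ∀ x < A, s3.a .mq (mp + x) = s2.a .num (s1.a .lab x) := hI3.2
      refine ⟨?_, fun x hx => ?_, fun i h1 h2 x hx y hy => ?_, fun h1 => ?_⟩
      · simp [l7, l6, upd_of_ne hne, ← hA]
      · simp [l6, upd_of_ne hne, ← hA] at hx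
        simp [l6, l7, upd_of_ne hne, ← hA, hmq x hx]
        have := hM2.ok.lt _ (hlt1 x hx)
        have := hlt1 x hx
        omega
      · simp [l6, upd_of_ne hne, ← hA] at hx hy
        simp [l7, hmq x hx, hmq y hy]
        -- The contracted edges are those covering the interval. Every other edge alive at version
        -- `i` is present for a part of the interval, hence was passed on.
        refine contract_iff (k := A) (f := fun x => s2.a .num (s1.a .lab x)) (F := fun x y => ∃ e,
          b ≤ e ∧ e < b + m ∧ s.a .qx e = x ∧ s.a .qy e = y ∧ Cover rs re lo (lo + L) (s.a .qr e))
          (fun x hx y hy => ?_) (fun x y => ?_) (fun x y => ?_) (fun x y => ?_) hx hy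
        · rw [← hl1 x hx y hy]
          exact ⟨fun h => hM2.ok.inj _ (hlt1 x hx) _ (hlt1 y hy) h, fun h => by simp only [h]⟩
        · rintro ⟨e, k1, k2, k3, k4, k5⟩
          refine (hNP i x y).2 ⟨e, k1, k2, k3, k4, ?_⟩
          simp only [Cover] at k5
          omega
        · intro h
          obtain ⟨e, k1, k2, k3, k4, k5, k6⟩ := (hNP i x y).1 h
          have := hmem e k1 k2
          refine ⟨by omega, by omega, ?_⟩
          by_cases hcov : Cover rs re lo (lo + L) (s.a .qr e)
          · exact .inl ⟨e, k1, k2, k3, k4, hcov⟩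
          · obtain ⟨f, w1, w2, w3, w4, w5⟩ := hM2.full e k1 k2 ⟨by omega, by omega, hcov⟩
            refine .inr ((hNR i _ _).2 ⟨f, w1, w2, ?_, ?_, ?_⟩)
            · rw [w4, k3]
            · rw [w5, k4]
            · rw [w3]
              exact ⟨k5, k6⟩
        · intro h
          obtain ⟨f, w1, w2, w3, w4, w5, w6⟩ := (hNR i x y).1 h
          obtain ⟨e, k1, k2, k3, k4, k5, k6⟩ := hM2.mem f w1 w2
          rw [k3] at w5 w6
          have := hmem e k1 k2
          exact ⟨_, _, this.1, this.2.1, (hNP i _ _).2 ⟨e, k1, k2, rfl, rfl, w5, w6⟩,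
            by rw [← k5, w3], by rw [← k6, w4]⟩
      · simp [l6]
        -- A lifetime that meets a single version contains it. So no edge is passed on to a leaf,
        -- and no vertex gets a number.
        by_contra hne
        obtain ⟨f, k1, k2, k3, k4, -⟩ := hM2.mem rp le_rfl (by omega)
        simp only [Part] at k4
        omega

/-! ### The trees -/

/-- The `j`-th node of level `l`. -/
def nid (nb l j : ℕ) : ℕ := nb * (2 ^ l - 1) + j

theorem nid_zero (nb j : ℕ) : nid nb 0 j = j := by simp [nid]

theorem nid_eq (nb l j : ℕ) : nid nb l j + nb = nb * 2 ^ l + j := by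
  have : 1 ≤ 2 ^ l := Nat.one_le_two_pow
  have h : nb * (2 ^ l - 1) + nb = nb * 2 ^ l := by
    rw [← Nat.mul_succ, Nat.succ_eq_add_one, Nat.sub_add_cancel this]
  simp only [nid]
  omega

theorem nid_child (nb l j : ℕ) : nid nb (l + 1) j = 2 * (nb * (2 ^ l - 1)) + nb + j := by
  have h1 := nid_eq nb (l + 1) j
  have h2 := nid_eq nb l 0
  have h3 : nid nb l 0 = nb * (2 ^ l - 1) := rfl
  rw [pow_succ, ← mul_assoc] at h1
  omega

/-- Parents and children are found by arithmetic; no pointers are stored. -/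
theorem nid_parent (nb l j : ℕ) : (nid nb (l + 1) j - nb) / 2 = nid nb l (j / 2) := by
  rw [nid_child]
  simp only [nid]
  omega

theorem nid_double (nb l j b : ℕ) : nid nb (l + 1) (2 * j + b) = 2 * nid nb l j + nb + b := by
  rw [nid_child]
  simp only [nid]
  omega

theorem nid_lt {nb l l' j j' : ℕ} (h : l' < l) (hj : j' < nb * 2 ^ l') : nid nb l' j' < nid nb l j := by
  have h1 := nid_eq nb l' j'
  have h2 := nid_eq nb l j
  have h3 : nb * 2 ^ (l' + 1) ≤ nb * 2 ^ l := Nat.mul_le_mul_left _ (Nat.pow_le_pow_right (by norm_num) h)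
  rw [pow_succ, ← mul_assoc] at h3
  omega

theorem nid_inj {nb l l' j j' : ℕ} (hj : j < nb * 2 ^ l) (hj' : j' < nb * 2 ^ l')
    (h : nid nb l j = nid nb l' j') : l = l' ∧ j = j' := by
  rcases lt_trichotomy l l' with hl | rfl | hl
  · have := nid_lt (j := j') hl hj
    omega
  · simp only [nid] at h
    exact ⟨rfl, by omega⟩
  · have := nid_lt (j := j) hl hj'
    omega

theorem le_nid (nb l j : ℕ) : nb ≤ nid nb (l + 1) j := by
  rw [nid_child]
  omega

theorem nid_end (nb l : ℕ) : nid nb l (nb * 2 ^ l) = nid nb (l + 1) 0 := by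
  have h1 := nid_eq nb l (nb * 2 ^ l)
  have h2 := nid_eq nb (l + 1) 0
  rw [pow_succ, ← mul_assoc] at h2
  omega

section
variable {E : Env} {P : Par E} {s : St} {ru rv rs re : ℕ → ℕ}

/-- On every level the intervals of the nodes tile `[0, Z)`, so costs proportional to the lengths of
the intervals add up to `Z`. -/
theorem Par.level (P : Par E) {l : ℕ} (hl : l ≤ P.d) : P.nb * 2 ^ l * 2 ^ (P.d - l) = P.Z := by
  rw [mul_assoc, ← pow_add, Nat.add_sub_cancel' hl]
  rfl

theorem Par.nid_lt (P : Par E) {l j : ℕ} (hl : l ≤ P.d) (hj : j < P.nb * 2 ^ l) :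
    nid P.nb l j < 2 * P.Z := by
  have h1 := nid_eq P.nb l j
  have h2 : P.nb * 2 ^ l ≤ P.Z := by
    rw [← P.level hl]
    exact Nat.le_mul_of_pos_right _ (Nat.two_pow_pos _)
  omega

/-- All nodes with numbers `< cur` are well-formed. -/
structure Tree (P : Par E) (rs re : ℕ → ℕ) (a : Arr → ℕ → ℕ) (cur rp mp : ℕ) : Prop where
  node : ∀ l ≤ P.d, ∀ j < P.nb * 2 ^ l, nid P.nb l j < cur →
    NodeOk (P.t - 1 + P.n) a (nid P.nb l j) (2 ^ (P.d - l)) rp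
  link : ∀ l < P.d, ∀ j < P.nb * 2 ^ (l + 1), nid P.nb (l + 1) j < cur →
    Link rs re a (nid P.nb l (j / 2)) (nid P.nb (l + 1) j) (j * 2 ^ (P.d - (l + 1)))
      (j * 2 ^ (P.d - (l + 1)) + 2 ^ (P.d - (l + 1))) mp
  root : ∀ i < P.nb, a .nA i = P.n
  sep : ∀ l < P.d, ∀ j < P.nb * 2 ^ (l + 1), ∀ c, nid P.nb (l + 1) j < c → c < cur →
    a .mb (nid P.nb (l + 1) j) + a .nA (nid P.nb l (j / 2)) ≤ a .mb c

theorem nid_parent_lt {nb l j : ℕ} (hj : j < nb * 2 ^ (l + 1)) : nid nb l (j / 2) < nid nb (l + 1) j := by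
  refine nid_lt (Nat.lt_succ_self l) ?_
  rw [pow_succ, ← mul_assoc] at hj
  omega

theorem Tree.step {a a' : Arr → ℕ → ℕ} {cur rp mp rp' mp' l j : ℕ} (h : Tree P rs re a cur rp mp)
    (hX : Ext cur rp mp a a') (hl : l < P.d) (hj : j < P.nb * 2 ^ (l + 1))
    (hc : nid P.nb (l + 1) j = cur)
    (hN : NodeOk (P.t - 1 + P.n) a' cur (2 ^ (P.d - (l + 1))) rp')
    (hL : Link rs re a' (nid P.nb l (j / 2)) cur (j * 2 ^ (P.d - (l + 1)))
      (j * 2 ^ (P.d - (l + 1)) + 2 ^ (P.d - (l + 1))) mp') (hr : rp ≤ rp') (hm : mp ≤ mp')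
    (hb : a' .mb cur = mp) : Tree P rs re a' (cur + 1) rp' mp' := by
  refine ⟨fun l' hl' j' hj' hc' => ?_, fun l' hl' j' hj' hc' => ?_, fun i hi => ?_,
    fun l' hl' j' hj' c hc1 hc2 => ?_⟩
  · rcases Nat.lt_succ_iff_lt_or_eq.1 hc' with hlt | he
    · exact (h.node l' hl' j' hj' hlt).ext hX hlt hr
    · obtain ⟨rfl, rfl⟩ := nid_inj hj' hj (he.trans hc.symm)
      rw [he]
      exact hN
  · rcases Nat.lt_succ_iff_lt_or_eq.1 hc' with hlt | he
    · have hp := nid_parent_lt hj'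
      have hj2 : j' / 2 < P.nb * 2 ^ l' := by
        rw [pow_succ, ← mul_assoc] at hj'
        omega
      exact (h.link l' hl' j' hj' hlt).ext hX (by omega) hlt (h.node l' hl'.le _ hj2 (by omega))
        (h.node (l' + 1) hl' j' hj' hlt) hm
    · obtain ⟨he1, rfl⟩ := nid_inj hj' hj (he.trans hc.symm)
      obtain rfl : l' = l := by omega
      rw [he]
      exact hL
  · have : i < cur := by
      have := le_nid P.nb l j
      omega
    rw [(hX.node i this).2.2.1, h.root i hi]
  · have hp := nid_parent_lt hj'
    rw [(hX.node _ (show nid P.nb (l' + 1) j' < cur by omega)).2.2.2,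
      (hX.node _ (show nid P.nb l' (j' / 2) < cur by omega)).2.2.1]
    rcases Nat.lt_succ_iff_lt_or_eq.1 hc2 with hlt | rfl
    · rw [(hX.node c hlt).2.2.2]
      exact h.sep l' hl' j' hj' c hc1 hlt
    · rw [hb]
      exact (h.link l' hl' j' hj' hc1).le

/-- Set up all nodes, level by level. -/
def nodes : Cmd :=
  .mp ::= lit 0 ;; .id ::= v .nb ;; .len ::= v .B ;; .lim ::= v .nb ;;
  .for .sz (v .d) (.len ::= v .len / lit 2 ;; .lim ::= v .lim + v .lim ;;
    .for .sl (v .lim) (.lo ::= v .sl * v .len ;; .hi ::= v .lo + v .len ;; process ;;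
      .id ::= v .id + lit 1))

/-- The roots are nodes. -/
theorem RootsOk.tree {a : Arr → ℕ → ℕ} {rp : ℕ} (h : RootsOk P ru rv rs re a rp P.nb)
    (hR : Recs P.n (P.t - 1) (P.t - 1 + P.n) P.Z ru rv rs re) : Tree P rs re a P.nb rp 0 := by
  have hB := P.n_le_B
  have hge := le_nid P.nb
  refine ⟨fun l hl j hj hc => ?_, fun l hl j hj hc => absurd (hge l j) (by omega), h.nA,
    fun l hl j hj c h1 h2 => absurd (hge l j) (by omega)⟩
  · obtain rfl : l = 0 := by
      by_contra hne
      obtain ⟨k, rfl⟩ := Nat.exists_eq_succ_of_ne_zero hne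
      exact absurd (hge k j) (by simpa using hc)
    rw [nid_zero] at hc ⊢
    have hL := h.list j hc
    have hA := h.nA j hc
    refine ⟨fun e h1 h2 => ?_, hL.inj, ?_, ?_, h.le j hc⟩
    · obtain ⟨k1, k2, k3, -⟩ := hL.mem e h1 h2
      have := hR.lt _ k1
      rw [k2, k3, hA]
      exact ⟨this.1, this.2, k1⟩
    · have := hL.card_le_four hR
      simp only [Par.B] at this
      rw [Nat.sub_zero]
      omega
    · rw [hA, Nat.sub_zero]
      simp only [Par.B] at hB
      omega

theorem RootsOk.live {a : Arr → ℕ → ℕ} {rp i j x y : ℕ} (h : RootsOk P ru rv rs re a rp P.nb)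
    (hj : j < P.nb) (h1 : j * P.B ≤ i) (h2 : i < j * P.B + P.B) :
    NRel rs re a j i x y ↔ Live (P.t - 1 + P.n) ru rv rs re i x y := by
  have hL := h.list j hj
  constructor
  · rintro ⟨e, k1, k2, rfl, rfl, k5, k6⟩
    obtain ⟨w1, w2, w3, -⟩ := hL.mem e k1 k2
    exact ⟨_, w1, w2.symm, w3.symm, k5, k6⟩
  · rintro ⟨r, hr, rfl, rfl, k5, k6⟩
    obtain ⟨e, k1, k2, rfl⟩ := hL.full r hr (by omega) (by omega)
    obtain ⟨w1, w2, w3, -⟩ := hL.mem e k1 k2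
    exact ⟨e, k1, k2, w2, w3, k5, k6⟩

theorem Setup.set (hS : Setup P s.v) {x : Var} {k : ℕ} (hx : x ∉ Par.vars) :
    Setup P (s.set x k).v := by
  simp only [Par.vars, List.mem_cons, List.not_mem_nil, not_or, or_false] at hx
  obtain ⟨h1, h2, h3, h4, h5, h6, h7, h8⟩ := hS
  obtain ⟨k1, k2, k3, k4, k5, k6, k7, k8⟩ := hx
  refine ⟨?_, ?_, ?_, ?_, ?_, ?_, ?_, ?_⟩ <;> rw [St.set_v, if_neg (Ne.symm ‹_›)] <;> assumption

/-- On each level the number of nodes times the length of their intervals is `Z`, so every level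
costs `O(Z)` in time and in the two pools. -/
theorem nodes_spec (hS : Setup P s.v) (hrs : s.a .rs = rs) (hre : s.a .re = re)
    (hR : Recs P.n (P.t - 1) (P.t - 1 + P.n) P.Z ru rv rs re)
    (hT : Tree P rs re s.a P.nb (s.v .rp) 0) (hrp : s.v .rp ≤ 14 * P.t) :
    wp E nodes (fun s' => s'.time ≤ s.time + 2000 * P.Z * P.d + 10 ∧
      Ext P.nb (s.v .rp) 0 s.a s'.a ∧
      s'.v .id = nid P.nb (P.d + 1) 0 ∧ s'.v .lim = P.Z ∧
      ∃ rp mp, mp ≤ 8 * P.Z * P.d ∧ Tree P rs re s'.a (nid P.nb (P.d + 1) 0) rp mp) s := by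
  have hE := P.hE
  have htN := P.tN
  have hn := P.hn
  have hnt := P.hnt
  have hZ := P.Z_lt'
  have hnb := P.nb_le
  have hnb0 := P.nb_pos
  have hd := P.d_lt
  have hN := P.hN
  have hZd : P.Z * P.d ≤ 3 * (P.t * P.d) := by
    have := Nat.mul_le_mul_right P.d hZ.le
    rwa [mul_assoc] at this
  rw [Nat.mul_add] at hN
  have hlevel : ∀ l ≤ P.d, P.Z * l ≤ P.Z * P.d := fun l hl => Nat.mul_le_mul_left _ hl
  simp only [nodes, wp_seq, wp_assign]
  simp [hS.nb, hS.B]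
  refine ⟨by omega, ?_⟩
  refine wp_for P.d (fun l _ => 2000 * (P.Z * l)) (fun l s' => s'.v .id = nid P.nb (l + 1) 0 ∧
    s'.v .len = 2 ^ (P.d - l) ∧ s'.v .lim = P.nb * 2 ^ l ∧ s'.v .rp ≤ 14 * P.t + 2 * (P.Z * l) ∧
    s'.v .mp ≤ 8 * (P.Z * l) ∧ s.v .rp ≤ s'.v .rp ∧ Ext P.nb (s.v .rp) 0 s.a s'.a ∧
    Tree P rs re s'.a (nid P.nb (l + 1) 0) (s'.v .rp) (s'.v .mp)) (by omega) rfl ?_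
    (fun l hl s' hI hA hz => ?_) (fun l hl s' ⟨hid, hlen, hlim, hr, hm, hrr, hX, hT'⟩ hA hz => ?_)
    (fun s1 ⟨hid, hlen, hlim, hr, hm, hrr, hX, hT'⟩ hA hz ht => ?_)
  · have : nid P.nb 1 0 = P.nb := by simp [nid]
    simp [this, Par.B, hrp, hT, Ext.refl]
  · have h1 : s'.v .d = P.d := by rw [hA.v .d rfl]; simpa using hS.d
    simp [h1]
  · have hl1 := hlevel (l + 1) hl
    have hlev := P.level (show l + 1 ≤ P.d from hl)
    obtain ⟨L, hL⟩ : ∃ L, L = 2 ^ (P.d - (l + 1)) := ⟨_, rfl⟩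
    have hL0 : 0 < L := by rw [hL]; exact Nat.two_pow_pos _
    have hLL : 2 ^ (P.d - l) = 2 * L := by
      rw [hL, show P.d - l = P.d - (l + 1) + 1 by omega, pow_succ, mul_comm]
    have hw : P.nb * 2 ^ l + P.nb * 2 ^ l = P.nb * 2 ^ (l + 1) := by rw [pow_succ]; ring
    have hBL : 2 * L ≤ P.B := by
      rw [← hLL]
      exact Nat.pow_le_pow_right (by norm_num) (by omega)
    have hB := P.B_lt
    rw [← hL] at hlev
    obtain ⟨w, hw'⟩ : ∃ w, w = P.nb * 2 ^ (l + 1) := ⟨_, rfl⟩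
    rw [← hw'] at hlev hw
    have hwZ : w ≤ P.Z := by rw [← hlev]; exact Nat.le_mul_of_pos_right _ hL0
    have hll : P.Z * (l + 1) = P.Z * l + P.Z := by ring
    have hlenL : s'.v .len / 2 = L := by omega
    have hlimw : s'.v .lim + s'.v .lim = w := by omega
    simp only [wp_seq, wp_assign]
    simp [hlenL, hlimw]
    refine ⟨by omega, by omega, ?_⟩
    have f1 : Setup P s'.v := by
      refine Setup.agree (s := ((((s.set .mp 0).set .id P.nb).set .len P.B).set .lim P.nb)) ?_ hA rfl
      exact Setup.set (Setup.set (Setup.set (Setup.set hS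
        (by decide)) (by decide)) (by decide)) (by decide)
    refine wp_for w (fun j _ => 1910 * (j * L)) (fun j s' => s'.v .id = nid P.nb (l + 1) j ∧
      s'.v .rp ≤ 14 * P.t + 2 * (P.Z * l) + 2 * (j * L) ∧
      s'.v .mp ≤ 8 * (P.Z * l) + 8 * (j * L) ∧ s.v .rp ≤ s'.v .rp ∧ Ext P.nb (s.v .rp) 0 s.a s'.a ∧
      Tree P rs re s'.a (nid P.nb (l + 1) j) (s'.v .rp) (s'.v .mp)) (by omega) rfl ?_
      (fun j hj s2 hI hA hz => ?_) (fun j hj s2 ⟨hid2, hr2, hm2, hrr2, hX2, hT2⟩ hA2 hz2 => ?_)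
      (fun s2 ⟨hid2, hr2, hm2, hrr2, hX2, hT2⟩ hA2 hz2 ht2 => ?_)
    · simp [hid, hT', hX, hrr]
      omega
    · have h1 : s2.v .lim = w := by rw [hA.v .lim rfl]; simp
      simp [h1]
    · have g1 : s2.v .len = L := by rw [hA2.v .len rfl]; simp
      have g2 : s2.v .nb = P.nb := by rw [hA2.v .nb rfl]; simpa using f1.nb
      have g3 : s2.a .rs = rs := by rw [hA2.a .rs rfl]; simp; rw [hA.a .rs rfl]; simpa
      have g4 : s2.a .re = re := by rw [hA2.a .re rfl]; simp; rw [hA.a .re rfl]; simpa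
      have hjL : (j + 1) * L = j * L + L := by ring
      have hjw : (j + 1) * L ≤ w * L := Nat.mul_le_mul_right _ hj
      rw [hlev] at hjw
      have hj' : j < P.nb * 2 ^ (l + 1) := by omega
      have hidlt := P.nid_lt (show l + 1 ≤ P.d from hl) hj'
      have hj2 : j / 2 < P.nb * 2 ^ l := by omega
      simp only [wp_seq, wp_assign]
      simp [hz2, g1]
      refine ⟨by omega, by omega, ?_⟩
      refine wp_mono (process_spec (p := nid P.nb l (j / 2)) (c := nid P.nb (l + 1) j) (nb := P.nb)
        (lo := j * L) (L := L) (rp := s2.v .rp) (mp := s2.v .mp) (rs := rs) (re := re) hE hR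
        (by simpa) (by simpa) (nid_parent _ _ _) (nid_parent_lt hj') (by simp) (by simp)
        (by simp) (by simp) (by simpa) (by simpa) (by omega) hL0 (by omega) (by omega)
        (fun r hr => by have := hR.end_le r hr; omega) (by omega) (by omega) (by omega) (by omega) ?_)
        fun s3 ⟨ht3, hrp3, hrp3', hmp3, hmp3', hb3, hX3, hN3, hL3⟩ hA3 => ?_
      · simp only [St.set_a, St.tick_a]
        rw [← hLL]
        exact hT2.node l hl.le _ hj2 (nid_parent_lt hj')
      · simp only [St.set_time, St.tick_time, St.set_a, St.tick_a] at ht3 hX3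
        have h1 : s3.v .id = nid P.nb (l + 1) j := by rw [hA3.v .id rfl]; simpa
        have h2 : nid P.nb (l + 1) (j + 1) = nid P.nb (l + 1) j + 1 := rfl
        have hnbid := le_nid P.nb l j
        simp [h1, h2]
        and_intros <;> first | omega | skip
        · exact hX2.trans hX3 hnbid hrr2 (Nat.zero_le _)
        · exact hT2.step hX3 hl hj' rfl (hL ▸ hN3) (hL ▸ hL3) hrp3' hmp3 hb3
    · have h1 : s2.v .len = L := by rw [hA2.v .len rfl]; simp
      have h2 : s2.v .lim = w := by rw [hA2.v .lim rfl]; simp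
      rw [hlev] at hr2 hm2 ht2
      have h3 : nid P.nb (l + 1) w = nid P.nb (l + 1 + 1) 0 := by rw [hw', nid_end]
      rw [h3] at hid2 hT2
      have hZ0 : 1 ≤ P.Z := by omega
      simp only [St.set_time, St.tick_time, Nat.zero_mul, Nat.mul_zero, Nat.add_zero] at ht2
      simp [h1, h2, hid2, ← hL, ← hw']
      refine ⟨⟨by omega, by omega, by omega, hX2, hT2⟩, ?_⟩
      rw [hll]
      omega
  · simp only [St.tick_time, St.tick_v, St.tick_a, St.set_time] at *
    refine ⟨?_, hX, hid, hlim, _, _, by rw [mul_assoc]; exact hm, hT'⟩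
    rw [mul_assoc]
    simp at ht
    omega

end

/-! ### Connectivity during the intervals of the nodes -/

def treeArrs : List Arr := [.rb, .rc, .nA, .mb, .qx, .qy, .qr, .mq]

/-- The trees are as in `a₀`. -/
def SameTree (a₀ a : Arr → ℕ → ℕ) : Prop := ∀ A ∈ treeArrs, a A = a₀ A

theorem SameTree.agree {a₀ : Arr → ℕ → ℕ} {c : Cmd} {s s' : St} (h : SameTree a₀ s.a)
    (hA : Agree c s s') (hc : (treeArrs.all fun A => !c.wa A) = true) : SameTree a₀ s'.a := by
  intro A hAm
  have := List.all_eq_true.1 hc A hAm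
  rw [hA.a A (by simpa using this), h A hAm]

/-- The entries of `T` for node `z` with parent `p` describe which vertices of `p` are connected
during all of `[lo, hi)`. -/
def ClassOk (rs re : ℕ → ℕ) (a : Arr → ℕ → ℕ) (T : ℕ → ℕ) (p z lo hi : ℕ) : Prop :=
  ∀ x < a .nA p, T (a .mb z + x) < 2 * a .nA p ∧ ∀ y < a .nA p,
    (T (a .mb z + x) = T (a .mb z + y) ↔
      ∀ i, lo ≤ i → i < hi → EqvGen (NRel rs re a p i) x y)

/-- All edges of a node have endpoints below `nA z`. The larger values of the map from the parent
therefore stand for isolated vertices. -/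
theorem NodeOk.isolated {M L rp z i c d : ℕ} {rs re : ℕ → ℕ} {a : Arr → ℕ → ℕ} (hN : NodeOk M a z L rp)
    (h : EqvGen (NRel rs re a z i) c d) : c = d ∨ (c < a .nA z ∧ d < a .nA z) := by
  induction h with
  | rel c d h =>
    obtain ⟨e, h1, h2, rfl, rfl, -⟩ := h
    have := hN.mem e h1 h2
    exact .inr ⟨this.1, this.2.1⟩
  | refl _ => exact .inl rfl
  | symm _ _ _ ih => omega
  | trans _ _ _ _ _ ih1 ih2 => omega

/-- A vertex of the parent whose image is isolated is connected, during the interval, only to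
vertices with the same image, so the image itself can name its class. Other classes are named by
representatives below `nA z`, so the two kinds of names cannot clash. -/
theorem ClassOk.combine {M L rp mp p z lo hi : ℕ} {rs re rep T : ℕ → ℕ} {a : Arr → ℕ → ℕ}
    (hN : NodeOk M a z L rp) (hL : Link rs re a p z lo hi mp) (hlt : lo < hi)
    (hrep : ∀ x < a .nA z, rep x ≤ x ∧ ∀ y < a .nA z,
      (rep x = rep y ↔ ∀ i, lo ≤ i → i < hi → EqvGen (NRel rs re a z i) x y))
    (hT : ∀ x < a .nA p, T (a .mb z + x) = if a .mq (a .mb z + x) < a .nA z then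
      rep (a .mq (a .mb z + x)) else a .mq (a .mb z + x)) : ClassOk rs re a T p z lo hi := by
  intro x hx
  have hq := hL.lt x hx
  refine ⟨?_, fun y hy => ?_⟩
  · rw [hT x hx]
    split_ifs with h
    · have := (hrep _ h).1
      omega
    · exact hq
  · rw [hT x hx, hT y hy]
    have hiff : (∀ i, lo ≤ i → i < hi → EqvGen (NRel rs re a p i) x y) ↔ ∀ i, lo ≤ i → i < hi →
        EqvGen (NRel rs re a z i) (a .mq (a .mb z + x)) (a .mq (a .mb z + y)) :=
      forall_congr' fun i => forall_congr' fun h1 => forall_congr' fun h2 => hL.iff i h1 h2 x hx y hy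
    rw [hiff]
    split_ifs with h1 h2 h2
    · exact (hrep _ h1).2 _ h2
    · have := (hrep _ h1).1
      refine ⟨fun h => by omega, fun h => ?_⟩
      have := hN.isolated (h lo le_rfl hlt)
      omega
    · have := (hrep _ h2).1
      refine ⟨fun h => by omega, fun h => ?_⟩
      have := hN.isolated (h lo le_rfl hlt)
      omega
    · refine ⟨fun h i _ _ => by rw [h]; exact .refl _, fun h => ?_⟩
      have := hN.isolated (h lo le_rfl hlt)
      omega

/-- Name the pairs of entries for the two children of node `id`. -/
def nameNode : Cmd :=
  .A ::= rd .nA (v .id) ;; .cx ::= lit 2 * v .id + v .nb ;;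
  .for .i (v .A) (.store .c1 (v .i) (rd .T2 (rd .mb (v .cx) + v .i)) ;;
    .store .c2 (v .i) (rd .T2 (rd .mb (v .cx + lit 1) + v .i))) ;;
  .k ::= v .A ;; .V ::= v .A + v .A ;; name

/-- A leaf has no children, but it has no vertices either: the positions of its children are
computed and never accessed. Hence the range condition for them is needed only if `0 < A`. -/
theorem nameNode_spec {E : Env} (hE : 100 * (E.N + 1) ≤ E.W) {s : St} {a₀ : Arr → ℕ → ℕ} {z c A nb : ℕ}
    (hs : SameTree a₀ s.a) (hz : s.v .id = z) (hnb : s.v .nb = nb) (hc : 2 * z + nb = c)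
    (hA : a₀ .nA z = A) (hzN : z < E.N) (hcN : 0 < A → c + 1 < E.N) (hcW : c < E.W) (hAN : 2 * A ≤ E.N)
    (h1 : ∀ x < A, a₀ .mb c + x < E.N ∧ s.a .T2 (a₀ .mb c + x) < 2 * A)
    (h2 : ∀ x < A, a₀ .mb (c + 1) + x < E.N ∧ s.a .T2 (a₀ .mb (c + 1) + x) < 2 * A) :
    wp E nameNode (fun s' => s'.time ≤ s.time + 130 * A + 60 ∧ s'.v .A = A ∧
      ∀ x < A, s'.a .rep x ≤ x ∧ ∀ y < A, (s'.a .rep x = s'.a .rep y ↔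
        s.a .T2 (a₀ .mb c + x) = s.a .T2 (a₀ .mb c + y) ∧
        s.a .T2 (a₀ .mb (c + 1) + x) = s.a .T2 (a₀ .mb (c + 1) + y))) s := by
  have e1 : s.a .nA = a₀ .nA := hs .nA (by simp [treeArrs])
  have e2 : s.a .mb = a₀ .mb := hs .mb (by simp [treeArrs])
  simp only [nameNode, wp_seq, wp_assign]
  simp [hz, hnb, e1, hA, hc]
  and_intros <;> first | omega | skip
  refine wp_for A (fun j _ => 4 * j) (fun j s' => ∀ x < j,
    s'.a .c1 x = s.a .T2 (a₀ .mb c + x) ∧ s'.a .c2 x = s.a .T2 (a₀ .mb (c + 1) + x))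
    (by omega) rfl (by simp) (fun j hj s' hI hA' hz => ?_) (fun j hj s' hI hA' hz => ?_)
    (fun s1 hI1 hA1 hz1 ht1 => ?_)
  · have : s'.v .A = A := by rw [hA'.v .A rfl]; simp
    simp [this]
  · have f1 : s'.v .cx = c := by rw [hA'.v .cx rfl]; simp
    have f2 : s'.a .mb = a₀ .mb := by rw [hA'.a .mb rfl]; simpa
    have f3 : s'.a .T2 = s.a .T2 := by rw [hA'.a .T2 rfl]; simp
    have := h1 j hj
    have := h2 j hj
    have := hcN (by omega)
    simp [hz, f1, f2, f3]
    and_intros <;> first | omega | skip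
    intro x hx
    simp only [upd_apply]
    split_ifs with h
    · rw [h]; simp
    · exact hI x (by omega)
  · have f1 : s1.v .A = A := by rw [hA1.v .A rfl]; simp
    simp [f1]
    refine ⟨by omega, ?_⟩
    refine wp_mono (name_spec (k := A) (V := A + A) hE (by simp) (by simp) (by omega) (by omega)
      (fun x hx => ?_) (fun x hx => ?_)) fun s2 ⟨ht2, hr2⟩ hA2 => ?_
    · simp [(hI1 x hx).1]
      have := h1 x hx
      omega
    · simp [(hI1 x hx).2]
      have := h2 x hx
      omega
    · simp only [St.set_time, St.tick_time, St.set_a, St.tick_a] at ht1 ht2 hr2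
      refine ⟨by omega, by rw [hA2.v .A rfl]; simpa, fun x hx => ⟨(hr2 x hx).le, fun y hy => ?_⟩⟩
      rw [MinRep.eq_iff hr2 hx hy, (hI1 x hx).1, (hI1 x hx).2, (hI1 y hy).1, (hI1 y hy).2]

/-- Compute the entries of `T2` for node `id`. -/
def classNode : Cmd :=
  nameNode ;;
  .p ::= (v .id - v .nb) / lit 2 ;; .cnt ::= rd .nA (v .p) ;; .base ::= rd .mb (v .id) ;;
  .for .i (v .cnt) (.y ::= rd .mq (v .base + v .i) ;;
    .ite (v .y) (v .A) (.store .T2 (v .base + v .i) (rd .rep (v .y)))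
      (.store .T2 (v .base + v .i) (v .y)))

theorem classNode_spec {E : Env} (hE : 100 * (E.N + 1) ≤ E.W) {s : St} {a₀ : Arr → ℕ → ℕ}
    {z c A nb p b k : ℕ}
    (hs : SameTree a₀ s.a) (hz : s.v .id = z) (hnb : s.v .nb = nb) (hc : 2 * z + nb = c)
    (hpz : (z - nb) / 2 = p) (hk : a₀ .nA p = k) (hb : a₀ .mb z = b)
    (hA : a₀ .nA z = A) (hzN : z < E.N) (hpN : p < E.N) (hcN : 0 < A → c + 1 < E.N) (hcW : c < E.W)
    (hAN : 2 * A ≤ E.N) (hbk : b + k ≤ E.N) (hb0 : b < E.N)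
    (h1 : ∀ x < A, a₀ .mb c + x < E.N ∧ s.a .T2 (a₀ .mb c + x) < 2 * A)
    (h2 : ∀ x < A, a₀ .mb (c + 1) + x < E.N ∧ s.a .T2 (a₀ .mb (c + 1) + x) < 2 * A) :
    wp E classNode (fun s' => s'.time ≤ s.time + 130 * A + 5 * k + 70 ∧
      (∀ x, x < b ∨ b + k ≤ x → s'.a .T2 x = s.a .T2 x) ∧
      ∃ rep : ℕ → ℕ, (∀ x < A, rep x ≤ x ∧ ∀ y < A, (rep x = rep y ↔
        s.a .T2 (a₀ .mb c + x) = s.a .T2 (a₀ .mb c + y) ∧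
        s.a .T2 (a₀ .mb (c + 1) + x) = s.a .T2 (a₀ .mb (c + 1) + y))) ∧
      ∀ x < k, s'.a .T2 (b + x) = if a₀ .mq (b + x) < A then rep (a₀ .mq (b + x)) else
        a₀ .mq (b + x)) s := by
  simp only [classNode, wp_seq]
  refine wp_mono (nameNode_spec hE hs hz hnb hc hA hzN hcN hcW hAN h1 h2) fun s1 ⟨ht1, hA1v, hr1⟩ hA1 => ?_
  have hs1 : SameTree a₀ s1.a := hs.agree hA1 rfl
  have e1 : s1.a .nA = a₀ .nA := hs1 .nA (by simp [treeArrs])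
  have e2 : s1.a .mb = a₀ .mb := hs1 .mb (by simp [treeArrs])
  have e3 : s1.a .mq = a₀ .mq := hs1 .mq (by simp [treeArrs])
  have e4 : s1.v .id = z := by rw [hA1.v .id rfl, hz]
  have e5 : s1.v .nb = nb := by rw [hA1.v .nb rfl, hnb]
  have e6 : s1.a .T2 = s.a .T2 := hA1.a .T2 rfl
  simp only [wp_assign]
  simp [e1, e2, e4, e5, hpz, hk, hb]
  and_intros <;> first | omega | skip
  refine wp_for k (fun j _ => 5 * j) (fun j s' => (∀ x, x < b ∨ b + k ≤ x → s'.a .T2 x = s.a .T2 x) ∧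
    ∀ x < j, s'.a .T2 (b + x) = if a₀ .mq (b + x) < A then s1.a .rep (a₀ .mq (b + x)) else
        a₀ .mq (b + x)) (by omega) rfl (by simp [e6]) (fun j hj s' hI hA' hz => ?_)
    (fun j hj s' hI hA' hz => ?_) (fun s2 hI2 hA2 hz2 ht2 => ?_)
  · have : s'.v .cnt = k := by rw [hA'.v .cnt rfl]; simp
    simp [this]
  · have f1 : s'.v .base = b := by rw [hA'.v .base rfl]; simp
    have f2 : s'.a .mq = a₀ .mq := by rw [hA'.a .mq rfl]; simpa
    have f3 : s'.a .rep = s1.a .rep := by rw [hA'.a .rep rfl]; simp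
    have f4 : s'.v .A = A := by rw [hA'.v .A rfl]; simpa
    have hfin : ∀ w, w = (if a₀ .mq (b + j) < A then s1.a .rep (a₀ .mq (b + j)) else a₀ .mq (b + j)) →
        (∀ x, x < b ∨ b + k ≤ x → upd (s'.a .T2) (b + j) w x = s.a .T2 x) ∧
        ∀ x ≤ j, upd (s'.a .T2) (b + j) w (b + x) = if a₀ .mq (b + x) < A then
          s1.a .rep (a₀ .mq (b + x)) else a₀ .mq (b + x) := by
      rintro _ rfl
      refine ⟨fun x hx => ?_, fun x hx => ?_⟩
      · rw [upd_of_ne (by omega)]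
        exact hI.1 x hx
      · by_cases hxj : x = j
        · subst hxj
          rw [upd_self]
        · rw [upd_of_ne (by omega)]
          exact hI.2 x (by omega)
    simp only [wp_seq, wp_assign]
    rcases lt_or_ge (a₀ .mq (b + j)) A with h | h
    · simp [hz, f1, f2, f3, f4, h, h.not_ge]
      and_intros <;> first | omega | skip
      · exact (hfin _ (by rw [if_pos h])).1
      · exact (hfin _ (by rw [if_pos h])).2
    · simp [hz, f1, f2, f3, f4, h, h.not_gt]
      and_intros <;> first | omega | skip
      · exact (hfin _ (by rw [if_neg h.not_gt])).1
      · exact (hfin _ (by rw [if_neg h.not_gt])).2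
  · simp only [St.tick_time, St.tick_a, St.set_time] at *
    exact ⟨by omega, hI2.1, s1.a .rep, hr1, hI2.2⟩

section
variable {E : Env} {P : Par E} {s : St} {rs re : ℕ → ℕ}

/-- The entries of `T` are right for all nodes with numbers `≥ cur`. -/
def Classes (P : Par E) (rs re : ℕ → ℕ) (a : Arr → ℕ → ℕ) (T : ℕ → ℕ) (cur : ℕ) : Prop :=
  ∀ l < P.d, ∀ j < P.nb * 2 ^ (l + 1), cur ≤ nid P.nb (l + 1) j →
    ClassOk rs re a T (nid P.nb l (j / 2)) (nid P.nb (l + 1) j) (j * 2 ^ (P.d - (l + 1)))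
      (j * 2 ^ (P.d - (l + 1)) + 2 ^ (P.d - (l + 1)))

/-- The entries for the two children of a node tell what happens during the interval of the node. -/
theorem Classes.children {a : Arr → ℕ → ℕ} {T : ℕ → ℕ} {cur rp mp l j : ℕ}
    (hC : Classes P rs re a T cur) (hT : Tree P rs re a (nid P.nb (P.d + 1) 0) rp mp)
    (hl : l < P.d) (hj : j < P.nb * 2 ^ l) (hcur : cur ≤ nid P.nb (l + 1) (2 * j)) :
    (∀ b < 2, ∀ x < a .nA (nid P.nb l j),
      a .mb (2 * nid P.nb l j + P.nb + b) + x < mp ∧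
      T (a .mb (2 * nid P.nb l j + P.nb + b) + x) < 2 * a .nA (nid P.nb l j)) ∧
    ∀ x < a .nA (nid P.nb l j), ∀ y < a .nA (nid P.nb l j),
      (T (a .mb (2 * nid P.nb l j + P.nb) + x) = T (a .mb (2 * nid P.nb l j + P.nb) + y) ∧
       T (a .mb (2 * nid P.nb l j + P.nb + 1) + x) = T (a .mb (2 * nid P.nb l j + P.nb + 1) + y) ↔
      ∀ i, j * 2 ^ (P.d - l) ≤ i → i < j * 2 ^ (P.d - l) + 2 ^ (P.d - l) →
        EqvGen (NRel rs re a (nid P.nb l j) i) x y) := by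
  have hb : ∀ b < 2, 2 * j + b < P.nb * 2 ^ (l + 1) ∧ (2 * j + b) / 2 = j ∧
      cur ≤ nid P.nb (l + 1) (2 * j + b) ∧
      nid P.nb (l + 1) (2 * j + b) < nid P.nb (P.d + 1) 0 := fun b hb => by
    have h1 : 2 * j + b < P.nb * 2 ^ (l + 1) := by
      rw [pow_succ, ← mul_assoc]
      omega
    refine ⟨h1, by omega, ?_, nid_lt (by omega) h1⟩
    simp only [nid] at *
    omega
  have hcl : ∀ b < 2, ClassOk rs re a T (nid P.nb l j) (2 * nid P.nb l j + P.nb + b)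
      ((2 * j + b) * 2 ^ (P.d - (l + 1))) ((2 * j + b) * 2 ^ (P.d - (l + 1)) + 2 ^ (P.d - (l + 1))) ∧
      a .mb (2 * nid P.nb l j + P.nb + b) + a .nA (nid P.nb l j) ≤ mp := fun b hb2 => by
    obtain ⟨h1, h2, h3, h4⟩ := hb b hb2
    have := hC l hl _ h1 h3
    have h5 := (hT.link l hl _ h1 h4).le
    rw [h2, nid_double] at this h5
    exact ⟨this, h5⟩
  refine ⟨fun b hb2 x hx => ⟨?_, ((hcl b hb2).1 x hx).1⟩, fun x hx y hy => ?_⟩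
  · have := (hcl b hb2).2
    omega
  · have h0 := ((hcl 0 (by omega)).1 x hx).2 y hy
    have h1 := ((hcl 1 (by omega)).1 x hx).2 y hy
    simp only [Nat.add_zero] at h0
    rw [h0, h1]
    obtain ⟨L, hL⟩ : ∃ L, L = 2 ^ (P.d - (l + 1)) := ⟨_, rfl⟩
    have hLL : 2 ^ (P.d - l) = 2 * L := by
      rw [hL, show P.d - l = P.d - (l + 1) + 1 by omega, pow_succ, mul_comm]
    rw [← hL, hLL]
    have e1 : j * (2 * L) = 2 * j * L := by ring
    have e2 : (2 * j + 1) * L = 2 * j * L + L := by ring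
    rw [e1, e2]
    constructor
    · rintro ⟨k1, k2⟩ i h1 h2
      rcases lt_or_ge i (2 * j * L + L) with h | h
      · exact k1 i h1 h
      · exact k2 i h (by omega)
    · intro h
      exact ⟨fun i h1 h2 => h i h1 (by omega), fun i h1 h2 => h i (by omega) (by omega)⟩

end

section
variable {E : Env} {P : Par E} {s : St} {rs re : ℕ → ℕ}

/-- Compute `T2` for all nodes, from the leaves upwards. -/
def classes : Cmd :=
  .for .sz (v .d) (.for .sl (v .lim) (.id ::= v .id - lit 1 ;; classNode) ;;
    .lim ::= v .lim / lit 2)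

/-- The segments of the nodes lie in the order of the nodes (`Tree.sep`), so filling the segment of
one node leaves the entries of all later nodes intact. -/
theorem Classes.step {a : Arr → ℕ → ℕ} {T T' : ℕ → ℕ} {rp mp l j : ℕ} (hl : l < P.d)
    (hj : j < P.nb * 2 ^ (l + 1)) (hC : Classes P rs re a T (nid P.nb (l + 1) j + 1))
    (hT : Tree P rs re a (nid P.nb (P.d + 1) 0) rp mp)
    (hout : ∀ x, x < a .mb (nid P.nb (l + 1) j) ∨
      a .mb (nid P.nb (l + 1) j) + a .nA (nid P.nb l (j / 2)) ≤ x → T' x = T x)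
    (hok : ClassOk rs re a T' (nid P.nb l (j / 2)) (nid P.nb (l + 1) j) (j * 2 ^ (P.d - (l + 1)))
      (j * 2 ^ (P.d - (l + 1)) + 2 ^ (P.d - (l + 1)))) :
    Classes P rs re a T' (nid P.nb (l + 1) j) := by
  intro l' hl' j' hj' hle
  rcases hle.lt_or_eq with hlt | he
  · have hsep := hT.sep l hl j hj _ hlt (nid_lt (by omega) hj')
    intro x hx
    rw [hout _ (.inr (by omega))]
    refine ⟨(hC l' hl' j' hj' hlt x hx).1, fun y hy => ?_⟩
    rw [hout _ (.inr (by omega))]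
    exact (hC l' hl' j' hj' hlt x hx).2 y hy
  · obtain ⟨he1, rfl⟩ := nid_inj hj hj' he
    obtain rfl : l = l' := by omega
    exact hok

theorem Tree.leaf_nA {a : Arr → ℕ → ℕ} {rp mp j : ℕ} (hT : Tree P rs re a (nid P.nb (P.d + 1) 0) rp mp)
    (hd : 0 < P.d) (hj : j < P.nb * 2 ^ P.d) : a .nA (nid P.nb P.d j) = 0 := by
  obtain ⟨l, hl⟩ : ∃ l, P.d = l + 1 := ⟨P.d - 1, by omega⟩
  rw [hl] at hj ⊢
  have := (hT.link l (by omega) j hj (nid_lt (by omega) hj)).leaf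
  rw [hl, Nat.sub_self] at this
  exact this (by omega)

theorem classes_spec (hS : Setup P s.v) {rp mp : ℕ} (hT : Tree P rs re s.a (nid P.nb (P.d + 1) 0) rp mp)
    (hmp : mp < E.N) (hid : s.v .id = nid P.nb (P.d + 1) 0) (hlim : s.v .lim = P.Z) :
    wp E classes (fun s' => s'.time ≤ s.time + 710 * (P.Z * P.d) + 2 ∧ SameTree s.a s'.a ∧
      Classes P rs re s.a (s'.a .T2) 0) s := by
  have hE := P.hE
  have htN := P.tN
  have hn := P.hn
  have hnt := P.hnt
  have hZ := P.Z_lt'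
  have hnb := P.nb_le
  have hnb0 := P.nb_pos
  have hd := P.d_lt
  obtain ⟨a, ha⟩ : ∃ a, a = s.a := ⟨_, rfl⟩
  rw [← ha] at hT ⊢
  refine wp_for P.d (fun g _ => 710 * (P.Z * g)) (fun g s' => s'.v .id = nid P.nb (P.d + 1 - g) 0 ∧
    s'.v .lim = P.nb * 2 ^ (P.d - g) ∧ SameTree a s'.a ∧
    Classes P rs re a (s'.a .T2) (nid P.nb (P.d + 1 - g) 0)) (by omega) rfl ?_
    (fun g hg s' hI hA hz => ?_) (fun g hg s' ⟨hid1, hlim1, hs1, hC1⟩ hA hz => ?_)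
    (fun s1 ⟨hid1, hlim1, hs1, hC1⟩ hA hz ht => ?_)
  · refine ⟨by simpa using hid, by simpa [Par.Z, Par.B] using hlim, fun A _ => by simp [ha], fun l hl j hj hle => ?_⟩
    have := nid_lt (nb := P.nb) (j := 0) (show l + 1 < P.d + 1 - 0 by omega) hj
    omega
  · have h1 : s'.v .d = P.d := by rw [hA.v .d rfl]; simpa using hS.d
    simp [h1]
  · obtain ⟨l, hlg⟩ : ∃ l, l + 1 = P.d - g := ⟨P.d - g - 1, by omega⟩
    have hl : l < P.d := by omega
    obtain ⟨w, hw⟩ : ∃ w, w = P.nb * 2 ^ (l + 1) := ⟨_, rfl⟩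
    obtain ⟨L, hL⟩ : ∃ L, L = 2 ^ (P.d - (l + 1)) := ⟨_, rfl⟩
    have hL0 : 0 < L := by rw [hL]; exact Nat.two_pow_pos _
    have hLL : 2 ^ (P.d - l) = 2 * L := by
      rw [hL, show P.d - l = P.d - (l + 1) + 1 by omega, pow_succ, mul_comm]
    have hlev := P.level (show l + 1 ≤ P.d from hl)
    rw [← hw, ← hL] at hlev
    have hwZ : w ≤ P.Z := by rw [← hlev]; exact Nat.le_mul_of_pos_right _ hL0
    have hBL : 2 * L ≤ P.B := by
      rw [← hLL]
      exact Nat.pow_le_pow_right (by norm_num) (by omega)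
    have hB := P.B_lt
    have hend : nid P.nb (P.d + 1 - g) 0 = nid P.nb (l + 1) w := by
      rw [hw, nid_end]
      congr 1
      omega
    rw [hend] at hid1 hC1
    rw [← hlg, ← hw] at hlim1
    have hSs : Setup P s'.v := hS.agree hA rfl
    simp only [wp_seq]
    refine wp_for w (fun j _ => 705 * (j * L)) (fun j s' => s'.v .id = nid P.nb (l + 1) (w - j) ∧
      SameTree a s'.a ∧ Classes P rs re a (s'.a .T2) (nid P.nb (l + 1) (w - j))) (by omega) rfl ?_
      (fun j hj s2 hI hA2 hz2 => ?_) (fun j hj s2 ⟨hid2, hs2, hC2⟩ hA2 hz2 => ?_)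
      (fun s2 ⟨hid2, hs2, hC2⟩ hA2 hz2 ht2 => ?_)
    · exact ⟨by simpa using hid1, by simpa using hs1, by simpa using hC1⟩
    · have h1 : s2.v .lim = w := by rw [hA2.v .lim rfl]; simpa using hlim1
      simp [h1]
    · have g2 : s2.v .nb = P.nb := by rw [hA2.v .nb rfl]; simpa using hSs.nb
      obtain ⟨i, hi⟩ : ∃ i, i = w - (j + 1) := ⟨_, rfl⟩
      have hi' : i < P.nb * 2 ^ (l + 1) := by omega
      have hij : w - j = i + 1 := by omega
      rw [hij] at hid2 hC2
      have hidv : nid P.nb (l + 1) (i + 1) - 1 = nid P.nb (l + 1) i := rfl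
      have hjL : (j + 1) * L = j * L + L := by ring
      have hlt := P.nid_lt (show l + 1 ≤ P.d from hl) hi'
      have hiN : nid P.nb (l + 1) i < nid P.nb (P.d + 1) 0 := nid_lt (by omega) hi'
      have hi2 : i / 2 < P.nb * 2 ^ l := by
        rw [pow_succ, ← mul_assoc] at hi'
        omega
      have hpl := nid_parent_lt hi'
      have hlink := hT.link l hl i hi' hiN
      have hnode := hT.node (l + 1) hl i hi' hiN
      have hnodep := hT.node l hl.le (i / 2) hi2 (by omega)
      have hA4 := hnode.nA_le
      have hk8 := hnodep.nA_le
      rw [hLL] at hk8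
      rw [← hL] at hA4
      have hlle := hlink.le
      have hch : (∀ b < 2, ∀ x < a .nA (nid P.nb (l + 1) i),
          a .mb (2 * nid P.nb (l + 1) i + P.nb + b) + x < mp ∧
          s2.a .T2 (a .mb (2 * nid P.nb (l + 1) i + P.nb + b) + x) < 2 * a .nA (nid P.nb (l + 1) i)) ∧
        (∀ x < a .nA (nid P.nb (l + 1) i), ∀ y < a .nA (nid P.nb (l + 1) i),
          (s2.a .T2 (a .mb (2 * nid P.nb (l + 1) i + P.nb) + x) =
              s2.a .T2 (a .mb (2 * nid P.nb (l + 1) i + P.nb) + y) ∧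
            s2.a .T2 (a .mb (2 * nid P.nb (l + 1) i + P.nb + 1) + x) =
              s2.a .T2 (a .mb (2 * nid P.nb (l + 1) i + P.nb + 1) + y) ↔
          ∀ τ, i * 2 ^ (P.d - (l + 1)) ≤ τ → τ < i * 2 ^ (P.d - (l + 1)) + 2 ^ (P.d - (l + 1)) →
            EqvGen (NRel rs re a (nid P.nb (l + 1) i) τ) x y)) ∧
        (0 < a .nA (nid P.nb (l + 1) i) → 2 * nid P.nb (l + 1) i + P.nb + 1 < E.N) := by
        -- For an inner node the entries of both children are ready, as their numbers are larger. A
        -- leaf has no vertices, and everything is vacuous.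
        rcases Nat.lt_or_ge (l + 1) P.d with h | h
        · have h1 := hC2.children hT h hi' (Nat.succ_le_of_lt (nid_lt (Nat.lt_succ_self _) hi'))
          refine ⟨h1.1, h1.2, fun _ => ?_⟩
          have h2 : 2 * i + 1 < P.nb * 2 ^ (l + 1 + 1) := by
            rw [pow_succ, ← mul_assoc]
            omega
          have h3 := P.nid_lt (show l + 1 + 1 ≤ P.d from h) h2
          rw [nid_double] at h3
          omega
        · have hdl : P.d = l + 1 := by omega
          have h0 := hT.leaf_nA (j := i) (by omega) (by rwa [hdl])
          rw [hdl] at h0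
          rw [h0]
          exact ⟨by omega, by omega, by omega⟩
      simp only [wp_seq, wp_assign]
      simp [hid2, hidv]
      refine ⟨by omega, ?_⟩
      refine wp_mono (classNode_spec (a₀ := a) (z := nid P.nb (l + 1) i)
        (c := 2 * nid P.nb (l + 1) i + P.nb) (nb := P.nb)
        (p := nid P.nb l (i / 2)) (b := a .mb (nid P.nb (l + 1) i)) (k := a .nA (nid P.nb l (i / 2)))
        (A := a .nA (nid P.nb (l + 1) i)) hE (by simpa using hs2) (by simp) (by simpa using g2) rfl
        (nid_parent _ _ _) rfl rfl rfl (by omega) (by omega) hch.2.2 (by omega) (by omega) (by omega)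
        (by omega) (fun x hx => ?_) (fun x hx => ?_)) fun s3 ⟨ht3, hout3, rep, hrep, hT3⟩ hA3 => ?_
      · have := hch.1 0 (by omega) x hx
        exact ⟨this.1.trans hmp, this.2⟩
      · have := hch.1 1 (by omega) x hx
        exact ⟨this.1.trans hmp, this.2⟩
      · have h1 : s3.v .id = nid P.nb (l + 1) i := by rw [hA3.v .id rfl]; simp
        have h2 : SameTree a s3.a := SameTree.agree (s := s2.tick.set .id (nid P.nb (l + 1) i))
          (by simpa using hs2) hA3 rfl
        simp only [St.set_a, St.tick_a, St.set_time, St.tick_time] at ht3 hout3 hrep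
        simp [h1, ← hi]
        refine ⟨⟨h2, ?_⟩, by omega⟩
        refine Classes.step hl hi' hC2 hT hout3 (ClassOk.combine hnode hlink (by
          have := Nat.two_pow_pos (P.d - (l + 1))
          omega) (rep := rep) (fun x hx => ⟨(hrep x hx).1, fun y hy => ?_⟩) hT3)
        rw [(hrep x hx).2 y hy]
        exact hch.2.1 x hx y hy
    · have h1 : s2.v .lim = w := by rw [hA2.v .lim rfl]; simpa using hlim1
      have h2 : P.d - g = l + 1 := hlg.symm
      have h3 : w / 2 = P.nb * 2 ^ (P.d - (g + 1)) := by
        rw [hw, show P.d - (g + 1) = l by omega, pow_succ, ← mul_assoc]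
        omega
      have h4 : P.Z * (g + 1) = P.Z * g + P.Z := by ring
      rw [Nat.sub_self] at hid2 hC2
      rw [hlev] at ht2
      simp only [St.tick_time, Nat.zero_mul, Nat.mul_zero, Nat.add_zero] at ht2
      simp [h1, h2, h3, hid2, hC2]
      exact ⟨by omega, hs2, by omega⟩
  · have h1 : nid P.nb (P.d + 1 - P.d) 0 = P.nb := by
      rw [show P.d + 1 - P.d = 1 by omega]
      simp [nid]
    rw [h1] at hC1
    simp only [St.tick_time, St.tick_a] at ht ⊢
    refine ⟨by simp at ht; omega, hs1, fun l hl j hj _ => hC1 l hl j hj (le_nid _ _ _)⟩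

end

/-! ### Counting the blocks in which two vertices are not always connected -/

section
variable {E : Env} {P : Par E} {s : St} {rs re : ℕ → ℕ}

/-- `u` and `w` are connected during all of block `b`. -/
def Solid (P : Par E) (rs re : ℕ → ℕ) (a : Arr → ℕ → ℕ) (b u w : ℕ) : Prop :=
  ∀ i, b * P.B ≤ i → i < b * P.B + P.B → EqvGen (NRel rs re a b i) u w

open Classical in
/-- `T` counts, for blocks `i ≥ i₀`, the later blocks that are not solid. -/
def TotOk (P : Par E) (rs re : ℕ → ℕ) (a : Arr → ℕ → ℕ) (T : ℕ → ℕ) (i₀ : ℕ) : Prop :=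
  ∀ i, i₀ ≤ i → i ≤ P.nb → ∀ u < P.n, ∀ w < P.n, T (i * (P.n * P.n) + (u * P.n + w)) =
    ∑ b ∈ Finset.Ico i P.nb, if Solid P rs re a b u w then 0 else 1

/-- The difference of two suffix sums counts the blocks in between that are not solid. -/
theorem TotOk.iff {a : Arr → ℕ → ℕ} {T : ℕ → ℕ} {i i' u w : ℕ} (h : TotOk P rs re a T 1) (hi : 1 ≤ i)
    (hii : i ≤ i') (hi' : i' ≤ P.nb) (hu : u < P.n) (hw : w < P.n) :
    T (i * (P.n * P.n) + (u * P.n + w)) = T (i' * (P.n * P.n) + (u * P.n + w)) ↔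
      ∀ b, i ≤ b → b < i' → Solid P rs re a b u w := by
  classical
  rw [h i hi (hii.trans hi') u hu w hw, h i' (hi.trans hii) hi' u hu w hw,
    ← Finset.sum_Ico_consecutive _ hii hi', Nat.add_eq_right, Finset.sum_eq_zero_iff]
  simp only [Finset.mem_Ico, ite_eq_left_iff, one_ne_zero, imp_false, not_not, and_imp]

theorem TotOk.le {a : Arr → ℕ → ℕ} {T : ℕ → ℕ} {i₀ i u w : ℕ} (h : TotOk P rs re a T i₀) (hi : i₀ ≤ i)
    (hi' : i ≤ P.nb) (hu : u < P.n) (hw : w < P.n) : T (i * (P.n * P.n) + (u * P.n + w)) ≤ P.nb := by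
  classical
  rw [h i hi hi' u hu w hw]
  refine (Finset.sum_le_card_nsmul _ _ 1 fun b _ => by split_ifs <;> simp).trans ?_
  simp

theorem pair_lt {n u w : ℕ} (hu : u < n) (hw : w < n) : u * n + w < n * n := by
  have : (u + 1) * n ≤ n * n := Nat.mul_le_mul_right _ hu
  rw [Nat.succ_mul] at this
  omega

theorem TotOk.step {a : Arr → ℕ → ℕ} {T T' rep : ℕ → ℕ} {b : ℕ} (h : TotOk P rs re a T (b + 1))
    (hb : b < P.nb)
    (hr : ∀ u < P.n, ∀ w < P.n, (rep u = rep w ↔ Solid P rs re a b u w))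
    (hT : ∀ x, T' x = if b * (P.n * P.n) ≤ x ∧ x < b * (P.n * P.n) + P.n * P.n then
      T (x + P.n * P.n) + (if rep ((x - b * (P.n * P.n)) / P.n) =
        rep ((x - b * (P.n * P.n)) % P.n) then 0 else 1) else T x) : TotOk P rs re a T' b := by
  classical
  intro i hi hi' u hu w hw
  have hp := pair_lt hu hw
  have hn := P.hn
  rw [hT]
  rcases hi.lt_or_eq with h1 | rfl
  · have h2 : (b + 1) * (P.n * P.n) ≤ i * (P.n * P.n) := Nat.mul_le_mul_right _ h1
    rw [Nat.succ_mul] at h2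
    rw [if_neg (by omega)]
    exact h i h1 hi' u hu w hw
  · rw [if_pos (by omega), Finset.sum_eq_sum_Ico_succ_bot hb, ← h (b + 1) le_rfl hb u hu w hw]
    have h2 : (b + 1) * (P.n * P.n) = b * (P.n * P.n) + P.n * P.n := Nat.succ_mul _ _
    have h3 : (u * P.n + w) / P.n = u := by
      rw [mul_comm, Nat.mul_add_div (by omega), Nat.div_eq_of_lt hw, add_zero]
    have h4 : (u * P.n + w) % P.n = w := by
      rw [mul_comm, Nat.mul_add_mod, Nat.mod_eq_of_lt hw]
    rw [Nat.add_sub_cancel_left, h3, h4, h2, add_right_comm, add_comm]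
    simp only [hr u hu w hw]

/-- Compute `tot`, from the last block downwards. -/
def totals : Cmd :=
  .for .sl (v .nb - lit 1) (.id ::= v .nb - lit 1 - v .sl ;; nameNode ;;
    .for .e (v .n * v .n) (.q ::= v .e / v .n ;; .x ::= rd .rep (v .q) ;;
      .y ::= rd .rep (v .e - v .q * v .n) ;; .base ::= v .id * (v .n * v .n) + v .e ;;
      .r ::= rd .tot (v .base + v .n * v .n) ;;
      .ite (lit 0) ((v .x - v .y) + (v .y - v .x)) (.r ::= v .r + lit 1) .skip ;;
      .store .tot (v .base) (v .r)))

/-- The loop body is reached only if there are at least two blocks. Then `n * n ≤ B`, so a block can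
pay for a row of the table. Row `0` is not needed, since the first block never lies strictly between
two others. -/
theorem totals_spec (hS : Setup P s.v) {a : Arr → ℕ → ℕ} {rp mp : ℕ}
    (hT : Tree P rs re a (nid P.nb (P.d + 1) 0) rp mp) (hs : SameTree a s.a)
    (hC : Classes P rs re a (s.a .T2) 0) (hmp : mp < E.N) (h0 : ∀ x, s.a .tot x = 0) :
    wp E totals (fun s' => s'.time ≤ s.time + 300 * P.Z ∧ TotOk P rs re a (s'.a .tot) 1) s := by
  have hE := P.hE
  have htN := P.tN
  have hn := P.hn
  have hnt := P.hnt
  have hZ := P.Z_lt'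
  have hnb := P.nb_le
  have hnb0 := P.nb_pos
  have hB0 := P.B_pos
  have hnB := P.n_le_B
  obtain ⟨nn, hnn⟩ : ∃ nn, nn = P.n * P.n := ⟨_, rfl⟩
  have hZe : P.Z = (P.nb - 1) * P.B + P.B := by
    rw [← Nat.succ_mul, Nat.succ_eq_add_one, Nat.sub_add_cancel hnb0]
    rfl
  have hBZ : P.B ≤ P.Z := by omega
  refine wp_for (P.nb - 1) (fun g _ => 240 * (g * P.B)) (fun g s' =>
    TotOk P rs re a (s'.a .tot) (P.nb - g)) (by omega) rfl ?_
    (fun g hg s' hI hA hz => ?_) (fun g hg s' hI hA hz => ?_)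
    (fun s1 hI hA hz ht => ?_)
  · intro i h1 h2 u hu w hw
    -- The row behind the last block is never written; it consists of the zeros of the initial
    -- memory, which are the correct empty sums.
    obtain rfl : i = P.nb := by omega
    simp [h0]
  · have h1 : s'.v .nb = P.nb := by rw [hA.v .nb rfl]; simpa using hS.nb
    simp [h1]
    omega
  · have hSs : Setup P s'.v := hS.agree hA rfl
    have hnnB := P.sq_le_B (by omega)
    rw [← hnn] at hnnB
    obtain ⟨b, hb⟩ : ∃ b, b = P.nb - 1 - g := ⟨_, rfl⟩
    have hbn : P.nb - g = b + 1 := by omega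
    have hbn' : P.nb - (g + 1) = b := by omega
    -- The entries of a root are read off its children, so the trees must not consist of roots
    -- alone.
    have hd : 0 < P.d := by
      rcases Nat.eq_zero_or_pos P.d with h | h
      · have h1 : P.B = 1 := by simp [Par.B, h]
        have : P.n * 2 ≤ P.n * P.n := Nat.mul_le_mul_left _ hn
        omega
      · exact h
    have hs1 : SameTree a s'.a := hs.agree hA rfl
    have hT2 : s'.a .T2 = s.a .T2 := by rw [hA.a .T2 rfl]
    have hnA := hT.root b (by omega)
    have hch := hC.children hT (l := 0) hd (j := b) (by rw [pow_zero, mul_one]; omega) (Nat.zero_le _)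
    simp only [nid_zero, hnA, Nat.sub_zero] at hch
    simp only [wp_seq, wp_assign]
    simp [hSs.nb, hz, ← hb]
    refine ⟨by omega, ?_⟩
    refine wp_mono (nameNode_spec (a₀ := a) (z := b) (c := 2 * b + P.nb) (A := P.n) (nb := P.nb) hE
      (by simpa using hs1) (by simp) (by simpa using hSs.nb) rfl hnA (by omega) (fun _ => by omega)
      (by omega) (by omega)
      (fun x hx => ?_) (fun x hx => ?_)) fun s2 ⟨ht2, _, hr2⟩ hA2 => ?_
    · have := hch.1 0 (by omega) x hx
      simp [hT2]
      exact ⟨this.1.trans hmp, this.2⟩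
    · have := hch.1 1 (by omega) x hx
      simp [hT2]
      exact ⟨this.1.trans hmp, this.2⟩
    have hS2 : Setup P s2.v := (Setup.set (s := s'.tick) hSs (x := .id) (by decide)).agree hA2 rfl
    have hid : s2.v .id = b := by rw [hA2.v .id rfl]; simp
    have htot : s2.a .tot = s'.a .tot := by rw [hA2.a .tot rfl]; simp
    rw [hbn] at hI
    rw [hbn']
    obtain ⟨rep, hrep⟩ : ∃ rep, rep = s2.a .rep := ⟨_, rfl⟩
    rw [← hrep] at hr2
    simp only [St.set_time, St.tick_time, St.set_a, St.tick_a, hT2] at ht2 hr2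
    obtain ⟨bn, hbnn⟩ : ∃ bn, bn = b * nn := ⟨_, rfl⟩
    have hbnZ : bn + 2 * nn ≤ P.Z + P.B := by
      have h1 : (b + 1) * nn ≤ P.nb * P.B := Nat.mul_le_mul (by omega) hnnB
      rw [Nat.succ_mul, ← hbnn] at h1
      have h2 : P.Z = P.nb * P.B := rfl
      omega
    have hBt := P.B_lt
    refine wp_for nn (fun j _ => 12 * j) (fun j s3 => ∀ x, s3.a .tot x =
      if bn ≤ x ∧ x < bn + j then s'.a .tot (x + nn) + (if rep ((x - bn) / P.n) =
        rep ((x - bn) % P.n) then 0 else 1) else s'.a .tot x) (by omega) rfl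
      (fun x => ?_) (fun j hj s3 hI3 hA3 hz3 => ?_) (fun j hj s3 hI3 hA3 hz3 => ?_)
      (fun s3 hI3 hA3 hz3 ht3 => ?_)
    · simp [htot]
    · have hS3 : Setup P s3.v := hS2.agree hA3 rfl
      simp [hS3.n, ← hnn]
      omega
    · have hS3 : Setup P s3.v := hS2.agree hA3 rfl
      have f1 : s3.v .id = b := by rw [hA3.v .id rfl]; simpa
      have f2 : s3.a .rep = rep := by rw [hA3.a .rep rfl]; simp [hrep]
      have hq : j / P.n < P.n := by
        rw [Nat.div_lt_iff_lt_mul (by omega), ← hnn]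
        exact hj
      have hr : j - j / P.n * P.n = j % P.n := by rw [mul_comm, Nat.mod_eq_sub_mul_div]
      have hr' := Nat.mod_lt j (show 0 < P.n by omega)
      have hqle := Nat.div_mul_le_self j P.n
      have hrd : s3.a .tot (bn + j + nn) = s'.a .tot (bn + j + nn) := by
        rw [hI3, if_neg (by omega)]
      have hle : s'.a .tot (bn + j + nn) ≤ P.nb := by
        have := hI.le le_rfl (by omega) hq hr'
        rw [← hnn, Nat.succ_mul, ← hbnn, ← hr] at this
        rwa [show bn + nn + (j / P.n * P.n + (j - j / P.n * P.n)) = bn + j + nn by omega] at this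
      have hfin : ∀ z, z = s'.a .tot (bn + j + nn) + (if rep (j / P.n) = rep (j % P.n) then 0 else 1) →
          ∀ x, upd (s3.a .tot) (bn + j) z x = if bn ≤ x ∧ x < bn + (j + 1) then s'.a .tot (x + nn) +
            (if rep ((x - bn) / P.n) = rep ((x - bn) % P.n) then 0 else 1) else s'.a .tot x := by
        rintro _ rfl x
        by_cases hx : x = bn + j
        · subst hx
          rw [upd_self, if_pos (show bn ≤ bn + j ∧ bn + j < bn + (j + 1) by omega), Nat.add_sub_cancel_left]
        · rw [upd_of_ne hx, hI3]
          by_cases h1 : bn ≤ x ∧ x < bn + j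
          · rw [if_pos h1, if_pos (show bn ≤ x ∧ x < bn + (j + 1) by omega)]
          · rw [if_neg h1, if_neg (show ¬ (bn ≤ x ∧ x < bn + (j + 1)) by omega)]
      have hrl := (hr2 (j / P.n) hq).1
      have hrl' := (hr2 (j % P.n) hr').1
      simp only [wp_seq, wp_assign]
      by_cases h : rep (j / P.n) = rep (j % P.n)
      · simp [hz3, f1, f2, hS3.n, ← hnn, ← hbnn, hr, hrd, h]
        and_intros <;> first | omega | skip
        simpa using hfin _ (by rw [if_pos h, add_zero])
      -- The absolute difference, written with truncated subtraction, is how the program tests for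
      -- inequality.
      · have h' : 0 < (rep (j / P.n) - rep (j % P.n)) + (rep (j % P.n) - rep (j / P.n)) := by omega
        rw [wp_ite]
        simp [hz3, f1, f2, hS3.n, ← hnn, ← hbnn, hr, hrd]
        and_intros <;> first | omega | skip
        · intro _
          and_intros <;> first | omega | skip
          simpa using hfin _ (by rw [if_neg h])
    · refine ⟨?_, ?_⟩
      · refine hI.step (rep := rep) (by omega) (fun u hu w hw => ?_) (fun x => ?_)
        · rw [(hr2 u hu).2 w hw]
          exact hch.2 u hu w hw
        · rw [← hnn, ← hbnn]
          exact hI3 x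
      · have h1 : (g + 1) * P.B = g * P.B + P.B := Nat.succ_mul _ _
        simp only [St.tick_time, St.set_time] at *
        omega
  · rw [show P.nb - (P.nb - 1) = 1 by omega] at hI
    simp only [St.tick_time, St.tick_a] at *
    exact ⟨by omega, hI⟩

end

/-! ### Decomposing an interval along two paths in a binary tree -/

/-- The dyadic interval of length `2 ^ s` that contains `i` is a sibling of the one that contains `z`,
and it is contained in `[a, b]`. -/
def Sib (a b z s i : ℕ) : Prop :=
  i / 2 ^ (s + 1) = z / 2 ^ (s + 1) ∧ i / 2 ^ s ≠ z / 2 ^ s ∧ a ≤ i / 2 ^ s * 2 ^ s ∧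
    (i / 2 ^ s + 1) * 2 ^ s ≤ b + 1

/-- `i` is covered by a sibling of length at least `2 ^ s₀` of a node on the path to `z`. -/
def Hang (a b z d s₀ i : ℕ) : Prop := ∃ s, s₀ ≤ s ∧ s < d ∧ Sib a b z s i

theorem Hang.mem {a b z d s₀ i : ℕ} (h : Hang a b z d s₀ i) : a ≤ i ∧ i ≤ b := by
  obtain ⟨s, _, _, _, _, h1, h2⟩ := h
  have h3 := Nat.div_mul_le_self i (2 ^ s)
  have h4 := Nat.lt_div_mul_add (a := i) (Nat.two_pow_pos s)
  rw [Nat.succ_mul] at h2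
  omega

theorem hang_succ {a b z d s i : ℕ} (hs : s < d) :
    Hang a b z d s i ↔ Hang a b z d (s + 1) i ∨ Sib a b z s i := by
  constructor
  · rintro ⟨s', h1, h2, h3⟩
    rcases h1.lt_or_eq with h | rfl
    · exact .inl ⟨s', h, h2, h3⟩
    · exact .inr h3
  · rintro (⟨s', h1, h2, h3⟩ | h)
    · exact ⟨s', by omega, h2, h3⟩
    · exact ⟨s, le_rfl, hs, h⟩

/-- The least scale at which the dyadic intervals of `i` and `z` coincide; one scale below, the two
paths separate. -/
theorem exists_split {i z S : ℕ} (hne : i ≠ z) (h : i / 2 ^ S = z / 2 ^ S) :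
    ∃ s < S, i / 2 ^ (s + 1) = z / 2 ^ (s + 1) ∧ i / 2 ^ s ≠ z / 2 ^ s := by
  classical
  have hex : ∃ s, i / 2 ^ s = z / 2 ^ s := ⟨S, h⟩
  obtain ⟨s, hs⟩ : ∃ s, Nat.find hex = s + 1 := by
    refine Nat.exists_eq_succ_of_ne_zero fun h0 => hne ?_
    have := Nat.find_spec hex
    rw [h0] at this
    simpa using this
  refine ⟨s, ?_, ?_, ?_⟩
  · have := Nat.find_min' hex h
    omega
  · rw [← hs]
    exact Nat.find_spec hex
  · exact Nat.find_min hex (by omega)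

theorem block_start_le {i s S : ℕ} (h : s ≤ S) : i / 2 ^ S * 2 ^ S ≤ i / 2 ^ s * 2 ^ s := by
  obtain ⟨k, rfl⟩ := Nat.exists_eq_add_of_le h
  rw [pow_add, ← Nat.div_div_eq_div_mul, mul_comm (2 ^ s), ← mul_assoc]
  exact Nat.mul_le_mul_right _ (Nat.div_mul_le_self _ _)

theorem div_eq_of_le {i z s S : ℕ} (h : s ≤ S) (he : i / 2 ^ s = z / 2 ^ s) : i / 2 ^ S = z / 2 ^ S := by
  obtain ⟨k, rfl⟩ := Nat.exists_eq_add_of_le h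
  rw [pow_add, ← Nat.div_div_eq_div_mul, ← Nat.div_div_eq_div_mul, he]

/-- Where the paths to `i` and `b` separate, the interval of `i` lies to the left of that of `b`,
hence ends in time. It starts late enough because the larger interval around it does. -/
theorem hang_right {a b d i S : ℕ} (hS : S ≤ d) (hib : i < b) (he : i / 2 ^ S = b / 2 ^ S)
    (ha : a ≤ i / 2 ^ S * 2 ^ S) : Hang a b b d 0 i := by
  obtain ⟨s, hs, h1, h2⟩ := exists_split hib.ne he
  refine ⟨s, Nat.zero_le _, by omega, h1, h2, ha.trans (block_start_le hs.le), ?_⟩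
  have h3 : i / 2 ^ s < b / 2 ^ s := lt_of_le_of_ne (Nat.div_le_div_right hib.le) h2
  exact ((Nat.mul_le_mul_right _ h3).trans (Nat.div_mul_le_self _ _)).trans (Nat.le_succ _)

/-- Suppose that `i` is in the block of `a`, and consider the dyadic interval of `i` where the paths
to `i` and `a` separate. It begins after `a`. If it ends by `b`, it hangs off the path to `a`.
Otherwise it contains `b`, and inside it `i` hangs off the path to `b`. If `i` shares a block with
`b` but not with `a`, it hangs off the path to `b`; else its block is strictly between. -/
theorem interval_cover {a b d i : ℕ} (hai : a ≤ i) (hib : i ≤ b) :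
    i = a ∨ i = b ∨ Hang a b a d 0 i ∨ Hang a b b d 0 i ∨
      (a / 2 ^ d < i / 2 ^ d ∧ i / 2 ^ d < b / 2 ^ d) := by
  rcases hai.eq_or_lt with rfl | hai
  · exact .inl rfl
  rcases hib.eq_or_lt with rfl | hib
  · exact .inr (.inl rfl)
  refine .inr (.inr ?_)
  have start : ∀ s, a / 2 ^ s < i / 2 ^ s → a ≤ i / 2 ^ s * 2 ^ s := fun s hs => by
    have h1 := Nat.lt_div_mul_add (a := a) (Nat.two_pow_pos s)
    have h2 : (a / 2 ^ s + 1) * 2 ^ s ≤ i / 2 ^ s * 2 ^ s := Nat.mul_le_mul_right _ hs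
    rw [Nat.succ_mul] at h2
    omega
  have h1 : a / 2 ^ d ≤ i / 2 ^ d := Nat.div_le_div_right hai.le
  have h2 : i / 2 ^ d ≤ b / 2 ^ d := Nat.div_le_div_right hib.le
  rcases h1.eq_or_lt with h1 | h1
  · obtain ⟨s, hs, k1, k2⟩ := exists_split hai.ne' h1.symm
    have k3 : a / 2 ^ s < i / 2 ^ s := lt_of_le_of_ne (Nat.div_le_div_right hai.le) (Ne.symm k2)
    rcases le_or_gt ((i / 2 ^ s + 1) * 2 ^ s) (b + 1) with h | h
    · exact .inl ⟨s, Nat.zero_le _, hs, k1, k2, start s k3, h⟩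
    · refine .inr (.inl (hang_right hs.le hib ?_ (start s k3)))
      -- The interval of `i` reaches beyond `b`, so `b` lies in it.
      refine le_antisymm (Nat.div_le_div_right hib.le) (Nat.lt_succ_iff.1 ?_)
      rw [Nat.div_lt_iff_lt_mul (Nat.two_pow_pos s)]
      exact (Nat.lt_succ_self b).trans h
  · rcases h2.eq_or_lt with h2 | h2
    · exact .inr (.inl (hang_right le_rfl hib h2 (start d h1)))
    · exact .inr (.inr ⟨h1, h2⟩)

/-- The other child of the parent of `j`. -/
def sibling (j : ℕ) : ℕ := 2 * (j / 2) + (1 - j % 2)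

theorem sib_iff {a b z s i : ℕ} : Sib a b z s i ↔ i / 2 ^ s = sibling (z / 2 ^ s) ∧
    a ≤ sibling (z / 2 ^ s) * 2 ^ s ∧ sibling (z / 2 ^ s) * 2 ^ s + 2 ^ s ≤ b + 1 := by
  have h : i / 2 ^ (s + 1) = z / 2 ^ (s + 1) ∧ i / 2 ^ s ≠ z / 2 ^ s ↔
      i / 2 ^ s = sibling (z / 2 ^ s) := by
    rw [pow_succ, ← Nat.div_div_eq_div_mul, ← Nat.div_div_eq_div_mul, sibling]
    omega
  rw [Sib, ← and_assoc, h]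
  constructor
  · rintro ⟨h1, h2, h3⟩
    rw [h1] at h2 h3
    exact ⟨h1, h2, by rwa [Nat.succ_mul] at h3⟩
  · rintro ⟨h1, h2, h3⟩
    rw [h1]
    exact ⟨rfl, h2, by rwa [Nat.succ_mul]⟩

theorem div_two_pow_iff {i j s : ℕ} : i / 2 ^ s = j ↔ j * 2 ^ s ≤ i ∧ i < j * 2 ^ s + 2 ^ s := by
  rw [Nat.div_eq_iff (Nat.two_pow_pos s)]
  have := Nat.two_pow_pos s
  omega

/-! ### Queries -/

section
variable {E : Env} {P : Par E} {s : St} {rs re : ℕ → ℕ}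

/-- The data structure is complete. -/
structure Data (P : Par E) (rs re : ℕ → ℕ) (a : Arr → ℕ → ℕ) (rp mp : ℕ) : Prop where
  tree : Tree P rs re a (nid P.nb (P.d + 1) 0) rp mp
  classes : Classes P rs re a (a .T2) 0
  tot : TotOk P rs re a (a .tot) 1
  lt : mp < E.N

/-- On the interval of node `z`, `C` tells whether `x` and `y` are connected. -/
structure At (rs re : ℕ → ℕ) (a : Arr → ℕ → ℕ) (C : ℕ → Prop) (z lo L x y : ℕ) : Prop where
  x_lt : x < a .nA z
  y_lt : y < a .nA z
  iff : ∀ i, lo ≤ i → i < lo + L → (C i ↔ EqvGen (NRel rs re a z i) x y)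

/-- Go to the child whose interval contains `z`; `sb` is the other child, whose interval starts at
`sl`. -/
def child : Cmd :=
  .len ::= v .len / lit 2 ;; .id ::= lit 2 * v .id + v .nb ;;
  .ite (v .z) (v .lo + v .len)
    (.sb ::= v .id + lit 1 ;; .sl ::= v .lo + v .len)
    (.sb ::= v .id ;; .id ::= v .id + lit 1 ;; .sl ::= v .lo ;; .lo ::= v .lo + v .len)

theorem child_spec (hS : Setup P s.v) {l σ z : ℕ} (hd : P.d = l + 1 + σ) (hz : z < P.Z)
    (h1 : s.v .z = z) (h2 : s.v .id = nid P.nb l (z / 2 ^ (σ + 1)))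
    (h3 : s.v .lo = z / 2 ^ (σ + 1) * 2 ^ (σ + 1)) (h4 : s.v .len = 2 ^ (σ + 1)) :
    wp E child (fun s' => s'.time ≤ s.time + 10 ∧ s'.v .id = nid P.nb (l + 1) (z / 2 ^ σ) ∧
      s'.v .lo = z / 2 ^ σ * 2 ^ σ ∧ s'.v .len = 2 ^ σ ∧
      s'.v .sb = nid P.nb (l + 1) (sibling (z / 2 ^ σ)) ∧
      s'.v .sl = sibling (z / 2 ^ σ) * 2 ^ σ) s := by
  have hE := P.hE
  have htN := P.tN
  have hZ := P.Z_lt'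
  have hBt := P.B_lt
  have hnb := P.nb_le
  obtain ⟨L, hL⟩ : ∃ L, L = 2 ^ σ := ⟨_, rfl⟩
  have hL0 : 0 < L := by rw [hL]; exact Nat.two_pow_pos _
  have hLL : 2 ^ (σ + 1) = 2 * L := by rw [hL, pow_succ, mul_comm]
  obtain ⟨j, hj⟩ : ∃ j, j = z / 2 ^ σ := ⟨_, rfl⟩
  have hj2 : z / 2 ^ (σ + 1) = j / 2 := by rw [hj, pow_succ, Nat.div_div_eq_div_mul]
  obtain ⟨hj1, hj3⟩ := div_two_pow_iff.1 hj.symm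
  rw [← hL] at hj1 hj3
  have hLB : L ≤ P.B := by
    rw [hL]
    exact Nat.pow_le_pow_right (by norm_num) (by omega)
  have hjn : j < P.nb * 2 ^ (l + 1) := by
    have h5 := P.level (show l + 1 ≤ P.d by omega)
    rw [show P.d - (l + 1) = σ by omega, ← hL] at h5
    rw [← h5] at hz
    exact lt_of_mul_lt_mul_right (hj1.trans_lt hz) (Nat.zero_le _)
  have hidlt := P.nid_lt (show l + 1 ≤ P.d by omega) hjn
  rw [hj2, hLL] at h3
  rw [hj2] at h2
  rw [hLL] at h4
  rw [← hj, ← hL]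
  obtain ⟨q, hq⟩ : ∃ q, q = j / 2 := ⟨_, rfl⟩
  rw [← hq] at h2 h3
  have hd0 := nid_double P.nb l q 0
  simp only [Nat.add_zero] at hd0
  have hd1 := nid_double P.nb l q 1
  have e0 : 2 * q * L = q * (2 * L) := by ring
  have e1 : (2 * q + 1) * L = q * (2 * L) + L := by ring
  simp only [child, wp_seq, wp_assign]
  rcases Nat.mod_two_eq_zero_or_one j with hm | hm
  · have hjq : j = 2 * q := by omega
    have hsj : sibling j = 2 * q + 1 := by rw [sibling]; omega
    rw [hsj, hjq]
    rw [hjq] at hj1 hj3 hidlt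
    have hlt : z < q * (2 * L) + L := by omega
    simp [h1, h2, h3, h4, hS.nb, hlt, hlt.not_ge]
    and_intros <;> omega
  · have hjq : j = 2 * q + 1 := by omega
    have hsj : sibling j = 2 * q := by rw [sibling]; omega
    rw [hsj, hjq]
    rw [hjq] at hj1 hj3 hidlt
    have hge : q * (2 * L) + L ≤ z := by omega
    simp [h1, h2, h3, h4, hS.nb, hge, hge.not_gt]
    and_intros <;> omega

/-- If the interval of `sb` is contained in the queried interval, check it. -/
def checkSibling : Cmd :=
  -- With truncated subtraction the sum is `0` exactly if `qa ≤ sl` and `sl + len ≤ qb + 1`, that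
  -- is, if the sibling's interval lies in the queried one.
  .ite ((v .qa - v .sl) + (v .sl + v .len - (v .qb + lit 1))) (lit 1)
    (.cx ::= rd .T2 (rd .mb (v .sb) + v .x) ;; .cy ::= rd .T2 (rd .mb (v .sb) + v .y) ;;
      .ite (lit 0) ((v .cx - v .cy) + (v .cy - v .cx)) (.ok ::= lit 0) .skip) .skip

theorem checkSibling_spec {a b x y σ c len : ℕ} {ar : Arr → ℕ → ℕ} (hE : 100 * (E.N + 1) ≤ E.W)
    (har : s.a = ar) (ha : s.v .qa = a) (hb : s.v .qb = b) (hsl : s.v .sl = σ) (hsb : s.v .sb = c)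
    (hlen : s.v .len = len) (hx : s.v .x = x) (hy : s.v .y = y) (haN : a ≤ E.N) (hbN : b ≤ E.N) (hs : σ + len ≤ E.N)
    (hc : c < E.N) (h1 : ar .mb c + x < E.N) (h2 : ar .mb c + y < E.N)
    (h3 : ar .T2 (ar .mb c + x) ≤ E.N) (h4 : ar .T2 (ar .mb c + y) ≤ E.N)  (hok : s.v .ok ≤ 1) :
    wp E checkSibling (fun s' => s'.time ≤ s.time + 10 ∧ s'.v .ok ≤ 1 ∧ (s'.v .ok = 1 ↔ s.v .ok = 1 ∧
      (a ≤ σ → σ + len ≤ b + 1 → ar .T2 (ar .mb c + x) = ar .T2 (ar .mb c + y)))) s := by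
  rw [checkSibling, wp_ite]
  simp [har, ha, hb, hsl, hsb, hlen, hx, hy]
  and_intros <;> omega

/-- Go down in the mappings; stop if one of the vertices is isolated from now on. -/
def descend : Cmd :=
  .r ::= rd .mb (v .id) ;; .x ::= rd .mq (v .r + v .x) ;; .y ::= rd .mq (v .r + v .y) ;;
  -- `x + (y - x)` with truncated subtraction is the maximum of `x` and `y`.
  .ite (v .x + (v .y - v .x)) (rd .nA (v .id)) .skip
    (.run ::= lit 0 ;; .ite (lit 0) ((v .x - v .y) + (v .y - v .x)) (.ok ::= lit 0) .skip)

theorem descend_spec {x y z x' y' : ℕ} {ar : Arr → ℕ → ℕ} (hE : 100 * (E.N + 1) ≤ E.W)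
    (har : s.a = ar) (hz : s.v .id = z) (hx : s.v .x = x) (hy : s.v .y = y) (hzN : z < E.N)
    (h1 : ar .mb z + x < E.N) (h2 : ar .mb z + y < E.N) (hx' : ar .mq (ar .mb z + x) = x')
    (hy' : ar .mq (ar .mb z + y) = y') (h3 : x' ≤ E.N) (h4 : y' ≤ E.N) (hok : s.v .ok ≤ 1) :
    wp E descend (fun s' => s'.time ≤ s.time + 10 ∧ s'.v .ok ≤ 1 ∧
      ((x' < ar .nA z ∧ y' < ar .nA z ∧ s'.v .run = s.v .run ∧ s'.v .x = x' ∧ s'.v .y = y' ∧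
          s'.v .ok = s.v .ok) ∨
        ((ar .nA z ≤ x' ∨ ar .nA z ≤ y') ∧ s'.v .run = 0 ∧
          (s'.v .ok = 1 ↔ s.v .ok = 1 ∧ x' = y')))) s := by
  simp only [descend, wp_seq, wp_assign]
  rw [wp_ite, wp_seq, wp_assign, wp_ite]
  simp [har, hz, hx, hy, hx', hy']
  and_intros <;> omega

end

section
variable {E : Env} {P : Par E} {s : St} {rs re : ℕ → ℕ}

def level : Cmd := child ;; checkSibling ;; descend

/-- The node of level `l` on the path to `z`. -/
def pathNode (P : Par E) (z l : ℕ) : ℕ := nid P.nb l (z / 2 ^ (P.d - l))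

def PathAt (P : Par E) (rs re : ℕ → ℕ) (a : Arr → ℕ → ℕ) (C : ℕ → Prop) (z l x y : ℕ) : Prop :=
  At rs re a C (pathNode P z l) (z / 2 ^ (P.d - l) * 2 ^ (P.d - l)) (2 ^ (P.d - l)) x y

theorem Par.div_lt (P : Par E) {z l : ℕ} (hz : z < P.Z) (hl : l ≤ P.d) :
    z / 2 ^ (P.d - l) < P.nb * 2 ^ l := by
  rw [Nat.div_lt_iff_lt_mul (Nat.two_pow_pos _), P.level hl]
  exact hz

/-- The sibling is checked with the names that the two vertices have in the parent. Afterwards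
either both have names in the child and the walk goes on, or one of them is isolated there. In the
latter case `C` is constant on the child's interval, which contains `z`, so its value at `z` settles
everything below. -/
theorem level_spec (hS : Setup P s.v) {a : Arr → ℕ → ℕ} {rp mp : ℕ} (hD : Data P rs re a rp mp)
    {C : ℕ → Prop} {l σ z x y qa qb : ℕ} (hd : P.d = l + 1 + σ) (hz : z < P.Z) (har : s.a = a)
    (h1 : s.v .z = z) (h2 : s.v .id = pathNode P z l)
    (h3 : s.v .lo = z / 2 ^ (σ + 1) * 2 ^ (σ + 1)) (h4 : s.v .len = 2 ^ (σ + 1))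
    (hx : s.v .x = x) (hy : s.v .y = y) (hat : PathAt P rs re a C z l x y)
    (hqa : s.v .qa = qa) (hqb : s.v .qb = qb) (haN : qa ≤ E.N) (hbN : qb ≤ E.N)
    (hok : s.v .ok ≤ 1) :
    wp E level (fun s' => s'.time ≤ s.time + 30 ∧ s'.v .ok ≤ 1 ∧
      s'.v .id = pathNode P z (l + 1) ∧ s'.v .lo = z / 2 ^ σ * 2 ^ σ ∧ s'.v .len = 2 ^ σ ∧
      ((s'.v .run = s.v .run ∧ PathAt P rs re a C z (l + 1) (s'.v .x) (s'.v .y) ∧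
          (s'.v .ok = 1 ↔ s.v .ok = 1 ∧ ∀ i, Sib qa qb z σ i → C i)) ∨
        (s'.v .run = 0 ∧ (C z → ∀ i, i / 2 ^ σ = z / 2 ^ σ → C i) ∧
          (s'.v .ok = 1 ↔ s.v .ok = 1 ∧ (∀ i, Sib qa qb z σ i → C i) ∧ C z)))) s := by
  have hE := P.hE
  have htN := P.tN
  have hZ := P.Z_lt'
  have hBt := P.B_lt
  have hlt := hD.lt
  have hdl : P.d - l = σ + 1 := by omega
  have hdl1 : P.d - (l + 1) = σ := by omega
  have hT := hD.tree
  obtain ⟨j, hj⟩ : ∃ j, j = z / 2 ^ σ := ⟨_, rfl⟩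
  obtain ⟨p, hp⟩ : ∃ p, p = pathNode P z l := ⟨_, rfl⟩
  have hjl : j < P.nb * 2 ^ (l + 1) := by
    have := P.div_lt hz (show l + 1 ≤ P.d by omega)
    rwa [hdl1, ← hj] at this
  have hj2 : z / 2 ^ (σ + 1) = j / 2 := by rw [hj, pow_succ, Nat.div_div_eq_div_mul]
  have hp' : p = nid P.nb l (j / 2) := by rw [hp, pathNode, hdl, hj2]
  have hc' : pathNode P z (l + 1) = nid P.nb (l + 1) j := by rw [pathNode, hdl1, ← hj]
  have hsl : sibling j < P.nb * 2 ^ (l + 1) := by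
    rw [pow_succ, ← mul_assoc] at hjl ⊢
    rw [sibling]
    omega
  have hs2 : sibling j / 2 = j / 2 := by
    rw [sibling]
    omega
  have hlinkc := hT.link l (by omega) j hjl (nid_lt (by omega) hjl)
  have hlinks := hT.link l (by omega) _ hsl (nid_lt (by omega) hsl)
  have hcls := hD.classes l (by omega) _ hsl (Nat.zero_le _)
  have hj2l : j / 2 < P.nb * 2 ^ l := by
    rw [pow_succ, ← mul_assoc] at hjl
    omega
  have hNp := hT.node l (by omega) (j / 2) hj2l (nid_lt (by omega) hj2l)
  have hNc := hT.node (l + 1) (by omega) j hjl (nid_lt (by omega) hjl)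
  have hidc := P.nid_lt (show l + 1 ≤ P.d by omega) hjl
  have hids := P.nid_lt (show l + 1 ≤ P.d by omega) hsl
  rw [hdl1] at hlinkc hlinks hcls
  rw [hs2, ← hp'] at hlinks hcls
  rw [← hp'] at hlinkc hNp
  unfold PathAt at hat
  rw [← hp, hdl, hj2] at hat
  have hLL : 2 ^ (σ + 1) = 2 * 2 ^ σ := by rw [pow_succ, mul_comm]
  have hLB : 2 ^ (σ + 1) ≤ P.B := Nat.pow_le_pow_right (by norm_num) (by omega)
  have hA4 := hNp.nA_le
  rw [hdl] at hA4
  have hsZ : sibling j * 2 ^ σ + 2 ^ σ ≤ P.Z := by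
    have h5 := P.level (show l + 1 ≤ P.d by omega)
    rw [hdl1] at h5
    rw [← h5, ← Nat.succ_mul]
    exact Nat.mul_le_mul_right _ hsl
  have hxl := hat.x_lt
  have hyl := hat.y_lt
  have hlec := hlinkc.le
  have hles := hlinks.le
  have hx'l := hlinkc.lt x hxl
  have hy'l := hlinkc.lt y hyl
  have hpar : ∀ k, k / 2 = j / 2 → ∀ i, i / 2 ^ σ = k →
      (C i ↔ EqvGen (NRel rs re a p i) x y) := fun k hk i hi => by
    have : i / 2 ^ (σ + 1) = j / 2 := by rw [pow_succ, ← Nat.div_div_eq_div_mul, hi, hk]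
    obtain ⟨k1, k2⟩ := div_two_pow_iff.1 this
    exact hat.iff i k1 k2
  have hsib : (qa ≤ sibling j * 2 ^ σ → sibling j * 2 ^ σ + 2 ^ σ ≤ qb + 1 →
      a .T2 (a .mb (nid P.nb (l + 1) (sibling j)) + x) =
        a .T2 (a .mb (nid P.nb (l + 1) (sibling j)) + y)) ↔ ∀ i, Sib qa qb z σ i → C i := by
    rw [(hcls x hxl).2 y hyl]
    constructor
    · intro h i hi
      rw [sib_iff, ← hj] at hi
      obtain ⟨k1, k2⟩ := div_two_pow_iff.1 hi.1
      exact (hpar _ hs2 i hi.1).2 (h hi.2.1 hi.2.2 i k1 k2)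
    · intro h h5 h6 i k1 k2
      have h7 := div_two_pow_iff.2 ⟨k1, k2⟩
      exact (hpar _ hs2 i h7).1 (h i (sib_iff.2 (by rw [← hj]; exact ⟨h7, h5, h6⟩)))
  have hch : ∀ i, i / 2 ^ σ = j → (C i ↔ EqvGen (NRel rs re a (nid P.nb (l + 1) j) i)
      (a .mq (a .mb (nid P.nb (l + 1) j) + x)) (a .mq (a .mb (nid P.nb (l + 1) j) + y))) := fun i hi => by
    obtain ⟨k1, k2⟩ := div_two_pow_iff.1 hi
    rw [hpar j rfl i hi]
    exact hlinkc.iff i k1 k2 x hxl y hyl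
  simp only [level, wp_seq]
  refine wp_mono (child_spec hS hd hz h1 (by rw [h2, ← hp, hp', hj2]) h3 h4)
    fun s1 ⟨ht1, i1, lo1, len1, sb1, sl1⟩ hA1 => ?_
  rw [← hj] at i1 lo1 sb1 sl1
  have o1 : s1.v .ok = s.v .ok := hA1.v .ok rfl
  have a1 : s1.a = a := by
    funext A
    rw [hA1.a A rfl, har]
  have x1 : s1.v .x = x := by rw [hA1.v .x rfl, hx]
  have y1 : s1.v .y = y := by rw [hA1.v .y rfl, hy]
  have t2b : ∀ x < a .nA p, a .T2 (a .mb (nid P.nb (l + 1) (sibling j)) + x) ≤ E.N := fun x hx => by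
    have := (hcls x hx).1
    omega
  refine wp_mono (checkSibling_spec hE a1 (by rw [hA1.v .qa rfl, hqa]) (by rw [hA1.v .qb rfl, hqb])
    sl1 sb1 len1 x1 y1 haN hbN (by omega) (by omega) (by omega) (by omega) (t2b x hxl) (t2b y hyl)
    (by omega)) fun s2 ⟨ht2, o2, k2⟩ hA2 => ?_
  rw [hsib, o1] at k2
  have a2 : s2.a = a := by
    funext A
    rw [hA2.a A rfl, a1]
  refine wp_mono (descend_spec hE a2 ((hA2.v .id rfl).trans i1) ((hA2.v .x rfl).trans x1)
    ((hA2.v .y rfl).trans y1) (by omega) (by omega) (by omega) rfl rfl (by omega) (by omega) o2)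
    fun s3 ⟨ht3, o3, hdis⟩ hA3 => ?_
  have r2 : s2.v .run = s.v .run := by rw [hA2.v .run rfl, hA1.v .run rfl]
  refine ⟨by omega, o3, by rw [hA3.v .id rfl, hA2.v .id rfl, i1, hc'],
    by rw [hA3.v .lo rfl, hA2.v .lo rfl, lo1, hj], by rw [hA3.v .len rfl, hA2.v .len rfl, len1], ?_⟩
  rcases hdis with ⟨w1, w2, w3, w4, w5, w6⟩ | ⟨w1, w2, w3⟩
  · refine .inl ⟨w3.trans r2, ?_, by rw [w6, k2]⟩
    unfold PathAt
    rw [hc', hdl1, ← hj, w4, w5]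
    exact ⟨w1, w2, fun i q1 q2 => hch i (div_two_pow_iff.2 ⟨q1, q2⟩)⟩
  -- If one image is isolated, connectivity means equality of the images, which does not depend on
  -- `i`.
  · have hiff : ∀ i, i / 2 ^ σ = j → (C i ↔ a .mq (a .mb (nid P.nb (l + 1) j) + x) =
        a .mq (a .mb (nid P.nb (l + 1) j) + y)) := fun i hi => by
      rw [hch i hi]
      constructor
      · intro h
        have := hNc.isolated h
        omega
      · intro h
        rw [h]
        exact .refl _
    refine .inr ⟨w2, fun hC i hi => ?_, ?_⟩
    · rw [hiff i (hi.trans hj.symm), ← hiff z hj.symm]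
      exact hC
    · rw [w3, k2, ← hiff z hj.symm, and_assoc]

/-- Check the subintervals that hang off the path to `z`, and `z` itself. -/
def walk : Cmd :=
  .id ::= v .z / v .B ;; .lo ::= v .id * v .B ;; .len ::= v .B ;; .x ::= v .qu ;; .y ::= v .qv ;;
  .run ::= lit 1 ;;
  .for .g (v .d) (.ite (lit 0) (v .run) level .skip)

/-- The loop always makes `d` rounds and idles once `run = 0`. While it runs, the siblings of length
at least `2 ^ (d - g)` have been checked; once it has stopped, all siblings and `z` itself are
accounted for. -/
theorem walk_spec (hS : Setup P s.v) {a : Arr → ℕ → ℕ} {rp mp : ℕ} (hD : Data P rs re a rp mp)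
    {C : ℕ → Prop} {z qu qv qa qb : ℕ} (hz : z < P.Z) (har : s.a = a)
    (h1 : s.v .z = z) (hqu : s.v .qu = qu) (hqv : s.v .qv = qv) (hu : qu < P.n) (hv : qv < P.n)
    (hC : ∀ i < P.Z, C i ↔ EqvGen (NRel rs re a (i / P.B) i) qu qv)
    (hqa : s.v .qa = qa) (hqb : s.v .qb = qb) (haN : qa ≤ E.N) (hbN : qb ≤ E.N)
    (hok : s.v .ok ≤ 1) :
    wp E walk (fun s' => s'.time ≤ s.time + 40 * P.d + 20 ∧ s'.v .ok ≤ 1 ∧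
      (s'.v .ok = 1 ↔ s.v .ok = 1 ∧ (∀ i, Hang qa qb z P.d 0 i → C i) ∧ C z)) s := by
  have hE := P.hE
  have htN := P.tN
  have hZ := P.Z_lt'
  have hBt := P.B_lt
  have hB0 := P.B_pos
  have hdt := P.d_lt
  have hBZ : z / P.B * P.B ≤ z := Nat.div_mul_le_self _ _
  simp only [walk, wp_seq, wp_assign]
  simp [h1, hS.B, hqu, hqv]
  and_intros <;> first | omega | skip
  obtain ⟨o0, ho0⟩ : ∃ o0, o0 = s.v .ok := ⟨_, rfl⟩
  refine wp_for P.d (fun g _ => 35 * g) (fun g s' => s'.v .ok ≤ 1 ∧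
    s'.v .id = (if s'.v .run = 1 then pathNode P z g else s'.v .id) ∧
    ((s'.v .run = 1 ∧ s'.v .lo = z / 2 ^ (P.d - g) * 2 ^ (P.d - g) ∧ s'.v .len = 2 ^ (P.d - g) ∧
      PathAt P rs re a C z g (s'.v .x) (s'.v .y) ∧
      (s'.v .ok = 1 ↔ o0 = 1 ∧ ∀ i, Hang qa qb z P.d (P.d - g) i → C i)) ∨
     (s'.v .run = 0 ∧ (s'.v .ok = 1 ↔ o0 = 1 ∧ (∀ i, Hang qa qb z P.d 0 i → C i) ∧ C z))))
    (by omega) rfl ?_ (fun g hg s' hI hA hz' => ?_)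
    (fun g hg s' ⟨hok1, hid, hI⟩ hA hz' => ?_) (fun s' ⟨hok1, hid, hI⟩ hA hz' ht => ?_)
  · simp [hok, ← ho0]
    have hlt := P.div_lt hz (Nat.zero_le _)
    simp only [Nat.sub_zero, pow_zero, mul_one] at hlt
    refine ⟨by omega, by simp [pathNode, nid_zero, Par.B], rfl, rfl, ?_, ?_⟩
    · refine ⟨?_, ?_, ?_⟩
      · simpa [pathNode, nid_zero, hD.tree.root _ hlt] using hu
      · simpa [pathNode, nid_zero, hD.tree.root _ hlt] using hv
      · intro i k1 k2
        have h3 : i / P.B = z / P.B := div_two_pow_iff.2 ⟨k1, k2⟩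
        have hiZ : i < P.Z := by
          rw [Par.Z, ← Nat.div_lt_iff_lt_mul hB0, h3, Nat.div_lt_iff_lt_mul hB0]
          exact hz
        rw [hC i hiZ, h3]
        simp [pathNode, nid_zero, Par.B]
    · intro _ i ⟨s, q1, q2, _⟩
      omega
  · have : s'.v .d = P.d := by rw [hA.v .d rfl]; simpa using hS.d
    simp [this]
  · rw [wp_ite]
    refine ⟨by simp; omega, by simp, fun hr => ?_, fun hr => ?_⟩
    · simp only [eval_lit, eval_var, St.tick_v] at hr
      rcases hI with ⟨r1, l1, n1, p1, k1⟩ | ⟨r1, -⟩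
      swap
      · omega
      rw [if_pos r1] at hid
      obtain ⟨σ, hσ⟩ : ∃ σ, P.d - g = σ + 1 := ⟨P.d - g - 1, by omega⟩
      rw [hσ] at l1 n1 k1
      have hS' : Setup P s'.v := by
        refine Setup.agree ?_ hA (by rfl)
        constructor <;> simp [hS.n, hS.t, hS.m, hS.te, hS.d, hS.B, hS.nb, hS.Z]
      refine wp_mono (level_spec (s := s'.tick.tick) (z := z) hS' hD (σ := σ) (by omega) hz ?_ ?_ hid l1 n1 rfl rfl p1
        (qa := qa) (qb := qb) ?_ ?_ haN hbN hok1) fun s2 ⟨ht2, o2, i2, l2, n2, hd2⟩ hA2 => ?_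
      · funext A
        simp only [St.tick_a]
        rw [hA.a A rfl]
        simp [har]
      · simp only [St.tick_v]
        rw [hA.v .z rfl]
        simp [h1]
      · simp only [St.tick_v]
        rw [hA.v .qa rfl]
        simp [hqa]
      · simp only [St.tick_v]
        rw [hA.v .qb rfl]
        simp [hqb]
      · have hσ' : P.d - (g + 1) = σ := by omega
        simp only [St.tick_v, St.tick_time] at ht2 hd2
        simp [hσ', o2, i2, l2, n2]
        refine ⟨?_, by omega⟩
        rcases hd2 with ⟨w1, w2, w3⟩ | ⟨w1, w2, w3⟩
        · refine .inl ⟨w1.trans r1, w2, ?_⟩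
          rw [w3, k1, and_assoc, ← forall_and]
          refine and_congr_right fun _ => forall_congr' fun i => ?_
          rw [hang_succ (s := σ) (by omega), or_imp]
        · refine .inr ⟨w1, ?_⟩
          rw [w3, k1, and_assoc]
          refine and_congr_right fun _ => ?_
          constructor
          · rintro ⟨q1, q2, q3⟩
            refine ⟨fun i ⟨s, _, m2, m3⟩ => ?_, q3⟩
            -- Siblings smaller than the current one lie in the child's interval, where `C` has the
            -- same value everywhere as at `z`; the larger ones were checked in earlier rounds.
            rcases lt_trichotomy s σ with h | rfl | h
            · exact w2 q3 i (div_eq_of_le h m3.1)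
            · exact q2 i m3
            · exact q1 i ⟨s, h, m2, m3⟩
          · rintro ⟨q1, q2⟩
            exact ⟨fun i ⟨s, _, m2, m3⟩ => q1 i ⟨s, Nat.zero_le _, m2, m3⟩,
              fun i m => q1 i ⟨σ, Nat.zero_le _, by omega, m⟩, q2⟩
    · simp only [eval_lit, eval_var, St.tick_v] at hr
      rcases hI with ⟨r1, -⟩ | ⟨r1, k1⟩
      · omega
      · simp [r1, hok1, k1]
        omega
  · simp only [St.tick_time, St.tick_v, St.set_time] at *
    refine ⟨by omega, hok1, ?_⟩
    rcases hI with ⟨r1, l1, n1, p1, k1⟩ | ⟨r1, k1⟩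
    -- The walk cannot still be running at a leaf, because leaves have no vertices. Here `d > 0`,
    -- since `min t (n * n)` is at least `2`.
    · exfalso
      have h5 := hD.tree.leaf_nA (j := z) (by
        have h6 := P.hB1
        have h7 := P.hn
        have h8 := P.hnt
        by_contra h
        rw [show P.d = 0 by omega] at h6
        have : P.n * 2 ≤ P.n * P.n := Nat.mul_le_mul_left _ h7
        simp at h6
        omega) hz
      have h6 := p1.x_lt
      simp [pathNode, h5] at h6
    · rw [← ho0]
      exact k1

/-- Check the blocks between those of the two ends of the queried interval. -/
def middle : Cmd :=
  .i ::= v .qa / v .B ;; .j ::= v .qb / v .B ;;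
  .ite (v .i) (v .j)
    (.h ::= v .qu * v .n + v .qv ;; .cx ::= rd .tot ((v .i + lit 1) * (v .n * v .n) + v .h) ;;
      .cy ::= rd .tot (v .j * (v .n * v .n) + v .h) ;;
      .ite (lit 0) ((v .cx - v .cy) + (v .cy - v .cx)) (.ok ::= lit 0) .skip) .skip

/-- The table is consulted only if the ends are in different blocks. Then there are at least two
blocks, `n * n ≤ B`, and the table fits into the arrays. -/
theorem middle_spec (hS : Setup P s.v) {a : Arr → ℕ → ℕ} {rp mp : ℕ} (hD : Data P rs re a rp mp)
    {C : ℕ → Prop} {u w qa qb : ℕ} (har : s.a = a)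
    (hqu : s.v .qu = u) (hqv : s.v .qv = w) (hu : u < P.n) (hw : w < P.n)
    (hC : ∀ i < P.Z, C i ↔ EqvGen (NRel rs re a (i / P.B) i) u w)
    (hqa : s.v .qa = qa) (hqb : s.v .qb = qb) (hab : qa ≤ qb) (hb : qb < P.t) (hok : s.v .ok ≤ 1) :
    wp E middle (fun s' => s'.time ≤ s.time + 10 ∧ s'.v .ok ≤ 1 ∧ (s'.v .ok = 1 ↔ s.v .ok = 1 ∧
      ∀ i, qa / P.B < i / P.B → i / P.B < qb / P.B → C i)) s := by
  have hE := P.hE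
  have htN := P.tN
  have htZ := P.t_le_Z
  have hZ := P.Z_lt'
  have hB0 := P.B_pos
  obtain ⟨i, hi⟩ : ∃ i, i = qa / P.B := ⟨_, rfl⟩
  obtain ⟨j, hj⟩ : ∃ j, j = qb / P.B := ⟨_, rfl⟩
  simp only [middle, wp_seq, wp_assign]
  simp only [eval_div, eval_var, safe_div, safe_var, St.set_v, hqa, hqb, hS.B, true_and, reduceCtorEq,
    if_false, ← hi, ← hj]
  rw [wp_ite]
  refine ⟨trivial, trivial, fun h => ?_, fun h => ?_⟩
  · simp at h
    have hjn : j < P.nb := by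
      rw [hj, Nat.div_lt_iff_lt_mul hB0]
      exact hb.trans_le htZ
    have hnnB := P.sq_le_B (by omega)
    have hp := pair_lt hu hw
    have hidx : ∀ i, i < P.nb → i * (P.n * P.n) + P.n * P.n ≤ P.Z := fun i hi => by
      rw [← Nat.succ_mul]
      exact Nat.mul_le_mul hi hnnB
    have hiff := hD.tot.iff (i := i + 1) (i' := j) (Nat.le_add_left _ _) h hjn.le hu hw
    have h6 := hidx (i + 1) (by omega)
    have h7 := hidx j hjn
    have hl := hD.tot.le (i := i + 1) (Nat.le_add_left _ _) (by omega) hu hw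
    have hl' := hD.tot.le (i := j) (by omega) hjn.le hu hw
    have hnb := P.nb_le
    have hsol : (∀ b, i + 1 ≤ b → b < j → Solid P rs re a b u w) ↔
        ∀ x, i < x / P.B → x / P.B < j → C x := by
      constructor
      · intro hs x h1 h2
        have hxZ : x < P.Z := by
          rw [Par.Z, ← Nat.div_lt_iff_lt_mul hB0]
          omega
        have h8 := (div_two_pow_iff (i := x) (s := P.d)).1 rfl
        rw [hC x hxZ]
        exact hs _ h1 h2 x h8.1 h8.2
      · intro hc b h1 h2 x h3 h4
        have h5 : x / P.B = b := div_two_pow_iff.2 ⟨h3, h4⟩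
        have hxZ : x < P.Z := by
          rw [Par.Z, ← Nat.div_lt_iff_lt_mul hB0]
          omega
        have := (hC x hxZ).1 (hc x (by omega) (by omega))
        rwa [h5] at this
    rw [← hsol, ← hiff]
    simp only [wp_seq, wp_assign]
    rw [wp_ite]
    simp [hS.n, har, hqu, hqv]
    and_intros <;> omega
  · simp at h ⊢
    exact ⟨hok, fun _ x h1 h2 => absurd (h1.trans h2) h.not_gt⟩

/-- The answer is left in `qu`, the variable of register `0`. -/
def query : Cmd :=
  .ok ::= lit 1 ;; .z ::= v .qa ;; walk ;; .z ::= v .qb ;; walk ;; middle ;; .qu ::= v .ok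

theorem query_spec (hS : Setup P s.v) {a : Arr → ℕ → ℕ} {rp mp : ℕ} (hD : Data P rs re a rp mp)
    {C : ℕ → Prop} {u w qa qb : ℕ} (har : s.a = a)
    (hqu : s.v .qu = u) (hqv : s.v .qv = w) (hu : u < P.n) (hw : w < P.n)
    (hC : ∀ i < P.Z, C i ↔ EqvGen (NRel rs re a (i / P.B) i) u w)
    (hqa : s.v .qa = qa) (hqb : s.v .qb = qb) (hab : qa ≤ qb) (hb : qb < P.t) :
    wp E query (fun s' => s'.time ≤ s.time + 80 * P.d + 80 ∧ s'.v .qu ≤ 1 ∧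
      (s'.v .qu = 1 ↔ ∀ i, qa ≤ i → i ≤ qb → C i)) s := by
  have hE := P.hE
  have htN := P.tN
  have htZ := P.t_le_Z
  have hZ := P.Z_lt'
  have hB0 := P.B_pos
  simp only [query, wp_seq]
  rw [wp_assign, wp_assign]
  refine ⟨by simp; omega, trivial, ?_⟩
  have hS1 : Setup P ((s.set .ok 1).set .z qa).v := by
    constructor <;> simp [hS.n, hS.t, hS.m, hS.te, hS.d, hS.B, hS.nb, hS.Z]
  simp only [eval_var, eval_lit, St.set_v, reduceCtorEq, if_false, hqa]
  refine wp_mono (walk_spec (z := qa) (qu := u) (qv := w) (qa := qa) (qb := qb) hS1 hD (by omega)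
    (by simpa using har) (by simp) (by simpa using hqu) (by simpa using hqv) hu hw hC
    (by simpa using hqa) (by simpa using hqb) (by omega) (by omega) (by simp))
    fun s1 ⟨ht1, o1, k1⟩ hA1 => ?_
  have b1 : s1.v .qb = qb := by rw [hA1.v .qb rfl]; simpa using hqb
  have hS2 : Setup P (s1.set .z qb).v := Setup.set (hS1.agree hA1 rfl) (by decide)
  have a1 : s1.a = a := by
    funext A
    rw [hA1.a A rfl]
    simp [har]
  have q1 : s1.v .qu = u ∧ s1.v .qv = w ∧ s1.v .qa = qa := by
    refine ⟨?_, ?_, ?_⟩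
    · rw [hA1.v .qu rfl]; simpa using hqu
    · rw [hA1.v .qv rfl]; simpa using hqv
    · rw [hA1.v .qa rfl]; simpa using hqa
  rw [wp_assign]
  refine ⟨trivial, ?_⟩
  simp only [eval_var, b1]
  refine wp_mono (walk_spec (z := qb) (qu := u) (qv := w) (qa := qa) (qb := qb) hS2 hD (by omega)
    (by simpa using a1) (by simp) (by simpa using q1.1) (by simpa using q1.2.1) hu hw hC
    (by simpa using q1.2.2) (by simpa using b1) (by omega) (by omega) (by simpa using o1))
    fun s2 ⟨ht2, o2, k2⟩ hA2 => ?_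
  have a2 : s2.a = a := by
    funext A
    rw [hA2.a A rfl]
    simp [a1]
  refine wp_mono (middle_spec (u := u) (w := w) (qa := qa) (qb := qb) (hS2.agree hA2 rfl) hD a2
    (by rw [hA2.v .qu rfl]; simpa using q1.1) (by rw [hA2.v .qv rfl]; simpa using q1.2.1) hu hw hC
    (by rw [hA2.v .qa rfl]; simpa using q1.2.2) (by rw [hA2.v .qb rfl]; simpa using b1) hab hb o2)
    fun s3 ⟨ht3, o3, k3⟩ hA3 => ?_
  simp only [St.set_v, St.set_time, reduceCtorEq, if_true, if_false] at k1 k2 ht1 ht2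
  have hmid : ∀ i, qa / P.B < i / P.B → i / P.B < qb / P.B → qa ≤ i ∧ i ≤ qb := fun i h1 h2 =>
    ⟨le_of_not_gt fun h => h1.not_ge (Nat.div_le_div_right h.le),
      le_of_not_gt fun h => h2.not_ge (Nat.div_le_div_right h.le)⟩
  simp only [wp_assign, safe_var, eval_var, St.set_v, St.set_time, if_true, true_and]
  refine ⟨by omega, o3, ?_⟩
  rw [k3, k2, k1]
  constructor
  · rintro ⟨⟨⟨-, m1, m2⟩, m3, m4⟩, m5⟩ i h1 h2
    -- Every version of the queried interval is one of its ends, hangs off one of the two paths, or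
    -- lies in a block strictly between.
    rcases interval_cover (d := P.d) h1 h2 with rfl | rfl | h | h | h
    · exact m2
    · exact m4
    · exact m1 i h
    · exact m3 i h
    · exact m5 i h.1 h.2
  · intro h
    exact ⟨⟨⟨trivial, fun i hi => h i hi.mem.1 hi.mem.2, h _ le_rfl hab⟩,
      fun i hi => h i hi.mem.1 hi.mem.2, h _ hab le_rfl⟩,
      fun i h1 h2 => h i (hmid i h1 h2).1 (hmid i h1 h2).2⟩

end

/-! ### The preprocessing as a whole. -/

section
variable {E : Env} {P : Par E} {s : St} {rs re : ℕ → ℕ}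

theorem SameTree.nRel {a a' : Arr → ℕ → ℕ} (h : SameTree a a') (z i : ℕ) :
    NRel rs re a' z i = NRel rs re a z i := by
  funext x y
  simp [NRel, h .rb (by simp [treeArrs]), h .rc (by simp [treeArrs]), h .qx (by simp [treeArrs]),
    h .qy (by simp [treeArrs]), h .qr (by simp [treeArrs])]

theorem SameTree.tree {a a' : Arr → ℕ → ℕ} (h : SameTree a a') {cur rp mp : ℕ}
    (hT : Tree P rs re a cur rp mp) : Tree P rs re a' cur rp mp := by
  have e1 := h .rb (by simp [treeArrs])
  have e2 := h .rc (by simp [treeArrs])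
  have e3 := h .nA (by simp [treeArrs])
  have e4 := h .mb (by simp [treeArrs])
  have e5 := h .qx (by simp [treeArrs])
  have e6 := h .qy (by simp [treeArrs])
  have e7 := h .qr (by simp [treeArrs])
  have e8 := h .mq (by simp [treeArrs])
  refine ⟨fun l hl j hj hc => ?_, fun l hl j hj hc => ?_, fun i hi => ?_, fun l hl j hj c h1 h2 => ?_⟩
  · have := hT.node l hl j hj hc
    constructor <;> simp only [e1, e2, e3, e4, e5, e6, e7, e8]
    exacts [this.mem, this.inj, this.rc_le, this.nA_le, this.le]
  · have := hT.link l hl j hj hc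
    constructor <;> simp only [e1, e2, e3, e4, e5, e6, e7, e8, h.nRel]
    exacts [this.le, this.lt, this.iff, this.leaf]
  · rw [e3]
    exact hT.root i hi
  · rw [e3, e4]
    exact hT.sep l hl j hj c h1 h2

theorem SameTree.classes {a a' : Arr → ℕ → ℕ} (h : SameTree a a') {T : ℕ → ℕ} {cur : ℕ}
    (hC : Classes P rs re a T cur) : Classes P rs re a' T cur := by
  have e3 := h .nA (by simp [treeArrs])
  have e4 := h .mb (by simp [treeArrs])
  intro l hl j hj hc
  have := hC l hl j hj hc
  simp only [ClassOk, e3, e4, h.nRel] at this ⊢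
  exact this

theorem SameTree.totOk {a a' : Arr → ℕ → ℕ} (h : SameTree a a') {T : ℕ → ℕ} {i₀ : ℕ}
    (hC : TotOk P rs re a T i₀) : TotOk P rs re a' T i₀ := by
  have hs : ∀ b u w, Solid P rs re a' b u w ↔ Solid P rs re a b u w := fun b u w => by
    simp only [Solid, h.nRel]
  classical
  intro i h1 h2 u hu w hw
  rw [hC i h1 h2 u hu w hw]
  exact Finset.sum_congr rfl fun b _ => if_congr (hs b u w).symm rfl rfl

/-- The preprocessing. -/
def preprocess : Cmd := prepare ;; roots ;; nodes ;; classes ;; totals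

theorem preprocess_spec {T : TL P.n P.t P.m} (hI : Inp P T) (h0 : ∀ A x, s.a A x = 0) :
    wp E preprocess (fun s' => Setup P s'.v ∧
      s'.time ≤ s.time + 1001 * P.m + 9000 * (P.t * (P.d + 2)) ∧
      ∃ rs re rp mp, Data P rs re s'.a rp mp ∧ ∀ i < P.t, ∀ u w,
        EqvGen (NRel rs re s'.a (i / P.B) i) u w ↔ EqvGen (T.g i) u w) s := by
  have hE := P.hE
  have htN := P.tN
  have hN := P.hN
  have hn := P.hn
  have hnt := P.hnt
  have hZ := P.Z_lt'
  have htZ := P.t_le_Z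
  have hB0 := P.B_pos
  simp only [preprocess, wp_seq]
  refine wp_mono (prepare_spec hI (h0 .last)) fun s1 ⟨hS1, ht1, hR, hL⟩ hA1 => ?_
  refine wp_mono (roots_spec hS1 ⟨rfl, rfl, rfl, rfl⟩ hR) fun s2 ⟨ht2, hrp, hRo⟩ hA2 => ?_
  have hS2 := hS1.agree hA2 rfl
  refine wp_mono (nodes_spec hS2 (hA2.a .rs rfl) (hA2.a .re rfl) hR (hRo.tree hR) hrp)
    fun s3 ⟨ht3, hX, hid, hlim, rp, mp, hmp, hT⟩ hA3 => ?_
  have hS3 := hS2.agree hA3 rfl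
  obtain ⟨X, hXe⟩ : ∃ X, X = P.t * P.d := ⟨_, rfl⟩
  have hX0 : P.t * (P.d + 2) = X + 2 * P.t := by rw [hXe]; ring
  have hZd : P.Z * P.d ≤ 3 * X := by
    rw [hXe, ← mul_assoc]
    exact Nat.mul_le_mul_right _ (by omega)
  rw [mul_assoc] at hmp ht3
  obtain ⟨Y, hY⟩ : ∃ Y, Y = P.Z * P.d := ⟨_, rfl⟩
  rw [← hY] at hZd hmp ht3
  have hmpN : mp < E.N := by omega
  refine wp_mono (classes_spec hS3 hT hmpN hid hlim) fun s4 ⟨ht4, hs4, hC⟩ hA4 => ?_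
  rw [← hY] at ht4
  have hS4 := hS3.agree hA4 rfl
  refine wp_mono (totals_spec hS4 hT hs4 hC hmpN (fun x => ?_)) fun s5 ⟨ht5, hTot⟩ hA5 => ?_
  · rw [hA4.a .tot rfl, hA3.a .tot rfl, hA2.a .tot rfl, hA1.a .tot rfl]
    exact h0 _ _
  have hs5 : SameTree s3.a s5.a := hs4.agree hA5 rfl
  refine ⟨hS4.agree hA5 rfl, by omega, _, _, rp, mp, ⟨hs5.tree hT, ?_, hs5.totOk hTot, hmpN⟩,
    fun i hi u w => ?_⟩
  · rw [hA5.a .T2 rfl]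
    exact hs5.classes hC
  · have hj : i / P.B < P.nb := by
      rw [Nat.div_lt_iff_lt_mul hB0]
      exact hi.trans_le htZ
    obtain ⟨h1, h2⟩ := (div_two_pow_iff (i := i) (s := P.d)).1 rfl
    -- The later phases have not touched the roots, and within its block the list of a root shows
    -- exactly the living records.
    have h3 : NRel (s1.a .rs) (s1.a .re) s5.a (i / P.B) i =
        Live (P.t - 1 + P.n) (s1.a .ru) (s1.a .rv) (s1.a .rs) (s1.a .re) i := by
      have hnode := (hRo.tree hR).node 0 (Nat.zero_le _) (i / P.B) (by simpa using hj) (by simpa [nid_zero] using hj)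
      rw [nid_zero] at hnode
      rw [hs5.nRel, NRel.ext hX hj hnode]
      funext x y
      exact propext (hRo.live hj h1 h2)
    rw [h3]
    exact hL i hi u w

end

/-! ### Timelines as sequences of relations on natural numbers -/

section
variable {n t : ℕ} {Γ : GraphTimeline n t} {I : TimelineInput n}

/-- Adjacency in version `i`, for the increasing order of the endpoints. -/
def adjAt (Γ : GraphTimeline n t) (i a b : ℕ) : Prop :=
  a < b ∧ ∃ (hi : i < t) (ha : a < n) (hb : b < n), s(⟨a, ha⟩, ⟨b, hb⟩) ∈ (Γ.graph ⟨i, hi⟩).edgeSet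

theorem minmax_iff {u v : Fin n} {a b : ℕ} (ha : a < n) (hb : b < n) (hab : a < b) :
    s((⟨a, ha⟩ : Fin n), ⟨b, hb⟩) = s(u, v) ↔
      min (u : ℕ) v = a ∧ max (u : ℕ) v = b := by
  rw [Sym2.eq_iff]
  simp only [Fin.ext_iff]
  omega

theorem adjAt_minmax {i : ℕ} {u v : Fin n} (hi : i < t) (huv : u ≠ v) :
    adjAt Γ i (min (u : ℕ) v) (max (u : ℕ) v) ↔ s(u, v) ∈ (Γ.graph ⟨i, hi⟩).edgeSet := by
  have h1 : min (u : ℕ) v < max (u : ℕ) v := by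
    have : (u : ℕ) ≠ v := fun h => huv (Fin.ext h)
    omega
  have h2 : min (u : ℕ) v < n := by omega
  have h3 : max (u : ℕ) v < n := by omega
  have h4 := (minmax_iff (u := u) (v := v) h2 h3 h1).2 ⟨rfl, rfl⟩
  constructor
  · rintro ⟨_, _, _, _, h⟩
    rwa [h4] at h
  · intro h
    exact ⟨h1, hi, h2, h3, by rwa [h4]⟩

theorem adjAt_swap {i : ℕ} {u v : Fin n} {hi : i < t} (h : (Γ.graph ⟨i, hi⟩).Adj u v) :
    EqvGen (adjAt Γ i) u v := by
  have h1 : s(u, v) ∈ (Γ.graph ⟨i, hi⟩).edgeSet := h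
  have h2 := (adjAt_minmax hi h.ne).2 h1
  rcases le_total (u : ℕ) v with h3 | h3
  · rw [min_eq_left h3, max_eq_right h3] at h2
    exact .rel _ _ h2
  · rw [min_eq_right h3, max_eq_left h3] at h2
    exact .symm _ _ (.rel _ _ h2)

theorem reachable_iff {i : ℕ} (hi : i < t) (u v : Fin n) :
    EqvGen (adjAt Γ i) u v ↔ (Γ.graph ⟨i, hi⟩).Reachable u v := by
  constructor
  · intro h
    -- The relation lives on all natural numbers; those that are not vertices are equivalent to
    -- themselves only.
    have key : ∀ x y : ℕ, EqvGen (adjAt Γ i) x y →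
        x = y ∨ ∃ (hx : x < n) (hy : y < n), (Γ.graph ⟨i, hi⟩).Reachable ⟨x, hx⟩ ⟨y, hy⟩ := by
      intro x y h
      induction h with
      | rel x y h =>
        obtain ⟨_, _, hx, hy, h⟩ := h
        exact .inr ⟨hx, hy, SimpleGraph.Adj.reachable h⟩
      | refl x => exact .inl rfl
      | symm x y _ ih =>
        rcases ih with rfl | ⟨hx, hy, h⟩
        · exact .inl rfl
        · exact .inr ⟨hy, hx, h.symm⟩
      | trans x y z _ _ ih1 ih2 =>
        rcases ih1 with rfl | ⟨hx, hy, h⟩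
        · exact ih2
        · rcases ih2 with rfl | ⟨hy', hz, h'⟩
          · exact .inr ⟨hx, hy, h⟩
          · exact .inr ⟨hx, hz, h.trans h'⟩
    rcases key _ _ h with h | ⟨_, _, h⟩
    · obtain rfl := Fin.ext h
      exact .refl _
    · exact h
  · intro h
    rw [SimpleGraph.reachable_iff_reflTransGen] at h
    induction h with
    | refl => exact .refl _
    | tail _ h ih => exact ih.trans _ _ _ (adjAt_swap h)

/-- The endpoints of the `j`-th edge of the input, and the type and endpoints of the updates. -/
def iuOf (I : TimelineInput n) (j : ℕ) : ℕ := if h : j < I.edges.length then I.edges[j].1 else 0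
def iwOf (I : TimelineInput n) (j : ℕ) : ℕ := if h : j < I.edges.length then I.edges[j].2 else 0
def addOf (I : TimelineInput n) (x : ℕ) : ℕ :=
  if h : x < I.updates.length then (if I.updates[x].add then 1 else 0) else 0
def euOf (I : TimelineInput n) (x : ℕ) : ℕ := if h : x < I.updates.length then I.updates[x].u else 0
def ewOf (I : TimelineInput n) (x : ℕ) : ℕ := if h : x < I.updates.length then I.updates[x].v else 0

/-- Exactly one edge changes, so an addition must concern an absent edge and a deletion a present
one; otherwise nothing would change. In particular the pair occurs as an edge of one of the two
versions and is not a loop. -/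
theorem update_mem (hD : I.Describes Γ) {x : ℕ} (hx : x + 1 < t) (hl : x < I.updates.length) :
    I.updates[x].u ≠ I.updates[x].v ∧
    (s(I.updates[x].u, I.updates[x].v) ∈ (Γ.graph ⟨x, by omega⟩).edgeSet ↔ I.updates[x].add = false) ∧
    (s(I.updates[x].u, I.updates[x].v) ∈ (Γ.graph ⟨x + 1, hx⟩).edgeSet ↔ I.updates[x].add = true) ∧
    ∀ e, e ≠ s(I.updates[x].u, I.updates[x].v) → (e ∈ (Γ.graph ⟨x + 1, hx⟩).edgeSet ↔
      e ∈ (Γ.graph ⟨x, by omega⟩).edgeSet) := by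
  have h1 := hD.step ⟨x, by omega⟩ ⟨x + 1, hx⟩ hl rfl
  have h2 := Γ.change ⟨x, by omega⟩ ⟨x + 1, hx⟩ rfl
  simp only at h1 h2
  obtain ⟨E0, hE0⟩ : ∃ E0, E0 = (Γ.graph ⟨x, by omega⟩).edgeSet := ⟨_, rfl⟩
  obtain ⟨E1, hE1⟩ : ∃ E1, E1 = (Γ.graph ⟨x + 1, hx⟩).edgeSet := ⟨_, rfl⟩
  have hne : ∀ u v : Fin n, s(u, v) ∈ E0 ∨ s(u, v) ∈ E1 → u ≠ v := by
    rintro u v (h | h) rfl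
    · rw [hE0] at h
      exact (SimpleGraph.irrefl _ h)
    · rw [hE1] at h
      exact (SimpleGraph.irrefl _ h)
  rw [← hE0, ← hE1] at h1 h2 ⊢
  clear hE0 hE1
  generalize I.updates[x] = p at *
  have hch : E0 ≠ E1 := by
    rintro rfl
    simp at h2
  rw [EdgeUpdate.apply] at h1
  cases hb : p.add with
  | true =>
    simp only [hb] at h1
    have h3 : s(p.u, p.v) ∉ E0 := fun h => hch (by rw [h1, Set.insert_eq_of_mem h])
    have h4 : s(p.u, p.v) ∈ E1 := by rw [h1]; exact Set.mem_insert _ _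
    refine ⟨hne _ _ (.inr h4), by simp [h3], by simp [h4], fun e he => ?_⟩
    rw [h1, Set.mem_insert_iff]
    simp [he]
  | false =>
    simp only [hb] at h1
    have h3 : s(p.u, p.v) ∈ E0 := by
      by_contra h
      exact hch (by rw [h1, Set.diff_singleton_eq_self h])
    have h4 : s(p.u, p.v) ∉ E1 := by rw [h1]; simp
    refine ⟨hne _ _ (.inl h3), by simp [h3], by simp [h4], fun e he => ?_⟩
    rw [h1, Set.mem_diff]
    simp [he]

/-- The relational form of a timeline. -/
def TL.ofInput (hD : I.Describes Γ) (ht : 0 < t) : TL n t I.edges.length where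
  g := adjAt Γ
  iu := iuOf I
  iw := iwOf I
  add := addOf I
  eu := euOf I
  ew := ewOf I
  i_lt j hj := by simp [iuOf, iwOf, hj]
  e_lt x hx := by
    have hl : x < I.updates.length := by rw [hD.length_updates]; omega
    simp [euOf, ewOf, hl]
  add_le x _ := by
    unfold addOf
    split_ifs <;> simp
  init a b hab := by
    constructor
    · rintro ⟨_, hi, ha, hb, h⟩
      rw [← hD.mem_edges ⟨0, hi⟩ rfl, List.mem_map] at h
      obtain ⟨p, hp, he⟩ := h
      obtain ⟨j, hj, rfl⟩ := List.getElem_of_mem hp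
      refine ⟨j, hj, ?_⟩
      simp only [iuOf, iwOf, hj, dif_pos]
      exact (minmax_iff ha hb hab).1 he.symm
    · rintro ⟨j, hj, h1, h2⟩
      simp only [iuOf, iwOf, hj, dif_pos] at h1 h2
      have ha : a < n := by omega
      have hb : b < n := by omega
      refine ⟨hab, ht, ha, hb, ?_⟩
      rw [← hD.mem_edges ⟨0, ht⟩ rfl, List.mem_map]
      exact ⟨_, List.getElem_mem hj, ((minmax_iff ha hb hab).2 ⟨h1, h2⟩).symm⟩
  hit x hx := by
    have hl : x < I.updates.length := by rw [hD.length_updates]; omega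
    obtain ⟨h1, h2, h3, -⟩ := update_mem hD hx hl
    simp only [euOf, ewOf, addOf, hl, dif_pos]
    rw [adjAt_minmax (by omega) h1, adjAt_minmax hx h1, h2, h3]
    have h4 : (I.updates[x].u : ℕ) ≠ I.updates[x].v := fun h => h1 (Fin.ext h)
    refine ⟨by omega, ?_, ?_⟩ <;> cases I.updates[x].add <;> simp
  miss x hx a b hne := by
    have hl : x < I.updates.length := by rw [hD.length_updates]; omega
    obtain ⟨-, -, -, h4⟩ := update_mem hD hx hl
    simp only [euOf, ewOf, hl, dif_pos] at hne
    constructor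
    · rintro ⟨hab, _, ha, hb, h⟩
      rw [h4 _ (fun h => hne ((minmax_iff ha hb hab).1 h))] at h
      exact ⟨hab, _, ha, hb, h⟩
    · rintro ⟨hab, _, ha, hb, h⟩
      rw [← h4 _ (fun h => hne ((minmax_iff ha hb hab).1 h))] at h
      exact ⟨hab, _, ha, hb, h⟩
  g_lt i a b := fun ⟨h, _, _, hb, _⟩ => ⟨h, hb⟩

/-! ### The number of edges of the first version -/

theorem edges_length_le_sq (hD : I.Describes Γ) : I.edges.length ≤ n * n := by
  classical
  have h1 := hD.nodup.length_le_card
  rw [List.length_map] at h1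
  refine h1.trans ((Fintype.card_le_of_surjective (fun p : Fin n × Fin n => s(p.1, p.2)) ?_).trans
    (by simp))
  intro e
  induction e with
  | h u v => exact ⟨(u, v), rfl⟩

/-- An edge of the first version that no update mentions is permanent, and the updates mention at
most `t - 1` edges. So reading the whole first version is within `O(m + t)`. -/
theorem edges_length_le (hD : I.Describes Γ) (ht : 0 < t) :
    I.edges.length ≤ Γ.numPermanent + (t - 1) := by
  classical
  obtain ⟨U, hU⟩ : ∃ U : Finset (Sym2 (Fin n)), U = (I.updates.map fun x => s(x.u, x.v)).toFinset :=
    ⟨_, rfl⟩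
  have hUc : U.card ≤ t - 1 := by
    rw [hU, ← hD.length_updates]
    exact (List.toFinset_card_le _).trans (by simp)
  have hsub : ((I.edges.map fun p => s(p.1, p.2)).toFinset : Set (Sym2 (Fin n))) ⊆
      {e | ∀ i, e ∈ (Γ.graph i).edgeSet} ∪ U := by
    intro e he
    rw [Finset.mem_coe, List.mem_toFinset, hD.mem_edges ⟨0, ht⟩ rfl] at he
    by_cases heU : e ∈ U
    · exact .inr heU
    · refine .inl fun ⟨i, hi⟩ => ?_
      induction i with
      | zero => exact he
      | succ i ih =>
        have hl : i < I.updates.length := by rw [hD.length_updates]; omega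
        refine ((update_mem hD hi hl).2.2.2 e fun h => heU ?_).2 (ih (by omega))
        rw [hU, List.mem_toFinset, List.mem_map]
        exact ⟨_, List.getElem_mem hl, h.symm⟩
  have h1 := Set.ncard_le_ncard hsub (Set.toFinite _)
  have h2 := Set.ncard_union_le {e | ∀ i, e ∈ (Γ.graph i).edgeSet} (U : Set (Sym2 (Fin n)))
  rw [Set.ncard_coe_finset] at h1 h2
  rw [List.toFinset_card_of_nodup hD.nodup, List.length_map] at h1
  unfold GraphTimeline.numPermanent
  omega

/-! ### The input words -/

theorem flatMap_length {α : Type*} {f : α → List ℕ} {k : ℕ} (hf : ∀ x, (f x).length = k) (l : List α) :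
    (l.flatMap f).length = k * l.length := by
  induction l with
  | nil => simp
  | cons x l ih => rw [List.flatMap_cons, List.length_append, hf, ih, List.length_cons]; ring

theorem flatMap_getD {α : Type*} {f : α → List ℕ} {k : ℕ} (hf : ∀ x, (f x).length = k) :
    ∀ (l : List α) (j r : ℕ) (hj : j < l.length), r < k →
      (l.flatMap f).getD (k * j + r) 0 = (f l[j]).getD r 0
  | x :: l, 0, r, _, hr => by
    rw [List.flatMap_cons, mul_zero, zero_add, List.getD_append _ _ _ _ (by rwa [hf])]
    rfl
  | x :: l, j + 1, r, hj, hr => by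
    rw [List.flatMap_cons, List.getD_append_right _ _ _ _ (by rw [hf]; nlinarith), hf,
      show k * (j + 1) + r - k = k * j + r by rw [mul_add, mul_one]; omega,
      flatMap_getD hf l j r (by simpa using hj) hr]
    rfl

theorem words_length (I : TimelineInput n) (t : ℕ) :
    (I.words t).length = 3 + 2 * I.edges.length + 3 * I.updates.length := by
  rw [TimelineInput.words, List.length_append, List.length_append,
    flatMap_length (k := 2) (fun _ => rfl), flatMap_length (k := 3) (fun _ => rfl)]
  rfl

theorem words_edge (I : TimelineInput n) (t : ℕ) {j r : ℕ} (hj : j < I.edges.length) (hr : r < 2) :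
    (I.words t).getD (3 + 2 * j + r) 0 = [(I.edges[j].1 : ℕ), (I.edges[j].2 : ℕ)].getD r 0 := by
  rw [TimelineInput.words, List.append_assoc, List.getD_append_right _ _ _ _ (by simp; omega),
    show 3 + 2 * j + r - [n, t, I.edges.length].length = 2 * j + r by simp; omega,
    List.getD_append _ _ _ _ (by rw [flatMap_length (k := 2) fun _ => rfl]; omega),
    flatMap_getD (k := 2) (fun _ => rfl) _ _ _ hj hr]

theorem words_update (I : TimelineInput n) (t : ℕ) {x r : ℕ} (hx : x < I.updates.length) (hr : r < 3) :
    (I.words t).getD (3 + 2 * I.edges.length + 3 * x + r) 0 =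
      [if I.updates[x].add then 1 else 0, (I.updates[x].u : ℕ), (I.updates[x].v : ℕ)].getD r 0 := by
  have hl : ([n, t, I.edges.length] ++ I.edges.flatMap fun p => [(p.1 : ℕ), (p.2 : ℕ)]).length =
      3 + 2 * I.edges.length := by
    rw [List.length_append, flatMap_length (k := 2) fun _ => rfl]
    rfl
  rw [TimelineInput.words, List.getD_append_right _ _ _ _ (by rw [hl]; omega), hl,
    show 3 + 2 * I.edges.length + 3 * x + r - (3 + 2 * I.edges.length) = 3 * x + r by omega,
    flatMap_getD (k := 3) (fun _ => rfl) _ _ _ hx hr]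

theorem Inp.ofInput {w N : ℕ} (hD : I.Describes Γ) (ht : 0 < t) (P : Par ⟨w, N, I.words t⟩)
    (T : TL P.n P.t P.m) (hn : P.n = n) (htt : P.t = t) (hm : P.m = I.edges.length)
    (h1 : T.iu = iuOf I) (h2 : T.iw = iwOf I) (h3 : T.add = addOf I) (h4 : T.eu = euOf I)
    (h5 : T.ew = ewOf I) : Inp P T := by
  have hl := hD.length_updates
  constructor
  · rw [words_length, hl, hm, htt]
  · rw [hn]; rfl
  · rw [htt]; rfl
  · rw [hm]; rfl
  · intro j hj
    rw [hm] at hj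
    rw [h1, iuOf, dif_pos hj]
    exact words_edge I t hj (r := 0) (by omega)
  · intro j hj
    rw [hm] at hj
    rw [h2, iwOf, dif_pos hj]
    exact words_edge I t hj (r := 1) (by omega)
  all_goals
    intro x hx
    rw [htt] at hx
    have hx' : x < I.updates.length := by omega
  · rw [h3, addOf, dif_pos hx', hm]
    exact words_update I t hx' (r := 0) (by omega)
  · rw [h4, euOf, dif_pos hx', hm]
    exact words_update I t hx' (r := 1) (by omega)
  · rw [h5, ewOf, dif_pos hx', hm]
    exact words_update I t hx' (r := 2) (by omega)

end

open WordRAM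

/-! ### The machine programs -/

section
variable {E : Env} {P : Par E} {s : St} {rs re : ℕ → ℕ}

/-- The environment of the queries. -/
def Env.noInput (E : Env) : Env := ⟨E.w, E.N, []⟩

/-- Nothing about the parameters or the data structure mentions the contents of the input, so all of
it carries over to the empty input with which queries are run. -/
def Par.noInput (P : Par E) : Par E.noInput :=
  ⟨P.n, P.t, P.m, P.d, P.nb, P.hn, P.hnt, P.hB1, P.hB2, P.hnb, P.hE, P.hN, P.hm, P.hnn⟩

theorem Setup.noInput {f : Var → ℕ} (h : Setup P f) : Setup P.noInput f :=
  ⟨h.n, h.t, h.m, h.te, h.d, h.B, h.nb, h.Z⟩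

theorem Data.noInput {a : Arr → ℕ → ℕ} {rp mp : ℕ} (h : Data P rs re a rp mp) :
    Data P.noInput rs re a rp mp :=
  ⟨⟨h.tree.node, h.tree.link, h.tree.root, h.tree.sep⟩, h.classes, h.tot, h.lt⟩

theorem Rep.noInput {σ : State} (h : Rep E σ s) : Rep E.noInput σ s := ⟨h.v, h.a, h.reg, h.mem⟩

theorem Rep.zero (E : Env) : Rep E State.zero ⟨fun _ => 0, fun _ _ => 0, 0⟩ :=
  ⟨fun _ => rfl, fun _ _ _ => rfl, fun _ => Nat.two_pow_pos _, fun _ => Nat.two_pow_pos _⟩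

theorem Rep.setVar {σ : State} (h : Rep E σ s) (x : Var) {k : ℕ} (hk : k < 2 ^ E.w) :
    Rep E (σ.setReg x.ctorIdx k) (s.set x k) := by
  refine ⟨fun y => ?_, h.a, fun i => ?_, h.mem⟩
  · simp only [State.setReg, Function.update_apply, St.set_v]
    by_cases hy : y = x
    · rw [hy, if_pos rfl, if_pos rfl]
    · rw [if_neg hy, if_neg fun h' => hy (Var.ctorIdx_inj h'), h.v]
  · simp only [State.setReg, Function.update_apply]
    split_ifs
    · exact hk
    · exact h.reg i

/-- The state in which a query starts. -/
def St.ask (s : St) (u v a b : ℕ) : St := (((s.set .qu u).set .qv v).set .qa a).set .qb b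

/-- Configurations of the data structure. -/
def Ready (P : Par E) (a : Arr → ℕ → ℕ) (σ : State) : Prop :=
  ∃ s : St, Rep E.noInput σ s ∧ Setup P s.v ∧ s.a = a

/-- The query program writes no array and no parameter, so it leaves a configuration that is ready
for the next query; this permits any number of them. -/
theorem query_ready {S : ℕ} (hS : 32 * E.N ≤ S) {a : Arr → ℕ → ℕ} {rp mp : ℕ}
    (hD : Data P rs re a rp mp) {σ : State} (hσ : Ready P a σ) {n t : ℕ} (hn : P.n = n) (ht : P.t = t)
    (u v : Fin n) {qa qb : Fin t} (hab : qa ≤ qb) :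
    ∃ k σ', Exec E.w S [] query.compile (σ.withQuery u v qa qb) k σ' ∧
      k ≤ query.cost * (80 * P.d + 80) ∧ Ready P a σ' ∧ σ'.reg 0 ≤ 1 ∧
      (σ'.reg 0 = 1 ↔ ∀ i, (qa : ℕ) ≤ i → i ≤ qb → EqvGen (NRel rs re a (i / P.B) i) u v) := by
  obtain ⟨s, hr, hs, ha⟩ := hσ
  have hE := P.hE
  have htN := P.tN
  have hn2 := P.hn
  have hnt := P.hnt
  have hu := u.2
  have hv := v.2
  have hqa := qa.2
  have hqb := qb.2
  have hW : E.W = 2 ^ E.w := rfl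
  have hr' : Rep E.noInput (σ.withQuery u v qa qb) (s.ask u v qa qb) :=
    (((hr.setVar .qu (k := u) (by simp only [Env.noInput]; omega)).setVar .qv (k := v)
      (by simp only [Env.noInput]; omega)).setVar .qa (k := qa)
      (by simp only [Env.noInput]; omega)).setVar .qb (k := qb) (by simp only [Env.noInput]; omega)
  have hs' : Setup P (s.ask u v qa qb).v := by
    constructor <;> simp [St.ask, hs.n, hs.t, hs.m, hs.te, hs.d, hs.B, hs.nb, hs.Z]
  obtain ⟨s', hrun, ht', hle, hiff⟩ := query_spec hs'.noInput hD.noInput (u := u) (w := v) (qa := qa)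
    (qb := qb) (C := fun i => EqvGen (NRel rs re a (i / P.B) i) u v)
    (by simpa [St.ask] using ha) (by simp [St.ask]) (by simp [St.ask]) (hu.trans_eq hn.symm)
    (hv.trans_eq hn.symm) (fun i _ => Iff.rfl) (by simp [St.ask]) (by simp [St.ask]) hab
    (hqb.trans_eq ht.symm)
  obtain ⟨k, σ', hex, hrep, hk⟩ := compile_correct (E := E.noInput) hS
    (by simp only [Env.noInput]; omega) hrun query.cost le_rfl _ hr'
  have h0 : σ'.reg 0 = s'.v .qu := hrep.v .qu
  refine ⟨k, σ', hex, ?_, ⟨s', hrep, hs'.agree hrun.agree rfl, ?_⟩, by rwa [h0], by rw [h0]; exact hiff⟩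
  · have h1 : query.cost * s'.time ≤ query.cost * ((s.ask u v qa qb).time + 80 * P.d + 80) :=
      Nat.mul_le_mul_left _ ht'
    rw [add_assoc, mul_add] at h1
    change _ ≤ _ * _ + query.cost * (80 * P.d + 80) at h1
    omega
  · funext A
    rw [hrun.agree.a A rfl]
    simp [St.ask, ha]

end

/-! ### The choice of the depth, the capacity and the constants. -/

/-- The depth of the trees. -/
def depth (n t : ℕ) : ℕ := Nat.clog 2 (min t (n * n))

theorem depth_spec {n t : ℕ} (hn : 2 ≤ n) (hnt : n ≤ t) :
    min t (n * n) ≤ 2 ^ depth n t ∧ 2 ^ depth n t < 2 * min t (n * n) := by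
  have h1 : n * 2 ≤ n * n := Nat.mul_le_mul_left _ hn
  refine ⟨Nat.le_pow_clog (by norm_num) _, ?_⟩
  have h2 := Nat.pow_pred_clog_lt_self (b := 2) (by norm_num) (x := min t (n * n)) (by omega)
  have h3 : 0 < depth n t := Nat.clog_pos (by norm_num) (by omega)
  obtain ⟨d, hd⟩ := Nat.exists_eq_succ_of_ne_zero h3.ne'
  rw [← depth, hd, Nat.pred_succ] at h2
  rw [hd, pow_succ]
  omega

/-- From `2 ^ d ≤ 2 * n ^ 2` and `log 2 ≤ log n` follows `(d + 2) * log 2 ≤ 5 * log n`, and `5 / log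
2 < 8`. -/
theorem depth_le_log {n t : ℕ} (hn : 2 ≤ n) (hnt : n ≤ t) :
    ((depth n t + 2 : ℕ) : ℝ) ≤ 8 * Real.log n := by
  have h1 : 2 ^ depth n t ≤ 2 * (n * n) := by
    have := (depth_spec hn hnt).2
    omega
  have h2 : ((2 : ℝ) ^ depth n t) ≤ 2 * (n * n) := by exact_mod_cast h1
  have hn0 : (0 : ℝ) < n := by
    have : 0 < n := by omega
    exact_mod_cast this
  have h3 := Real.log_le_log (by positivity) h2
  rw [Real.log_pow, Real.log_mul (by norm_num) (by positivity), Real.log_mul hn0.ne' hn0.ne'] at h3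
  have h4 : Real.log 2 ≤ Real.log n := Real.log_le_log (by norm_num) (by exact_mod_cast hn)
  have h5 := Real.log_two_gt_d9
  have h6 : (0 : ℝ) ≤ depth n t := Nat.cast_nonneg _
  push_cast
  nlinarith

/-- The capacity of the arrays. -/
def capacity (n t : ℕ) : ℕ := 64 * (t * (depth n t + 2))

/-- The capacity is at most `192 * t ^ 2`. Since `t ≥ 2`, the power `t ^ 20` is at least `2 ^ 18 * t
^ 2`, which leaves room for the factor `100`. -/
theorem two_pow_bounds {n t m w : ℕ} (hn : 2 ≤ n) (hnt : n ≤ t) (hm : m ≤ n * n)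
    (hw : t ^ 20 ≤ 2 ^ w) : 100 * (capacity n t + 1) ≤ 2 ^ w ∧ 100 * (m + t + 1) ≤ 2 ^ w ∧
      n * n < 2 ^ w := by
  have h1 := (depth_spec hn hnt).2
  have h2 : depth n t < 2 ^ depth n t := Nat.lt_two_pow_self
  have h3 : t * (depth n t + 2) ≤ t * (3 * t) := Nat.mul_le_mul_left _ (by omega)
  have h4 : n * n ≤ t * t := Nat.mul_le_mul hnt hnt
  have h5 : t * 2 ≤ t * t := Nat.mul_le_mul_left _ (by omega)
  have h6 : 2 ^ 18 * (t * t) ≤ t ^ 20 := by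
    calc 2 ^ 18 * (t * t) ≤ t ^ 18 * (t * t) :=
          Nat.mul_le_mul_right _ (Nat.pow_le_pow_left (by omega) _)
      _ = t ^ 20 := by ring
  have h7 : t * (3 * t) = 3 * (t * t) := by ring
  unfold capacity
  norm_num at h6
  omega

end ForallRAM

open ForallRAM in
/-- There are a preprocessing program and a query program for the word RAM such that, for all
timelines of `t ≥ n ≥ 2` graphs on `n` vertices with `m` permanent edges and all words of at least
`c log t` bits: the preprocessing takes `O(m + t log n)` steps, `O(t log n)` words of memory are
used, and every query of an arbitrary sequence of queries is answered correctly (with `1` for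
`yes` and `0` for `no`, in register `0`) within `O(log n)` steps. -/
theorem mainTheorem1 :
    ∃ (pre query : WordRAM.Prog) (c : ℕ) (C : ℝ), ∀ n t : ℕ, 2 ≤ n → n ≤ t →
      ∃ S : ℕ, (S : ℝ) ≤ C * (t * Real.log n) ∧
        ∀ (Γ : GraphTimeline n t) (I : TimelineInput n), I.Describes Γ →
          ∀ w : ℕ, t ^ c ≤ 2 ^ w →
            (∃ (k : ℕ) (σ : WordRAM.State),
              WordRAM.Exec w S (I.words t) pre WordRAM.State.zero k σ ∧
                (k : ℝ) ≤ C * (Γ.numPermanent + t * Real.log n)) ∧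
            ∀ σ : WordRAM.State, DataStructureState n t w S (I.words t) pre query σ →
              ∀ (u v : Fin n) (a b : Fin t), a ≤ b →
                ∃ (k : ℕ) (σ' : WordRAM.State),
                  WordRAM.Exec w S [] query (σ.withQuery u v a b) k σ' ∧
                    (k : ℝ) ≤ C * Real.log n ∧
                    (Γ.ForallConnected u v a b → σ'.reg 0 = 1) ∧
                    (¬ Γ.ForallConnected u v a b → σ'.reg 0 = 0) := by
  -- As `t ≤ t * (d + 2) ≤ 8 * t * log n`, preprocessing takes at most `1001 * m + 10001 * 8 * t *
  -- log n` units of time, the memory is at most `32 * 64 * 8 * t * log n` words, and a query takes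
  -- at most `80 * 8 * log n` units. The factor `100000` covers all three.
  refine ⟨preprocess.compile, query.compile, 20,
    100000 * (preprocess.cost + query.cost + 1), fun n t hn hnt => ?_⟩
  obtain ⟨d, hd⟩ : ∃ d, d = depth n t := ⟨_, rfl⟩
  obtain ⟨hd1, hd2⟩ := depth_spec hn hnt
  have hdl := depth_le_log hn hnt
  rw [← hd] at hd1 hd2 hdl
  obtain ⟨c₁, hc₁⟩ : ∃ c, c = preprocess.cost := ⟨_, rfl⟩
  obtain ⟨c₂, hc₂⟩ : ∃ c, c = query.cost := ⟨_, rfl⟩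
  rw [← hc₁, ← hc₂]
  have hl0 : 0 ≤ Real.log n := Real.log_natCast_nonneg n
  have ht0 : (0 : ℝ) ≤ t := Nat.cast_nonneg t
  have hc₁0 : (0 : ℝ) ≤ c₁ := Nat.cast_nonneg c₁
  have hc₂0 : (0 : ℝ) ≤ c₂ := Nat.cast_nonneg c₂
  have htd : ((t * (d + 2) : ℕ) : ℝ) ≤ 8 * (t * Real.log n) := by
    rw [Nat.cast_mul]
    clear hc₁ hc₂ hd
    nlinarith
  have htl0 : 0 ≤ t * Real.log n := mul_nonneg ht0 hl0
  refine ⟨32 * capacity n t, ?_, fun Γ I hI w hw => ?_⟩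
  · rw [capacity, ← hd]
    push_cast at htd ⊢
    clear hc₁ hc₂ hd
    nlinarith [mul_nonneg hc₁0 htl0, mul_nonneg hc₂0 htl0]
  obtain ⟨hw1, hw2, hw3⟩ := two_pow_bounds hn hnt (edges_length_le_sq hI) hw
  have ht : 0 < t := by omega
  let E : Env := ⟨w, capacity n t, I.words t⟩
  let P : Par E := ⟨n, t, I.edges.length, d, _, hn, hnt, hd1, hd2, rfl, hw1,
    by rw [hd]; exact le_rfl, hw2, hw3⟩
  have hInp : Inp P (TL.ofInput hI ht) := Inp.ofInput hI ht P _ rfl rfl rfl rfl rfl rfl rfl rfl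
  obtain ⟨s, hrun, hset, htime, rs, re, rp, mp, hD, hC⟩ := preprocess_spec hInp
    (s := ⟨fun _ => 0, fun _ _ => 0, 0⟩) (fun _ _ => rfl)
  obtain ⟨k, σ, hex, hrep, hk⟩ := compile_correct (E := E) (S := 32 * capacity n t) le_rfl
    (by simp only [E]; omega) hrun preprocess.cost le_rfl _ (Rep.zero E)
  refine ⟨⟨k, σ, hex, ?_⟩, fun σ' hσ' u v a b hab => ?_⟩
  · have hm := edges_length_le hI ht
    have h1 : k ≤ c₁ * (1001 * (Γ.numPermanent + t) + 9000 * (t * (d + 2))) := by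
      rw [← hc₁] at hk
      have h2 : c₁ * s.time ≤ c₁ * (1001 * (Γ.numPermanent + t) + 9000 * (t * (d + 2))) := by
        refine Nat.mul_le_mul_left _ (htime.trans ?_)
        simp only [P]
        omega
      simp only [Nat.mul_zero, Nat.add_zero] at hk
      omega
    have h2 : (t : ℝ) ≤ ((t * (d + 2) : ℕ) : ℝ) := by
      exact_mod_cast Nat.le_mul_of_pos_right t (by omega)
    have h3 : (k : ℝ) ≤ c₁ * (1001 * (Γ.numPermanent + t) + 9000 * ((t * (d + 2) : ℕ) : ℝ)) := by
      exact_mod_cast h1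
    have hp0 : (0 : ℝ) ≤ Γ.numPermanent := Nat.cast_nonneg _
    refine h3.trans ?_
    calc (c₁ : ℝ) * (1001 * (Γ.numPermanent + t) + 9000 * ((t * (d + 2) : ℕ) : ℝ))
        ≤ c₁ * (100000 * (Γ.numPermanent + t * Real.log n)) := by
          refine mul_le_mul_of_nonneg_left ?_ hc₁0
          clear hc₁ hc₂ hk
          linarith
      _ ≤ 100000 * (c₁ + c₂ + 1) * (Γ.numPermanent + t * Real.log n) := by
          clear hc₁ hc₂ hk
          nlinarith [mul_nonneg hc₂0 (add_nonneg hp0 htl0)]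
  -- Since the machine is deterministic, an arbitrary run of either program is the one constructed
  -- above. So every configuration that can be reached is ready.
  · have hready : ∀ σ', DataStructureState n t w (32 * capacity n t) (I.words t) preprocess.compile
        query.compile σ' → Ready P s.a σ' := by
      intro σ' h
      induction h with
      | preprocessed h =>
        obtain ⟨-, rfl⟩ := h.deterministic hex
        exact ⟨s, hrep.noInput, hset, rfl⟩
      | queried u v a b hab _ h ih =>
        obtain ⟨_, _, h', -, hr, -⟩ := query_ready (S := 32 * capacity n t) le_rfl hD ih rfl rfl u v hab
        obtain ⟨-, rfl⟩ := h.deterministic h'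
        exact hr
    obtain ⟨k', σ'', h', hk', -, hle, hiff⟩ := query_ready (S := 32 * capacity n t) le_rfl hD
      (hready σ' hσ') rfl rfl u v hab
    have hans : σ''.reg 0 = 1 ↔ Γ.ForallConnected u v a b := by
      rw [hiff]
      constructor
      · intro h i h1 h2
        exact (reachable_iff i.2 u v).1 ((hC i i.2 _ _).1 (h i h1 h2))
      · intro h i h1 h2
        have hi : i < t := h2.trans_lt b.2
        exact (hC i hi _ _).2 ((reachable_iff hi u v).2 (h ⟨i, hi⟩ h1 h2))
    refine ⟨k', σ'', h', ?_, hans.2, fun h => ?_⟩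
    · rw [← hc₂] at hk'
      have h3 : (k' : ℝ) ≤ c₂ * (80 * ((d + 2 : ℕ) : ℝ)) := by
        have : k' ≤ c₂ * (80 * (d + 2)) := hk'.trans (Nat.mul_le_mul_left _ (by simp only [P]; omega))
        exact_mod_cast this
      refine h3.trans ?_
      calc (c₂ : ℝ) * (80 * ((d + 2 : ℕ) : ℝ)) ≤ c₂ * (100000 * Real.log n) :=
            mul_le_mul_of_nonneg_left (by clear hc₁ hc₂ hk; linarith) hc₂0
        _ ≤ 100000 * (c₁ + c₂ + 1) * Real.log n := by
            clear hc₁ hc₂ hk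
            nlinarith [mul_nonneg hc₁0 hl0]
    · have := mt hans.1 h
      omega
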